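/- Let $G$ be $O(2)\times T$, $Pin(2)\times T$ or the normalizer of the maximal torus of $U(2)$; so $G$ has identity component a 2-torus $\mathbb T$, component group $W$ of order 2, and $H_1(\mathbb T;\mathbb Q)=\mathbb Q\oplus\tilde{\mathbb Q}$. Let $Z,\tilde T\subseteq\mathbb T$ be the two corresponding circles. A subgroup is full if it maps onto $W$. The conjugacy classes of full subgroups are labelled as $G$; $H(\infty,n)$ $(n\ge 1)$, those that contain $Z$; $H^{s}(m,\infty),H^{ns}(m,\infty)$ $(m\ge1)$, those that contain $\tilde T$; and the finite ones $H_1^{s}(m,n),H_1^{ns}(m,n)$ $(m,n\ge 1)$ together with one more class $H_2(m,n)$ for certain pairs $(m,n)$. For $F=H^\lambda(m,n)$ one has $F\cdot Z=H(\infty,n)$, and $F\cdot\tilde T$ is $H^{s}(m,\infty)$ for $H^s_1$, $H^{ns}(m,\infty)$ for $H^{ns}_1$, and one of these two for $H_2$. The component group of the Weyl group is trivial for $G$ and for $H^{s}(m,\infty),H^{ns}(m,\infty)$, has order 2 for $H(\infty,n)$, and has order 1 or 2 for finite $F$, mapping isomorphically to that of $F\cdot Z$ when it has order 2. (The result below holds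 whatever the set of pairs $(m,n)$ that admit $H_2(m,n)$, whichever of the two subgroups $H_2(m,n)\cdot\tilde T$ is, and whatever the orders 1 or 2 at the finite $F$.) Give $\mathbb Q[c]$ the grading with $c$ in degree $-2$, and let all modules and products be graded. Put $$\mathcal O_{\mathcal F/Z}=\prod_{H(\infty,n)}\mathbb Q,\qquad \mathcal O_{\mathcal F/\tilde T}=\prod_{H^{s/ns}(m,\infty)}\mathbb Q[c],\qquad \mathcal O_{\mathcal F}=\prod_{F}\mathbb Q[c],$$ with the inflation maps $\mathcal O_{\mathcal F/Z}\to\mathcal O_{\mathcal F}$ and $\mathcal O_{\mathcal F/\tilde T}\to\mathcal O_{\mathcal F}$ whose components at $F$ are the projections to the factors $F\cdot Z$ and $F\cdot\tilde T$. Let $\mathcal I\subseteq\mathcal O_{\mathcal F/Z}$ be the set of characteristic functions of cofinite sets, let $\mathcal E\subseteq\mathcal O_{\mathcal F/\tilde T}$ be the set of $c^v$ with $v$ an $\mathbb N$-valued function that is zero almost everywhere, and denote their images in $\mathcal O_{\mathcal F}$ in the same way. An object of the standard model $\mathcal A=\mathcal A(G|\mathrm{full})$ consists of an $\mathcal O_{\mathcal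 F}$-module $N=N(\uparrow 1)$, with the quasicoherent diagram of localizations $N(\uparrow Z)=\mathcal E^{-1}N$, $N(\uparrow\tilde T)=\mathcal I^{-1}N$, $N(\uparrow G)=\mathcal E^{-1}\mathcal I^{-1}N$; an $\mathcal O_{\mathcal F/Z}$-module $\phi^ZN$, an $\mathcal O_{\mathcal F/\tilde T}$-module $\phi^{\tilde T}N$ and a $\mathbb Q$-module $\phi^GN$; isomorphisms $$\mathcal E^{-1}N\cong\mathcal E^{-1}\mathcal O_{\mathcal F}\otimes_{\mathcal O_{\mathcal F/Z}}\phi^ZN,\quad \mathcal I^{-1}N\cong\mathcal I^{-1}\mathcal O_{\mathcal F}\otimes_{\mathcal O_{\mathcal F/\tilde T}}\phi^{\tilde T}N,$$ $$\mathcal I^{-1}\phi^ZN\cong\mathcal I^{-1}\mathcal O_{\mathcal F/Z}\otimes\phi^GN,\quad \mathcal E^{-1}\phi^{\tilde T}N\cong\mathcal E^{-1}\mathcal O_{\mathcal F/\tilde T}\otimes\phi^GN$$ which induce the same isomorphism $N(\uparrow G)\cong\mathcal E^{-1}\mathcal I^{-1}\mathcal O_{\mathcal F}\otimes\phi^GN$;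 and compatible actions of the component groups on $N$ and $\phi^ZN$. Morphisms are compatible families of degree preserving module maps. The algebraic dual cells are the following objects of $\mathcal A$, together with their suspensions: $D\sigma_G$, with $N=\mathcal O_{\mathcal F}$, $\phi^ZN=\mathcal O_{\mathcal F/Z}$, $\phi^{\tilde T}N=\mathcal O_{\mathcal F/\tilde T}$, $\phi^GN=\mathbb Q$; for $H\supseteq Z$, $H\ne G$, the cell $D\sigma_H$ with $\phi^GN=0$, $\phi^{\tilde T}N=0$, $\phi^ZN$ the rational group ring $\mathbb Q[C_H]$ of the component group $C_H$ at $H$, placed at $H$, and $N=\prod_{F\cdot Z=H}\mathbb Q[c]\otimes \mathbb Q[C_H]$; for $H\supseteq\tilde T$, $H\ne G$, the cell $D\sigma_H$ with $\phi^GN=0$, $\phi^ZN=0$, $\phi^{\tilde T}N=\mathbb Q$ placed at $H$ and $N=\prod_{F\cdot\tilde T=H}\mathbb Q$; and for $F$ finite the cell $D\sigma_F$ with $\phi^GN$, $\phi^ZN$, $\phi^{\tilde T}N$ zero and $N$ the rational group ring of the component group at $F$, placed at $F$. Then: (1) $\mathcal A$ is an abelian category of injective dimension $\le 2$: every object $X$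 has an injective resolution $0\to X\to I_0\to I_1\to I_2\to 0$ in $\mathcal A$. (2) The bound is attained: some object of $\mathcal A$ has no injective resolution of length $\le 1$. (3) All objects of $\mathcal A$ are cellular: every object lies in the smallest class of objects of $\mathcal A$ that contains the suspensions of the dual cells, is closed under arbitrary direct sums, and contains all three terms of a short exact sequence as soon as it contains two of them. -/

import Mathlib

open CategoryTheory CategoryTheory.Limits Polynomial

/-! ### The full subgroups

`G` has identity component a 2-torus and component group `W` of order two, with rational toral
lattice `ℚ ⊕ ℚ̃`; `Z` and `T̃` are the circles tangent to the two eigenspaces. The conjugacy classes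
of full subgroups are
* `G` itself;
* `H(∞, n)` for `n ≥ 1`: the proper full subgroups containing `Z`;
* `H^s(m, ∞)`, `H^ns(m, ∞)` for `m ≥ 1`: the proper full subgroups containing `T̃`;
* the finite ones: `H₁^s(m, n)`, `H₁^ns(m, n)` for all `m, n ≥ 1` and, for some pairs `(m, n)`, one
  further class `H₂(m, n)`.
-/

/-- The two superscripts, `s` (split) and `ns` (non-split). -/
inductive Splitting : Type
  | s
  | ns

/-- The labels `λ` of the finite full subgroups `H^λ(m, n)`. -/
inductive SubgroupLabel : Type
  | oneS
  | oneNS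
  | two

/-- What distinguishes the spaces of full subgroups of the groups in question: for which pairs there
is a class `H₂(m, n)`, which of `H^s(m, ∞)`, `H^ns(m, ∞)` contains it, and which finite subgroups
`F = H^λ(m, n)` have a Weyl group `N_G(F)/F` with two components (the others having a connected
one). -/
structure FullSubgroups where
  typeTwo : ℕ+ → ℕ+ → Prop
  twoLiesIn : ℕ+ → ℕ+ → Splitting
  weylDisconnected : ℕ+ → ℕ+ → SubgroupLabel → Prop

/-- The labelling for toral lattice `ℤ ⊕ ℤ̃` (the groups `O(2) × T` and `Pin(2) × T`): a third
subgroup when `m` and `n` are both even. -/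
def FullSubgroups.ofSumLattice (w : ℕ+ → ℕ+ → SubgroupLabel → Prop) : FullSubgroups where
  typeTwo m n := Even (m : ℕ) ∧ Even (n : ℕ)
  twoLiesIn _ _ := Splitting.s
  weylDisconnected := w

/-- The labelling for toral lattice `ℤW` (the normalizer of the maximal torus in `U(2)`): a third
subgroup when `m + n` and `m - n` are both even. -/
def FullSubgroups.ofGroupRingLattice (w : ℕ+ → ℕ+ → SubgroupLabel → Prop) : FullSubgroups where
  typeTwo m n := Even ((m : ℤ) + n) ∧ Even ((m : ℤ) - n)
  twoLiesIn _ _ := Splitting.s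
  weylDisconnected := w

/-- Conjugacy classes of subgroups `H(∞, n)`. -/
abbrev OverZ : Type := ℕ+

/-- Conjugacy classes of subgroups `H^s(m, ∞)`, `H^ns(m, ∞)`. -/
abbrev OverT : Type := ℕ+ × Splitting

/-- Conjugacy classes of finite full subgroups `H^λ(m, n)`. -/
structure FiniteSubgroup (D : FullSubgroups) where
  m : ℕ+
  n : ℕ+
  label : SubgroupLabel
  exists_of_two : label = SubgroupLabel.two → D.typeTwo m n

namespace FiniteSubgroup

variable {D : FullSubgroups}

/-- `F ↦ F · Z`, that is `H^λ(m, n) ↦ H(∞, n)`. -/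
def mulZ (F : FiniteSubgroup D) : OverZ := F.n

/-- `F ↦ F · T̃`, that is `H^λ(m, n) ↦ H^λ'(m, ∞)`. -/
def mulT (F : FiniteSubgroup D) : OverT :=
  (F.m, match F.label with
    | SubgroupLabel.oneS => Splitting.s
    | SubgroupLabel.oneNS => Splitting.ns
    | SubgroupLabel.two => D.twoLiesIn F.m F.n)

/-- The component group of `N_G(F)/F` has order two (otherwise it is trivial). -/
def Disconnected (F : FiniteSubgroup D) : Prop := D.weylDisconnected F.m F.n F.label

end FiniteSubgroup

/-! ### The rings

`ℚ[c]` is graded with `c` in degree `-2`, and all modules are graded. The product of graded rings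
`∏_S ℚ[c]` is, degree by degree, `∏_S ℚ · c ^ k`: it is the polynomial ring `(S → ℚ)[X]` with
`X = (c)_S`. -/

noncomputable section

/-- The characteristic function of `T`. -/
def charFun {S : Type} (T : Set S) : S → ℚ := T.indicator 1

/-- `𝒪_{ℱ/Z} = ∏ ℚ`, concentrated in degree zero. -/
abbrev RingZ : Type := OverZ → ℚ

/-- `𝒪_{ℱ/T̃} = ∏ ℚ[c]`. -/
abbrev RingT : Type := (OverT → ℚ)[X]

/-- `𝒪_ℱ = ∏ ℚ[c]`. -/
abbrev RingF (D : FullSubgroups) : Type := (FiniteSubgroup D → ℚ)[X]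

/-- The inflation `𝒪_{ℱ/Z} ⟶ 𝒪_ℱ`; its component at `F` is the projection to the factor `F · Z`. -/
def inflZ (D : FullSubgroups) : RingZ →+* RingF D :=
  Polynomial.C.comp (RingHom.pi fun F : FiniteSubgroup D => Pi.evalRingHom (fun _ => ℚ) F.mulZ)

/-- The inflation `𝒪_{ℱ/T̃} ⟶ 𝒪_ℱ`; its component at `F` is the projection to the factor
`F · T̃`. -/
def inflT (D : FullSubgroups) : RingT →+* RingF D :=
  Polynomial.mapRingHom
    (RingHom.pi fun F : FiniteSubgroup D => Pi.evalRingHom (fun _ => ℚ) F.mulT)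

/-- The Euler class that is `c` at `H` and `1` elsewhere. -/
def eulerClass (H : OverT) : RingT :=
  Polynomial.C (charFun {H}) * Polynomial.X + Polynomial.C (charFun {H}ᶜ)

/-- `ℰ ⊆ 𝒪_{ℱ/T̃}`: the elements `c ^ v`, where `v : OverT → ℕ` is zero almost everywhere. -/
def eulerT : Submonoid RingT := Submonoid.closure (Set.range eulerClass)

/-- `ℰ ⊆ 𝒪_ℱ`, obtained by inflation. -/
def eulerF (D : FullSubgroups) : Submonoid (RingF D) := eulerT.map (inflT D)

/-- `ℐ ⊆ 𝒪_{ℱ/Z}`: the characteristic functions of cofinite sets. -/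
def cofZ : Submonoid RingZ where
  carrier := {a | ∃ T : Set OverZ, Tᶜ.Finite ∧ a = charFun T}
  one_mem' := ⟨Set.univ, by simp, by simp [charFun]⟩
  mul_mem' := by
    rintro a b ⟨T, hT, rfl⟩ ⟨T', hT', rfl⟩
    refine ⟨T ∩ T', by rw [Set.compl_inter]; exact hT.union hT', ?_⟩
    simp only [charFun]
    rw [Set.inter_indicator_one]

/-- `ℐ ⊆ 𝒪_ℱ`, obtained by inflation. -/
def cofF (D : FullSubgroups) : Submonoid (RingF D) := cofZ.map (inflZ D)

/-- `ℚ ⟶ ℐ⁻¹ 𝒪_{ℱ/Z}`. -/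
def unitZ : ℚ →+* Localization cofZ := (algebraMap RingZ _).comp (algebraMap ℚ RingZ)

/-- `ℚ ⟶ ℰ⁻¹ 𝒪_{ℱ/T̃}`. -/
def unitT : ℚ →+* Localization eulerT := (algebraMap RingT _).comp (algebraMap ℚ RingT)

/-- `𝒪_{ℱ/Z} ⟶ ℰ⁻¹ 𝒪_ℱ`. -/
def locInflZ (D : FullSubgroups) : RingZ →+* Localization (eulerF D) :=
  (algebraMap (RingF D) _).comp (inflZ D)

/-- `𝒪_{ℱ/T̃} ⟶ ℐ⁻¹ 𝒪_ℱ`. -/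
def locInflT (D : FullSubgroups) : RingT →+* Localization (cofF D) :=
  (algebraMap (RingF D) _).comp (inflT D)

/-- The homogeneous elements of degree `i` in a ring concentrated in degree zero. -/
def degZero (R : Type) [CommRing R] (i : ℤ) : Set R := {a | a ≠ 0 → i = 0}

/-- The homogeneous elements of degree `i` in `∏_S ℚ[c]`, with `c` in degree `-2`. -/
def degC (S : Type) (i : ℤ) : Set (S → ℚ)[X] := {a | ∀ k : ℕ, a.coeff k ≠ 0 → i = -2 * (k : ℤ)}

/-! ### Graded modules -/

/-- A graded module over a graded ring `R`, whose homogeneous elements are given by `A`. -/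
structure GrMod (R : Type) [CommRing R] (A : ℤ → Set R) where
  carrier : Type
  [addCommGroup : AddCommGroup carrier]
  [module : Module R carrier]
  gr : ℤ → AddSubgroup carrier
  internal : DirectSum.IsInternal gr
  smul_mem : ∀ {i j : ℤ} {a : R} {x : carrier}, a ∈ A i → x ∈ gr j → a • x ∈ gr (i + j)

instance {R : Type} [CommRing R] {A : ℤ → Set R} : CoeSort (GrMod R A) Type := ⟨GrMod.carrier⟩

attribute [instance] GrMod.addCommGroup GrMod.module

/-- The homogeneous elements of degree `k` in an `ℰ`-localization `S⁻¹ M`, where `M` is a graded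
module over `R` and `RingT` acts on it through `θ`: there is a finite set `T` of factors such that
`y` comes from a homogeneous element of degree `k` away from `T`, while on `T` it is `c ^ (-j)` times
an element that comes from one of degree `k - 2 * j`. -/
def eulerLocGr {R : Type} [CommRing R] {A : ℤ → Set R} (θ : RingT →+* R) (S : Submonoid R)
    (M : GrMod R A) (k : ℤ) : Set (LocalizedModule S M) :=
  {y | ∃ (T : Finset OverT) (j : ℕ), ∃ x₁ ∈ M.gr (k - 2 * (j : ℤ)), ∃ x₂ ∈ M.gr k,
    θ (Polynomial.C (charFun (T : Set OverT)) * Polynomial.X ^ j) • y = LocalizedModule.mk x₁ 1 ∧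
    θ (Polynomial.C (charFun (T : Set OverT)ᶜ)) • y = LocalizedModule.mk x₂ 1}

/-- The semilinear map `f : M ⟶ L` over `σ : R ⟶ A` exhibits `L` as `A ⊗_R M`. -/
def ExhibitsBaseChange {R A : Type} [CommRing R] [CommRing A] (σ : R →+* A) {M : Type} {L : Type}
    [AddCommMonoid M] [Module R M] [AddCommMonoid L] [Module A L] (f : M →ₛₗ[σ] L) : Prop :=
  letI : Algebra R A := σ.toAlgebra
  letI : Module R L := Module.compHom L σ
  haveI : IsScalarTower R A L := ⟨fun r a x => mul_smul (σ r) a x⟩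
  IsBaseChange A
    ({ toFun := f, map_add' := f.map_add, map_smul' := f.map_smulₛₗ } : M →ₗ[R] L)

/-! ### The standard model -/

/-- An object of the standard model `𝒜(G|full)`.

Quasicoherence is built in: `N` is `N(↑1)`, and `N(↑Z) = ℰ⁻¹ N`, `N(↑T̃) = ℐ⁻¹ N`,
`N(↑G) = (ℰℐ)⁻¹ N`. Extendedness is witnessed by `P = φ^Z N`, `Q = φ^T̃ N` and `V = φ^G N`:
the maps `P ⟶ ℰ⁻¹ N`, `Q ⟶ ℐ⁻¹ N`, `V ⟶ ℐ⁻¹ P`, `V ⟶ ℰ⁻¹ Q` become isomorphisms after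
extension of scalars, so that `ℐ⁻¹ 𝒪_{ℱ/Z} ⊗ V = ℐ⁻¹ P`, `ℰ⁻¹ 𝒪_{ℱ/T̃} ⊗ V = ℰ⁻¹ Q`,
`ℰ⁻¹ 𝒪_ℱ ⊗ P = ℰ⁻¹ N`, `ℐ⁻¹ 𝒪_ℱ ⊗ Q = ℐ⁻¹ N` and `(ℰℐ)⁻¹ 𝒪_ℱ ⊗ V = (ℰℐ)⁻¹ N`.

The component groups act as follows. The group of order two at each `H(∞, n)` acts on `P`
through the involution `actP`. At `F` with disconnected Weyl group the group of order two acts on `N`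
through the involution `actN`, and it maps isomorphically to the group at `F · Z`; at the other `F`
the group is trivial. The groups at `H^s(m, ∞)`, `H^ns(m, ∞)` and `G` are trivial. -/
structure StandardModel (D : FullSubgroups) where
  V : GrMod ℚ (degZero ℚ)
  P : GrMod RingZ (degZero RingZ)
  Q : GrMod RingT (degC OverT)
  N : GrMod (RingF D) (degC (FiniteSubgroup D))
  /-- `φ^Z N ⟶ N(↑Z)` -/
  extP : P →ₛₗ[locInflZ D] LocalizedModule (eulerF D) N
  /-- `φ^T̃ N ⟶ N(↑T̃)` -/
  extQ : Q →ₛₗ[locInflT D] LocalizedModule (cofF D) N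
  extVP : V →ₛₗ[unitZ] LocalizedModule cofZ P
  extVQ : V →ₛₗ[unitT] LocalizedModule eulerT Q
  extP_baseChange : ExhibitsBaseChange (A := Localization (eulerF D)) (locInflZ D) extP
  extQ_baseChange : ExhibitsBaseChange (A := Localization (cofF D)) (locInflT D) extQ
  extVP_baseChange : ExhibitsBaseChange (A := Localization cofZ) unitZ extVP
  extVQ_baseChange : ExhibitsBaseChange (A := Localization eulerT) unitT extVQ
  extP_gr : ∀ k, ∀ p ∈ P.gr k, extP p ∈ eulerLocGr (inflT D) (eulerF D) N k
  extQ_gr : ∀ k, ∀ q ∈ Q.gr k, ∃ x ∈ N.gr k, extQ q = LocalizedModule.mk x 1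
  extVP_gr : ∀ k, ∀ v ∈ V.gr k, ∃ p ∈ P.gr k, extVP v = LocalizedModule.mk p 1
  extVQ_gr : ∀ k, ∀ v ∈ V.gr k, extVQ v ∈ eulerLocGr (RingHom.id RingT) eulerT Q k
  /-- The maps `V ⟶ ℐ⁻¹ P ⟶ (ℰℐ)⁻¹ N` and `V ⟶ ℰ⁻¹ Q ⟶ (ℰℐ)⁻¹ N` agree: if `v` is `p / i` in
  `ℐ⁻¹ P` and `q / e` in `ℰ⁻¹ Q`, if `p` is `x / e'` in `ℰ⁻¹ N` and `q` is `y / i'` in `ℐ⁻¹ N`, then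
  `x / (e' i) = y / (i' e)`. -/
  square : ∀ (v : V) (p : P) (i : cofZ) (q : Q) (e : eulerT)
    (x : N) (e' : eulerF D) (y : N) (i' : cofF D),
    extVP v = LocalizedModule.mk p i → extVQ v = LocalizedModule.mk q e →
    extP p = LocalizedModule.mk x e' → extQ q = LocalizedModule.mk y i' →
    (LocalizedModule.mk x
        ⟨e' * inflZ D i, Submonoid.mul_mem_sup e'.2 (Submonoid.mem_map_of_mem _ i.2)⟩ :
      LocalizedModule (eulerF D ⊔ cofF D) N) =
    LocalizedModule.mk y
        ⟨inflT D e * i', Submonoid.mul_mem_sup (Submonoid.mem_map_of_mem _ e.2) i'.2⟩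
  actP : P →ₗ[RingZ] P
  actN : N →ₗ[RingF D] N
  actP_gr : ∀ k, ∀ p ∈ P.gr k, actP p ∈ P.gr k
  actN_gr : ∀ k, ∀ x ∈ N.gr k, actN x ∈ N.gr k
  actP_actP : ∀ p, actP (actP p) = p
  actN_actN : ∀ x, actN (actN x) = x
  /-- The action is trivial at `F` with connected Weyl group. -/
  actN_connected : ∀ x : N,
    (Polynomial.C (charFun {F : FiniteSubgroup D | F.Disconnected}ᶜ) : RingF D) • actN x =
      (Polynomial.C (charFun {F : FiniteSubgroup D | F.Disconnected}ᶜ) : RingF D) • x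
  /-- `P ⟶ ℰ⁻¹ N` is equivariant at the `F` with disconnected Weyl group. -/
  extP_act : ∀ (p : P) (x : N) (e : eulerF D), extP p = LocalizedModule.mk x e →
    (Polynomial.C (charFun {F : FiniteSubgroup D | F.Disconnected}) : RingF D) • extP (actP p) =
      (Polynomial.C (charFun {F : FiniteSubgroup D | F.Disconnected}) : RingF D) •
        LocalizedModule.mk (actN x) e
  /-- The induced action on `ℐ⁻¹ N = ℐ⁻¹ 𝒪_ℱ ⊗ Q` is trivial. -/
  actN_cof : ∀ x : N,
    (LocalizedModule.mk (actN x) 1 : LocalizedModule (cofF D) N) = LocalizedModule.mk x 1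
  /-- The induced action on `ℐ⁻¹ P = ℐ⁻¹ 𝒪_{ℱ/Z} ⊗ V` is trivial. -/
  actP_cof : ∀ p : P,
    (LocalizedModule.mk (actP p) 1 : LocalizedModule cofZ P) = LocalizedModule.mk p 1

namespace StandardModel

variable {D : FullSubgroups}

/-- A morphism: degree preserving linear maps of all the modules, compatible with the structure maps
and with the actions of the component groups. -/
@[ext]
structure Hom (X Y : StandardModel D) where
  onV : X.V →ₗ[ℚ] Y.V
  onP : X.P →ₗ[RingZ] Y.P
  onQ : X.Q →ₗ[RingT] Y.Q
  onN : X.N →ₗ[RingF D] Y.N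
  onV_gr : ∀ k, ∀ v ∈ X.V.gr k, onV v ∈ Y.V.gr k
  onP_gr : ∀ k, ∀ p ∈ X.P.gr k, onP p ∈ Y.P.gr k
  onQ_gr : ∀ k, ∀ q ∈ X.Q.gr k, onQ q ∈ Y.Q.gr k
  onN_gr : ∀ k, ∀ x ∈ X.N.gr k, onN x ∈ Y.N.gr k
  comm_extP : ∀ (p : X.P) (x : X.N) (e : eulerF D),
    X.extP p = LocalizedModule.mk x e → Y.extP (onP p) = LocalizedModule.mk (onN x) e
  comm_extQ : ∀ (q : X.Q) (x : X.N) (i : cofF D),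
    X.extQ q = LocalizedModule.mk x i → Y.extQ (onQ q) = LocalizedModule.mk (onN x) i
  comm_extVP : ∀ (v : X.V) (p : X.P) (i : cofZ),
    X.extVP v = LocalizedModule.mk p i → Y.extVP (onV v) = LocalizedModule.mk (onP p) i
  comm_extVQ : ∀ (v : X.V) (q : X.Q) (e : eulerT),
    X.extVQ v = LocalizedModule.mk q e → Y.extVQ (onV v) = LocalizedModule.mk (onQ q) e
  comm_actP : ∀ p, onP (X.actP p) = Y.actP (onP p)
  comm_actN : ∀ x, onN (X.actN x) = Y.actN (onN x)

instance : Category (StandardModel D) where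
  Hom := Hom
  id X :=
    { onV := LinearMap.id
      onP := LinearMap.id
      onQ := LinearMap.id
      onN := LinearMap.id
      onV_gr := fun _ _ h => h
      onP_gr := fun _ _ h => h
      onQ_gr := fun _ _ h => h
      onN_gr := fun _ _ h => h
      comm_extP := fun _ _ _ h => h
      comm_extQ := fun _ _ _ h => h
      comm_extVP := fun _ _ _ h => h
      comm_extVQ := fun _ _ _ h => h
      comm_actP := fun _ => rfl
      comm_actN := fun _ => rfl }
  comp f g :=
    { onV := g.onV.comp f.onV
      onP := g.onP.comp f.onP
      onQ := g.onQ.comp f.onQ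
      onN := g.onN.comp f.onN
      onV_gr := fun k v h => g.onV_gr k _ (f.onV_gr k v h)
      onP_gr := fun k p h => g.onP_gr k _ (f.onP_gr k p h)
      onQ_gr := fun k q h => g.onQ_gr k _ (f.onQ_gr k q h)
      onN_gr := fun k x h => g.onN_gr k _ (f.onN_gr k x h)
      comm_extP := fun p x e h => g.comm_extP _ _ e (f.comm_extP p x e h)
      comm_extQ := fun q x i h => g.comm_extQ _ _ i (f.comm_extQ q x i h)
      comm_extVP := fun v p i h => g.comm_extVP _ _ i (f.comm_extVP v p i h)
      comm_extVQ := fun v q e h => g.comm_extVQ _ _ e (f.comm_extVQ v q e h)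
      comm_actP := fun p => by
        rw [LinearMap.comp_apply, f.comm_actP, g.comm_actP, LinearMap.comp_apply]
      comm_actN := fun x => by
        rw [LinearMap.comp_apply, f.comm_actN, g.comm_actN, LinearMap.comp_apply] }
  id_comp _ := rfl
  comp_id _ := rfl
  assoc _ _ _ := rfl

/-! ### Cells and cellular objects -/

/-- The `k`-fold suspension of the cell `Dσ_G`: all the modules are free on compatible generators
in degree `k`, fixed by the component groups. -/
def IsCellG (k : ℤ) (X : StandardModel D) : Prop :=
  ∃ v ∈ X.V.gr k, ∃ p ∈ X.P.gr k, ∃ q ∈ X.Q.gr k, ∃ x ∈ X.N.gr k,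
    (Function.Bijective fun a : ℚ => a • v) ∧
    (Function.Bijective fun a : RingZ => a • p) ∧
    (Function.Bijective fun a : RingT => a • q) ∧
    (Function.Bijective fun a : RingF D => a • x) ∧
    X.extVP v = LocalizedModule.mk p 1 ∧ X.extVQ v = LocalizedModule.mk q 1 ∧
    X.extP p = LocalizedModule.mk x 1 ∧ X.extQ q = LocalizedModule.mk x 1 ∧
    X.actP p = p ∧ X.actN x = x

/-- The `k`-fold suspension of the cell `Dσ_H` for `H = H(∞, n)`: `P` is the group ring over `ℚ` of
the component group of order two at `H`, and `N = ∏_{F ⊆ H} ℚ[c] ⊗ P`. -/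
def IsCellZ (n : OverZ) (k : ℤ) (X : StandardModel D) : Prop :=
  Subsingleton X.V ∧ Subsingleton X.Q ∧
  ∃ p ∈ X.P.gr k, ∃ x ∈ X.N.gr k, ∃ x' ∈ X.N.gr k,
    charFun {n} • p = p ∧
    (Function.Bijective fun a : ℚ × ℚ =>
      (a.1 • charFun {n} : RingZ) • p + (a.2 • charFun {n} : RingZ) • X.actP p) ∧
    X.extP p = LocalizedModule.mk x 1 ∧ X.extP (X.actP p) = LocalizedModule.mk x' 1 ∧
    inflZ D (charFun {n}) • x = x ∧ inflZ D (charFun {n}) • x' = x' ∧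
    (∀ y : X.N, ∃ a a' : RingF D, y = a • x + a' • x') ∧
    (∀ a a' : RingF D, a • x + a' • x' = 0 →
      inflZ D (charFun {n}) * a = 0 ∧ inflZ D (charFun {n}) * a' = 0)

/-- The `k`-fold suspension of the cell `Dσ_H` for `H = H^s(m, ∞)` or `H = H^ns(m, ∞)`: `Q` is the
residue field `ℚ` at `H`, and `N = ∏_{F ⊆ H} ℚ`. -/
def IsCellT (H : OverT) (k : ℤ) (X : StandardModel D) : Prop :=
  Subsingleton X.V ∧ Subsingleton X.P ∧
  ∃ q ∈ X.Q.gr k, ∃ x ∈ X.N.gr k,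
    (∀ y : X.Q, ∃ a : RingT, y = a • q) ∧ (∀ a : RingT, a • q = 0 ↔ a.coeff 0 H = 0) ∧
    (∀ y : X.N, ∃ a : RingF D, y = a • x) ∧
    (∀ a : RingF D, a • x = 0 ↔ ∀ F : FiniteSubgroup D, F.mulT = H → a.coeff 0 F = 0) ∧
    X.extQ q = LocalizedModule.mk x 1 ∧ X.actN x = x

/-- The `k`-fold suspension of the cell `Dσ_F` for a finite subgroup `F`: `N` is the group ring over
`ℚ` of the component group of the Weyl group of `F`, with all other factors of `𝒪_ℱ` and `c` acting
as zero. -/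
def IsCellF (F : FiniteSubgroup D) (k : ℤ) (X : StandardModel D) : Prop :=
  Subsingleton X.V ∧ Subsingleton X.P ∧ Subsingleton X.Q ∧
  ∃ x ∈ X.N.gr k,
    (∀ a : RingF D, a • x = 0 ↔ a.coeff 0 F = 0) ∧
    (∀ y : X.N, ∃ a b : RingF D, y = a • x + b • X.actN x) ∧
    (F.Disconnected → ∀ a b : RingF D, a • x + b • X.actN x = 0 →
      a.coeff 0 F = 0 ∧ b.coeff 0 F = 0)

/-- The suspensions of the algebraic dual cells. -/
def IsCell (X : StandardModel D) : Prop :=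
  ∃ k : ℤ, IsCellG k X ∨ (∃ n, IsCellZ n k X) ∨ (∃ H, IsCellT H k X) ∨ ∃ F, IsCellF F k X

/-- The cellular objects: those built from the suspensions of the cells by arbitrary direct sums and
by completing short exact sequences. -/
inductive IsCellular [HasZeroMorphisms (StandardModel D)] : StandardModel D → Prop
  | cell (X : StandardModel D) (h : IsCell X) : IsCellular X
  | coproduct {J : Type} (X : J → StandardModel D) (c : Cofan X) (hc : IsColimit c)
      (h : ∀ j, IsCellular (X j)) : IsCellular c.pt
  | left (S : ShortComplex (StandardModel D)) (hS : S.ShortExact)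
      (h₂ : IsCellular S.X₂) (h₃ : IsCellular S.X₃) : IsCellular S.X₁
  | middle (S : ShortComplex (StandardModel D)) (hS : S.ShortExact)
      (h₁ : IsCellular S.X₁) (h₃ : IsCellular S.X₃) : IsCellular S.X₂
  | right (S : ShortComplex (StandardModel D)) (hS : S.ShortExact)
      (h₁ : IsCellular S.X₁) (h₂ : IsCellular S.X₂) : IsCellular S.X₃

end StandardModel

end

noncomputable section

/-! ### Semilinear maps that exhibit a base change -/

namespace ExhibitsBaseChange

variable {R A : Type} [CommRing R] [CommRing A] {σ : R →+* A}
  {M L M₂ L₂ : Type} [AddCommGroup M] [Module R M] [AddCommGroup L] [Module A L]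
  [AddCommGroup M₂] [Module R M₂] [AddCommGroup L₂] [Module A L₂]
  {f : M →ₛₗ[σ] L} {f₂ : M₂ →ₛₗ[σ] L₂}

theorem span_range (hf : ExhibitsBaseChange σ f) : Submodule.span A (Set.range f) = ⊤ := by
  let : Algebra R A := σ.toAlgebra
  let : Module R L := Module.compHom L σ
  have : IsScalarTower R A L := ⟨fun r a x => mul_smul (σ r) a x⟩
  rw [eq_top_iff]
  rintro l -
  refine IsBaseChange.inductionOn hf l (fun l => l ∈ Submodule.span A (Set.range f)) ?_ ?_ ?_ ?_
  · exact Submodule.zero_mem _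
  · intro m; exact Submodule.subset_span ⟨m, rfl⟩
  · intro a l h; exact Submodule.smul_mem _ a h
  · intro a b ha hb; exact Submodule.add_mem _ ha hb

theorem of_injective (hσ : σ.Flat) (hf : ExhibitsBaseChange σ f) (i : M₂ →ₗ[R] M)
    (hi : Function.Injective i) (j : L₂ →ₗ[A] L) (comm : ∀ m, j (f₂ m) = f (i m))
    (hspan : Submodule.span A (Set.range f₂) = ⊤) : ExhibitsBaseChange σ f₂ := by
  let : Algebra R A := σ.toAlgebra
  let : Module R L := Module.compHom L σ
  have : IsScalarTower R A L := ⟨fun r a x => mul_smul (σ r) a x⟩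
  let : Module R L₂ := Module.compHom L₂ σ
  have : IsScalarTower R A L₂ := ⟨fun r a x => mul_smul (σ r) a x⟩
  have : Module.Flat R A := hσ
  let F : M →ₗ[R] L := { toFun := f, map_add' := f.map_add, map_smul' := f.map_smulₛₗ }
  let F₂ : M₂ →ₗ[R] L₂ := { toFun := f₂, map_add' := f₂.map_add, map_smul' := f₂.map_smulₛₗ }
  let β : TensorProduct R A M →ₗ[A] L := (IsBaseChange.equiv (f := F) hf).toLinearMap
  have hβ : Function.Injective β := (IsBaseChange.equiv (f := F) hf).injective
  have hβt : ∀ a m, β (a ⊗ₜ[R] m) = a • f m := fun a m => IsBaseChange.equiv_tmul (f := F) hf a m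
  let β₂ : TensorProduct R A M₂ →ₗ[A] L₂ := F₂.liftBaseChange A
  have hβ₂t : ∀ a m, β₂ (a ⊗ₜ[R] m) = a • f₂ m := fun a m => LinearMap.liftBaseChange_tmul (A := A) F₂ a m
  have hc : ∀ t, j (β₂ t) = β (i.lTensor A t) := by
    intro t
    induction t using TensorProduct.induction_on with
    | zero => simp
    | tmul a m => rw [hβ₂t, LinearMap.lTensor_tmul, hβt, map_smul, comm]
    | add x y hx hy => simp only [map_add, hx, hy]
  have hinj : Function.Injective β₂ := by
    intro s t h
    apply Module.Flat.lTensor_preserves_injective_linearMap (M := A) i hi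
    apply hβ
    rw [← hc, ← hc, h]
  have hsurj : Function.Surjective β₂ := by
    rw [← LinearMap.range_eq_top, eq_top_iff, ← hspan, Submodule.span_le]
    rintro _ ⟨m, rfl⟩
    exact ⟨1 ⊗ₜ m, by rw [hβ₂t, one_smul]⟩
  exact IsBaseChange.of_equiv (f := F₂) (LinearEquiv.ofBijective β₂ ⟨hinj, hsurj⟩)
    (fun m => (hβ₂t 1 m).trans (one_smul A (f₂ m)))

theorem of_surjective (hf : ExhibitsBaseChange σ f) (p : M →ₗ[R] M₂)
    (hp : Function.Surjective p) (h : L →ₗ[A] L₂) (hh : Function.Surjective h)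
    (comm : ∀ m, f₂ (p m) = h (f m))
    (hker : ∀ l, h l = 0 → l ∈ Submodule.span A (f '' {m | p m = 0})) :
    ExhibitsBaseChange σ f₂ := by
  let : Algebra R A := σ.toAlgebra
  let : Module R L := Module.compHom L σ
  have : IsScalarTower R A L := ⟨fun r a x => mul_smul (σ r) a x⟩
  let : Module R L₂ := Module.compHom L₂ σ
  have : IsScalarTower R A L₂ := ⟨fun r a x => mul_smul (σ r) a x⟩
  let F : M →ₗ[R] L := { toFun := f, map_add' := f.map_add, map_smul' := f.map_smulₛₗ }
  let F₂ : M₂ →ₗ[R] L₂ := { toFun := f₂, map_add' := f₂.map_add, map_smul' := f₂.map_smulₛₗ }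
  let β := IsBaseChange.equiv (f := F) hf
  have hβt : ∀ a m, β (a ⊗ₜ[R] m) = a • f m := fun a m => IsBaseChange.equiv_tmul (f := F) hf a m
  let β₂ : TensorProduct R A M₂ →ₗ[A] L₂ := F₂.liftBaseChange A
  have hβ₂t : ∀ a m, β₂ (a ⊗ₜ[R] m) = a • f₂ m := fun a m => LinearMap.liftBaseChange_tmul (A := A) F₂ a m
  have hc : ∀ t, β₂ (p.lTensor A t) = h (β t) := by
    intro t
    induction t using TensorProduct.induction_on with
    | zero => simp
    | tmul a m => rw [LinearMap.lTensor_tmul, hβ₂t, hβt, map_smul, comm]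
    | add x y hx hy => simp only [map_add, hx, hy]
  have hinj : Function.Injective β₂ := by
    rw [injective_iff_map_eq_zero]
    intro s hs
    obtain ⟨t, rfl⟩ := LinearMap.lTensor_surjective A hp s
    rw [hc] at hs
    have ht : ∀ l ∈ Submodule.span A (f '' {m | p m = 0}), p.lTensor A (β.symm l) = 0 := by
      intro l hl
      induction hl using Submodule.span_induction with
      | mem x hx =>
        obtain ⟨m, hm, rfl⟩ := hx
        have : β.symm (f m) = 1 ⊗ₜ m := by
          rw [LinearEquiv.symm_apply_eq, hβt, one_smul]
        rw [this, LinearMap.lTensor_tmul, show p m = 0 from hm, TensorProduct.tmul_zero]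
      | zero => simp
      | add x y _ _ hx hy => rw [map_add, map_add, hx, hy, add_zero]
      | smul a x _ hx =>
        have := (LinearMap.baseChange A p).map_smul a (β.symm x)
        rw [map_smul]
        refine this.trans ?_
        rw [show (LinearMap.baseChange A p) (β.symm x) = 0 from hx, smul_zero]
    simpa using ht _ (hker _ hs)
  have hsurj : Function.Surjective β₂ := by
    intro l
    obtain ⟨l', rfl⟩ := hh l
    exact ⟨p.lTensor A (β.symm l'), by rw [hc, LinearEquiv.apply_symm_apply]⟩
  exact IsBaseChange.of_equiv (f := F₂) (LinearEquiv.ofBijective β₂ ⟨hinj, hsurj⟩)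
    (fun m => (hβ₂t 1 m).trans (one_smul A (f₂ m)))

theorem mem_span_of_map_eq_zero (hσ : σ.Flat) (hf : ExhibitsBaseChange σ f)
    (hf₂ : ExhibitsBaseChange σ f₂) (g : M →ₗ[R] M₂) (h : L →ₗ[A] L₂)
    (comm : ∀ m, f₂ (g m) = h (f m)) {l : L} (hl : h l = 0) :
    l ∈ Submodule.span A (f '' {m | g m = 0}) := by
  let : Algebra R A := σ.toAlgebra
  let : Module R L := Module.compHom L σ
  have : IsScalarTower R A L := ⟨fun r a x => mul_smul (σ r) a x⟩
  let : Module R L₂ := Module.compHom L₂ σ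
  have : IsScalarTower R A L₂ := ⟨fun r a x => mul_smul (σ r) a x⟩
  have : Module.Flat R A := hσ
  let F : M →ₗ[R] L := { toFun := f, map_add' := f.map_add, map_smul' := f.map_smulₛₗ }
  let F₂ : M₂ →ₗ[R] L₂ := { toFun := f₂, map_add' := f₂.map_add, map_smul' := f₂.map_smulₛₗ }
  let β := IsBaseChange.equiv (f := F) hf
  have hβt : ∀ a m, β (a ⊗ₜ[R] m) = a • f m := fun a m => IsBaseChange.equiv_tmul (f := F) hf a m
  let β₂ := IsBaseChange.equiv (f := F₂) hf₂
  have hβ₂t : ∀ a m, β₂ (a ⊗ₜ[R] m) = a • f₂ m :=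
    fun a m => IsBaseChange.equiv_tmul (f := F₂) hf₂ a m
  have hc : ∀ t, β₂ (g.lTensor A t) = h (β t) := by
    intro t
    induction t using TensorProduct.induction_on with
    | zero => simp
    | tmul a m => rw [LinearMap.lTensor_tmul, hβ₂t, hβt, map_smul, comm]
    | add x y hx hy => simp only [map_add, hx, hy]
  obtain ⟨t, rfl⟩ := β.surjective l
  rw [← hc, LinearEquiv.map_eq_zero_iff] at hl
  have hex : Function.Exact (LinearMap.ker g).subtype g := LinearMap.exact_subtype_ker_map g
  obtain ⟨s, rfl⟩ := (Module.Flat.lTensor_exact A hex t).1 hl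
  induction s using TensorProduct.induction_on with
  | zero => simp
  | tmul a m =>
    rw [LinearMap.lTensor_tmul, hβt]
    exact Submodule.smul_mem _ _ (Submodule.subset_span ⟨m, m.2, rfl⟩)
  | add x y hx hy =>
    rw [map_add, map_add]
    refine Submodule.add_mem _ (hx ?_) (hy ?_) <;>
    · exact (Module.Flat.lTensor_exact A hex _).2 ⟨_, rfl⟩

theorem directSum {J : Type} {M : J → Type} {L : J → Type} [∀ j, AddCommGroup (M j)]
    [∀ j, Module R (M j)] [∀ j, AddCommGroup (L j)] [∀ j, Module A (L j)]
    {f : ∀ j, M j →ₛₗ[σ] L j} (hf : ∀ j, ExhibitsBaseChange σ (f j))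
    {L₂ : Type} [AddCommGroup L₂] [Module A L₂] {f₂ : DirectSum J M →ₛₗ[σ] L₂}
    (pr : ∀ j, L₂ →ₗ[A] L j) (comm : ∀ j m, pr j (f₂ m) = f j (m j))
    (hspan : Submodule.span A (Set.range f₂) = ⊤) : ExhibitsBaseChange σ f₂ := by
  classical
  let : Algebra R A := σ.toAlgebra
  let : ∀ j, Module R (L j) := fun j => Module.compHom (L j) σ
  have : ∀ j, IsScalarTower R A (L j) := fun j => ⟨fun r a x => mul_smul (σ r) a x⟩
  let : Module R L₂ := Module.compHom L₂ σ
  have : IsScalarTower R A L₂ := ⟨fun r a x => mul_smul (σ r) a x⟩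
  let F : ∀ j, M j →ₗ[R] L j := fun j =>
    { toFun := f j, map_add' := (f j).map_add, map_smul' := (f j).map_smulₛₗ }
  let F₂ : DirectSum J M →ₗ[R] L₂ :=
    { toFun := f₂, map_add' := f₂.map_add, map_smul' := f₂.map_smulₛₗ }
  let β := fun j => IsBaseChange.equiv (f := F j) (hf j)
  have hβt : ∀ j a m, β j (a ⊗ₜ[R] m) = a • f j m :=
    fun j a m => IsBaseChange.equiv_tmul (f := F j) (hf j) a m
  let β₂ : TensorProduct R A (DirectSum J M) →ₗ[A] L₂ := F₂.liftBaseChange A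
  have hβ₂t : ∀ a m, β₂ (a ⊗ₜ[R] m) = a • f₂ m := fun a m => LinearMap.liftBaseChange_tmul (A := A) F₂ a m
  have hc : ∀ j t, pr j (β₂ t) = β j ((TensorProduct.directSumRight R R A M t) j) := by
    intro j t
    induction t using TensorProduct.induction_on with
    | zero => simp
    | tmul a m =>
      rw [hβ₂t, map_smul, comm]
      induction m using DirectSum.induction_on with
      | zero => simp
      | of i x =>
        change _ = β j ((TensorProduct.directSumRight R R A M
          (a ⊗ₜ[R] DirectSum.lof R J M i x)) j)
        rw [TensorProduct.directSumRight_tmul_lof]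
        by_cases hij : i = j
        · subst hij
          rw [DirectSum.lof_apply, hβt, DirectSum.of_eq_same]
        · have h1 : (DirectSum.of M i x) j = 0 := DirectSum.of_eq_of_ne _ _ _ (Ne.symm hij)
          have h2 : (DirectSum.lof R J (fun i => TensorProduct R A (M i)) i (a ⊗ₜ[R] x)) j = 0 :=
            DirectSum.of_eq_of_ne _ _ _ (Ne.symm hij)
          rw [h1, h2, map_zero, map_zero, smul_zero]
      | add x y hx hy =>
        rw [TensorProduct.tmul_add, map_add, DirectSum.add_apply, map_add, smul_add, hx, hy,
          DirectSum.add_apply, map_add]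
    | add x y hx hy => simp only [map_add, hx, hy, DirectSum.add_apply]
  have hinj : Function.Injective β₂ := by
    rw [injective_iff_map_eq_zero]
    intro t ht
    apply (TensorProduct.directSumRight R R A M).injective
    rw [map_zero]
    ext1 j
    apply (β j).injective
    rw [← hc, ht]
    simp
  have hsurj : Function.Surjective β₂ := by
    rw [← LinearMap.range_eq_top, eq_top_iff, ← hspan, Submodule.span_le]
    rintro _ ⟨m, rfl⟩
    exact ⟨1 ⊗ₜ m, by rw [hβ₂t, one_smul]⟩
  exact IsBaseChange.of_equiv (f := F₂) (LinearEquiv.ofBijective β₂ ⟨hinj, hsurj⟩)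
    (fun m => (hβ₂t 1 m).trans (one_smul A (f₂ m)))

theorem of_generator {f : R →ₛₗ[σ] L} (hl : Function.Bijective fun a : A => a • f 1) :
    ExhibitsBaseChange σ f := by
  let : Algebra R A := σ.toAlgebra
  let : Module R L := Module.compHom L σ
  have : IsScalarTower R A L := ⟨fun r a x => mul_smul (σ r) a x⟩
  let F : R →ₗ[R] L := { toFun := f, map_add' := f.map_add, map_smul' := f.map_smulₛₗ }
  let e : A ≃ₗ[A] L := LinearEquiv.ofBijective (LinearMap.toSpanSingleton A L (f 1)) hl
  refine IsBaseChange.of_equiv (f := F)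
    ((TensorProduct.AlgebraTensorModule.rid R A A).trans e) (fun x => ?_)
  change ((TensorProduct.AlgebraTensorModule.rid R A A) (1 ⊗ₜ x)) • f 1 = f x
  rw [TensorProduct.AlgebraTensorModule.rid_tmul]
  change (σ x * 1) • f 1 = f x
  rw [mul_one, ← f.map_smulₛₗ, smul_eq_mul, mul_one]

end ExhibitsBaseChange

/-! ### Flatness -/

/-- A product of copies of a field is von Neumann regular, so all its modules are flat. -/
theorem flat_pi (S : Type) (M : Type) [AddCommGroup M] [Module (S → ℚ) M] :
    Module.Flat (S → ℚ) M := by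
  classical
  rw [Module.Flat.iff_rTensor_injective]
  intro I hI
  have hret : ∃ r : (S → ℚ) →ₗ[S → ℚ] I, ∀ x : I, r x = x := by
    obtain ⟨e, heI, he⟩ : ∃ e ∈ I, ∀ x ∈ I, x * e = x := by
      obtain ⟨s, rfl⟩ := hI
      induction s using Finset.induction_on with
      | empty => exact ⟨0, by simp, by simp⟩
      | insert a s _ ih =>
        obtain ⟨e, he, h⟩ := ih
        let b : S → ℚ := fun i => (a i)⁻¹ * (a i)
        have hab : a * b = a := by
          ext i
          by_cases h0 : a i = 0
          · simp [b, h0]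
          · simp [b, h0]
        have hs : Ideal.span (s : Set (S → ℚ)) ≤ Ideal.span (insert a s : Set (S → ℚ)) :=
          Ideal.span_mono (Set.subset_insert _ _)
        have ha : a ∈ Ideal.span (insert a s : Set (S → ℚ)) :=
          Ideal.subset_span (Set.mem_insert _ _)
        rw [Finset.coe_insert]
        have hb : b ∈ Ideal.span (insert a s : Set (S → ℚ)) := by
          have : b = (fun i => (a i)⁻¹) * a := rfl
          rw [this]; exact Ideal.mul_mem_left _ _ ha
        refine ⟨e + b - e * b, Ideal.sub_mem _ (Ideal.add_mem _ (hs he) hb)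
          (Ideal.mul_mem_left _ _ hb), ?_⟩
        intro x hx
        rw [Ideal.span, Submodule.mem_span_insert] at hx
        obtain ⟨c, z, hz, rfl⟩ := hx
        have hze := h z hz
        simp only [smul_eq_mul]
        linear_combination (c - c * e) * hab + (1 - b) * hze
    exact ⟨LinearMap.codRestrict I (LinearMap.mulRight (S → ℚ) e)
      (fun x => I.mul_mem_left x heI), fun x => Subtype.ext (he x x.2)⟩
  obtain ⟨r, hr⟩ := hret
  have : (r.rTensor M) ∘ₗ (LinearMap.rTensor M (Submodule.subtype I)) = LinearMap.id := by
    rw [← LinearMap.rTensor_comp, show r ∘ₗ Submodule.subtype I = LinearMap.id from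
      LinearMap.ext hr, LinearMap.rTensor_id]
  exact Function.LeftInverse.injective (g := r.rTensor M) (fun x => LinearMap.congr_fun this x)

theorem flat_of_pi {S A : Type} [CommRing A] (σ : (S → ℚ) →+* A) : σ.Flat := by
  let := σ.toAlgebra
  exact flat_pi S A

theorem flat_mapRingHom {S S' : Type} (τ : (S → ℚ) →+* (S' → ℚ)) :
    (Polynomial.mapRingHom τ).Flat := by
  let : Algebra (S → ℚ) (S' → ℚ) := τ.toAlgebra
  have : Module.Flat (S → ℚ) (S' → ℚ) := flat_pi S _
  have h : Module.Flat (S → ℚ)[X] (TensorProduct (S → ℚ) (S → ℚ)[X] (S' → ℚ)) :=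
    Module.Flat.baseChange _ _ _
  let : Algebra (S → ℚ)[X] (S' → ℚ)[X] := Polynomial.algebra (S → ℚ) (S' → ℚ)
  have e := (Algebra.IsPushout.out (R := S → ℚ) (S := (S → ℚ)[X]) (R' := S' → ℚ)
    (S' := (S' → ℚ)[X])).equiv
  exact Module.Flat.of_linearEquiv e.symm

theorem flat_locInflZ (D : FullSubgroups) :
    RingHom.Flat (S := Localization (eulerF D)) (locInflZ D) := flat_of_pi _

theorem flat_locInflT (D : FullSubgroups) :
    RingHom.Flat (S := Localization (cofF D)) (locInflT D) := by
  refine RingHom.Flat.comp (flat_mapRingHom _) ?_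
  rw [RingHom.flat_algebraMap_iff]
  exact IsLocalization.flat _ (cofF D)

theorem flat_of_rat {A : Type} [CommRing A] (σ : ℚ →+* A) : σ.Flat := by
  let : Algebra ℚ A := σ.toAlgebra
  exact (inferInstance : Module.Flat ℚ A)

theorem flat_unitZ : RingHom.Flat (S := Localization cofZ) unitZ := flat_of_rat _

theorem flat_unitT : RingHom.Flat (S := Localization eulerT) unitT := flat_of_rat _

end

noncomputable section

/-! ### Idempotents and Euler elements -/

section Idem

variable {S : Type}

/-- The idempotent of `∏_S ℚ[c]` supported on `U`. -/
def idem (U : Set S) : (S → ℚ)[X] := Polynomial.C (charFun U)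

/-- The factor at `i` of an element of `∏_S ℚ[c]`. -/
def factorAt (i : S) : (S → ℚ)[X] →+* ℚ[X] :=
  Polynomial.mapRingHom (Pi.evalRingHom (fun _ => ℚ) i)

theorem coeff_factorAt (i : S) (p : (S → ℚ)[X]) (k : ℕ) :
    (factorAt i p).coeff k = p.coeff k i := by
  simp [factorAt]

theorem ext_factorAt {p q : (S → ℚ)[X]} (h : ∀ i, factorAt i p = factorAt i q) : p = q := by
  ext k i
  rw [← coeff_factorAt, ← coeff_factorAt, h]

open Classical in
theorem charFun_apply (U : Set S) (i : S) : charFun U i = if i ∈ U then 1 else 0 := by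
  simp [charFun, Set.indicator_apply]

theorem charFun_mul (U U' : Set S) : charFun U * charFun U' = charFun (U ∩ U') := by
  simp only [charFun]
  rw [Set.inter_indicator_one]

open Classical in
theorem factorAt_idem (U : Set S) (i : S) : factorAt i (idem U) = if i ∈ U then 1 else 0 := by
  simp only [factorAt, idem, coe_mapRingHom, map_C, Pi.evalRingHom_apply, charFun_apply]
  split_ifs <;> simp

theorem factorAt_X (i : S) : factorAt i X = X := by simp [factorAt]

theorem idem_mul (U U' : Set S) : idem U * idem U' = idem (U ∩ U') := by
  rw [idem, idem, ← Polynomial.C_mul, charFun_mul]; rfl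

theorem idem_mul_self (U : Set S) : idem U * idem U = idem U := by rw [idem_mul, Set.inter_self]

@[simp] theorem idem_univ : idem (Set.univ : Set S) = 1 := by simp [idem, charFun]

@[simp] theorem idem_empty : idem (∅ : Set S) = 0 := by
  rw [idem, charFun, Set.indicator_empty']; exact Polynomial.C_0

theorem charFun_add_compl (U : Set S) : charFun U + charFun Uᶜ = 1 := by
  simp [charFun]

theorem idem_add_compl (U : Set S) : idem U + idem Uᶜ = 1 := by
  rw [idem, idem, ← Polynomial.C_add, charFun_add_compl, Polynomial.C_1]

/-- The element that is `c ^ m` on `U` and `1` elsewhere. -/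
def eulerElt (U : Set S) (m : ℕ) : (S → ℚ)[X] := idem U * X ^ m + idem Uᶜ

open Classical in
theorem factorAt_eulerElt (U : Set S) (m : ℕ) (i : S) :
    factorAt i (eulerElt U m) = if i ∈ U then X ^ m else 1 := by
  simp only [eulerElt, map_add, map_mul, map_pow, factorAt_idem, factorAt_X, Set.mem_compl_iff]
  split_ifs <;> simp

theorem eulerElt_mul (U : Set S) (m m' : ℕ) :
    eulerElt U m * eulerElt U m' = eulerElt U (m + m') := by
  refine ext_factorAt fun i => ?_
  simp only [map_mul, factorAt_eulerElt]
  split_ifs <;> simp [pow_add]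

theorem eulerElt_mul_of_disjoint {U U' : Set S} (h : Disjoint U U') (m : ℕ) :
    eulerElt U m * eulerElt U' m = eulerElt (U ∪ U') m := by
  refine ext_factorAt fun i => ?_
  have hi : i ∈ U → i ∉ U' := fun h1 h2 => Set.disjoint_left.1 h h1 h2
  have hu : i ∈ U ∪ U' ↔ i ∈ U ∨ i ∈ U' := Iff.rfl
  simp only [map_mul, factorAt_eulerElt]
  split_ifs <;> first | (exfalso; tauto) | simp

@[simp] theorem eulerElt_zero (U : Set S) : eulerElt U 0 = 1 := by
  rw [eulerElt, pow_zero, mul_one, idem_add_compl]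

@[simp] theorem eulerElt_empty (m : ℕ) : eulerElt (∅ : Set S) m = 1 := by
  simp [eulerElt]

theorem idem_mul_eulerElt (U : Set S) (m : ℕ) : idem U * eulerElt U m = idem U * X ^ m := by
  refine ext_factorAt fun i => ?_
  simp only [map_mul, factorAt_eulerElt, factorAt_idem, map_pow, factorAt_X]
  split_ifs <;> simp

theorem idem_compl_mul_eulerElt (U : Set S) (m : ℕ) : idem Uᶜ * eulerElt U m = idem Uᶜ := by
  refine ext_factorAt fun i => ?_
  have hu : i ∈ Uᶜ ↔ i ∉ U := Iff.rfl
  simp only [map_mul, factorAt_eulerElt, factorAt_idem]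
  split_ifs <;> first | (exfalso; tauto) | simp

theorem eulerClass_eq (H : OverT) : eulerClass H = eulerElt {H} 1 := by
  rw [eulerClass, eulerElt, pow_one]; rfl

theorem eulerElt_singleton_mem (H : OverT) (m : ℕ) : eulerElt {H} m ∈ eulerT := by
  induction m with
  | zero => simp [one_mem]
  | succ m ih =>
    rw [← eulerElt_mul, ← eulerClass_eq]
    exact mul_mem ih (Submonoid.subset_closure ⟨H, rfl⟩)

theorem eulerElt_mem (T : Finset OverT) (m : ℕ) : eulerElt (T : Set OverT) m ∈ eulerT := by
  classical
  induction T using Finset.induction_on with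
  | empty => simp [one_mem]
  | insert a s ha ih =>
    rw [Finset.coe_insert, ← Set.singleton_union, ← eulerElt_mul_of_disjoint (by simpa using ha)]
    exact mul_mem (eulerElt_singleton_mem a m) ih

theorem eulerElt_dvd_of_subset {U U' : Set S} (h : U ⊆ U') (m : ℕ) :
    eulerElt U m ∣ eulerElt U' m :=
  ⟨eulerElt (U' \ U) m, by
    rw [eulerElt_mul_of_disjoint Set.disjoint_sdiff_right, Set.union_sdiff_cancel h]⟩

theorem eulerElt_dvd_of_le (U : Set S) {m m' : ℕ} (h : m ≤ m') :
    eulerElt U m ∣ eulerElt U m' :=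
  ⟨eulerElt U (m' - m), by rw [eulerElt_mul, Nat.add_sub_cancel' h]⟩

theorem exists_dvd_eulerElt {e : RingT} (he : e ∈ eulerT) :
    ∃ (T : Finset OverT) (m : ℕ), e ∣ eulerElt (T : Set OverT) m := by
  classical
  induction he using Submonoid.closure_induction with
  | mem x hx =>
    obtain ⟨H, rfl⟩ := hx
    exact ⟨{H}, 1, by rw [eulerClass_eq]; simp⟩
  | one => exact ⟨∅, 0, by simp⟩
  | mul x y _ _ hx hy =>
    obtain ⟨T, m, h⟩ := hx
    obtain ⟨T', m', h'⟩ := hy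
    refine ⟨T ∪ T', m + m', ?_⟩
    rw [← eulerElt_mul]
    exact mul_dvd_mul (h.trans (eulerElt_dvd_of_subset (by simp) _))
      (h'.trans (eulerElt_dvd_of_subset (by simp) _))

/-! ### Inflation -/

theorem inflZ_charFun (D : FullSubgroups) (T : Set OverZ) :
    inflZ D (charFun T) = idem (FiniteSubgroup.mulZ ⁻¹' T) := rfl

theorem inflT_idem (D : FullSubgroups) (T : Set OverT) :
    inflT D (idem T) = idem (FiniteSubgroup.mulT ⁻¹' T) := by
  rw [inflT, idem, Polynomial.coe_mapRingHom, Polynomial.map_C]; rfl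

@[simp] theorem inflT_X (D : FullSubgroups) : inflT D X = X := by
  rw [inflT, Polynomial.coe_mapRingHom, Polynomial.map_X]

theorem inflT_eulerElt (D : FullSubgroups) (T : Set OverT) (m : ℕ) :
    inflT D (eulerElt T m) = eulerElt (FiniteSubgroup.mulT ⁻¹' T) m := by
  rw [eulerElt, map_add, map_mul, map_pow, inflT_X, inflT_idem, inflT_idem]; rfl

theorem coeff_inflT (D : FullSubgroups) (p : RingT) (k : ℕ) (F : FiniteSubgroup D) :
    (inflT D p).coeff k F = p.coeff k F.mulT := by
  simp [inflT]

/-! ### Homogeneous elements -/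

theorem idem_mem_degC (U : Set S) : idem U ∈ degC S 0 := by
  intro k hk
  rcases Nat.eq_zero_or_pos k with rfl | h
  · simp
  · exact absurd (Polynomial.coeff_C_of_ne_zero h.ne') hk

theorem X_pow_mem_degC (S : Type) (m : ℕ) : (X ^ m : (S → ℚ)[X]) ∈ degC S (-2 * (m : ℤ)) := by
  intro k hk
  rw [Polynomial.coeff_X_pow] at hk
  split_ifs at hk with h
  · rw [h]
  · exact absurd rfl hk

theorem C_mem_degC (a : S → ℚ) : (Polynomial.C a) ∈ degC S 0 := by
  intro k hk
  rcases Nat.eq_zero_or_pos k with rfl | h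
  · simp
  · exact absurd (Polynomial.coeff_C_of_ne_zero h.ne') hk

theorem mul_mem_degC {i j : ℤ} {a b : (S → ℚ)[X]} (ha : a ∈ degC S i) (hb : b ∈ degC S j) :
    a * b ∈ degC S (i + j) := by
  intro k hk
  rw [Polynomial.coeff_mul] at hk
  obtain ⟨⟨k₁, k₂⟩, hk', hne⟩ := Finset.exists_ne_zero_of_sum_ne_zero hk
  have h1 := ha k₁ (left_ne_zero_of_mul hne)
  have h2 := hb k₂ (right_ne_zero_of_mul hne)
  have := Finset.HasAntidiagonal.mem_antidiagonal.1 hk'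
  simp only at this
  rw [h1, h2, ← this]; push_cast; ring

theorem idem_mul_X_pow_mem_degC (U : Set S) (m : ℕ) :
    idem U * X ^ m ∈ degC S (-2 * (m : ℤ)) := by
  have := mul_mem_degC (idem_mem_degC U) (X_pow_mem_degC S m)
  rwa [zero_add] at this

theorem inflT_mem_degC (D : FullSubgroups) {i : ℤ} {a : RingT} (ha : a ∈ degC OverT i) :
    inflT D a ∈ degC (FiniteSubgroup D) i := by
  intro k hk
  apply ha k
  intro h0
  apply hk
  ext F
  rw [coeff_inflT, h0]; rfl

theorem inflZ_mem_degC (D : FullSubgroups) (a : RingZ) :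
    inflZ D a ∈ degC (FiniteSubgroup D) 0 := C_mem_degC _

end Idem

/-! ### Graded modules -/

namespace GrMod

variable {R : Type} [CommRing R] {A : ℤ → Set R}

theorem internal_of_proj {M : Type} [AddCommGroup M] (gr : ℤ → AddSubgroup M) (π : ℤ → M →+ M)
    (hmem : ∀ k x, π k x ∈ gr k) (hid : ∀ k, ∀ x ∈ gr k, π k x = x)
    (hne : ∀ j k, j ≠ k → ∀ x ∈ gr k, π j x = 0)
    (hsum : ∀ x, ∃ s : Finset ℤ, x = ∑ k ∈ s, π k x) : DirectSum.IsInternal gr := by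
  classical
  constructor
  · rw [injective_iff_map_eq_zero]
    intro f hf
    have key : ∀ (g : DirectSum ℤ fun k => gr k) (k : ℤ),
        π k (DirectSum.coeAddMonoidHom gr g) = g k := by
      intro g k
      induction g using DirectSum.induction_on with
      | zero => simp
      | of i x =>
        rw [DirectSum.coeAddMonoidHom_of]
        by_cases h : k = i
        · subst h; rw [hid _ _ x.2, DirectSum.of_eq_same]
        · rw [hne _ _ h _ x.2, DirectSum.of_eq_of_ne _ _ _ h]; rfl
      | add x y hx hy => rw [map_add, map_add, hx, hy]; rfl
    ext k
    rw [← key f k, hf, map_zero]; rfl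
  · intro x
    obtain ⟨s, hs⟩ := hsum x
    refine ⟨∑ k ∈ s, DirectSum.of (fun k => gr k) k ⟨π k x, hmem k x⟩, ?_⟩
    rw [map_sum, hs]
    refine Finset.sum_congr rfl fun k _ => ?_
    rw [DirectSum.coeAddMonoidHom_of, ← hs]

/-- The projection to the homogeneous elements of degree `k`. -/
def proj (M : GrMod R A) (k : ℤ) : M →+ M :=
  (M.gr k).subtype.comp ((DFinsupp.evalAddMonoidHom (β := fun k => M.gr k) k).comp
    (AddEquiv.ofBijective (DirectSum.coeAddMonoidHom M.gr) M.internal).symm.toAddMonoidHom)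

variable (M : GrMod R A)

theorem proj_mem (k : ℤ) (x : M) : M.proj k x ∈ M.gr k :=
  ((AddEquiv.ofBijective (DirectSum.coeAddMonoidHom M.gr) M.internal).symm x k).2

theorem proj_coe (k : ℤ) (f : DirectSum ℤ fun k => M.gr k) :
    M.proj k (DirectSum.coeAddMonoidHom M.gr f) = f k := by
  have : (AddEquiv.ofBijective (DirectSum.coeAddMonoidHom M.gr) M.internal).symm
      (DirectSum.coeAddMonoidHom M.gr f) = f :=
    (AddEquiv.ofBijective (DirectSum.coeAddMonoidHom M.gr) M.internal).symm_apply_apply f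
  change (((AddEquiv.ofBijective (DirectSum.coeAddMonoidHom M.gr) M.internal).symm
      (DirectSum.coeAddMonoidHom M.gr f)) k : M) = f k
  rw [this]

variable {M}

theorem proj_of_mem {k : ℤ} {x : M} (hx : x ∈ M.gr k) : M.proj k x = x := by
  have := M.proj_coe k (DirectSum.of (fun k => M.gr k) k ⟨x, hx⟩)
  rwa [DirectSum.coeAddMonoidHom_of, DirectSum.of_eq_same] at this

theorem proj_of_mem_ne {j k : ℤ} (h : j ≠ k) {x : M} (hx : x ∈ M.gr k) : M.proj j x = 0 := by
  have := M.proj_coe j (DirectSum.of (fun k => M.gr k) k ⟨x, hx⟩)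
  rwa [DirectSum.coeAddMonoidHom_of, DirectSum.of_eq_of_ne _ _ _ h] at this

theorem exists_sum_proj (x : M) :
    ∃ s : Finset ℤ, (∀ k ∉ s, M.proj k x = 0) ∧ x = ∑ k ∈ s, M.proj k x := by
  classical
  obtain ⟨f, rfl⟩ := M.internal.2 x
  refine ⟨f.support, fun k hk => ?_, ?_⟩
  · rw [proj_coe, DFinsupp.notMem_support_iff.1 hk]; rfl
  · conv_lhs => rw [DirectSum.coeAddMonoidHom_eq_dfinsuppSum]
    exact Finset.sum_congr rfl fun k _ => (M.proj_coe k f).symm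

theorem mem_of_forall_proj {H : AddSubgroup M} {x : M} (h : ∀ k, M.proj k x ∈ H) : x ∈ H := by
  obtain ⟨s, -, hs⟩ := exists_sum_proj x
  rw [hs]; exact sum_mem fun k _ => h k

theorem proj_smul {i j : ℤ} {a : R} (ha : a ∈ A i) (x : M) :
    M.proj (i + j) (a • x) = a • M.proj j x := by
  obtain ⟨s, hs, hx⟩ := exists_sum_proj x
  have h1 : ∀ k ∈ s, M.proj (i + j) (a • M.proj k x) = if k = j then a • M.proj j x else 0 := by
    intro k _
    have hk := M.smul_mem ha (M.proj_mem k x)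
    split_ifs with h
    · subst h; exact proj_of_mem hk
    · exact proj_of_mem_ne (by omega) hk
  conv_lhs => rw [hx, Finset.smul_sum, map_sum, Finset.sum_congr rfl h1]
  rw [Finset.sum_ite_eq' s j]
  split_ifs with h
  · rfl
  · rw [hs j h, smul_zero]

theorem proj_smul_zero {j : ℤ} {a : R} (ha : a ∈ A 0) (x : M) :
    M.proj j (a • x) = a • M.proj j x := by
  have := proj_smul (j := j) ha x
  rwa [zero_add] at this

theorem map_proj {R' : Type} [CommRing R'] {A' : ℤ → Set R'} {M' : GrMod R' A'} (f : M →+ M')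
    (hf : ∀ k, ∀ x ∈ M.gr k, f x ∈ M'.gr k) (k : ℤ) (x : M) :
    f (M.proj k x) = M'.proj k (f x) := by
  obtain ⟨s, hs, hx⟩ := exists_sum_proj x
  have h1 : ∀ j ∈ s, M'.proj k (f (M.proj j x)) = if j = k then f (M.proj k x) else 0 := by
    intro j _
    have hj := hf j _ (M.proj_mem j x)
    split_ifs with h
    · subst h; exact proj_of_mem hj
    · exact proj_of_mem_ne (Ne.symm h) hj
  conv_rhs => rw [hx, map_sum, map_sum, Finset.sum_congr rfl h1]
  rw [Finset.sum_ite_eq' s k]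
  split_ifs with h
  · rfl
  · rw [hs k h, map_zero]

/-- A submodule is homogeneous if it contains the homogeneous components of its elements. -/
def Homogeneous (N : Submodule R M) : Prop := ∀ k, ∀ x ∈ N, M.proj k x ∈ N

/-- A homogeneous submodule as a graded module. -/
abbrev ofSub (N : Submodule R M) (hN : Homogeneous N) : GrMod R A where
  carrier := N
  gr k := (M.gr k).comap N.subtype.toAddMonoidHom
  internal := by
    refine internal_of_proj _
      (fun k => ((M.proj k).comp N.subtype.toAddMonoidHom).codRestrict N
        (fun x => hN k x x.2)) ?_ ?_ ?_ ?_
    · intro k x; exact M.proj_mem k x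
    · intro k x hx; exact Subtype.ext (proj_of_mem hx)
    · intro j k h x hx; exact Subtype.ext (proj_of_mem_ne h hx)
    · intro x
      obtain ⟨s, -, hs⟩ := exists_sum_proj (x : M)
      refine ⟨s, Subtype.ext ?_⟩
      conv_lhs => rw [hs]
      change _ = N.subtype.toAddMonoidHom _
      rw [map_sum]; rfl
  smul_mem ha hx := M.smul_mem ha hx

/-- The quotient by a homogeneous submodule. -/
abbrev quot (N : Submodule R M) (hN : Homogeneous N) : GrMod R A where
  carrier := M ⧸ N
  gr k := (M.gr k).map N.mkQ.toAddMonoidHom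
  internal := by
    have hle : ∀ k, N.toAddSubgroup ≤
        (N.mkQ.toAddMonoidHom.comp (M.proj k)).ker := by
      intro k x hx
      exact (Submodule.Quotient.mk_eq_zero N).2 (hN k x hx)
    refine internal_of_proj _ (fun k => QuotientAddGroup.lift N.toAddSubgroup _ (hle k)) ?_ ?_ ?_ ?_
    · intro k x
      obtain ⟨x, rfl⟩ := N.mkQ_surjective x
      exact ⟨M.proj k x, M.proj_mem k x, rfl⟩
    · rintro k _ ⟨x, hx, rfl⟩
      exact congrArg N.mkQ (proj_of_mem hx)
    · rintro j k h _ ⟨x, hx, rfl⟩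
      exact (congrArg N.mkQ (proj_of_mem_ne h hx)).trans (map_zero _)
    · intro x
      obtain ⟨x, rfl⟩ := N.mkQ_surjective x
      obtain ⟨s, -, hs⟩ := exists_sum_proj x
      refine ⟨s, ?_⟩
      conv_lhs => rw [hs, map_sum]
      rfl
  smul_mem := by
    rintro i j a _ ha ⟨x, hx, rfl⟩
    exact ⟨a • x, M.smul_mem ha hx, map_smul N.mkQ a x⟩

/-- The direct sum of graded modules. -/
abbrev dsum {J : Type} (M : J → GrMod R A) : GrMod R A where
  carrier := DirectSum J fun j => M j
  gr k :=
    { carrier := {x | ∀ j, x j ∈ (M j).gr k}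
      zero_mem' := fun j => zero_mem _
      add_mem' := fun hx hy j => add_mem (hx j) (hy j)
      neg_mem' := fun hx j => neg_mem (hx j) }
  internal := by
    classical
    refine internal_of_proj _ (fun k => DFinsupp.mapRange.addMonoidHom fun j => (M j).proj k)
      ?_ ?_ ?_ ?_
    · intro k x j; exact (M j).proj_mem k (x j)
    · intro k x hx; ext1 j; exact proj_of_mem (hx j)
    · intro j k h x hx; ext1 i; exact proj_of_mem_ne h (hx i)
    · intro x
      choose s hs hx using fun j => exists_sum_proj (x j)
      refine ⟨(DFinsupp.support x).biUnion s, ?_⟩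
      ext1 j
      rw [DirectSum.sum_apply]
      change x j = ∑ k ∈ _, (M j).proj k (x j)
      by_cases hj : x j = 0
      · rw [hj]; simp
      · conv_lhs => rw [hx j]
        refine Finset.sum_subset (Finset.subset_biUnion_of_mem s (DFinsupp.mem_support_iff.2 hj)) ?_
        intro k _ hk; exact hs j k hk
  smul_mem ha hx j := (M j).smul_mem ha (hx j)

end GrMod

end

noncomputable section

/-! ### Localization at the characteristic functions of cofinite sets -/

section Cof

theorem charFun_mem_cofZ {T : Set OverZ} (hT : Tᶜ.Finite) : charFun T ∈ cofZ := ⟨T, hT, rfl⟩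

theorem inflZ_charFun_mem_cofF (D : FullSubgroups) {T : Set OverZ} (hT : Tᶜ.Finite) :
    inflZ D (charFun T) ∈ cofF D := Submonoid.mem_map_of_mem _ (charFun_mem_cofZ hT)

theorem charFun_mul_self {S : Type} (T : Set S) : charFun T * charFun T = charFun T := by
  rw [charFun_mul, Set.inter_self]

theorem mk_eq_mk_one_of_idempotent {R : Type} [CommRing R] {S : Submonoid R} {M : Type}
    [AddCommGroup M] [Module R M] (s : S) (hs : (s : R) * s = s) (x : M) :
    (LocalizedModule.mk x s : LocalizedModule S M) = LocalizedModule.mk x 1 := by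
  refine LocalizedModule.mk_eq.2 ⟨s, ?_⟩
  simp only [Submonoid.smul_def, one_smul, smul_smul, hs]

variable {P : Type} [AddCommGroup P] [Module RingZ P]

theorem mk_cofZ (p : P) (i : cofZ) :
    (LocalizedModule.mk p i : LocalizedModule cofZ P) = LocalizedModule.mk p 1 := by
  obtain ⟨_, T, hT, rfl⟩ := i
  exact mk_eq_mk_one_of_idempotent _ (charFun_mul_self T) p

theorem exists_mk_cofZ (y : LocalizedModule cofZ P) : ∃ p : P, y = LocalizedModule.mk p 1 := by
  induction y using LocalizedModule.induction_on with
  | h p i => exact ⟨p, mk_cofZ p i⟩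

theorem mk_cofZ_eq_iff {p p' : P} :
    (LocalizedModule.mk p 1 : LocalizedModule cofZ P) = LocalizedModule.mk p' 1 ↔
      ∃ T : Set OverZ, Tᶜ.Finite ∧ charFun T • p = charFun T • p' := by
  rw [LocalizedModule.mk_eq]
  constructor
  · rintro ⟨⟨_, T, hT, rfl⟩, h⟩
    refine ⟨T, hT, ?_⟩
    simpa [Submonoid.smul_def] using h
  · rintro ⟨T, hT, h⟩
    refine ⟨⟨_, charFun_mem_cofZ hT⟩, ?_⟩
    simpa [Submonoid.smul_def] using h

variable {D : FullSubgroups} {N : Type} [AddCommGroup N] [Module (RingF D) N]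

theorem mk_cofF (x : N) (i : cofF D) :
    (LocalizedModule.mk x i : LocalizedModule (cofF D) N) = LocalizedModule.mk x 1 := by
  obtain ⟨_, _, ⟨T, hT, rfl⟩, rfl⟩ := i
  refine mk_eq_mk_one_of_idempotent _ ?_ x
  change inflZ D _ * inflZ D _ = inflZ D _
  rw [← map_mul, charFun_mul_self]

theorem exists_mk_cofF (y : LocalizedModule (cofF D) N) :
    ∃ x : N, y = LocalizedModule.mk x 1 := by
  induction y using LocalizedModule.induction_on with
  | h x i => exact ⟨x, mk_cofF x i⟩

theorem mk_cofF_eq_iff {x x' : N} :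
    (LocalizedModule.mk x 1 : LocalizedModule (cofF D) N) = LocalizedModule.mk x' 1 ↔
      ∃ T : Set OverZ, Tᶜ.Finite ∧ inflZ D (charFun T) • x = inflZ D (charFun T) • x' := by
  rw [LocalizedModule.mk_eq]
  constructor
  · rintro ⟨⟨_, _, ⟨T, hT, rfl⟩, rfl⟩, h⟩
    refine ⟨T, hT, ?_⟩
    simpa [Submonoid.smul_def] using h
  · rintro ⟨T, hT, h⟩
    refine ⟨⟨_, inflZ_charFun_mem_cofF D hT⟩, ?_⟩
    simpa [Submonoid.smul_def] using h

end Cof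

/-! ### Localization at Euler classes -/

section Euler

variable {R : Type} [CommRing R] {θ : RingT →+* R} {S : Submonoid R}

theorem eulerElt_mem_map (hS : S = eulerT.map θ) (T : Finset OverT) (m : ℕ) :
    θ (eulerElt (T : Set OverT) m) ∈ S := by
  rw [hS]; exact Submonoid.mem_map_of_mem _ (eulerElt_mem T m)

theorem exists_mul_eq_eulerElt (hS : S = eulerT.map θ) (s : S) :
    ∃ (T : Finset OverT) (m : ℕ) (r : R), r * s = θ (eulerElt (T : Set OverT) m) := by
  obtain ⟨s, hs⟩ := s
  subst hS
  obtain ⟨e, he, rfl⟩ := hs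
  obtain ⟨T, m, f, hf⟩ := exists_dvd_eulerElt he
  exact ⟨T, m, θ f, by rw [hf, map_mul, mul_comm]⟩

variable {M : Type} [AddCommGroup M] [Module R M]

theorem exists_mk_eulerElt (hS : S = eulerT.map θ) (y : LocalizedModule S M) :
    ∃ (T : Finset OverT) (m : ℕ) (x : M),
      y = LocalizedModule.mk x ⟨θ (eulerElt (T : Set OverT) m), eulerElt_mem_map hS T m⟩ := by
  induction y using LocalizedModule.induction_on with
  | h x s =>
    obtain ⟨T, m, r, hr⟩ := exists_mul_eq_eulerElt hS s
    refine ⟨T, m, r • x, LocalizedModule.mk_eq.2 ⟨1, ?_⟩⟩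
    simp only [Submonoid.smul_def, one_smul, smul_smul]
    rw [← hr, mul_comm]

theorem mk_euler_eq_iff (hS : S = eulerT.map θ) {x x' : M} :
    (LocalizedModule.mk x 1 : LocalizedModule S M) = LocalizedModule.mk x' 1 ↔
      ∃ (T : Finset OverT) (m : ℕ), θ (eulerElt (T : Set OverT) m) • x =
        θ (eulerElt (T : Set OverT) m) • x' := by
  rw [LocalizedModule.mk_eq]
  constructor
  · rintro ⟨u, h⟩
    obtain ⟨T, m, r, hr⟩ := exists_mul_eq_eulerElt hS u
    refine ⟨T, m, ?_⟩
    simp only [Submonoid.smul_def, one_smul] at h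
    rw [← hr, mul_smul, mul_smul, h]
  · rintro ⟨T, m, h⟩
    refine ⟨⟨_, eulerElt_mem_map hS T m⟩, ?_⟩
    simpa [Submonoid.smul_def] using h

theorem smul_mk_self {R : Type} [CommRing R] {S : Submonoid R} {M : Type}
    [AddCommGroup M] [Module R M] (s : S) (x : M) :
    (s : R) • (LocalizedModule.mk x s : LocalizedModule S M) = LocalizedModule.mk x 1 := by
  rw [LocalizedModule.smul'_mk, ← Submonoid.smul_def, LocalizedModule.mk_cancel]

theorem smul_mk_one {R : Type} [CommRing R] {S : Submonoid R} {M : Type}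
    [AddCommGroup M] [Module R M] (r : R) (x : M) :
    r • (LocalizedModule.mk x 1 : LocalizedModule S M) = LocalizedModule.mk (r • x) 1 :=
  LocalizedModule.smul'_mk _ _ _

theorem mk_one_add {R : Type} [CommRing R] {S : Submonoid R} {M : Type}
    [AddCommGroup M] [Module R M] (x y : M) :
    (LocalizedModule.mk (x + y) 1 : LocalizedModule S M) =
      LocalizedModule.mk x 1 + LocalizedModule.mk y 1 :=
  map_add (LocalizedModule.mkLinearMap S M) x y

theorem mk_one_sub {R : Type} [CommRing R] {S : Submonoid R} {M : Type}
    [AddCommGroup M] [Module R M] (x y : M) :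
    (LocalizedModule.mk (x - y) 1 : LocalizedModule S M) =
      LocalizedModule.mk x 1 - LocalizedModule.mk y 1 :=
  map_sub (LocalizedModule.mkLinearMap S M) x y

theorem smul_left_cancel_of_mem {R : Type} [CommRing R] {S : Submonoid R} {M : Type}
    [AddCommGroup M] [Module R M] {s : R} (hs : s ∈ S) {y y' : LocalizedModule S M}
    (h : s • y = s • y') : y = y' :=
  ((LocalizedModule.smul_eq_iff_of_mem s hs y (s • y')).1 h).trans
    ((LocalizedModule.smul_eq_iff_of_mem s hs y' (s • y')).1 rfl).symm

variable {A : ℤ → Set R}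

/-- `θ` sends homogeneous idempotents and powers of `c` to homogeneous elements. -/
def PreservesDegree (θ : RingT →+* R) (A : ℤ → Set R) : Prop :=
  ∀ i, ∀ a ∈ degC OverT i, θ a ∈ A i

theorem preservesDegree_id : PreservesDegree (RingHom.id RingT) (degC OverT) :=
  fun _ _ h => h

theorem preservesDegree_inflT (D : FullSubgroups) :
    PreservesDegree (inflT D) (degC (FiniteSubgroup D)) := fun _ _ h => inflT_mem_degC D h

theorem mk_proj_eq (hθ : PreservesDegree θ A) (hS : S = eulerT.map θ) {M : GrMod R A} {x h : M}
    {d : ℤ} (hh : h ∈ M.gr d)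
    (hx : (LocalizedModule.mk x 1 : LocalizedModule S M) = LocalizedModule.mk h 1) :
    (LocalizedModule.mk (M.proj d x) 1 : LocalizedModule S M) = LocalizedModule.mk x 1 := by
  rw [hx]
  obtain ⟨T, m, hT⟩ := (mk_euler_eq_iff hS).1 hx
  refine (mk_euler_eq_iff hS).2 ⟨T, m, ?_⟩
  have h1 : θ (idem (T : Set OverT) * X ^ m) • M.proj d x =
      θ (idem (T : Set OverT) * X ^ m) • h := by
    have hd := hθ _ _ (idem_mul_X_pow_mem_degC (T : Set OverT) m)
    rw [← GrMod.proj_smul hd, ← idem_mul_eulerElt, map_mul, mul_smul, hT, ← mul_smul, ← map_mul,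
      idem_mul_eulerElt, GrMod.proj_smul hd, GrMod.proj_of_mem hh]
  have h2 : θ (idem (T : Set OverT)ᶜ) • M.proj d x = θ (idem (T : Set OverT)ᶜ) • h := by
    have hd := hθ _ _ (idem_mem_degC (T : Set OverT)ᶜ)
    rw [← GrMod.proj_smul_zero hd, ← idem_compl_mul_eulerElt _ m, map_mul, mul_smul, hT,
      ← mul_smul, ← map_mul, idem_compl_mul_eulerElt, GrMod.proj_smul_zero hd,
      GrMod.proj_of_mem hh]
  rw [eulerElt, map_add, add_smul, add_smul, h1, h2]

theorem mem_eulerLocGr_of_map (hθ : PreservesDegree θ A) (hS : S = eulerT.map θ)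
    {M M' : GrMod R A} (f : M' →ₗ[R] M) (hf : Function.Injective f)
    (hgr : ∀ k, ∀ x ∈ M'.gr k, f x ∈ M.gr k) {k : ℤ} {y : LocalizedModule S M'}
    (hy : LocalizedModule.map S f y ∈ eulerLocGr θ S M k) : y ∈ eulerLocGr θ S M' k := by
  classical
  obtain ⟨T, j, x₁, hx₁, x₂, hx₂, h₁, h₂⟩ := hy
  change θ (idem (T : Set OverT) * X ^ j) • _ = _ at h₁
  change θ (idem (T : Set OverT)ᶜ) • _ = _ at h₂
  obtain ⟨W, m, x, rfl⟩ := exists_mk_eulerElt hS y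
  set y := (LocalizedModule.mk x ⟨θ (eulerElt (W : Set OverT) m), eulerElt_mem_map hS W m⟩ :
    LocalizedModule S M') with hy
  have hyx : θ (eulerElt (W : Set OverT) m) • y = LocalizedModule.mk x 1 := by
    rw [hy]; exact smul_mk_self (S := S) ⟨_, eulerElt_mem_map hS W m⟩ x
  have hinj := LocalizedModule.map_injective S f hf
  -- a homogeneous multiple of `y` that comes from `M'` comes from a homogeneous element
  have key : ∀ (a b : RingT) (d : ℤ) (h : M), a = b * eulerElt (W : Set OverT) m → h ∈ M.gr d →
      θ a • LocalizedModule.map S f y = LocalizedModule.mk h 1 →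
      ∃ z ∈ M'.gr d, θ a • y = LocalizedModule.mk z 1 := by
    intro a b d h hab hh hay
    have h3 : θ a • y = LocalizedModule.mk (θ b • x) 1 := by
      rw [hab, map_mul, mul_smul, hyx, smul_mk_one]
    refine ⟨M'.proj d (θ b • x), M'.proj_mem _ _, ?_⟩
    apply hinj
    have h4 : (LocalizedModule.mk (f (θ b • x)) 1 : LocalizedModule S M) =
        LocalizedModule.mk h 1 := by
      rw [← LocalizedModule.map_mk, ← h3, ← hay]
      exact ((LocalizedModule.map S f).restrictScalars R).map_smul _ _
    have h5 : f (M'.proj d (θ b • x)) = M.proj d (f (θ b • x)) :=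
      GrMod.map_proj f.toAddMonoidHom hgr d _
    rw [h3, LocalizedModule.map_mk, LocalizedModule.map_mk, h5, mk_proj_eq hθ hS hh h4]
  have hsm : ∀ (a : RingT) (z : M), θ a • (LocalizedModule.mk z 1 : LocalizedModule S M) =
    LocalizedModule.mk (θ a • z) 1 := fun a z => smul_mk_one _ _
  set U : Finset OverT := T ∪ W with hU
  set n := j + m with hn
  obtain ⟨z₂, hz₂, hz₂'⟩ : ∃ z ∈ M'.gr k, θ (idem (U : Set OverT)ᶜ) • y =
      LocalizedModule.mk z 1 := by
    refine key _ (idem (U : Set OverT)ᶜ) k (θ (idem (U : Set OverT)ᶜ) • x₂) ?_ ?_ ?_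
    · refine ext_factorAt fun i => ?_
      have h1 : i ∈ (U : Set OverT)ᶜ → i ∉ (W : Set OverT) := by
        intro h h'; exact h (by simpa [hU] using Or.inr h')
      simp only [map_mul, factorAt_eulerElt, factorAt_idem]
      split_ifs <;> first | (exfalso; tauto) | simp
    · simpa using M.smul_mem (hθ _ _ (idem_mem_degC (U : Set OverT)ᶜ)) hx₂
    · have : (idem (U : Set OverT)ᶜ : RingT) = idem (U : Set OverT)ᶜ * idem (T : Set OverT)ᶜ := by
        rw [idem_mul]; congr 1; ext i; simp [hU]; tauto
      rw [← hsm, ← h₂, ← mul_smul, ← map_mul, ← this]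
  obtain ⟨z₁, hz₁, hz₁'⟩ : ∃ z ∈ M'.gr (k - 2 * (n : ℤ)),
      θ (idem (U : Set OverT) * X ^ n) • y = LocalizedModule.mk z 1 := by
    refine key _
      (idem (U : Set OverT) * (idem (W : Set OverT) * X ^ j + idem (W : Set OverT)ᶜ * X ^ n))
      (k - 2 * (n : ℤ)) (θ (idem (T : Set OverT) * X ^ m) • x₁ +
        θ (idem ((U : Set OverT) ∩ (T : Set OverT)ᶜ) * X ^ n) • x₂) ?_ ?_ ?_
    · refine ext_factorAt fun i => ?_
      have h1 : i ∈ (U : Set OverT) ↔ (i ∈ (T : Set OverT) ∨ i ∈ (W : Set OverT)) := by simp [hU]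
      have h2 : i ∈ (W : Set OverT)ᶜ ↔ i ∉ (W : Set OverT) := Iff.rfl
      simp only [map_mul, map_add, map_pow, factorAt_X, factorAt_eulerElt, factorAt_idem]
      split_ifs <;> first | (exfalso; tauto) | simp [hn, pow_add]
    · refine add_mem ?_ ?_
      · have := M.smul_mem (hθ _ _ (idem_mul_X_pow_mem_degC (T : Set OverT) m)) hx₁
        convert this using 2; rw [hn]; push_cast; ring
      · have := M.smul_mem (hθ _ _ (idem_mul_X_pow_mem_degC
          ((U : Set OverT) ∩ (T : Set OverT)ᶜ) n)) hx₂
        convert this using 2; ring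
    · rw [mk_one_add, ← hsm, ← hsm, ← h₁, ← h₂, ← mul_smul, ← mul_smul, ← map_mul, ← map_mul,
        ← add_smul, ← map_add]
      congr 2
      refine ext_factorAt fun i => ?_
      have h1 : i ∈ (U : Set OverT) ↔ (i ∈ (T : Set OverT) ∨ i ∈ (W : Set OverT)) := by simp [hU]
      have h2 : i ∈ (T : Set OverT)ᶜ ↔ i ∉ (T : Set OverT) := Iff.rfl
      have h3 : i ∈ (U : Set OverT) ∩ (T : Set OverT)ᶜ ↔
        (i ∈ (U : Set OverT) ∧ i ∉ (T : Set OverT)) := Iff.rfl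
      simp only [map_mul, map_add, map_pow, factorAt_X, factorAt_idem]
      split_ifs <;> first | (exfalso; tauto) | (simp [hn, pow_add]; try ring)
  exact ⟨U, n, z₁, hz₁, z₂, hz₂, hz₁', hz₂'⟩

theorem eulerLocGr_add (hθ : PreservesDegree θ A) {M : GrMod R A} {k : ℤ}
    {y y' : LocalizedModule S M} (hy : y ∈ eulerLocGr θ S M k) (hy' : y' ∈ eulerLocGr θ S M k) :
    y + y' ∈ eulerLocGr θ S M k := by
  classical
  have enlarge : ∀ (T W : Finset OverT) (j m : ℕ), ∀ x₁ ∈ M.gr (k - 2 * (j : ℤ)), ∀ x₂ ∈ M.gr k,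
      ∀ y : LocalizedModule S M, θ (idem (T : Set OverT) * X ^ j) • y = LocalizedModule.mk x₁ 1 →
      θ (idem (T : Set OverT)ᶜ) • y = LocalizedModule.mk x₂ 1 →
      ∃ z₁ ∈ M.gr (k - 2 * ((j + m : ℕ) : ℤ)), ∃ z₂ ∈ M.gr k,
      θ (idem ((T ∪ W : Finset OverT) : Set OverT) * X ^ (j + m)) • y = LocalizedModule.mk z₁ 1 ∧
      θ (idem ((T ∪ W : Finset OverT) : Set OverT)ᶜ) • y = LocalizedModule.mk z₂ 1 := by
    intro T W j m x₁ hx₁ x₂ hx₂ y h₁ h₂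
    refine ⟨θ (X ^ m) • x₁ + θ (idem ((W : Set OverT) \ T) * X ^ (j + m)) • x₂, ?_,
      θ (idem ((T ∪ W : Finset OverT) : Set OverT)ᶜ) • x₂, ?_, ?_, ?_⟩
    · refine add_mem ?_ ?_
      · have := M.smul_mem (hθ _ _ (X_pow_mem_degC OverT m)) hx₁
        convert this using 2; push_cast; ring
      · have := M.smul_mem (hθ _ _ (idem_mul_X_pow_mem_degC ((W : Set OverT) \ T) (j + m))) hx₂
        convert this using 2; ring
    · simpa using M.smul_mem (hθ _ _ (idem_mem_degC ((T ∪ W : Finset OverT) : Set OverT)ᶜ)) hx₂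
    · rw [mk_one_add, ← smul_mk_one, ← smul_mk_one, ← h₁, ← h₂, ← mul_smul, ← mul_smul, ← map_mul,
        ← map_mul, ← add_smul, ← map_add]
      congr 2
      refine ext_factorAt fun i => ?_
      have h1 : i ∈ ((T ∪ W : Finset OverT) : Set OverT) ↔
        (i ∈ (T : Set OverT) ∨ i ∈ (W : Set OverT)) := by simp
      have h2 : i ∈ (T : Set OverT)ᶜ ↔ i ∉ (T : Set OverT) := Iff.rfl
      have h3 : i ∈ (W : Set OverT) \ T ↔
        (i ∈ (W : Set OverT) ∧ i ∉ (T : Set OverT)) := Iff.rfl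
      simp only [map_mul, map_add, map_pow, factorAt_X, factorAt_idem]
      split_ifs <;> first | (exfalso; tauto) | (simp [pow_add]; try ring)
    · rw [← smul_mk_one, ← h₂, ← mul_smul, ← map_mul, idem_mul]
      congr 3; ext i; simp; tauto
  obtain ⟨T, j, x₁, hx₁, x₂, hx₂, h₁, h₂⟩ := hy
  obtain ⟨T', j', x₁', hx₁', x₂', hx₂', h₁', h₂'⟩ := hy'
  obtain ⟨z₁, hz₁, z₂, hz₂, g₁, g₂⟩ := enlarge T T' j j' x₁ hx₁ x₂ hx₂ y h₁ h₂
  obtain ⟨z₁', hz₁', z₂', hz₂', g₁', g₂'⟩ := enlarge T' T j' j x₁' hx₁' x₂' hx₂' y' h₁' h₂'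
  rw [Finset.union_comm, add_comm j' j] at g₁'
  rw [Finset.union_comm] at g₂'
  rw [add_comm j' j] at hz₁'
  exact ⟨T ∪ T', j + j', z₁ + z₁', add_mem hz₁ hz₁', z₂ + z₂', add_mem hz₂ hz₂',
    by rw [smul_add, mk_one_add]; exact congrArg₂ _ g₁ g₁',
    by rw [smul_add, mk_one_add]; exact congrArg₂ _ g₂ g₂'⟩

theorem zero_mem_eulerLocGr {M : GrMod R A} {k : ℤ} :
    (0 : LocalizedModule S M) ∈ eulerLocGr θ S M k :=
  ⟨∅, 0, 0, zero_mem _, 0, zero_mem _, by rw [smul_zero, LocalizedModule.zero_mk],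
    by rw [smul_zero, LocalizedModule.zero_mk]⟩

theorem map_mem_eulerLocGr {M M' : GrMod R A} (f : M' →ₗ[R] M)
    (hgr : ∀ k, ∀ x ∈ M'.gr k, f x ∈ M.gr k) {k : ℤ} {y : LocalizedModule S M'}
    (hy : y ∈ eulerLocGr θ S M' k) : LocalizedModule.map S f y ∈ eulerLocGr θ S M k := by
  obtain ⟨T, j, x₁, hx₁, x₂, hx₂, h₁, h₂⟩ := hy
  have hs : ∀ a : R, a • LocalizedModule.map S f y = LocalizedModule.map S f (a • y) :=
    fun a => (((LocalizedModule.map S f).restrictScalars R).map_smul a y).symm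
  exact ⟨T, j, f x₁, hgr _ _ hx₁, f x₂, hgr _ _ hx₂,
    by rw [hs, h₁, LocalizedModule.map_mk], by rw [hs, h₂, LocalizedModule.map_mk]⟩

end Euler

end

noncomputable section

/-! ### Localizations of submodules -/

section LocSub

variable {R : Type} [CommRing R] (S : Submonoid R) {N : Type} [AddCommGroup N] [Module R N]

/-- The localization of a submodule as a submodule of the localization. -/
def locSub (N' : Submodule R N) : Submodule (Localization S) (LocalizedModule S N) :=
  LinearMap.range (LocalizedModule.map S N'.subtype)

variable {S}

theorem mem_locSub {N' : Submodule R N} {y : LocalizedModule S N} :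
    y ∈ locSub S N' ↔ ∃ x ∈ N', ∃ s, y = LocalizedModule.mk x s := by
  constructor
  · rintro ⟨z, rfl⟩
    induction z using LocalizedModule.induction_on with
    | h x s => exact ⟨x, x.2, s, by rw [LocalizedModule.map_mk]; rfl⟩
  · rintro ⟨x, hx, s, rfl⟩
    exact ⟨LocalizedModule.mk ⟨x, hx⟩ s, by rw [LocalizedModule.map_mk]; rfl⟩

theorem mk_mem_locSub {N' : Submodule R N} {x : N} (hx : x ∈ N') (s : S) :
    LocalizedModule.mk x s ∈ locSub S N' := mem_locSub.2 ⟨x, hx, s, rfl⟩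

theorem loc_smul_mk (x : N) (s : S) :
    (LocalizedModule.mk x s : LocalizedModule S N) =
      (Localization.mk 1 s : Localization S) • LocalizedModule.mk x 1 := by
  rw [LocalizedModule.mk_smul_mk, one_smul, mul_one]

theorem mk_mem_of_mk_one_mem {L : Submodule (Localization S) (LocalizedModule S N)} {x : N}
    (h : LocalizedModule.mk x 1 ∈ L) (s : S) : LocalizedModule.mk x s ∈ L := by
  rw [loc_smul_mk]; exact L.smul_mem _ h

theorem locSub_le {N' : Submodule R N} {L : Submodule (Localization S) (LocalizedModule S N)}
    (h : ∀ x ∈ N', LocalizedModule.mk x 1 ∈ L) : locSub S N' ≤ L := by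
  intro y hy
  obtain ⟨x, hx, s, rfl⟩ := mem_locSub.1 hy
  exact mk_mem_of_mk_one_mem (h x hx) s

theorem locSub_mono {N₁ N₂ : Submodule R N} (h : N₁ ≤ N₂) : locSub S N₁ ≤ locSub S N₂ :=
  locSub_le fun _ hx => mk_mem_locSub (h hx) 1

@[simp] theorem locSub_top : locSub S (⊤ : Submodule R N) = ⊤ := by
  rw [eq_top_iff]
  rintro y -
  induction y using LocalizedModule.induction_on with
  | h x s => exact mk_mem_locSub Submodule.mem_top s

@[simp] theorem locSub_bot : locSub S (⊥ : Submodule R N) = ⊥ := by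
  rw [eq_bot_iff]
  refine locSub_le fun x hx => ?_
  rw [(Submodule.mem_bot R).1 hx]
  exact LocalizedModule.zero_mk (S := S) 1

theorem locSub_iSup {J : Type} (N' : J → Submodule R N) :
    locSub S (⨆ j, N' j) = ⨆ j, locSub S (N' j) := by
  refine le_antisymm (locSub_le fun x hx => ?_) (iSup_le fun j => locSub_mono (le_iSup N' j))
  refine Submodule.iSup_induction N' (motive := fun x => LocalizedModule.mk x 1 ∈ _) hx ?_ ?_ ?_
  · intro j x hx
    exact Submodule.mem_iSup_of_mem j (mk_mem_locSub hx 1)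
  · rw [LocalizedModule.zero_mk]; exact zero_mem _
  · intro x y hx hy
    rw [mk_one_add]; exact add_mem hx hy

theorem locSub_sup (N₁ N₂ : Submodule R N) :
    locSub S (N₁ ⊔ N₂) = locSub S N₁ ⊔ locSub S N₂ := by
  refine le_antisymm (locSub_le fun x hx => ?_)
    (sup_le (locSub_mono le_sup_left) (locSub_mono le_sup_right))
  obtain ⟨a, ha, b, hb, rfl⟩ := Submodule.mem_sup.1 hx
  rw [mk_one_add]
  exact add_mem (Submodule.mem_sup_left (mk_mem_locSub ha 1))
    (Submodule.mem_sup_right (mk_mem_locSub hb 1))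

theorem locSub_span_singleton (x : N) :
    locSub S (Submodule.span R {x}) =
      Submodule.span (Localization S) {LocalizedModule.mk x 1} := by
  refine le_antisymm (locSub_le fun y hy => ?_) ?_
  · obtain ⟨r, rfl⟩ := Submodule.mem_span_singleton.1 hy
    refine Submodule.mem_span_singleton.2 ⟨algebraMap R _ r, ?_⟩
    rw [algebraMap_smul, smul_mk_one]
  · rw [Submodule.span_singleton_le_iff_mem]
    exact mk_mem_locSub (Submodule.mem_span_singleton_self x) 1

theorem map_mem_locSub_of_exact {N₂ : Type} [AddCommGroup N₂] [Module R N₂] (g : N →ₗ[R] N₂)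
    {y : LocalizedModule S N} :
    LocalizedModule.map S g y = 0 ↔ y ∈ locSub S (LinearMap.ker g) := by
  have h : Function.Exact (LinearMap.ker g).subtype g := LinearMap.exact_subtype_ker_map g
  exact LocalizedModule.map_exact S _ _ h y

theorem loc_map_smul {N₂ : Type} [AddCommGroup N₂] [Module R N₂] (g : N →ₗ[R] N₂) (r : R)
    (y : LocalizedModule S N) :
    LocalizedModule.map S g (r • y) = r • LocalizedModule.map S g y :=
  ((LocalizedModule.map S g).restrictScalars R).map_smul r y

theorem loc_map_map {N₂ N₃ : Type} [AddCommGroup N₂] [Module R N₂] [AddCommGroup N₃] [Module R N₃]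
    (g : N →ₗ[R] N₂) (h : N₂ →ₗ[R] N₃) (y : LocalizedModule S N) :
    LocalizedModule.map S h (LocalizedModule.map S g y) = LocalizedModule.map S (h.comp g) y := by
  induction y using LocalizedModule.induction_on with
  | h x s => simp only [LocalizedModule.map_mk]; rfl

theorem loc_map_add {N₂ : Type} [AddCommGroup N₂] [Module R N₂] (g h : N →ₗ[R] N₂)
    (y : LocalizedModule S N) :
    LocalizedModule.map S (g + h) y = LocalizedModule.map S g y + LocalizedModule.map S h y := by
  rw [map_add]; rfl

theorem loc_map_id (y : LocalizedModule S N) :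
    LocalizedModule.map S (LinearMap.id : N →ₗ[R] N) y = y := by
  rw [LocalizedModule.map_id]; rfl

theorem loc_map_zero {N₂ : Type} [AddCommGroup N₂] [Module R N₂]
    (y : LocalizedModule S N) :
    LocalizedModule.map S (0 : N →ₗ[R] N₂) y = 0 := by
  rw [map_zero]; rfl

theorem loc_subtype_mk_eq {N' : Submodule R N} {x y : N'} {s t : S}
    (h : (LocalizedModule.mk (x : N) s : LocalizedModule S N) = LocalizedModule.mk (y : N) t) :
    (LocalizedModule.mk x s : LocalizedModule S N') = LocalizedModule.mk y t := by
  apply LocalizedModule.map_injective S N'.subtype N'.injective_subtype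
  rw [LocalizedModule.map_mk, LocalizedModule.map_mk]
  exact h

open Classical in
theorem loc_directSum_ext {J : Type} {N : J → Type} [∀ j, AddCommGroup (N j)]
    [∀ j, Module R (N j)] {y y' : LocalizedModule S (DirectSum J N)}
    (h : ∀ j, LocalizedModule.map S (DirectSum.component R J N j) y =
      LocalizedModule.map S (DirectSum.component R J N j) y') : y = y' := by
  rw [← sub_eq_zero]
  have h' : ∀ j, LocalizedModule.map S (DirectSum.component R J N j) (y - y') = 0 := fun j => by
    rw [map_sub, h, sub_self]
  generalize y - y' = z at h' ⊢
  induction z using LocalizedModule.induction_on with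
  | h x s =>
    have h1 : ∀ j, ∃ u : S, u • x j = 0 := by
      intro j
      have := h' j
      rw [LocalizedModule.map_mk, ← LocalizedModule.zero_mk s, LocalizedModule.mk_eq] at this
      obtain ⟨u, hu⟩ := this
      refine ⟨u * s, ?_⟩
      rw [smul_zero, smul_zero] at hu
      rw [mul_smul]; exact hu
    choose u hu using h1
    rw [← LocalizedModule.zero_mk s, LocalizedModule.mk_eq]
    refine ⟨∏ j ∈ DFinsupp.support x, u j, ?_⟩
    rw [smul_zero, smul_zero, smul_comm]
    have : (∏ j ∈ DFinsupp.support x, u j) • x = 0 := by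
      ext j
      change ((((∏ j ∈ DFinsupp.support x, u j : S) : R) • x) j) = 0
      rw [DirectSum.smul_apply]
      by_cases hj : x j = 0
      · rw [hj, smul_zero]
      · rw [← Finset.prod_erase_mul _ _ (DFinsupp.mem_support_iff.2 hj), Submonoid.coe_mul, mul_smul]
        have := hu j
        rw [Submonoid.smul_def] at this
        rw [this, smul_zero]
    rw [this, smul_zero]

end LocSub

/-! ### Semilinear maps into localizations -/

section Ext

variable {R₁ R : Type} [CommRing R₁] [CommRing R] {S : Submonoid R} {σ : R₁ →+* Localization S}
  {M N : Type} [AddCommGroup M] [Module R₁ M] [AddCommGroup N] [Module R N]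

/-- `f` identifies the extension of scalars of `M'` with the localization of `N'`. -/
def Spans (f : M →ₛₗ[σ] LocalizedModule S N) (M' : Submodule R₁ M) (N' : Submodule R N) : Prop :=
  Submodule.span (Localization S) (f '' M') = locSub S N'

namespace Spans

variable {f : M →ₛₗ[σ] LocalizedModule S N} {M' : Submodule R₁ M} {N' : Submodule R N}

theorem mem (h : Spans f M' N') {m : M} (hm : m ∈ M') : f m ∈ locSub S N' := by
  rw [← h]; exact Submodule.subset_span ⟨m, hm, rfl⟩

theorem span_image_sup (M₁ M₂ : Submodule R₁ M) :
    Submodule.span (Localization S) (f '' (M₁ ⊔ M₂ : Submodule R₁ M)) =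
      Submodule.span (Localization S) (f '' M₁) ⊔ Submodule.span (Localization S) (f '' M₂) := by
  refine le_antisymm (Submodule.span_le.2 ?_) (sup_le (Submodule.span_mono (Set.image_mono
    (SetLike.coe_subset_coe.2 le_sup_left))) (Submodule.span_mono (Set.image_mono
    (SetLike.coe_subset_coe.2 le_sup_right))))
  rintro _ ⟨m, hm, rfl⟩
  obtain ⟨a, ha, b, hb, rfl⟩ := Submodule.mem_sup.1 hm
  rw [map_add]
  exact add_mem (Submodule.mem_sup_left (Submodule.subset_span ⟨a, ha, rfl⟩))
    (Submodule.mem_sup_right (Submodule.subset_span ⟨b, hb, rfl⟩))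

theorem span_image_span (s : Set M) :
    Submodule.span (Localization S) (f '' (Submodule.span R₁ s : Submodule R₁ M)) =
      Submodule.span (Localization S) (f '' s) := by
  refine le_antisymm (Submodule.span_le.2 ?_)
    (Submodule.span_mono (Set.image_mono Submodule.subset_span))
  rintro _ ⟨m, hm, rfl⟩
  induction hm using Submodule.span_induction with
  | mem x hx => exact Submodule.subset_span ⟨x, hx, rfl⟩
  | zero => rw [map_zero]; exact zero_mem _
  | add x y _ _ hx hy => rw [map_add]; exact add_mem hx hy
  | smul a x _ hx => rw [f.map_smulₛₗ]; exact Submodule.smul_mem _ _ hx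

theorem iSup {J : Type} {M' : J → Submodule R₁ M} {N' : J → Submodule R N}
    (h : ∀ j, Spans f (M' j) (N' j)) : Spans f (⨆ j, M' j) (⨆ j, N' j) := by
  rw [Spans, locSub_iSup]
  refine le_antisymm (Submodule.span_le.2 ?_) (iSup_le fun j => ?_)
  · rintro _ ⟨m, hm, rfl⟩
    refine Submodule.iSup_induction M' (motive := fun m => f m ∈ _) hm ?_ ?_ ?_
    · intro j x hx
      exact Submodule.mem_iSup_of_mem j ((h j).mem hx)
    · rw [map_zero]; exact zero_mem _
    · intro x y hx hy
      rw [map_add]; exact add_mem hx hy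
  · rw [← h j]
    exact Submodule.span_mono (Set.image_mono (SetLike.coe_subset_coe.2 (le_iSup M' j)))

theorem sup {M₁ M₂ : Submodule R₁ M} {N₁ N₂ : Submodule R N}
    (h₁ : Spans f M₁ N₁) (h₂ : Spans f M₂ N₂) : Spans f (M₁ ⊔ M₂) (N₁ ⊔ N₂) := by
  rw [Spans, locSub_sup, span_image_sup, h₁, h₂]

theorem top (hf : ExhibitsBaseChange σ f) : Spans f ⊤ ⊤ := by
  rw [Spans, locSub_top, Submodule.top_coe, Set.image_univ, hf.span_range]

theorem bot : Spans f ⊥ ⊥ := by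
  rw [Spans, locSub_bot, Submodule.bot_coe, Set.image_singleton, map_zero]
  exact Submodule.span_zero_singleton _

variable {M₂ N₂ : Type} [AddCommGroup M₂] [Module R₁ M₂] [AddCommGroup N₂] [Module R N₂]
  {f₂ : M₂ →ₛₗ[σ] LocalizedModule S N₂} {g : M →ₗ[R₁] M₂} {h : N →ₗ[R] N₂}

theorem ker (hσ : σ.Flat) (hf : ExhibitsBaseChange σ f) (hf₂ : ExhibitsBaseChange σ f₂)
    (comm : ∀ m, f₂ (g m) = LocalizedModule.map S h (f m)) :
    Spans f (LinearMap.ker g) (LinearMap.ker h) := by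
  refine le_antisymm (Submodule.span_le.2 ?_) fun y hy => ?_
  · rintro _ ⟨m, hm, rfl⟩
    refine (map_mem_locSub_of_exact h).1 ?_
    rw [← comm, show g m = 0 from hm, map_zero]
  · exact ExhibitsBaseChange.mem_span_of_map_eq_zero hσ hf hf₂ g (LocalizedModule.map S h) comm
      ((map_mem_locSub_of_exact h).2 hy)

theorem map (comm : ∀ m, f₂ (g m) = LocalizedModule.map S h (f m)) (hs : Spans f M' N') :
    Spans f₂ (M'.map g) (N'.map h) := by
  have h1 : locSub S (N'.map h) = (locSub S N').map (LocalizedModule.map S h) := by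
    refine le_antisymm (locSub_le ?_) ?_
    · rintro _ ⟨x, hx, rfl⟩
      exact ⟨LocalizedModule.mk x 1, mk_mem_locSub hx 1, LocalizedModule.map_mk _ _ _ _⟩
    · rintro _ ⟨y, hy, rfl⟩
      obtain ⟨x, hx, s, rfl⟩ := mem_locSub.1 hy
      rw [LocalizedModule.map_mk]
      exact mk_mem_locSub (N' := N'.map h) ⟨x, hx, rfl⟩ s
  rw [Spans, h1, ← hs, Submodule.map_span]
  congr 1
  ext y
  constructor
  · rintro ⟨_, ⟨m, hm, rfl⟩, rfl⟩
    exact ⟨f m, ⟨m, hm, rfl⟩, (comm m).symm⟩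
  · rintro ⟨_, ⟨m, hm, rfl⟩, rfl⟩
    exact ⟨g m, ⟨m, hm, rfl⟩, comm m⟩

end Spans

/-- The restriction of `f` to submodules. -/
def subExt (f : M →ₛₗ[σ] LocalizedModule S N) {M' : Submodule R₁ M} {N' : Submodule R N}
    (h : Spans f M' N') : M' →ₛₗ[σ] LocalizedModule S N' :=
  (LinearEquiv.ofInjective (LocalizedModule.map S N'.subtype)
    (LocalizedModule.map_injective S _ N'.injective_subtype)).symm.toLinearMap.comp
    ((f.comp M'.subtype).codRestrict (locSub S N') fun m => h.mem m.2)

/-- The map induced by `f` on quotients. -/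
def quotExt (f : M →ₛₗ[σ] LocalizedModule S N) {M' : Submodule R₁ M} {N' : Submodule R N}
    (h : Spans f M' N') : (M ⧸ M') →ₛₗ[σ] LocalizedModule S (N ⧸ N') :=
  M'.liftQ ((LocalizedModule.map S N'.mkQ).comp f) fun m hm => by
    change LocalizedModule.map S N'.mkQ (f m) = 0
    rw [map_mem_locSub_of_exact, Submodule.ker_mkQ]
    exact h.mem hm

section

variable (f : M →ₛₗ[σ] LocalizedModule S N) {M' : Submodule R₁ M} {N' : Submodule R N}
  (h : Spans f M' N')

theorem map_subExt (m : M') : LocalizedModule.map S N'.subtype (subExt f h m) = f m := by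
  have := LinearEquiv.apply_symm_apply (LinearEquiv.ofInjective (LocalizedModule.map S N'.subtype)
    (LocalizedModule.map_injective S _ N'.injective_subtype))
    ((f.comp M'.subtype).codRestrict (locSub S N') (fun m => h.mem m.2) m)
  exact congrArg Subtype.val this

theorem quotExt_mkQ (m : M) :
    quotExt f h (M'.mkQ m) = LocalizedModule.map S N'.mkQ (f m) := rfl

theorem subExt_baseChange (hσ : σ.Flat) (hf : ExhibitsBaseChange σ f) :
    ExhibitsBaseChange σ (subExt f h) := by
  refine hf.of_injective hσ M'.subtype M'.injective_subtype (LocalizedModule.map S N'.subtype)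
    (map_subExt f h) ?_
  have hinj := LocalizedModule.map_injective S _ N'.injective_subtype
  apply Submodule.map_injective_of_injective hinj
  rw [Submodule.map_span, Submodule.map_top]
  refine Eq.trans ?_ h
  congr 1
  ext y
  constructor
  · rintro ⟨_, ⟨m, rfl⟩, rfl⟩
    exact ⟨m, m.2, (map_subExt f h m).symm⟩
  · rintro ⟨m, hm, rfl⟩
    exact ⟨_, ⟨⟨m, hm⟩, rfl⟩, map_subExt f h ⟨m, hm⟩⟩

theorem quotExt_baseChange (hf : ExhibitsBaseChange σ f) :
    ExhibitsBaseChange σ (quotExt f h) := by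
  refine hf.of_surjective M'.mkQ M'.mkQ_surjective (LocalizedModule.map S N'.mkQ)
    (LocalizedModule.map_surjective S _ N'.mkQ_surjective) (quotExt_mkQ f h) fun l hl => ?_
  rw [map_mem_locSub_of_exact, Submodule.ker_mkQ, ← h] at hl
  have : {m | M'.mkQ m = 0} = (M' : Set M) := by ext m; simp
  rwa [this]

end

open Classical in
/-- The direct sum of the maps `f j`. -/
def dsumExt {J : Type} {M N : J → Type} [∀ j, AddCommGroup (M j)] [∀ j, Module R₁ (M j)]
    [∀ j, AddCommGroup (N j)] [∀ j, Module R (N j)]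
    (f : ∀ j, M j →ₛₗ[σ] LocalizedModule S (N j)) :
    DirectSum J M →ₛₗ[σ] LocalizedModule S (DirectSum J N) :=
  let φ : DirectSum J M →+ LocalizedModule S (DirectSum J N) := DirectSum.toAddMonoid fun j =>
      ((LocalizedModule.map S (DirectSum.lof R J N j)).comp (f j)).toAddMonoidHom
  { φ with
    map_smul' := fun r x => by
      change φ (r • x) = σ r • φ x
      have hφ : ∀ j x, φ (DirectSum.lof R₁ J M j x) =
        LocalizedModule.map S (DirectSum.lof R J N j) (f j x) := DirectSum.toAddMonoid_of _
      induction x using DirectSum.induction_on with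
      | zero => simp
      | of j x =>
        change φ (r • DirectSum.lof R₁ J M j x) = σ r • φ (DirectSum.lof R₁ J M j x)
        rw [← map_smul, hφ, hφ, LinearMap.map_smulₛₗ, map_smul]
      | add x y hx hy => rw [smul_add, map_add, map_add, smul_add, hx, hy] }

section

open Classical

variable {J : Type} {M N : J → Type} [∀ j, AddCommGroup (M j)] [∀ j, Module R₁ (M j)]
  [∀ j, AddCommGroup (N j)] [∀ j, Module R (N j)] (f : ∀ j, M j →ₛₗ[σ] LocalizedModule S (N j))

theorem dsumExt_lof (j : J) (m : M j) : dsumExt f (DirectSum.lof R₁ J M j m) =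
    LocalizedModule.map S (DirectSum.lof R J N j) (f j m) :=
  DirectSum.toAddMonoid_of (fun j =>
    ((LocalizedModule.map S (DirectSum.lof R J N j)).comp (f j)).toAddMonoidHom) j m

theorem map_component_dsumExt (j : J) (m : DirectSum J M) :
    LocalizedModule.map S (DirectSum.component R J N j) (dsumExt f m) = f j (m j) := by
  induction m using DirectSum.induction_on with
  | zero => simp
  | of i x =>
    change LocalizedModule.map S _ (dsumExt f (DirectSum.lof R₁ J M i x)) = _
    rw [dsumExt_lof, loc_map_map]
    by_cases h : i = j
    · subst h
      have : (DirectSum.component R J N i).comp (DirectSum.lof R J N i) = LinearMap.id := by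
        ext x; simp
      rw [this, loc_map_id]
      congr 1
      exact (DirectSum.of_eq_same i x).symm
    · have : (DirectSum.component R J N j).comp (DirectSum.lof R J N i) = 0 := by
        ext x
        exact DirectSum.of_eq_of_ne _ _ _ (Ne.symm h)
      rw [this, loc_map_zero, DirectSum.of_eq_of_ne _ _ _ (Ne.symm h), map_zero]
  | add x y hx hy => rw [map_add, map_add, hx, hy, DirectSum.add_apply, map_add]

theorem dsumExt_baseChange (hf : ∀ j, ExhibitsBaseChange σ (f j)) :
    ExhibitsBaseChange σ (dsumExt f) := by
  refine ExhibitsBaseChange.directSum hf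
    (fun j => LocalizedModule.map S (DirectSum.component R J N j)) (map_component_dsumExt f) ?_
  rw [eq_top_iff]
  rintro y -
  induction y using LocalizedModule.induction_on with
  | h x s =>
    refine mk_mem_of_mk_one_mem ?_ s
    induction x using DirectSum.induction_on with
    | zero => rw [LocalizedModule.zero_mk]; exact zero_mem _
    | of j x =>
      have h1 : LocalizedModule.mk (DirectSum.of N j x) 1 =
          LocalizedModule.map S (DirectSum.lof R J N j) (LocalizedModule.mk x 1) := by
        rw [LocalizedModule.map_mk]; rfl
      rw [h1]
      have h2 : (LocalizedModule.mk x 1 : LocalizedModule S (N j)) ∈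
          Submodule.span (Localization S) (Set.range (f j)) := by
        rw [(hf j).span_range]; trivial
      have h3 := Submodule.mem_map_of_mem (f := LocalizedModule.map S (DirectSum.lof R J N j)) h2
      rw [Submodule.map_span] at h3
      refine Submodule.span_mono ?_ h3
      rintro _ ⟨_, ⟨m, rfl⟩, rfl⟩
      exact ⟨_, dsumExt_lof f j m⟩
    | add x y hx hy => rw [mk_one_add]; exact add_mem hx hy

end

end Ext

/-! ### Homogeneous elements of localizations at idempotents -/

section IdemGr

variable {R : Type} [CommRing R] {A : ℤ → Set R} {S : Submonoid R}

/-- The elements of degree `k` in the localization at a set of idempotents of degree zero. -/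
def idemLocGr (S : Submonoid R) (M : GrMod R A) (k : ℤ) : AddSubgroup (LocalizedModule S M) :=
  (M.gr k).map (LocalizedModule.mkLinearMap S M).toAddMonoidHom

theorem mem_idemLocGr {M : GrMod R A} {k : ℤ} {y : LocalizedModule S M} :
    y ∈ idemLocGr S M k ↔ ∃ x ∈ M.gr k, y = LocalizedModule.mk x 1 :=
  ⟨fun ⟨x, hx, h⟩ => ⟨x, hx, h.symm⟩, fun ⟨x, hx, h⟩ => ⟨x, hx, h.symm⟩⟩

theorem map_mem_idemLocGr {M M' : GrMod R A} (f : M' →ₗ[R] M)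
    (hgr : ∀ k, ∀ x ∈ M'.gr k, f x ∈ M.gr k) {k : ℤ} {y : LocalizedModule S M'}
    (hy : y ∈ idemLocGr S M' k) : LocalizedModule.map S f y ∈ idemLocGr S M k := by
  obtain ⟨x, hx, rfl⟩ := mem_idemLocGr.1 hy
  exact mem_idemLocGr.2 ⟨f x, hgr _ _ hx, LocalizedModule.map_mk _ _ _ _⟩

theorem mem_idemLocGr_of_map (hS : ∀ s ∈ S, s ∈ A 0 ∧ s * s = s) {M M' : GrMod R A}
    (f : M' →ₗ[R] M) (hf : Function.Injective f) (hgr : ∀ k, ∀ x ∈ M'.gr k, f x ∈ M.gr k) {k : ℤ}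
    {y : LocalizedModule S M'} (hy : LocalizedModule.map S f y ∈ idemLocGr S M k) :
    y ∈ idemLocGr S M' k := by
  obtain ⟨x, hx, h⟩ := mem_idemLocGr.1 hy
  induction y using LocalizedModule.induction_on with
  | h z s =>
    rw [mk_eq_mk_one_of_idempotent s (hS s s.2).2] at h ⊢
    rw [LocalizedModule.map_mk, LocalizedModule.mk_eq] at h
    obtain ⟨u, hu⟩ := h
    simp only [Submonoid.smul_def, one_smul] at hu
    refine mem_idemLocGr.2 ⟨M'.proj k z, M'.proj_mem _ _, LocalizedModule.mk_eq.2 ⟨u, ?_⟩⟩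
    simp only [Submonoid.smul_def, one_smul]
    apply hf
    have h1 := GrMod.map_proj f.toAddMonoidHom hgr k z
    change f _ = M.proj k (f z) at h1
    rw [map_smul, map_smul, hu, h1, ← GrMod.proj_smul_zero (hS u u.2).1, hu,
      GrMod.proj_smul_zero (hS u u.2).1, GrMod.proj_of_mem hx]

theorem cofZ_idem : ∀ s ∈ cofZ, s ∈ degZero RingZ 0 ∧ s * s = s := by
  rintro _ ⟨T, hT, rfl⟩
  exact ⟨fun _ => rfl, charFun_mul_self T⟩

theorem cofF_idem (D : FullSubgroups) :
    ∀ s ∈ cofF D, s ∈ degC (FiniteSubgroup D) 0 ∧ s * s = s := by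
  rintro _ ⟨_, ⟨T, hT, rfl⟩, rfl⟩
  exact ⟨inflZ_mem_degC D _, by rw [← map_mul, charFun_mul_self]⟩

end IdemGr

end

noncomputable section

namespace StandardModel

variable {D : FullSubgroups}

/-! ### The compatibility square in terms of representatives -/

section Square

theorem loc_mk_eq_iff {R : Type} [CommRing R] {S : Submonoid R} {M : Type} [AddCommGroup M]
    [Module R M] {x y : M} {s t : R} (hs : s ∈ S) (ht : t ∈ S) :
    (LocalizedModule.mk x ⟨s, hs⟩ : LocalizedModule S M) = LocalizedModule.mk y ⟨t, ht⟩ ↔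
      ∃ c ∈ S, (c * t) • x = (c * s) • y := by
  rw [LocalizedModule.mk_eq]
  simp only [Submonoid.smul_def, smul_smul, Subtype.exists, exists_prop]

variable {V P Q N : Type} [AddCommGroup V] [Module ℚ V] [AddCommGroup P] [Module RingZ P]
  [AddCommGroup Q] [Module RingT Q] [AddCommGroup N] [Module (RingF D) N]
  (extP : P →ₛₗ[locInflZ D] LocalizedModule (eulerF D) N)
  (extQ : Q →ₛₗ[locInflT D] LocalizedModule (cofF D) N)
  (extVP : V →ₛₗ[unitZ] LocalizedModule cofZ P) (extVQ : V →ₛₗ[unitT] LocalizedModule eulerT Q)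

/-- An Euler class as an element of the inflated multiplicative set. -/
def inflE (D : FullSubgroups) (e : eulerT) : eulerF D := ⟨inflT D e, e, e.2, rfl⟩

@[simp] theorem coe_inflE (e : eulerT) : (inflE D e : RingF D) = inflT D e := rfl

/-- There are representatives of the images of `v` with a common image. -/
def Compat (v : V) : Prop :=
  ∃ (p : P) (q : Q) (x : N) (e : eulerT), extVP v = LocalizedModule.mk p 1 ∧
    extVQ v = LocalizedModule.mk q e ∧
    extP p = LocalizedModule.mk x (inflE D e) ∧
    extQ q = LocalizedModule.mk x 1

variable {extP extQ extVP extVQ}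

theorem ext_smul_locInflZ (a : RingZ) (p : P) : extP (a • p) = inflZ D a • extP p := by
  rw [extP.map_smulₛₗ]
  exact algebraMap_smul (Localization (eulerF D)) (inflZ D a) (extP p)

theorem ext_smul_locInflT (a : RingT) (q : Q) : extQ (a • q) = inflT D a • extQ q := by
  rw [extQ.map_smulₛₗ]
  exact algebraMap_smul (Localization (cofF D)) (inflT D a) (extQ q)

theorem square_of_compat {v : V} (h : Compat extP extQ extVP extVQ v) (p : P) (i : cofZ) (q : Q)
    (e : eulerT) (x : N) (e' : eulerF D) (y : N) (i' : cofF D)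
    (hp : extVP v = LocalizedModule.mk p i) (hq : extVQ v = LocalizedModule.mk q e)
    (hx : extP p = LocalizedModule.mk x e') (hy : extQ q = LocalizedModule.mk y i') :
    (LocalizedModule.mk x
        ⟨e' * inflZ D i, Submonoid.mul_mem_sup e'.2 (Submonoid.mem_map_of_mem _ i.2)⟩ :
      LocalizedModule (eulerF D ⊔ cofF D) N) =
    LocalizedModule.mk y
        ⟨inflT D e * i', Submonoid.mul_mem_sup (Submonoid.mem_map_of_mem _ e.2) i'.2⟩ := by
  obtain ⟨p₀, q₀, x₀, e₀, h1, h2, h3, h4⟩ := h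
  obtain ⟨T, hT, hpT⟩ := mk_cofZ_eq_iff.1 (((mk_cofZ p i).symm.trans hp.symm).trans h1)
  obtain ⟨u, hu⟩ := LocalizedModule.mk_eq.1 (hq.symm.trans h2)
  have e1 : inflZ D (charFun T) • (LocalizedModule.mk x e' : LocalizedModule (eulerF D) N) =
      inflZ D (charFun T) • LocalizedModule.mk x₀ (inflE D e₀) := by
    rw [← hx, ← h3, ← ext_smul_locInflZ (extP := extP), hpT, ext_smul_locInflZ]
  rw [LocalizedModule.smul'_mk, LocalizedModule.smul'_mk] at e1
  obtain ⟨w, hw⟩ := LocalizedModule.mk_eq.1 e1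
  have e2 := congrArg extQ hu
  simp only [Submonoid.smul_def, ext_smul_locInflT, h4, hy, LocalizedModule.smul'_mk] at e2
  obtain ⟨s, hs⟩ := LocalizedModule.mk_eq.1 e2
  have hi : (inflZ D i) * inflZ D i = inflZ D i := by
    rw [← map_mul, (cofZ_idem i i.2).2]
  simp only [Submonoid.smul_def, smul_smul, Submonoid.coe_one, one_mul, coe_inflE] at hw hs
  refine (loc_mk_eq_iff _ _).2 ⟨(w * inflT D u * inflT D e₀) *
    (inflZ D (charFun T) * s * inflZ D i), Submonoid.mul_mem_sup
      (mul_mem (mul_mem w.2 (Submonoid.mem_map_of_mem _ u.2)) (Submonoid.mem_map_of_mem _ e₀.2))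
      (mul_mem (mul_mem (inflZ_charFun_mem_cofF D hT) s.2) (Submonoid.mem_map_of_mem _ i.2)), ?_⟩
  have a1 := congrArg (fun z => ((inflT D u) * s * inflZ D i * inflT D e * i' : RingF D) • z) hw
  have a2 := congrArg (fun z =>
    (w * inflZ D (charFun T) * inflZ D i * inflZ D i * e' : RingF D) • z) hs
  simp only [smul_smul] at a1 a2
  refine Eq.trans (Eq.trans (congrArg (· • x) ?_) a1) (Eq.trans (Eq.trans (congrArg (· • x₀) ?_)
    a2.symm) (congrArg (· • y) ?_))
  · ring
  · have : (w * inflZ D (charFun T) * inflZ D i * inflZ D i * e' : RingF D) =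
        w * inflZ D (charFun T) * inflZ D i * e' := by
      rw [mul_assoc _ (inflZ D i) (inflZ D i), hi]
    rw [this]; ring
  · ring

end Square

theorem compat (X : StandardModel D) (v : X.V) : Compat X.extP X.extQ X.extVP X.extVQ v := by
  obtain ⟨p, hp⟩ := exists_mk_cofZ (X.extVP v)
  obtain ⟨q, e, hq⟩ : ∃ q e, X.extVQ v = LocalizedModule.mk q e := by
    induction X.extVQ v using LocalizedModule.induction_on with
    | h q e => exact ⟨q, e, rfl⟩
  obtain ⟨x, ⟨e', he'⟩, hx⟩ : ∃ x e, X.extP p = LocalizedModule.mk x (inflE D e) := by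
    induction X.extP p using LocalizedModule.induction_on with
    | h x e =>
      obtain ⟨_, e, he, rfl⟩ := e
      exact ⟨x, ⟨e, he⟩, rfl⟩
  obtain ⟨y, hy⟩ := exists_mk_cofF (X.extQ q)
  obtain ⟨c, hc, h⟩ := (loc_mk_eq_iff _ _).1 (X.square v p 1 q e x _ y 1 hp hq hx hy)
  obtain ⟨_, ⟨c₁, hc₁, rfl⟩, _, ⟨_, ⟨T, hT, rfl⟩, rfl⟩, rfl⟩ := Submonoid.mem_sup.1 hc
  simp only [Submonoid.coe_one, map_one, mul_one, coe_inflE] at h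
  have hTT : inflZ D (charFun T) * inflZ D (charFun T) = inflZ D (charFun T) := by
    rw [← map_mul, charFun_mul_self]
  refine ⟨charFun T • p, (c₁ * e') • q, (inflZ D (charFun T) * (inflT D c₁ * inflT D e')) • y,
    ⟨c₁, hc₁⟩ * ⟨e', he'⟩ * e, ?_, ?_, ?_, ?_⟩
  · rw [hp, mk_cofZ_eq_iff]
    exact ⟨T, hT, by rw [smul_smul, charFun_mul_self]⟩
  · rw [hq]
    refine LocalizedModule.mk_eq.2 ⟨1, ?_⟩
    simp only [Submonoid.smul_def, smul_smul, Submonoid.coe_mul, Submonoid.coe_one, one_mul]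
    congr 1; ring
  · rw [ext_smul_locInflZ, hx, LocalizedModule.smul'_mk]
    refine LocalizedModule.mk_eq.2 ⟨1, ?_⟩
    simp only [Submonoid.smul_def, smul_smul, Submonoid.coe_mul, Submonoid.coe_one, one_mul,
      map_mul, coe_inflE]
    have h' := congrArg (fun z => inflT D e' • z) h
    simp only [smul_smul] at h'
    refine Eq.trans (congrArg (· • x) ?_) (h'.trans (congrArg (· • y) ?_)) <;> ring
  · rw [ext_smul_locInflT, hy, smul_mk_one, mk_cofF_eq_iff]
    refine ⟨T, hT, ?_⟩
    rw [smul_smul, smul_smul, ← mul_assoc, hTT, map_mul]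

/-! ### The axioms in terms of localized maps -/

/-- The idempotent of the finite subgroups with disconnected Weyl group. -/
def disc (D : FullSubgroups) : RingF D := idem {F : FiniteSubgroup D | F.Disconnected}

/-- The idempotent of the finite subgroups with connected Weyl group. -/
def conn (D : FullSubgroups) : RingF D := idem {F : FiniteSubgroup D | F.Disconnected}ᶜ

theorem disc_add_conn : disc D + conn D = 1 := idem_add_compl _

theorem conn_smul_actN (X : StandardModel D) (x : X.N) : conn D • X.actN x = conn D • x :=
  X.actN_connected x

theorem disc_smul_extP_actP (X : StandardModel D) (p : X.P) :
    disc D • X.extP (X.actP p) = disc D • LocalizedModule.map _ X.actN (X.extP p) := by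
  obtain ⟨x, e, h⟩ : ∃ x e, X.extP p = LocalizedModule.mk x e := by
    induction X.extP p using LocalizedModule.induction_on with
    | h x e => exact ⟨x, e, rfl⟩
  rw [h, LocalizedModule.map_mk]
  exact X.extP_act p x e h

section Hom

variable {X Y Z : StandardModel D}

/-- The component at `G`. -/
abbrev onV (f : X ⟶ Y) : X.V →ₗ[ℚ] Y.V := Hom.onV f
/-- The component over `Z`. -/
abbrev onP (f : X ⟶ Y) : X.P →ₗ[RingZ] Y.P := Hom.onP f
/-- The component over `T̃`. -/
abbrev onQ (f : X ⟶ Y) : X.Q →ₗ[RingT] Y.Q := Hom.onQ f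
/-- The component at the trivial subgroup. -/
abbrev onN (f : X ⟶ Y) : X.N →ₗ[RingF D] Y.N := Hom.onN f

theorem onV_mem (f : X ⟶ Y) {k : ℤ} {v : X.V} (h : v ∈ X.V.gr k) : onV f v ∈ Y.V.gr k :=
  Hom.onV_gr f k v h
theorem onP_mem (f : X ⟶ Y) {k : ℤ} {p : X.P} (h : p ∈ X.P.gr k) : onP f p ∈ Y.P.gr k :=
  Hom.onP_gr f k p h
theorem onQ_mem (f : X ⟶ Y) {k : ℤ} {q : X.Q} (h : q ∈ X.Q.gr k) : onQ f q ∈ Y.Q.gr k :=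
  Hom.onQ_gr f k q h
theorem onN_mem (f : X ⟶ Y) {k : ℤ} {x : X.N} (h : x ∈ X.N.gr k) : onN f x ∈ Y.N.gr k :=
  Hom.onN_gr f k x h

theorem onP_actP (f : X ⟶ Y) (p : X.P) : onP f (X.actP p) = Y.actP (onP f p) := Hom.comm_actP f p
theorem onN_actN (f : X ⟶ Y) (x : X.N) : onN f (X.actN x) = Y.actN (onN f x) := Hom.comm_actN f x

theorem extP_onP (f : X ⟶ Y) (p : X.P) :
    Y.extP (onP f p) = LocalizedModule.map _ (onN f) (X.extP p) := by
  obtain ⟨x, e, h⟩ : ∃ x e, X.extP p = LocalizedModule.mk x e := by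
    induction X.extP p using LocalizedModule.induction_on with
    | h x e => exact ⟨x, e, rfl⟩
  rw [h, LocalizedModule.map_mk]
  exact Hom.comm_extP f p x e h

theorem extQ_onQ (f : X ⟶ Y) (q : X.Q) :
    Y.extQ (onQ f q) = LocalizedModule.map _ (onN f) (X.extQ q) := by
  obtain ⟨x, e, h⟩ : ∃ x e, X.extQ q = LocalizedModule.mk x e := by
    induction X.extQ q using LocalizedModule.induction_on with
    | h x e => exact ⟨x, e, rfl⟩
  rw [h, LocalizedModule.map_mk]
  exact Hom.comm_extQ f q x e h

theorem extVP_onV (f : X ⟶ Y) (v : X.V) :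
    Y.extVP (onV f v) = LocalizedModule.map _ (onP f) (X.extVP v) := by
  obtain ⟨x, e, h⟩ : ∃ x e, X.extVP v = LocalizedModule.mk x e := by
    induction X.extVP v using LocalizedModule.induction_on with
    | h x e => exact ⟨x, e, rfl⟩
  rw [h, LocalizedModule.map_mk]
  exact Hom.comm_extVP f v x e h

theorem extVQ_onV (f : X ⟶ Y) (v : X.V) :
    Y.extVQ (onV f v) = LocalizedModule.map _ (onQ f) (X.extVQ v) := by
  obtain ⟨x, e, h⟩ : ∃ x e, X.extVQ v = LocalizedModule.mk x e := by
    induction X.extVQ v using LocalizedModule.induction_on with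
    | h x e => exact ⟨x, e, rfl⟩
  rw [h, LocalizedModule.map_mk]
  exact Hom.comm_extVQ f v x e h

/-- A morphism from maps that commute with the localized structure maps. -/
def homMk (v : X.V →ₗ[ℚ] Y.V) (p : X.P →ₗ[RingZ] Y.P) (q : X.Q →ₗ[RingT] Y.Q)
    (n : X.N →ₗ[RingF D] Y.N)
    (grV : ∀ k, ∀ a ∈ X.V.gr k, v a ∈ Y.V.gr k) (grP : ∀ k, ∀ a ∈ X.P.gr k, p a ∈ Y.P.gr k)
    (grQ : ∀ k, ∀ a ∈ X.Q.gr k, q a ∈ Y.Q.gr k) (grN : ∀ k, ∀ a ∈ X.N.gr k, n a ∈ Y.N.gr k)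
    (cP : ∀ a, Y.extP (p a) = LocalizedModule.map _ n (X.extP a))
    (cQ : ∀ a, Y.extQ (q a) = LocalizedModule.map _ n (X.extQ a))
    (cVP : ∀ a, Y.extVP (v a) = LocalizedModule.map _ p (X.extVP a))
    (cVQ : ∀ a, Y.extVQ (v a) = LocalizedModule.map _ q (X.extVQ a))
    (actP : ∀ a, p (X.actP a) = Y.actP (p a)) (actN : ∀ a, n (X.actN a) = Y.actN (n a)) :
    X ⟶ Y :=
  { onV := v, onP := p, onQ := q, onN := n
    onV_gr := grV, onP_gr := grP, onQ_gr := grQ, onN_gr := grN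
    comm_extP := fun a x e h => by rw [cP, h, LocalizedModule.map_mk]
    comm_extQ := fun a x e h => by rw [cQ, h, LocalizedModule.map_mk]
    comm_extVP := fun a x e h => by rw [cVP, h, LocalizedModule.map_mk]
    comm_extVQ := fun a x e h => by rw [cVQ, h, LocalizedModule.map_mk]
    comm_actP := actP
    comm_actN := actN : Hom X Y }

theorem hom_ext {f g : X ⟶ Y} (hV : ∀ v, onV f v = onV g v) (hP : ∀ p, onP f p = onP g p)
    (hQ : ∀ q, onQ f q = onQ g q) (hN : ∀ x, onN f x = onN g x) : f = g :=
  Hom.ext (LinearMap.ext hV) (LinearMap.ext hP) (LinearMap.ext hQ) (LinearMap.ext hN)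

@[simp] theorem onP_comp (f : X ⟶ Y) (g : Y ⟶ Z) (v : X.P) : onP (f ≫ g) v = onP g (onP f v) := rfl
@[simp] theorem onN_comp (f : X ⟶ Y) (g : Y ⟶ Z) (v : X.N) : onN (f ≫ g) v = onN g (onN f v) := rfl

theorem Compat.map {X : StandardModel D} {V' P' Q' N' : Type} [AddCommGroup V'] [Module ℚ V']
    [AddCommGroup P'] [Module RingZ P'] [AddCommGroup Q'] [Module RingT Q'] [AddCommGroup N']
    [Module (RingF D) N']
    {extP : P' →ₛₗ[locInflZ D] LocalizedModule (eulerF D) N'}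
    {extQ : Q' →ₛₗ[locInflT D] LocalizedModule (cofF D) N'}
    {extVP : V' →ₛₗ[unitZ] LocalizedModule cofZ P'}
    {extVQ : V' →ₛₗ[unitT] LocalizedModule eulerT Q'}
    (v : X.V →ₗ[ℚ] V') (p : X.P →ₗ[RingZ] P') (q : X.Q →ₗ[RingT] Q') (n : X.N →ₗ[RingF D] N')
    (cP : ∀ a, extP (p a) = LocalizedModule.map _ n (X.extP a))
    (cQ : ∀ a, extQ (q a) = LocalizedModule.map _ n (X.extQ a))
    (cVP : ∀ a, extVP (v a) = LocalizedModule.map _ p (X.extVP a))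
    (cVQ : ∀ a, extVQ (v a) = LocalizedModule.map _ q (X.extVQ a)) (a : X.V) :
    Compat extP extQ extVP extVQ (v a) := by
  obtain ⟨b, c, x, e, h1, h2, h3, h4⟩ := X.compat a
  exact ⟨p b, q c, n x, e, by rw [cVP, h1, LocalizedModule.map_mk],
    by rw [cVQ, h2, LocalizedModule.map_mk], by rw [cP, h3, LocalizedModule.map_mk],
    by rw [cQ, h4, LocalizedModule.map_mk]⟩

end Hom

/-! ### Subobjects -/

/-- A subobject: homogeneous submodules, closed under the actions, that are compatible with
localization and extension of scalars. -/
@[ext]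
structure Sub (X : StandardModel D) where
  V : Submodule ℚ X.V
  P : Submodule RingZ X.P
  Q : Submodule RingT X.Q
  N : Submodule (RingF D) X.N
  homV : GrMod.Homogeneous V
  homP : GrMod.Homogeneous P
  homQ : GrMod.Homogeneous Q
  homN : GrMod.Homogeneous N
  spanP : Spans X.extP P N
  spanQ : Spans X.extQ Q N
  spanVP : Spans X.extVP V P
  spanVQ : Spans X.extVQ V Q
  actP_mem : ∀ p ∈ P, X.actP p ∈ P
  actN_mem : ∀ x ∈ N, X.actN x ∈ N

namespace Sub

variable {X : StandardModel D} (Γ : Sub X)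

/-- A subobject as an object. -/
def toModel : StandardModel D where
  V := GrMod.ofSub Γ.V Γ.homV
  P := GrMod.ofSub Γ.P Γ.homP
  Q := GrMod.ofSub Γ.Q Γ.homQ
  N := GrMod.ofSub Γ.N Γ.homN
  extP := subExt X.extP Γ.spanP
  extQ := subExt X.extQ Γ.spanQ
  extVP := subExt X.extVP Γ.spanVP
  extVQ := subExt X.extVQ Γ.spanVQ
  extP_baseChange := subExt_baseChange _ _ (flat_locInflZ D) X.extP_baseChange
  extQ_baseChange := subExt_baseChange _ _ (flat_locInflT D) X.extQ_baseChange
  extVP_baseChange := subExt_baseChange _ _ flat_unitZ X.extVP_baseChange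
  extVQ_baseChange := subExt_baseChange _ _ flat_unitT X.extVQ_baseChange
  extP_gr k p hp := by
    refine mem_eulerLocGr_of_map (M := X.N) (M' := GrMod.ofSub Γ.N Γ.homN)
      (preservesDegree_inflT D) rfl Γ.N.subtype Γ.N.injective_subtype (fun _ _ h => h) ?_
    exact (map_subExt X.extP Γ.spanP p).symm ▸ X.extP_gr k _ hp
  extQ_gr k q hq := by
    refine mem_idemLocGr.1 (mem_idemLocGr_of_map (M := X.N) (M' := GrMod.ofSub Γ.N Γ.homN)
      (cofF_idem D) Γ.N.subtype Γ.N.injective_subtype (fun _ _ h => h) ?_)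
    exact (map_subExt X.extQ Γ.spanQ q).symm ▸ mem_idemLocGr.2 (X.extQ_gr k _ hq)
  extVP_gr k v hv := by
    refine mem_idemLocGr.1 (mem_idemLocGr_of_map (M := X.P) (M' := GrMod.ofSub Γ.P Γ.homP)
      cofZ_idem Γ.P.subtype Γ.P.injective_subtype (fun _ _ h => h) ?_)
    exact (map_subExt X.extVP Γ.spanVP v).symm ▸ mem_idemLocGr.2 (X.extVP_gr k _ hv)
  extVQ_gr k v hv := by
    refine mem_eulerLocGr_of_map (M := X.Q) (M' := GrMod.ofSub Γ.Q Γ.homQ)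
      preservesDegree_id (Submonoid.map_id _).symm Γ.Q.subtype Γ.Q.injective_subtype
      (fun _ _ h => h) ?_
    exact (map_subExt X.extVQ Γ.spanVQ v).symm ▸ X.extVQ_gr k _ hv
  square v p i q e x e' y i' h1 h2 h3 h4 := by
    refine loc_subtype_mk_eq ?_
    refine X.square (Γ.V.subtype v) (Γ.P.subtype p) i (Γ.Q.subtype q) e (Γ.N.subtype x) e'
      (Γ.N.subtype y) i' ?_ ?_ ?_ ?_
    · exact (map_subExt X.extVP Γ.spanVP v).symm.trans
        ((congrArg _ h1).trans (LocalizedModule.map_mk _ _ _ _))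
    · exact (map_subExt X.extVQ Γ.spanVQ v).symm.trans
        ((congrArg _ h2).trans (LocalizedModule.map_mk _ _ _ _))
    · exact (map_subExt X.extP Γ.spanP p).symm.trans
        ((congrArg _ h3).trans (LocalizedModule.map_mk _ _ _ _))
    · exact (map_subExt X.extQ Γ.spanQ q).symm.trans
        ((congrArg _ h4).trans (LocalizedModule.map_mk _ _ _ _))
  actP := X.actP.restrict Γ.actP_mem
  actN := X.actN.restrict Γ.actN_mem
  actP_gr k p hp := X.actP_gr k (Γ.P.subtype p) hp
  actN_gr k x hx := X.actN_gr k (Γ.N.subtype x) hx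
  actP_actP p := Subtype.ext (X.actP_actP (Γ.P.subtype p))
  actN_actN x := Subtype.ext (X.actN_actN (Γ.N.subtype x))
  actN_connected x := Subtype.ext (X.actN_connected (Γ.N.subtype x))
  extP_act p x e h := by
    apply LocalizedModule.map_injective (eulerF D) Γ.N.subtype Γ.N.injective_subtype
    refine (loc_map_smul _ _ _).trans (Eq.trans ?_ (loc_map_smul _ _ _).symm)
    refine Eq.trans ?_ (congrArg _ (LocalizedModule.map_mk _ _ _ _).symm)
    have h1 := (map_subExt X.extP Γ.spanP p).symm.trans
        ((congrArg _ h).trans (LocalizedModule.map_mk _ _ _ _))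
    exact (congrArg _ (map_subExt X.extP Γ.spanP _)).trans (X.extP_act _ _ _ h1)
  actN_cof x := by
    exact loc_subtype_mk_eq (X.actN_cof x)
  actP_cof p := by
    exact loc_subtype_mk_eq (X.actP_cof p)

/-- The inclusion of a subobject. -/
def ι : Γ.toModel ⟶ X :=
  homMk (X := Γ.toModel) (Y := X) Γ.V.subtype Γ.P.subtype Γ.Q.subtype Γ.N.subtype
    (fun _ _ h => h) (fun _ _ h => h) (fun _ _ h => h) (fun _ _ h => h)
    (fun p => (map_subExt X.extP Γ.spanP p).symm) (fun p => (map_subExt X.extQ Γ.spanQ p).symm)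
    (fun p => (map_subExt X.extVP Γ.spanVP p).symm) (fun p => (map_subExt X.extVQ Γ.spanVQ p).symm)
    (fun _ => rfl) (fun _ => rfl)

/-- The quotient by a subobject. -/
def quotient : StandardModel D where
  V := GrMod.quot Γ.V Γ.homV
  P := GrMod.quot Γ.P Γ.homP
  Q := GrMod.quot Γ.Q Γ.homQ
  N := GrMod.quot Γ.N Γ.homN
  extP := quotExt X.extP Γ.spanP
  extQ := quotExt X.extQ Γ.spanQ
  extVP := quotExt X.extVP Γ.spanVP
  extVQ := quotExt X.extVQ Γ.spanVQ
  extP_baseChange := quotExt_baseChange _ _ X.extP_baseChange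
  extQ_baseChange := quotExt_baseChange _ _ X.extQ_baseChange
  extVP_baseChange := quotExt_baseChange _ _ X.extVP_baseChange
  extVQ_baseChange := quotExt_baseChange _ _ X.extVQ_baseChange
  extP_gr := by
    rintro k _ ⟨p, hp, rfl⟩
    exact map_mem_eulerLocGr (M' := X.N) (M := GrMod.quot Γ.N Γ.homN) Γ.N.mkQ
      (fun _ x hx => ⟨x, hx, rfl⟩) (X.extP_gr k p hp)
  extQ_gr := by
    rintro k _ ⟨p, hp, rfl⟩
    exact mem_idemLocGr.1 (map_mem_idemLocGr (M' := X.N) (M := GrMod.quot Γ.N Γ.homN) Γ.N.mkQ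
      (fun _ x hx => ⟨x, hx, rfl⟩) (mem_idemLocGr.2 (X.extQ_gr k p hp)))
  extVP_gr := by
    rintro k _ ⟨p, hp, rfl⟩
    exact mem_idemLocGr.1 (map_mem_idemLocGr (M' := X.P) (M := GrMod.quot Γ.P Γ.homP) Γ.P.mkQ
      (fun _ x hx => ⟨x, hx, rfl⟩) (mem_idemLocGr.2 (X.extVP_gr k p hp)))
  extVQ_gr := by
    rintro k _ ⟨p, hp, rfl⟩
    exact map_mem_eulerLocGr (M' := X.Q) (M := GrMod.quot Γ.Q Γ.homQ) Γ.Q.mkQ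
      (fun _ x hx => ⟨x, hx, rfl⟩) (X.extVQ_gr k p hp)
  square v := by
    obtain ⟨v, rfl⟩ := Γ.V.mkQ_surjective v
    exact square_of_compat (Compat.map Γ.V.mkQ Γ.P.mkQ Γ.Q.mkQ Γ.N.mkQ
      (quotExt_mkQ X.extP Γ.spanP) (quotExt_mkQ X.extQ Γ.spanQ) (quotExt_mkQ X.extVP Γ.spanVP)
      (quotExt_mkQ X.extVQ Γ.spanVQ) v)
  actP := Γ.P.mapQ Γ.P X.actP Γ.actP_mem
  actN := Γ.N.mapQ Γ.N X.actN Γ.actN_mem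
  actP_gr := by
    rintro k _ ⟨p, hp, rfl⟩
    exact ⟨X.actP p, X.actP_gr k p hp, rfl⟩
  actN_gr := by
    rintro k _ ⟨p, hp, rfl⟩
    exact ⟨X.actN p, X.actN_gr k p hp, rfl⟩
  actP_actP p := by
    obtain ⟨p, rfl⟩ := Γ.P.mkQ_surjective p
    exact congrArg Γ.P.mkQ (X.actP_actP p)
  actN_actN p := by
    obtain ⟨p, rfl⟩ := Γ.N.mkQ_surjective p
    exact congrArg Γ.N.mkQ (X.actN_actN p)
  actN_connected p := by
    obtain ⟨p, rfl⟩ := Γ.N.mkQ_surjective p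
    exact congrArg Γ.N.mkQ (X.actN_connected p)
  extP_act p x e h := by
    obtain ⟨p, rfl⟩ := Γ.P.mkQ_surjective p
    have h1 : LocalizedModule.mk (Γ.N.mapQ Γ.N X.actN Γ.actN_mem x) e =
      LocalizedModule.map (eulerF D) (Γ.N.mapQ Γ.N X.actN Γ.actN_mem)
        (LocalizedModule.map (eulerF D) Γ.N.mkQ (X.extP p)) := by
      rw [← quotExt_mkQ X.extP Γ.spanP]
      exact (LocalizedModule.map_mk _ _ _ _).symm.trans (congrArg _ h.symm)
    refine Eq.trans ?_ (congrArg _ h1.symm)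
    rw [loc_map_map]
    have h2 : (Γ.N.mapQ Γ.N X.actN Γ.actN_mem).comp Γ.N.mkQ = Γ.N.mkQ.comp X.actN := rfl
    rw [h2, ← loc_map_map]
    refine Eq.trans (loc_map_smul Γ.N.mkQ _ _).symm (Eq.trans ?_ (loc_map_smul Γ.N.mkQ _ _))
    exact congrArg _ (X.disc_smul_extP_actP p)
  actN_cof x := by
    obtain ⟨x, rfl⟩ := Γ.N.mkQ_surjective x
    have := congrArg (LocalizedModule.map (cofF D) Γ.N.mkQ) (X.actN_cof x)
    rwa [LocalizedModule.map_mk, LocalizedModule.map_mk] at this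
  actP_cof x := by
    obtain ⟨x, rfl⟩ := Γ.P.mkQ_surjective x
    have := congrArg (LocalizedModule.map cofZ Γ.P.mkQ) (X.actP_cof x)
    rwa [LocalizedModule.map_mk, LocalizedModule.map_mk] at this

/-- The projection to the quotient. -/
def π : X ⟶ Γ.quotient :=
  homMk (X := X) (Y := Γ.quotient) Γ.V.mkQ Γ.P.mkQ Γ.Q.mkQ Γ.N.mkQ
    (fun _ x h => ⟨x, h, rfl⟩) (fun _ x h => ⟨x, h, rfl⟩) (fun _ x h => ⟨x, h, rfl⟩)
    (fun _ x h => ⟨x, h, rfl⟩)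
    (fun _ => rfl) (fun _ => rfl) (fun _ => rfl) (fun _ => rfl) (fun _ => rfl) (fun _ => rfl)

end Sub

end StandardModel

end

noncomputable section

namespace StandardModel

variable {D : FullSubgroups}

/-! ### The preadditive structure -/

section Preadditive

variable {X Y Z : StandardModel D}

instance : Zero (X ⟶ Y) where
  zero := homMk 0 0 0 0 (fun _ _ _ => zero_mem _) (fun _ _ _ => zero_mem _)
    (fun _ _ _ => zero_mem _) (fun _ _ _ => zero_mem _)
    (fun _ => (map_zero _).trans (loc_map_zero _).symm)
    (fun _ => (map_zero _).trans (loc_map_zero _).symm)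
    (fun _ => (map_zero _).trans (loc_map_zero _).symm)
    (fun _ => (map_zero _).trans (loc_map_zero _).symm)
    (fun _ => (map_zero _).symm) (fun _ => (map_zero _).symm)

instance : Add (X ⟶ Y) where
  add f g := homMk (onV f + onV g) (onP f + onP g) (onQ f + onQ g) (onN f + onN g)
    (fun _ _ h => add_mem (onV_mem f h) (onV_mem g h))
    (fun _ _ h => add_mem (onP_mem f h) (onP_mem g h))
    (fun _ _ h => add_mem (onQ_mem f h) (onQ_mem g h))
    (fun _ _ h => add_mem (onN_mem f h) (onN_mem g h))
    (fun a => by rw [loc_map_add, LinearMap.add_apply, map_add, extP_onP, extP_onP])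
    (fun a => by rw [loc_map_add, LinearMap.add_apply, map_add, extQ_onQ, extQ_onQ])
    (fun a => by rw [loc_map_add, LinearMap.add_apply, map_add, extVP_onV, extVP_onV])
    (fun a => by rw [loc_map_add, LinearMap.add_apply, map_add, extVQ_onV, extVQ_onV])
    (fun a => by simp only [LinearMap.add_apply, map_add, onP_actP])
    (fun a => by simp only [LinearMap.add_apply, map_add, onN_actN])

theorem loc_map_neg {R : Type} [CommRing R] {S : Submonoid R} {N N₂ : Type} [AddCommGroup N]
    [Module R N] [AddCommGroup N₂] [Module R N₂] (g : N →ₗ[R] N₂) (y : LocalizedModule S N) :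
    LocalizedModule.map S (-g) y = -LocalizedModule.map S g y := by
  rw [map_neg]; rfl

instance : Neg (X ⟶ Y) where
  neg f := homMk (-onV f) (-onP f) (-onQ f) (-onN f)
    (fun _ _ h => neg_mem (onV_mem f h)) (fun _ _ h => neg_mem (onP_mem f h))
    (fun _ _ h => neg_mem (onQ_mem f h)) (fun _ _ h => neg_mem (onN_mem f h))
    (fun a => by rw [loc_map_neg, LinearMap.neg_apply, map_neg, extP_onP])
    (fun a => by rw [loc_map_neg, LinearMap.neg_apply, map_neg, extQ_onQ])
    (fun a => by rw [loc_map_neg, LinearMap.neg_apply, map_neg, extVP_onV])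
    (fun a => by rw [loc_map_neg, LinearMap.neg_apply, map_neg, extVQ_onV])
    (fun a => by simp only [LinearMap.neg_apply, map_neg, onP_actP])
    (fun a => by simp only [LinearMap.neg_apply, map_neg, onN_actN])

instance : AddCommGroup (X ⟶ Y) where
  add_assoc f g h := hom_ext (fun _ => add_assoc _ _ _) (fun _ => add_assoc _ _ _)
    (fun _ => add_assoc _ _ _) (fun _ => add_assoc _ _ _)
  zero_add f := hom_ext (fun _ => zero_add _) (fun _ => zero_add _)
    (fun _ => zero_add _) (fun _ => zero_add _)
  add_zero f := hom_ext (fun _ => add_zero _) (fun _ => add_zero _)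
    (fun _ => add_zero _) (fun _ => add_zero _)
  neg_add_cancel f := hom_ext (fun _ => neg_add_cancel _) (fun _ => neg_add_cancel _)
    (fun _ => neg_add_cancel _) (fun _ => neg_add_cancel _)
  add_comm f g := hom_ext (fun _ => add_comm _ _) (fun _ => add_comm _ _)
    (fun _ => add_comm _ _) (fun _ => add_comm _ _)
  nsmul := nsmulRec
  zsmul := zsmulRec

scoped instance : Preadditive (StandardModel D) where
  add_comp _ _ _ f g h := hom_ext (fun x => map_add (onV h) (onV f x) (onV g x))
    (fun x => map_add (onP h) (onP f x) (onP g x)) (fun x => map_add (onQ h) (onQ f x) (onQ g x))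
    (fun x => map_add (onN h) (onN f x) (onN g x))
  comp_add _ _ _ _ _ _ := hom_ext (fun _ => rfl) (fun _ => rfl) (fun _ => rfl) (fun _ => rfl)

end Preadditive

/-! ### Injective and surjective morphisms -/

section InjSurj

variable {X Y Z : StandardModel D}

/-- All components are injective. -/
structure Inj (f : X ⟶ Y) : Prop where
  V : Function.Injective (onV f)
  P : Function.Injective (onP f)
  Q : Function.Injective (onQ f)
  N : Function.Injective (onN f)

/-- All components are surjective. -/
structure Surj (f : X ⟶ Y) : Prop where
  V : Function.Surjective (onV f)
  P : Function.Surjective (onP f)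
  Q : Function.Surjective (onQ f)
  N : Function.Surjective (onN f)

theorem Inj.comp {f : X ⟶ Y} {g : Y ⟶ Z} (hf : Inj f) (hg : Inj g) : Inj (f ≫ g) :=
  ⟨hg.V.comp hf.V, hg.P.comp hf.P, hg.Q.comp hf.Q, hg.N.comp hf.N⟩

theorem Inj.of_comp {f : X ⟶ Y} {g : Y ⟶ Z} (h : Inj (f ≫ g)) : Inj f :=
  ⟨Function.Injective.of_comp (f := onV g) h.V, Function.Injective.of_comp (f := onP g) h.P,
    Function.Injective.of_comp (f := onQ g) h.Q, Function.Injective.of_comp (f := onN g) h.N⟩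

theorem Surj.of_comp {f : X ⟶ Y} {g : Y ⟶ Z} (h : Surj (f ≫ g)) : Surj g :=
  ⟨Function.Surjective.of_comp (g := onV f) h.V, Function.Surjective.of_comp (g := onP f) h.P,
    Function.Surjective.of_comp (g := onQ f) h.Q, Function.Surjective.of_comp (g := onN f) h.N⟩

theorem linear_exists_lift {R A B C : Type} [CommRing R] [AddCommGroup A] [Module R A]
    [AddCommGroup B] [Module R B] [AddCommGroup C] [Module R C] (f : A →ₗ[R] B)
    (hf : Function.Injective f) (g : C →ₗ[R] B) (h : ∀ c, ∃ a, f a = g c) :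
    ∃ l : C →ₗ[R] A, ∀ c, f (l c) = g c := by
  choose l hl using h
  exact ⟨{ toFun := l, map_add' := fun a b => hf (by rw [hl, map_add, map_add, hl, hl])
           map_smul' := fun a b => hf (by
            rw [hl, map_smul, RingHom.id_apply, map_smul, hl]) }, hl⟩

theorem linear_exists_desc {R A B C : Type} [CommRing R] [AddCommGroup A] [Module R A]
    [AddCommGroup B] [Module R B] [AddCommGroup C] [Module R C] (f : A →ₗ[R] B)
    (hf : Function.Surjective f) (g : A →ₗ[R] C) (h : ∀ a, f a = 0 → g a = 0) :
    ∃ l : B →ₗ[R] C, ∀ a, l (f a) = g a := by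
  have key : ∀ a a', f a = f a' → g a = g a' := fun a a' haa => by
    rw [← sub_eq_zero, ← map_sub]; exact h _ (by rw [map_sub, haa, sub_self])
  choose s hs using hf
  exact ⟨{ toFun := fun b => g (s b)
           map_add' := fun a b => by
            rw [← map_add]; exact key _ _ (by rw [map_add, hs, hs, hs])
           map_smul' := fun a b => by
            rw [RingHom.id_apply, ← map_smul]; exact key _ _ (by rw [map_smul, hs, hs]) },
    fun a => key _ _ (hs _)⟩

theorem gr_of_injective {R : Type} [CommRing R] {A : ℤ → Set R} {M M' : GrMod R A}
    (f : M →ₗ[R] M') (hf : Function.Injective f) (hgr : ∀ k, ∀ x ∈ M.gr k, f x ∈ M'.gr k) {k : ℤ}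
    {x : M} (hx : f x ∈ M'.gr k) : x ∈ M.gr k := by
  have h := GrMod.map_proj f.toAddMonoidHom hgr k x
  have h2 : M.proj k x = x := hf (h.trans (GrMod.proj_of_mem hx))
  rw [← h2]; exact M.proj_mem k x

theorem exists_gr_of_surjective {R : Type} [CommRing R] {A : ℤ → Set R} {M M' : GrMod R A}
    (f : M →ₗ[R] M') (hf : Function.Surjective f) (hgr : ∀ k, ∀ x ∈ M.gr k, f x ∈ M'.gr k) {k : ℤ}
    {y : M'} (hy : y ∈ M'.gr k) : ∃ x ∈ M.gr k, f x = y := by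
  obtain ⟨x, rfl⟩ := hf y
  exact ⟨M.proj k x, M.proj_mem k x,
    (GrMod.map_proj f.toAddMonoidHom hgr k x).trans (GrMod.proj_of_mem hy)⟩

theorem exists_lift {f : X ⟶ Y} (hf : Inj f) (g : Z ⟶ Y) (hV : ∀ z, ∃ x, onV f x = onV g z)
    (hP : ∀ z, ∃ x, onP f x = onP g z) (hQ : ∀ z, ∃ x, onQ f x = onQ g z)
    (hN : ∀ z, ∃ x, onN f x = onN g z) : ∃ h : Z ⟶ X, h ≫ f = g := by
  obtain ⟨v, hv⟩ := linear_exists_lift _ hf.V _ hV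
  obtain ⟨p, hp⟩ := linear_exists_lift _ hf.P _ hP
  obtain ⟨q, hq⟩ := linear_exists_lift _ hf.Q _ hQ
  obtain ⟨n, hn⟩ := linear_exists_lift _ hf.N _ hN
  have hv' : (onV f).comp v = onV g := LinearMap.ext hv
  have hp' : (onP f).comp p = onP g := LinearMap.ext hp
  have hq' : (onQ f).comp q = onQ g := LinearMap.ext hq
  have hn' : (onN f).comp n = onN g := LinearMap.ext hn
  refine ⟨homMk v p q n ?_ ?_ ?_ ?_ ?_ ?_ ?_ ?_ ?_ ?_, hom_ext hv hp hq hn⟩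
  · intro k a ha
    exact gr_of_injective _ hf.V (Hom.onV_gr f) (by rw [hv]; exact onV_mem g ha)
  · intro k a ha
    exact gr_of_injective _ hf.P (Hom.onP_gr f) (by rw [hp]; exact onP_mem g ha)
  · intro k a ha
    exact gr_of_injective _ hf.Q (Hom.onQ_gr f) (by rw [hq]; exact onQ_mem g ha)
  · intro k a ha
    exact gr_of_injective _ hf.N (Hom.onN_gr f) (by rw [hn]; exact onN_mem g ha)
  · intro a
    apply LocalizedModule.map_injective _ _ hf.N
    rw [← extP_onP, hp, extP_onP, loc_map_map, hn']
  · intro a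
    apply LocalizedModule.map_injective _ _ hf.N
    rw [← extQ_onQ, hq, extQ_onQ, loc_map_map, hn']
  · intro a
    apply LocalizedModule.map_injective _ _ hf.P
    rw [← extVP_onV, hv, extVP_onV, loc_map_map, hp']
  · intro a
    apply LocalizedModule.map_injective _ _ hf.Q
    rw [← extVQ_onV, hv, extVQ_onV, loc_map_map, hq']
  · intro a
    apply hf.P
    rw [onP_actP, hp, hp, onP_actP]
  · intro a
    apply hf.N
    rw [onN_actN, hn, hn, onN_actN]

theorem exists_desc {f : X ⟶ Y} (hf : Surj f) (g : X ⟶ Z) (hV : ∀ x, onV f x = 0 → onV g x = 0)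
    (hP : ∀ x, onP f x = 0 → onP g x = 0) (hQ : ∀ x, onQ f x = 0 → onQ g x = 0)
    (hN : ∀ x, onN f x = 0 → onN g x = 0) : ∃ h : Y ⟶ Z, f ≫ h = g := by
  obtain ⟨v, hv⟩ := linear_exists_desc _ hf.V _ hV
  obtain ⟨p, hp⟩ := linear_exists_desc _ hf.P _ hP
  obtain ⟨q, hq⟩ := linear_exists_desc _ hf.Q _ hQ
  obtain ⟨n, hn⟩ := linear_exists_desc _ hf.N _ hN
  have hv' : v.comp (onV f) = onV g := LinearMap.ext hv
  have hp' : p.comp (onP f) = onP g := LinearMap.ext hp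
  have hq' : q.comp (onQ f) = onQ g := LinearMap.ext hq
  have hn' : n.comp (onN f) = onN g := LinearMap.ext hn
  refine ⟨homMk v p q n ?_ ?_ ?_ ?_ ?_ ?_ ?_ ?_ ?_ ?_, hom_ext hv hp hq hn⟩
  · intro k a ha
    obtain ⟨x, hx, rfl⟩ := exists_gr_of_surjective _ hf.V (Hom.onV_gr f) ha
    rw [hv]; exact onV_mem g hx
  · intro k a ha
    obtain ⟨x, hx, rfl⟩ := exists_gr_of_surjective _ hf.P (Hom.onP_gr f) ha
    rw [hp]; exact onP_mem g hx
  · intro k a ha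
    obtain ⟨x, hx, rfl⟩ := exists_gr_of_surjective _ hf.Q (Hom.onQ_gr f) ha
    rw [hq]; exact onQ_mem g hx
  · intro k a ha
    obtain ⟨x, hx, rfl⟩ := exists_gr_of_surjective _ hf.N (Hom.onN_gr f) ha
    rw [hn]; exact onN_mem g hx
  · intro a
    obtain ⟨x, rfl⟩ := hf.P a
    rw [hp, extP_onP, extP_onP, loc_map_map, hn']
  · intro a
    obtain ⟨x, rfl⟩ := hf.Q a
    rw [hq, extQ_onQ, extQ_onQ, loc_map_map, hn']
  · intro a
    obtain ⟨x, rfl⟩ := hf.V a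
    rw [hv, extVP_onV, extVP_onV, loc_map_map, hp']
  · intro a
    obtain ⟨x, rfl⟩ := hf.V a
    rw [hv, extVQ_onV, extVQ_onV, loc_map_map, hq']
  · intro a
    obtain ⟨x, rfl⟩ := hf.P a
    rw [← onP_actP, hp, hp, onP_actP]
  · intro a
    obtain ⟨x, rfl⟩ := hf.N a
    rw [← onN_actN, hn, hn, onN_actN]

theorem Inj.mono {f : X ⟶ Y} (hf : Inj f) : Mono f where
  right_cancellation _ _ h := hom_ext
    (fun v => hf.V (congrArg (fun g => onV g v) h)) (fun v => hf.P (congrArg (fun g => onP g v) h))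
    (fun v => hf.Q (congrArg (fun g => onQ g v) h)) (fun v => hf.N (congrArg (fun g => onN g v) h))

theorem Surj.epi {f : X ⟶ Y} (hf : Surj f) : Epi f where
  left_cancellation g g' h := by
    refine hom_ext (fun v => ?_) (fun v => ?_) (fun v => ?_) (fun v => ?_)
    · obtain ⟨v, rfl⟩ := hf.V v; exact congrArg (fun g => onV g v) h
    · obtain ⟨v, rfl⟩ := hf.P v; exact congrArg (fun g => onP g v) h
    · obtain ⟨v, rfl⟩ := hf.Q v; exact congrArg (fun g => onQ g v) h
    · obtain ⟨v, rfl⟩ := hf.N v; exact congrArg (fun g => onN g v) h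

theorem isIso_of_inj_surj {f : X ⟶ Y} (hf : Inj f) (hs : Surj f) : IsIso f := by
  obtain ⟨g, hg⟩ := exists_lift hf (𝟙 Y) (fun z => hs.V z) (fun z => hs.P z) (fun z => hs.Q z)
    (fun z => hs.N z)
  have := hf.mono
  exact ⟨g, by rw [← cancel_mono f, Category.assoc, hg, Category.comp_id, Category.id_comp], hg⟩

end InjSurj

/-! ### Operations on subobjects -/

namespace Sub

variable {X Y : StandardModel D}

theorem inj_ι (Γ : Sub X) : Inj Γ.ι :=
  ⟨Γ.V.injective_subtype, Γ.P.injective_subtype, Γ.Q.injective_subtype, Γ.N.injective_subtype⟩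

theorem surj_π (Γ : Sub X) : Surj Γ.π :=
  ⟨Γ.V.mkQ_surjective, Γ.P.mkQ_surjective, Γ.Q.mkQ_surjective, Γ.N.mkQ_surjective⟩

theorem onV_π (Γ : Sub X) {x : X.V} : onV Γ.π x = 0 ↔ x ∈ Γ.V := Submodule.Quotient.mk_eq_zero _
theorem onP_π (Γ : Sub X) {x : X.P} : onP Γ.π x = 0 ↔ x ∈ Γ.P := Submodule.Quotient.mk_eq_zero _
theorem onQ_π (Γ : Sub X) {x : X.Q} : onQ Γ.π x = 0 ↔ x ∈ Γ.Q := Submodule.Quotient.mk_eq_zero _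
theorem onN_π (Γ : Sub X) {x : X.N} : onN Γ.π x = 0 ↔ x ∈ Γ.N := Submodule.Quotient.mk_eq_zero _

theorem exists_lift_ι (Γ : Sub X) (g : Y ⟶ X) (hV : ∀ z, onV g z ∈ Γ.V)
    (hP : ∀ z, onP g z ∈ Γ.P) (hQ : ∀ z, onQ g z ∈ Γ.Q) (hN : ∀ z, onN g z ∈ Γ.N) :
    ∃ h : Y ⟶ Γ.toModel, h ≫ Γ.ι = g :=
  exists_lift Γ.inj_ι g (fun z => ⟨⟨_, hV z⟩, rfl⟩) (fun z => ⟨⟨_, hP z⟩, rfl⟩)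
    (fun z => ⟨⟨_, hQ z⟩, rfl⟩) (fun z => ⟨⟨_, hN z⟩, rfl⟩)

theorem exists_desc_π (Γ : Sub X) (g : X ⟶ Y) (hV : ∀ z ∈ Γ.V, onV g z = 0)
    (hP : ∀ z ∈ Γ.P, onP g z = 0) (hQ : ∀ z ∈ Γ.Q, onQ g z = 0) (hN : ∀ z ∈ Γ.N, onN g z = 0) :
    ∃ h : Γ.quotient ⟶ Y, Γ.π ≫ h = g :=
  exists_desc Γ.surj_π g (fun z hz => hV z (Γ.onV_π.1 hz)) (fun z hz => hP z (Γ.onP_π.1 hz))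
    (fun z hz => hQ z (Γ.onQ_π.1 hz)) (fun z hz => hN z (Γ.onN_π.1 hz))

theorem homogeneous_ker {R : Type} [CommRing R] {A : ℤ → Set R} {M M' : GrMod R A}
    (f : M →ₗ[R] M') (hgr : ∀ k, ∀ x ∈ M.gr k, f x ∈ M'.gr k) :
    GrMod.Homogeneous (LinearMap.ker f) := by
  intro k x hx
  have h := GrMod.map_proj f.toAddMonoidHom hgr k x
  change f _ = _ at h
  rw [LinearMap.mem_ker, h]
  change M'.proj k (f x) = 0
  rw [show f x = 0 from hx, map_zero]

theorem homogeneous_map {R : Type} [CommRing R] {A : ℤ → Set R} {M M' : GrMod R A}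
    (f : M →ₗ[R] M') (hgr : ∀ k, ∀ x ∈ M.gr k, f x ∈ M'.gr k) {N : Submodule R M}
    (hN : GrMod.Homogeneous N) : GrMod.Homogeneous (N.map f) := by
  rintro k _ ⟨x, hx, rfl⟩
  exact ⟨M.proj k x, hN k x hx, GrMod.map_proj f.toAddMonoidHom hgr k x⟩

theorem homogeneous_iSup {R : Type} [CommRing R] {A : ℤ → Set R} {M : GrMod R A} {J : Type}
    {N : J → Submodule R M} (hN : ∀ j, GrMod.Homogeneous (N j)) :
    GrMod.Homogeneous (⨆ j, N j) := by
  intro k x hx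
  refine Submodule.iSup_induction N (motive := fun x => M.proj k x ∈ _) hx ?_ ?_ ?_
  · intro j x hx; exact Submodule.mem_iSup_of_mem j (hN j k x hx)
  · rw [map_zero]; exact zero_mem _
  · intro x y hx hy; rw [map_add]; exact add_mem hx hy

theorem homogeneous_sup {R : Type} [CommRing R] {A : ℤ → Set R} {M : GrMod R A}
    {N N' : Submodule R M} (hN : GrMod.Homogeneous N) (hN' : GrMod.Homogeneous N') :
    GrMod.Homogeneous (N ⊔ N') := by
  intro k x hx
  obtain ⟨a, ha, b, hb, rfl⟩ := Submodule.mem_sup.1 hx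
  rw [map_add]
  exact add_mem (Submodule.mem_sup_left (hN k a ha)) (Submodule.mem_sup_right (hN' k b hb))

theorem homogeneous_top {R : Type} [CommRing R] {A : ℤ → Set R} {M : GrMod R A} :
    GrMod.Homogeneous (⊤ : Submodule R M) := fun _ _ _ => trivial

theorem homogeneous_bot {R : Type} [CommRing R] {A : ℤ → Set R} {M : GrMod R A} :
    GrMod.Homogeneous (⊥ : Submodule R M) := fun k x hx => by
  rw [(Submodule.mem_bot R).1 hx, map_zero]; exact zero_mem _

/-- The kernel of a morphism. -/
def ker (f : X ⟶ Y) : Sub X where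
  V := LinearMap.ker (onV f)
  P := LinearMap.ker (onP f)
  Q := LinearMap.ker (onQ f)
  N := LinearMap.ker (onN f)
  homV := homogeneous_ker _ (Hom.onV_gr f)
  homP := homogeneous_ker _ (Hom.onP_gr f)
  homQ := homogeneous_ker _ (Hom.onQ_gr f)
  homN := homogeneous_ker _ (Hom.onN_gr f)
  spanP := Spans.ker (flat_locInflZ D) X.extP_baseChange Y.extP_baseChange (extP_onP f)
  spanQ := Spans.ker (flat_locInflT D) X.extQ_baseChange Y.extQ_baseChange (extQ_onQ f)
  spanVP := Spans.ker flat_unitZ X.extVP_baseChange Y.extVP_baseChange (extVP_onV f)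
  spanVQ := Spans.ker flat_unitT X.extVQ_baseChange Y.extVQ_baseChange (extVQ_onV f)
  actP_mem p hp := by
    rw [LinearMap.mem_ker, onP_actP, LinearMap.mem_ker.1 hp, map_zero]
  actN_mem p hp := by
    rw [LinearMap.mem_ker, onN_actN, LinearMap.mem_ker.1 hp, map_zero]

/-- The image of a subobject. -/
def map (f : X ⟶ Y) (Γ : Sub X) : Sub Y where
  V := Γ.V.map (onV f)
  P := Γ.P.map (onP f)
  Q := Γ.Q.map (onQ f)
  N := Γ.N.map (onN f)
  homV := homogeneous_map _ (Hom.onV_gr f) Γ.homV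
  homP := homogeneous_map _ (Hom.onP_gr f) Γ.homP
  homQ := homogeneous_map _ (Hom.onQ_gr f) Γ.homQ
  homN := homogeneous_map _ (Hom.onN_gr f) Γ.homN
  spanP := Γ.spanP.map (extP_onP f)
  spanQ := Γ.spanQ.map (extQ_onQ f)
  spanVP := Γ.spanVP.map (extVP_onV f)
  spanVQ := Γ.spanVQ.map (extVQ_onV f)
  actP_mem := by
    rintro _ ⟨p, hp, rfl⟩
    exact ⟨X.actP p, Γ.actP_mem p hp, onP_actP f p⟩
  actN_mem := by
    rintro _ ⟨p, hp, rfl⟩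
    exact ⟨X.actN p, Γ.actN_mem p hp, onN_actN f p⟩

/-- The whole object. -/
def top (X : StandardModel D) : Sub X where
  V := ⊤
  P := ⊤
  Q := ⊤
  N := ⊤
  homV := homogeneous_top
  homP := homogeneous_top
  homQ := homogeneous_top
  homN := homogeneous_top
  spanP := Spans.top X.extP_baseChange
  spanQ := Spans.top X.extQ_baseChange
  spanVP := Spans.top X.extVP_baseChange
  spanVQ := Spans.top X.extVQ_baseChange
  actP_mem _ _ := trivial
  actN_mem _ _ := trivial

/-- The range of a morphism. -/
def range (f : X ⟶ Y) : Sub Y := map f (top X)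

/-- The join of subobjects. -/
def iSup {J : Type} (Γ : J → Sub X) : Sub X where
  V := ⨆ j, (Γ j).V
  P := ⨆ j, (Γ j).P
  Q := ⨆ j, (Γ j).Q
  N := ⨆ j, (Γ j).N
  homV := homogeneous_iSup fun j => (Γ j).homV
  homP := homogeneous_iSup fun j => (Γ j).homP
  homQ := homogeneous_iSup fun j => (Γ j).homQ
  homN := homogeneous_iSup fun j => (Γ j).homN
  spanP := Spans.iSup fun j => (Γ j).spanP
  spanQ := Spans.iSup fun j => (Γ j).spanQ
  spanVP := Spans.iSup fun j => (Γ j).spanVP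
  spanVQ := Spans.iSup fun j => (Γ j).spanVQ
  actP_mem p hp := by
    refine Submodule.iSup_induction _ (motive := fun x => X.actP x ∈ _) hp ?_ ?_ ?_
    · intro j x hx; exact Submodule.mem_iSup_of_mem j ((Γ j).actP_mem x hx)
    · rw [map_zero]; exact zero_mem _
    · intro x y hx hy; rw [map_add]; exact add_mem hx hy
  actN_mem p hp := by
    refine Submodule.iSup_induction _ (motive := fun x => X.actN x ∈ _) hp ?_ ?_ ?_
    · intro j x hx; exact Submodule.mem_iSup_of_mem j ((Γ j).actN_mem x hx)
    · rw [map_zero]; exact zero_mem _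
    · intro x y hx hy; rw [map_add]; exact add_mem hx hy

/-- The join of two subobjects. -/
def sup (Γ Γ' : Sub X) : Sub X where
  V := Γ.V ⊔ Γ'.V
  P := Γ.P ⊔ Γ'.P
  Q := Γ.Q ⊔ Γ'.Q
  N := Γ.N ⊔ Γ'.N
  homV := homogeneous_sup Γ.homV Γ'.homV
  homP := homogeneous_sup Γ.homP Γ'.homP
  homQ := homogeneous_sup Γ.homQ Γ'.homQ
  homN := homogeneous_sup Γ.homN Γ'.homN
  spanP := Γ.spanP.sup Γ'.spanP
  spanQ := Γ.spanQ.sup Γ'.spanQ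
  spanVP := Γ.spanVP.sup Γ'.spanVP
  spanVQ := Γ.spanVQ.sup Γ'.spanVQ
  actP_mem p hp := by
    obtain ⟨a, ha, b, hb, rfl⟩ := Submodule.mem_sup.1 hp
    rw [map_add]
    exact add_mem (Submodule.mem_sup_left (Γ.actP_mem a ha))
      (Submodule.mem_sup_right (Γ'.actP_mem b hb))
  actN_mem p hp := by
    obtain ⟨a, ha, b, hb, rfl⟩ := Submodule.mem_sup.1 hp
    rw [map_add]
    exact add_mem (Submodule.mem_sup_left (Γ.actN_mem a ha))
      (Submodule.mem_sup_right (Γ'.actN_mem b hb))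

end Sub

/-! ### Kernels, cokernels, monomorphisms and epimorphisms -/

section KerCoker

variable {X Y Z : StandardModel D}

theorem ι_ker_comp (f : X ⟶ Y) : (Sub.ker f).ι ≫ f = 0 :=
  hom_ext (fun v => v.2) (fun v => v.2) (fun v => v.2) (fun v => v.2)

theorem comp_π_range (f : X ⟶ Y) : f ≫ (Sub.range f).π = 0 :=
  hom_ext (fun v => (Sub.onV_π _).2 ⟨v, trivial, rfl⟩) (fun v => (Sub.onP_π _).2 ⟨v, trivial, rfl⟩)
    (fun v => (Sub.onQ_π _).2 ⟨v, trivial, rfl⟩) (fun v => (Sub.onN_π _).2 ⟨v, trivial, rfl⟩)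

theorem mono_iff {f : X ⟶ Y} : Mono f ↔ Inj f := by
  refine ⟨fun _ => ?_, Inj.mono⟩
  have h : (Sub.ker f).ι = 0 := by
    rw [← cancel_mono f, ι_ker_comp, Limits.zero_comp]
  refine ⟨?_, ?_, ?_, ?_⟩
  · exact (injective_iff_map_eq_zero _).2 fun a ha =>
      congrArg (fun g : (Sub.ker f).toModel ⟶ X => onV g (⟨a, ha⟩ : LinearMap.ker (onV f))) h
  · exact (injective_iff_map_eq_zero _).2 fun a ha =>
      congrArg (fun g : (Sub.ker f).toModel ⟶ X => onP g (⟨a, ha⟩ : LinearMap.ker (onP f))) h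
  · exact (injective_iff_map_eq_zero _).2 fun a ha =>
      congrArg (fun g : (Sub.ker f).toModel ⟶ X => onQ g (⟨a, ha⟩ : LinearMap.ker (onQ f))) h
  · exact (injective_iff_map_eq_zero _).2 fun a ha =>
      congrArg (fun g : (Sub.ker f).toModel ⟶ X => onN g (⟨a, ha⟩ : LinearMap.ker (onN f))) h

theorem epi_iff {f : X ⟶ Y} : Epi f ↔ Surj f := by
  refine ⟨fun _ => ?_, Surj.epi⟩
  have h : (Sub.range f).π = 0 := by
    rw [← cancel_epi f, comp_π_range, Limits.comp_zero]
  refine ⟨fun y => ?_, fun y => ?_, fun y => ?_, fun y => ?_⟩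
  · obtain ⟨x, -, hx⟩ := (Sub.onV_π _).1 (congrArg (fun g => onV g y) h); exact ⟨x, hx⟩
  · obtain ⟨x, -, hx⟩ := (Sub.onP_π _).1 (congrArg (fun g => onP g y) h); exact ⟨x, hx⟩
  · obtain ⟨x, -, hx⟩ := (Sub.onQ_π _).1 (congrArg (fun g => onQ g y) h); exact ⟨x, hx⟩
  · obtain ⟨x, -, hx⟩ := (Sub.onN_π _).1 (congrArg (fun g => onN g y) h); exact ⟨x, hx⟩

/-- The sequence of components is exact in the middle. -/
structure ExactAt (f : X ⟶ Y) (g : Y ⟶ Z) : Prop where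
  V : ∀ y, onV g y = 0 ↔ ∃ x, onV f x = y
  P : ∀ y, onP g y = 0 ↔ ∃ x, onP f x = y
  Q : ∀ y, onQ g y = 0 ↔ ∃ x, onQ f x = y
  N : ∀ y, onN g y = 0 ↔ ∃ x, onN f x = y

theorem ExactAt.comp_eq_zero {f : X ⟶ Y} {g : Y ⟶ Z} (h : ExactAt f g) : f ≫ g = 0 :=
  hom_ext (fun v => (h.V _).2 ⟨v, rfl⟩) (fun v => (h.P _).2 ⟨v, rfl⟩)
    (fun v => (h.Q _).2 ⟨v, rfl⟩) (fun v => (h.N _).2 ⟨v, rfl⟩)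

theorem exactAt_ker (f : X ⟶ Y) : ExactAt (Sub.ker f).ι f :=
  ⟨fun y => ⟨fun h => ⟨⟨y, h⟩, rfl⟩, by rintro ⟨x, rfl⟩; exact x.2⟩,
    fun y => ⟨fun h => ⟨⟨y, h⟩, rfl⟩, by rintro ⟨x, rfl⟩; exact x.2⟩,
    fun y => ⟨fun h => ⟨⟨y, h⟩, rfl⟩, by rintro ⟨x, rfl⟩; exact x.2⟩,
    fun y => ⟨fun h => ⟨⟨y, h⟩, rfl⟩, by rintro ⟨x, rfl⟩; exact x.2⟩⟩

theorem exactAt_range (f : X ⟶ Y) : ExactAt f (Sub.range f).π :=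
  ⟨fun _ => (Sub.onV_π _).trans ⟨fun ⟨x, _, h⟩ => ⟨x, h⟩, fun ⟨x, h⟩ => ⟨x, trivial, h⟩⟩,
    fun _ => (Sub.onP_π _).trans ⟨fun ⟨x, _, h⟩ => ⟨x, h⟩, fun ⟨x, h⟩ => ⟨x, trivial, h⟩⟩,
    fun _ => (Sub.onQ_π _).trans ⟨fun ⟨x, _, h⟩ => ⟨x, h⟩, fun ⟨x, h⟩ => ⟨x, trivial, h⟩⟩,
    fun _ => (Sub.onN_π _).trans ⟨fun ⟨x, _, h⟩ => ⟨x, h⟩, fun ⟨x, h⟩ => ⟨x, trivial, h⟩⟩⟩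

theorem exactAt_ι_π (Γ : Sub X) : ExactAt Γ.ι Γ.π :=
  ⟨fun y => Γ.onV_π.trans ⟨fun h => ⟨⟨y, h⟩, rfl⟩, by rintro ⟨x, rfl⟩; exact x.2⟩,
    fun y => Γ.onP_π.trans ⟨fun h => ⟨⟨y, h⟩, rfl⟩, by rintro ⟨x, rfl⟩; exact x.2⟩,
    fun y => Γ.onQ_π.trans ⟨fun h => ⟨⟨y, h⟩, rfl⟩, by rintro ⟨x, rfl⟩; exact x.2⟩,
    fun y => Γ.onN_π.trans ⟨fun h => ⟨⟨y, h⟩, rfl⟩, by rintro ⟨x, rfl⟩; exact x.2⟩⟩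

/-- An injective morphism that is exact is a kernel. -/
def ExactAt.isLimit {f : X ⟶ Y} {g : Y ⟶ Z} (h : ExactAt f g) (hf : Inj f) :
    IsLimit (KernelFork.ofι f h.comp_eq_zero) :=
  have key : ∀ {W : StandardModel D} (k : W ⟶ Y), k ≫ g = 0 → ∃ l : W ⟶ X, l ≫ f = k :=
    fun k hk => exists_lift hf k
      (fun z => (h.V _).1 (congrArg (fun g => onV g z) hk))
      (fun z => (h.P _).1 (congrArg (fun g => onP g z) hk))
      (fun z => (h.Q _).1 (congrArg (fun g => onQ g z) hk))
      (fun z => (h.N _).1 (congrArg (fun g => onN g z) hk))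
  have := hf.mono
  KernelFork.IsLimit.ofι' f h.comp_eq_zero fun k hk => ⟨(key k hk).choose, (key k hk).choose_spec⟩

/-- A surjective morphism that is exact is a cokernel. -/
def ExactAt.isColimit {f : X ⟶ Y} {g : Y ⟶ Z} (h : ExactAt f g) (hg : Surj g) :
    IsColimit (CokernelCofork.ofπ g h.comp_eq_zero) :=
  have key : ∀ {W : StandardModel D} (k : Y ⟶ W), f ≫ k = 0 → ∃ l : Z ⟶ W, g ≫ l = k :=
    fun k hk => exists_desc hg k
      (fun y hy => by
        obtain ⟨x, rfl⟩ := (h.V _).1 hy; exact congrArg (fun g => onV g x) hk)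
      (fun y hy => by
        obtain ⟨x, rfl⟩ := (h.P _).1 hy; exact congrArg (fun g => onP g x) hk)
      (fun y hy => by
        obtain ⟨x, rfl⟩ := (h.Q _).1 hy; exact congrArg (fun g => onQ g x) hk)
      (fun y hy => by
        obtain ⟨x, rfl⟩ := (h.N _).1 hy; exact congrArg (fun g => onN g x) hk)
  have := hg.epi
  CokernelCofork.IsColimit.ofπ' g h.comp_eq_zero fun k hk =>
    ⟨(key k hk).choose, (key k hk).choose_spec⟩

scoped instance : HasKernels (StandardModel D) where
  has_limit f := HasLimit.mk ⟨_, (exactAt_ker f).isLimit (Sub.inj_ι _)⟩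

scoped instance : HasCokernels (StandardModel D) where
  has_colimit f := HasColimit.mk ⟨_, (exactAt_range f).isColimit (Sub.surj_π _)⟩

scoped instance : IsNormalMonoCategory (StandardModel D) where
  normalMonoOfMono f hf := ⟨⟨_, _, _, (exactAt_range f).isLimit (mono_iff.1 hf)⟩⟩

scoped instance : IsNormalEpiCategory (StandardModel D) where
  normalEpiOfEpi f hf := ⟨⟨_, _, _, (exactAt_ker f).isColimit (epi_iff.1 hf)⟩⟩

end KerCoker

end StandardModel

end

noncomputable section

namespace StandardModel

variable {D : FullSubgroups}

/-! ### Direct sums -/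

section DirectSum

theorem loc_directSum_mk_eq {R : Type} [CommRing R] {S : Submonoid R} {J : Type} {N : J → Type}
    [∀ j, AddCommGroup (N j)] [∀ j, Module R (N j)] {x y : DirectSum J N} {s t : S}
    (h : ∀ j, (LocalizedModule.mk (x j) s : LocalizedModule S (N j)) = LocalizedModule.mk (y j) t) :
    (LocalizedModule.mk x s : LocalizedModule S (DirectSum J N)) = LocalizedModule.mk y t :=
  loc_directSum_ext fun j => by
    rw [LocalizedModule.map_mk, LocalizedModule.map_mk]
    exact h j

variable {J : Type} (X : J → StandardModel D)

theorem dsum_gr_mem {R : Type} [CommRing R] {A : ℤ → Set R} {L : Type} [AddCommGroup L]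
    {M : J → GrMod R A} {k : ℤ} {p : GrMod.dsum M} (hp : p ∈ (GrMod.dsum M).gr k)
    (f : GrMod.dsum M →+ L) (C : Set L) (h0 : 0 ∈ C) (hadd : ∀ a ∈ C, ∀ b ∈ C, a + b ∈ C)
    (h : ∀ j, ∀ m ∈ (M j).gr k, ∀ inst : DecidableEq J,
      f (@DirectSum.of J (fun j => M j) _ inst j m) ∈ C) : f p ∈ C := by
  classical
  have : p = ∑ i ∈ DFinsupp.support p, DirectSum.of (fun j => M j) i (p i) :=
    (DirectSum.sum_support_of p).symm
  rw [this, map_sum]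
  refine Finset.sum_induction _ (· ∈ C) (fun a b ha hb => hadd a ha b hb) h0 fun j _ => ?_
  exact h j _ (hp j) _

theorem lof_mem {R : Type} [CommRing R] {A : ℤ → Set R} [DecidableEq J] (M : J → GrMod R A)
    (j : J) (k : ℤ) (x : M j) (hx : x ∈ (M j).gr k) :
    DirectSum.lof R J (fun j => M j) j x ∈ (GrMod.dsum M).gr k := by
  intro i
  by_cases h : j = i
  · subst h
    exact (DirectSum.of_eq_same (β := fun j => M j) j x).symm ▸ hx
  · exact (DirectSum.of_eq_of_ne (β := fun j => M j) _ _ x (Ne.symm h)).symm ▸ zero_mem _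

/-- The direct sum of a family of objects. -/
def dsum : StandardModel D where
  V := GrMod.dsum fun j => (X j).V
  P := GrMod.dsum fun j => (X j).P
  Q := GrMod.dsum fun j => (X j).Q
  N := GrMod.dsum fun j => (X j).N
  extP := dsumExt fun j => (X j).extP
  extQ := dsumExt fun j => (X j).extQ
  extVP := dsumExt fun j => (X j).extVP
  extVQ := dsumExt fun j => (X j).extVQ
  extP_baseChange := dsumExt_baseChange _ fun j => (X j).extP_baseChange
  extQ_baseChange := dsumExt_baseChange _ fun j => (X j).extQ_baseChange
  extVP_baseChange := dsumExt_baseChange _ fun j => (X j).extVP_baseChange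
  extVQ_baseChange := dsumExt_baseChange _ fun j => (X j).extVQ_baseChange
  extP_gr k p hp := by
    classical
    refine dsum_gr_mem hp (dsumExt fun j => (X j).extP).toAddMonoidHom _ zero_mem_eulerLocGr
      (fun a ha b hb => eulerLocGr_add (preservesDegree_inflT D) ha hb) fun j m hm inst => ?_
    cases Subsingleton.elim inst (fun a b => Classical.propDecidable (a = b))
    refine Set.mem_of_eq_of_mem (dsumExt_lof (fun j => (X j).extP) j m) ?_
    refine map_mem_eulerLocGr (M' := (X j).N) (M := GrMod.dsum fun j => (X j).N) _
      (lof_mem (fun j => (X j).N) j) ((X j).extP_gr k m hm)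
  extQ_gr k p hp := by
    classical
    refine mem_idemLocGr.1 (dsum_gr_mem hp (dsumExt fun j => (X j).extQ).toAddMonoidHom
      (idemLocGr (cofF D) (GrMod.dsum fun j => (X j).N) k) (zero_mem _)
      (fun a ha b hb => add_mem ha hb) fun j m hm inst => ?_)
    cases Subsingleton.elim inst (fun a b => Classical.propDecidable (a = b))
    refine Set.mem_of_eq_of_mem (dsumExt_lof (fun j => (X j).extQ) j m) ?_
    refine map_mem_idemLocGr (M' := (X j).N) (M := GrMod.dsum fun j => (X j).N) _
      (lof_mem (fun j => (X j).N) j) (mem_idemLocGr.2 ((X j).extQ_gr k m hm))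
  extVP_gr k p hp := by
    classical
    refine mem_idemLocGr.1 (dsum_gr_mem hp (dsumExt fun j => (X j).extVP).toAddMonoidHom
      (idemLocGr cofZ (GrMod.dsum fun j => (X j).P) k) (zero_mem _)
      (fun a ha b hb => add_mem ha hb) fun j m hm inst => ?_)
    cases Subsingleton.elim inst (fun a b => Classical.propDecidable (a = b))
    refine Set.mem_of_eq_of_mem (dsumExt_lof (fun j => (X j).extVP) j m) ?_
    refine map_mem_idemLocGr (M' := (X j).P) (M := GrMod.dsum fun j => (X j).P) _
      (lof_mem (fun j => (X j).P) j) (mem_idemLocGr.2 ((X j).extVP_gr k m hm))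
  extVQ_gr k p hp := by
    classical
    refine dsum_gr_mem hp (dsumExt fun j => (X j).extVQ).toAddMonoidHom _ zero_mem_eulerLocGr
      (fun a ha b hb => eulerLocGr_add preservesDegree_id ha hb) fun j m hm inst => ?_
    cases Subsingleton.elim inst (fun a b => Classical.propDecidable (a = b))
    refine Set.mem_of_eq_of_mem (dsumExt_lof (fun j => (X j).extVQ) j m) ?_
    refine map_mem_eulerLocGr (M' := (X j).Q) (M := GrMod.dsum fun j => (X j).Q) _
      (lof_mem (fun j => (X j).Q) j) ((X j).extVQ_gr k m hm)
  square v p i q e x e' y i' h1 h2 h3 h4 := by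
    refine loc_directSum_mk_eq fun j => (X j).square (v j) (p j) i (q j) e (x j) e' (y j) i'
      ?_ ?_ ?_ ?_
    · exact (map_component_dsumExt _ j v).symm.trans
        ((congrArg _ h1).trans (LocalizedModule.map_mk _ _ _ _))
    · exact (map_component_dsumExt _ j v).symm.trans
        ((congrArg _ h2).trans (LocalizedModule.map_mk _ _ _ _))
    · exact (map_component_dsumExt _ j p).symm.trans
        ((congrArg _ h3).trans (LocalizedModule.map_mk _ _ _ _))
    · exact (map_component_dsumExt _ j q).symm.trans
        ((congrArg _ h4).trans (LocalizedModule.map_mk _ _ _ _))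
  actP := DFinsupp.mapRange.linearMap fun j => (X j).actP
  actN := DFinsupp.mapRange.linearMap fun j => (X j).actN
  actP_gr k p hp j := (X j).actP_gr k _ (hp j)
  actN_gr k p hp j := (X j).actN_gr k _ (hp j)
  actP_actP p := DFinsupp.ext fun j => (X j).actP_actP (p j)
  actN_actN p := DFinsupp.ext fun j => (X j).actN_actN (p j)
  actN_connected p := DFinsupp.ext fun j => (X j).actN_connected (p j)
  extP_act p x e h := by
    refine loc_directSum_ext fun j => ?_
    refine (loc_map_smul _ _ _).trans (Eq.trans ?_ (loc_map_smul _ _ _).symm)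
    refine Eq.trans ?_ (congrArg _ (LocalizedModule.map_mk _ _ _ _).symm)
    refine (congrArg _ (map_component_dsumExt _ j _)).trans ((X j).extP_act (p j) (x j) e ?_)
    exact (map_component_dsumExt _ j p).symm.trans
        ((congrArg _ h).trans (LocalizedModule.map_mk _ _ _ _))
  actN_cof x := loc_directSum_mk_eq fun j => (X j).actN_cof (x j)
  actP_cof p := loc_directSum_mk_eq fun j => (X j).actP_cof (p j)

open Classical in
/-- The inclusion of a summand. -/
def inj (j : J) : X j ⟶ dsum X :=
  homMk (X := X j) (Y := dsum X)
    (DirectSum.lof ℚ J (fun j => (X j).V) j) (DirectSum.lof RingZ J (fun j => (X j).P) j)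
    (DirectSum.lof RingT J (fun j => (X j).Q) j) (DirectSum.lof (RingF D) J (fun j => (X j).N) j)
    (lof_mem (fun j => (X j).V) j) (lof_mem (fun j => (X j).P) j) (lof_mem (fun j => (X j).Q) j)
    (lof_mem (fun j => (X j).N) j)
    (dsumExt_lof (fun j => (X j).extP) j) (dsumExt_lof (fun j => (X j).extQ) j)
    (dsumExt_lof (fun j => (X j).extVP) j) (dsumExt_lof (fun j => (X j).extVQ) j)
    (fun _ => (DFinsupp.mapRange_single (f := fun j => (X j).actP) (hf := fun _ => map_zero _)).symm)
    (fun _ => (DFinsupp.mapRange_single (f := fun j => (X j).actN) (hf := fun _ => map_zero _)).symm)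

/-- The projection to a summand. -/
def proj (j : J) : dsum X ⟶ X j :=
  homMk (X := dsum X) (Y := X j)
    (DirectSum.component ℚ J (fun j => (X j).V) j) (DirectSum.component RingZ J (fun j => (X j).P) j)
    (DirectSum.component RingT J (fun j => (X j).Q) j)
    (DirectSum.component (RingF D) J (fun j => (X j).N) j)
    (fun _ _ hx => hx j) (fun _ _ hx => hx j) (fun _ _ hx => hx j) (fun _ _ hx => hx j)
    (fun a => (map_component_dsumExt (fun j => (X j).extP) j a).symm)
    (fun a => (map_component_dsumExt (fun j => (X j).extQ) j a).symm)
    (fun a => (map_component_dsumExt (fun j => (X j).extVP) j a).symm)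
    (fun a => (map_component_dsumExt (fun j => (X j).extVQ) j a).symm)
    (fun _ => rfl) (fun _ => rfl)

variable {X}

theorem dsum_extV {x y : (dsum X).V} (h : ∀ j, onV (proj X j) x = onV (proj X j) y) : x = y :=
  DFinsupp.ext (β := fun j => (X j).V) h
theorem dsum_extP {x y : (dsum X).P} (h : ∀ j, onP (proj X j) x = onP (proj X j) y) : x = y :=
  DFinsupp.ext (β := fun j => (X j).P) h
theorem dsum_extQ {x y : (dsum X).Q} (h : ∀ j, onQ (proj X j) x = onQ (proj X j) y) : x = y :=
  DFinsupp.ext (β := fun j => (X j).Q) h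
theorem dsum_extN {x y : (dsum X).N} (h : ∀ j, onN (proj X j) x = onN (proj X j) y) : x = y :=
  DFinsupp.ext (β := fun j => (X j).N) h

open Classical in
theorem inj_proj_self (j : J) : inj X j ≫ proj X j = 𝟙 (X j) :=
  hom_ext (fun x => DirectSum.of_eq_same (β := fun j => (X j).V) j x)
    (fun x => DirectSum.of_eq_same (β := fun j => (X j).P) j x)
    (fun x => DirectSum.of_eq_same (β := fun j => (X j).Q) j x)
    (fun x => DirectSum.of_eq_same (β := fun j => (X j).N) j x)

open Classical in
theorem inj_proj_of_ne {i j : J} (h : i ≠ j) : inj X i ≫ proj X j = 0 :=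
  hom_ext (fun x => DirectSum.of_eq_of_ne (β := fun j => (X j).V) _ _ x h.symm)
    (fun x => DirectSum.of_eq_of_ne (β := fun j => (X j).P) _ _ x h.symm)
    (fun x => DirectSum.of_eq_of_ne (β := fun j => (X j).Q) _ _ x h.symm)
    (fun x => DirectSum.of_eq_of_ne (β := fun j => (X j).N) _ _ x h.symm)

open Classical in
@[elab_as_elim]
theorem dsum_inductionV {C : (dsum X).V → Prop} (x : (dsum X).V) (h0 : C 0)
    (h : ∀ j m, C (onV (inj X j) m)) (hadd : ∀ a b, C a → C b → C (a + b)) : C x := by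
  refine DirectSum.induction_on (β := fun j => (X j).V) x h0 (fun j m => ?_) hadd
  exact h j m
open Classical in
@[elab_as_elim]
theorem dsum_inductionP {C : (dsum X).P → Prop} (x : (dsum X).P) (h0 : C 0)
    (h : ∀ j m, C (onP (inj X j) m)) (hadd : ∀ a b, C a → C b → C (a + b)) : C x := by
  refine DirectSum.induction_on (β := fun j => (X j).P) x h0 (fun j m => ?_) hadd
  exact h j m
open Classical in
@[elab_as_elim]
theorem dsum_inductionQ {C : (dsum X).Q → Prop} (x : (dsum X).Q) (h0 : C 0)
    (h : ∀ j m, C (onQ (inj X j) m)) (hadd : ∀ a b, C a → C b → C (a + b)) : C x := by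
  refine DirectSum.induction_on (β := fun j => (X j).Q) x h0 (fun j m => ?_) hadd
  exact h j m
open Classical in
@[elab_as_elim]
theorem dsum_inductionN {C : (dsum X).N → Prop} (x : (dsum X).N) (h0 : C 0)
    (h : ∀ j m, C (onN (inj X j) m)) (hadd : ∀ a b, C a → C b → C (a + b)) : C x := by
  refine DirectSum.induction_on (β := fun j => (X j).N) x h0 (fun j m => ?_) hadd
  exact h j m

theorem toModule_mem {R : Type} [CommRing R] {A : ℤ → Set R} [DecidableEq J]
    {M : J → GrMod R A} {L : GrMod R A} (f : ∀ j, M j →ₗ[R] L)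
    (hf : ∀ j k, ∀ x ∈ (M j).gr k, f j x ∈ L.gr k) (k : ℤ) (x : GrMod.dsum M)
    (hx : x ∈ (GrMod.dsum M).gr k) : DirectSum.toModule R J L f x ∈ L.gr k := by
  refine dsum_gr_mem hx (DirectSum.toModule R J L f).toAddMonoidHom (L.gr k) (zero_mem _)
    (fun a ha b hb => add_mem ha hb) fun j m hm inst => ?_
  cases Subsingleton.elim inst (by assumption)
  exact (DirectSum.toModule_lof R (M := fun j => M j) (φ := f) j m).symm ▸ hf j k m hm

open Classical in
theorem exists_desc_dsum {Y : StandardModel D} (f : ∀ j, X j ⟶ Y) :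
    ∃ h : dsum X ⟶ Y, ∀ j, inj X j ≫ h = f j := by
  obtain ⟨v, grV, hV⟩ : ∃ l : (dsum X).V →ₗ[ℚ] Y.V, (∀ k, ∀ x ∈ (dsum X).V.gr k, l x ∈ Y.V.gr k) ∧
      ∀ j m, l (onV (inj X j) m) = onV (f j) m :=
    ⟨_, toModule_mem _ fun j => Hom.onV_gr (f j),
      fun j m => DirectSum.toModule_lof ℚ (M := fun j => (X j).V) j m⟩
  obtain ⟨p, grP, hP⟩ : ∃ l : (dsum X).P →ₗ[RingZ] Y.P,
      (∀ k, ∀ x ∈ (dsum X).P.gr k, l x ∈ Y.P.gr k) ∧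
      ∀ j m, l (onP (inj X j) m) = onP (f j) m :=
    ⟨_, toModule_mem _ fun j => Hom.onP_gr (f j),
      fun j m => DirectSum.toModule_lof RingZ (M := fun j => (X j).P) j m⟩
  obtain ⟨q, grQ, hQ⟩ : ∃ l : (dsum X).Q →ₗ[RingT] Y.Q,
      (∀ k, ∀ x ∈ (dsum X).Q.gr k, l x ∈ Y.Q.gr k) ∧
      ∀ j m, l (onQ (inj X j) m) = onQ (f j) m :=
    ⟨_, toModule_mem _ fun j => Hom.onQ_gr (f j),
      fun j m => DirectSum.toModule_lof RingT (M := fun j => (X j).Q) j m⟩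
  obtain ⟨n, grN, hN⟩ : ∃ l : (dsum X).N →ₗ[RingF D] Y.N,
      (∀ k, ∀ x ∈ (dsum X).N.gr k, l x ∈ Y.N.gr k) ∧
      ∀ j m, l (onN (inj X j) m) = onN (f j) m :=
    ⟨_, toModule_mem _ fun j => Hom.onN_gr (f j),
      fun j m => DirectSum.toModule_lof (RingF D) (M := fun j => (X j).N) j m⟩
  have cP : ∀ j, p.comp (onP (inj X j)) = onP (f j) := fun j => LinearMap.ext (hP j)
  have cQ : ∀ j, q.comp (onQ (inj X j)) = onQ (f j) := fun j => LinearMap.ext (hQ j)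
  have cN : ∀ j, n.comp (onN (inj X j)) = onN (f j) := fun j => LinearMap.ext (hN j)
  refine ⟨homMk v p q n grV grP grQ grN ?_ ?_ ?_ ?_ ?_ ?_,
    fun j => hom_ext (hV j) (hP j) (hQ j) (hN j)⟩
  · intro a
    induction a using dsum_inductionP with
    | h0 => rw [map_zero, map_zero, map_zero, map_zero]
    | h j m => rw [hP j m, extP_onP (inj X j) m, extP_onP (f j) m, loc_map_map, cN j]
    | hadd a b ha hb => rw [map_add, map_add, map_add, map_add, ha, hb]
  · intro a
    induction a using dsum_inductionQ with
    | h0 => rw [map_zero, map_zero, map_zero, map_zero]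
    | h j m => rw [hQ j m, extQ_onQ (inj X j) m, extQ_onQ (f j) m, loc_map_map, cN j]
    | hadd a b ha hb => rw [map_add, map_add, map_add, map_add, ha, hb]
  · intro a
    induction a using dsum_inductionV with
    | h0 => rw [map_zero, map_zero, map_zero, map_zero]
    | h j m => rw [hV j m, extVP_onV (inj X j) m, extVP_onV (f j) m, loc_map_map, cP j]
    | hadd a b ha hb => rw [map_add, map_add, map_add, map_add, ha, hb]
  · intro a
    induction a using dsum_inductionV with
    | h0 => rw [map_zero, map_zero, map_zero, map_zero]
    | h j m => rw [hV j m, extVQ_onV (inj X j) m, extVQ_onV (f j) m, loc_map_map, cQ j]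
    | hadd a b ha hb => rw [map_add, map_add, map_add, map_add, ha, hb]
  · intro a
    induction a using dsum_inductionP with
    | h0 => rw [map_zero, map_zero, map_zero]
    | h j m => rw [← onP_actP, hP, hP, onP_actP]
    | hadd a b ha hb => rw [map_add, map_add, map_add, map_add, ha, hb]
  · intro a
    induction a using dsum_inductionN with
    | h0 => rw [map_zero, map_zero, map_zero]
    | h j m => rw [← onN_actN, hN, hN, onN_actN]
    | hadd a b ha hb => rw [map_add, map_add, map_add, map_add, ha, hb]

/-- The morphism from a direct sum with given restrictions to the summands. -/
def desc {Y : StandardModel D} (f : ∀ j, X j ⟶ Y) : dsum X ⟶ Y := (exists_desc_dsum f).choose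

theorem inj_desc {Y : StandardModel D} (f : ∀ j, X j ⟶ Y) (j : J) : inj X j ≫ desc f = f j :=
  (exists_desc_dsum f).choose_spec j

theorem dsum_hom_ext {Y : StandardModel D} {f g : dsum X ⟶ Y}
    (h : ∀ j, inj X j ≫ f = inj X j ≫ g) : f = g := by
  refine hom_ext (fun v => ?_) (fun v => ?_) (fun v => ?_) (fun v => ?_)
  · induction v using dsum_inductionV with
    | h0 => rw [map_zero, map_zero]
    | h j m => exact congrArg (fun g => onV g m) (h j)
    | hadd a b ha hb => rw [map_add, map_add, ha, hb]
  · induction v using dsum_inductionP with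
    | h0 => rw [map_zero, map_zero]
    | h j m => exact congrArg (fun g => onP g m) (h j)
    | hadd a b ha hb => rw [map_add, map_add, ha, hb]
  · induction v using dsum_inductionQ with
    | h0 => rw [map_zero, map_zero]
    | h j m => exact congrArg (fun g => onQ g m) (h j)
    | hadd a b ha hb => rw [map_add, map_add, ha, hb]
  · induction v using dsum_inductionN with
    | h0 => rw [map_zero, map_zero]
    | h j m => exact congrArg (fun g => onN g m) (h j)
    | hadd a b ha hb => rw [map_add, map_add, ha, hb]

variable (X) in
/-- The direct sum is a coproduct. -/
def isColimitDsum : IsColimit (Cofan.mk (dsum X) (inj X)) :=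
  Cofan.IsColimit.mk _ (fun s => desc s.inj) (fun _ j => inj_desc _ j)
    fun _ _ h => dsum_hom_ext fun j => (h j).trans (inj_desc _ j).symm

scoped instance : HasColimitsOfShape (Discrete J) (StandardModel D) where
  has_colimit F := by
    have : HasColimit (Discrete.functor (F.obj ∘ Discrete.mk)) :=
      ⟨⟨⟨_, isColimitDsum (F.obj ∘ Discrete.mk)⟩⟩⟩
    exact hasColimit_of_iso (Discrete.natIsoFunctor (F := F))

scoped instance : HasFiniteBiproducts (StandardModel D) :=
  have : HasFiniteCoproducts (StandardModel D) := ⟨fun _ => inferInstance⟩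
  HasFiniteBiproducts.of_hasFiniteCoproducts

scoped instance instAbelian : Abelian (StandardModel D) where
  has_finite_products := inferInstance
  has_kernels := inferInstance
  has_cokernels := inferInstance

end DirectSum

/-! ### Exact sequences -/

section Exact

variable {X Y Z : StandardModel D}

theorem ExactAt.shortExact {f : X ⟶ Y} {g : Y ⟶ Z} (h : ExactAt f g) (hf : Inj f) (hg : Surj g) :
    (ShortComplex.mk f g h.comp_eq_zero).ShortExact := by
  have := hf.mono
  have := hg.epi
  exact { exact := ShortComplex.exact_of_f_is_kernel _ (h.isLimit hf) }

theorem exactAt_of_exact {f : X ⟶ Y} {g : Y ⟶ Z} (w : f ≫ g = 0)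
    (h : (ShortComplex.mk f g w).Exact) (hf : Inj f) : ExactAt f g := by
  have := hf.mono
  obtain ⟨l, hl⟩ : ∃ l : (Sub.ker g).toModel ⟶ X, l ≫ f = (Sub.ker g).ι :=
    ⟨h.lift _ (ι_ker_comp g), h.lift_f _ _⟩
  refine ⟨fun y => ⟨fun hy => ⟨onV l ⟨y, hy⟩, ?_⟩, ?_⟩, fun y => ⟨fun hy => ⟨onP l ⟨y, hy⟩, ?_⟩, ?_⟩,
    fun y => ⟨fun hy => ⟨onQ l ⟨y, hy⟩, ?_⟩, ?_⟩, fun y => ⟨fun hy => ⟨onN l ⟨y, hy⟩, ?_⟩, ?_⟩⟩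
  · exact congrArg (fun g' : (Sub.ker g).toModel ⟶ Y => onV g' (⟨y, hy⟩ : LinearMap.ker (onV g))) hl
  · rintro ⟨x, rfl⟩; exact congrArg (fun g => onV g x) w
  · exact congrArg (fun g' : (Sub.ker g).toModel ⟶ Y => onP g' (⟨y, hy⟩ : LinearMap.ker (onP g))) hl
  · rintro ⟨x, rfl⟩; exact congrArg (fun g => onP g x) w
  · exact congrArg (fun g' : (Sub.ker g).toModel ⟶ Y => onQ g' (⟨y, hy⟩ : LinearMap.ker (onQ g))) hl
  · rintro ⟨x, rfl⟩; exact congrArg (fun g => onQ g x) w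
  · exact congrArg (fun g' : (Sub.ker g).toModel ⟶ Y => onN g' (⟨y, hy⟩ : LinearMap.ker (onN g))) hl
  · rintro ⟨x, rfl⟩; exact congrArg (fun g => onN g x) w

end Exact

end StandardModel

end

noncomputable section

/-! ### Base change of unions of cyclic modules -/

section BaseChange

theorem ExhibitsBaseChange.of_directed {R A : Type} [CommRing R] [CommRing A] {σ : R →+* A}
    {M L : Type} [AddCommGroup M] [Module R M] [AddCommGroup L] [Module A L] {f : M →ₛₗ[σ] L}
    (G : Set M) (hG : ∀ m m' : M, ∃ g ∈ G, ∃ r r' : R, m = r • g ∧ m' = r' • g)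
    (hf : ∀ g ∈ G, ∀ a : A, a • f g = 0 → a = 0)
    (hspan : Submodule.span A (Set.range f) = ⊤) : ExhibitsBaseChange σ f := by
  let : Algebra R A := σ.toAlgebra
  let : Module R L := Module.compHom L σ
  have : IsScalarTower R A L := ⟨fun r a x => mul_smul (σ r) a x⟩
  let F : M →ₗ[R] L := { toFun := f, map_add' := f.map_add, map_smul' := f.map_smulₛₗ }
  let β : TensorProduct R A M →ₗ[A] L := F.liftBaseChange A
  have hβt : ∀ a m, β (a ⊗ₜ[R] m) = a • f m :=
    fun a m => LinearMap.liftBaseChange_tmul (A := A) F a m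
  have hrep : ∀ t : TensorProduct R A M, ∃ g ∈ G, ∃ a : A, t = a ⊗ₜ[R] g := by
    intro t
    induction t using TensorProduct.induction_on with
    | zero =>
      obtain ⟨g, hg, -⟩ := hG 0 0
      exact ⟨g, hg, 0, by simp⟩
    | tmul a m =>
      obtain ⟨g, hg, r, -, hr, -⟩ := hG m m
      exact ⟨g, hg, r • a, by rw [hr, ← TensorProduct.smul_tmul]⟩
    | add x y hx hy =>
      obtain ⟨g, -, a, rfl⟩ := hx
      obtain ⟨g', -, a', rfl⟩ := hy
      obtain ⟨h, hh, r, r', hr, hr'⟩ := hG g g'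
      exact ⟨h, hh, r • a + r' • a', by
        rw [hr, hr', ← TensorProduct.smul_tmul, ← TensorProduct.smul_tmul,
          ← TensorProduct.add_tmul]⟩
  have hinj : Function.Injective β := by
    rw [injective_iff_map_eq_zero]
    intro t ht
    obtain ⟨g, hg, a, rfl⟩ := hrep t
    rw [hβt] at ht
    rw [hf g hg a ht, TensorProduct.zero_tmul]
  have hsurj : Function.Surjective β := by
    rw [← LinearMap.range_eq_top, eq_top_iff, ← hspan, Submodule.span_le]
    rintro _ ⟨m, rfl⟩
    exact ⟨1 ⊗ₜ m, by rw [hβt, one_smul]⟩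
  exact IsBaseChange.of_equiv (f := F) (LinearEquiv.ofBijective β ⟨hinj, hsurj⟩)
    (fun m => (hβt 1 m).trans (one_smul A (f m)))

theorem eq_zero_of_smul_mk {R : Type} [CommRing R] {S : Submonoid R} {M : Type} [AddCommGroup M]
    [Module R M] (x₀ : M) (ann : ∀ r : R, r • x₀ = 0 → r = 0) (a : Localization S)
    (ha : a • (LocalizedModule.mk x₀ 1 : LocalizedModule S M) = 0) : a = 0 := by
  induction a using Localization.induction_on with
  | H a =>
    obtain ⟨r, s⟩ := a
    rw [LocalizedModule.mk_smul_mk, mul_one, ← LocalizedModule.zero_mk s,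
      LocalizedModule.mk_eq] at ha
    obtain ⟨u, hu⟩ := ha
    simp only [Submonoid.smul_def, smul_smul, smul_zero] at hu
    have := ann _ hu
    rw [← Localization.mk_zero s, Localization.mk_eq_mk_iff, Localization.r_iff_exists]
    refine ⟨u * s, ?_⟩
    simp only [Submonoid.coe_mul, mul_zero]
    linear_combination (s : R) * this

theorem bijective_smul_mk {R : Type} [CommRing R] {S : Submonoid R} {M : Type} [AddCommGroup M]
    [Module R M] (x₀ : M) (ann : ∀ r : R, r • x₀ = 0 → r = 0)
    (gen : ∀ y : M, ∃ s ∈ S, ∃ r : R, s • y = r • x₀) :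
    Function.Bijective fun a : Localization S =>
      a • (LocalizedModule.mk x₀ 1 : LocalizedModule S M) := by
  constructor
  · change Function.Injective (LinearMap.toSpanSingleton (Localization S) _
      (LocalizedModule.mk x₀ 1 : LocalizedModule S M))
    rw [injective_iff_map_eq_zero]
    exact fun a ha => eq_zero_of_smul_mk x₀ ann a ha
  · intro y
    induction y using LocalizedModule.induction_on with
    | h y s =>
      obtain ⟨t, ht, r, hr⟩ := gen y
      refine ⟨Localization.mk r (⟨t, ht⟩ * s), ?_⟩
      change Localization.mk r (⟨t, ht⟩ * s) • (LocalizedModule.mk x₀ 1 : LocalizedModule S M) = _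
      rw [LocalizedModule.mk_smul_mk, ← hr, mul_one]
      exact LocalizedModule.mk_cancel_common_left ⟨t, ht⟩ s y

/-- The semilinear map with a given value at `1`. -/
def semilinearOfOne {R A L : Type} [CommRing R] [CommRing A] (σ : R →+* A) [AddCommMonoid L]
    [Module A L] (y : L) : R →ₛₗ[σ] L where
  toFun r := σ r • y
  map_add' r s := by rw [map_add, add_smul]
  map_smul' r s := by rw [smul_eq_mul, map_mul, mul_smul]

end BaseChange

/-! ### Laurent polynomials -/

section Laurent

variable {S : Type}

/-- The inverse of the Euler element. -/
def eulerInv (U : Set S) (m : ℕ) : LaurentPolynomial (S → ℚ) :=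
  toLaurent (idem U) * LaurentPolynomial.T (-m) + toLaurent (idem Uᶜ)

theorem eulerElt_mul_eulerInv (U : Set S) (m : ℕ) :
    toLaurent (eulerElt U m) * eulerInv U m = 1 := by
  have h1 : toLaurent (idem U) * toLaurent (idem U) = toLaurent (idem U) := by
    rw [← map_mul, idem_mul_self]
  have h2 : toLaurent (idem U) + toLaurent (idem Uᶜ) = 1 := by
    rw [← map_add, idem_add_compl, map_one]
  have h3 : (LaurentPolynomial.T (m : ℤ) : LaurentPolynomial (S → ℚ)) *
      LaurentPolynomial.T (-m) = 1 := by
    rw [← LaurentPolynomial.T_add, add_neg_cancel, LaurentPolynomial.T_zero]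
  rw [eulerInv, eulerElt, map_add, map_mul, toLaurent_X_pow]
  have h4 : (toLaurent (idem Uᶜ) : LaurentPolynomial (S → ℚ)) = 1 - toLaurent (idem U) := by
    rw [← h2]; ring
  rw [h4]
  linear_combination (toLaurent (idem U)) * (toLaurent (idem U)) * h3 +
    (2 - LaurentPolynomial.T (m : ℤ) - LaurentPolynomial.T (-m : ℤ)) * h1

theorem laurent_smul_def (a : (S → ℚ)[X]) (f : LaurentPolynomial (S → ℚ)) :
    a • f = toLaurent a * f := rfl

theorem coeff_C_mul_T_mul (a : S → ℚ) (n : ℤ) (f : LaurentPolynomial (S → ℚ)) (j : ℤ) :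
    (LaurentPolynomial.C a * LaurentPolynomial.T n * f).coeff j = a * f.coeff (j - n) := by
  rw [← LaurentPolynomial.single_eq_C_mul_T]
  exact AddMonoidAlgebra.coeff_single_mul_eq_mul_coeff (j - n) fun m' _ => by omega

theorem coeff_toLaurent_nat (p : (S → ℚ)[X]) (n : ℕ) : (toLaurent p).coeff (n : ℤ) = p.coeff n := by
  rw [LaurentPolynomial.coeff_toLaurent]
  exact Finsupp.mapDomain_apply Nat.cast_injective _ n

theorem coeff_toLaurent_neg (p : (S → ℚ)[X]) {j : ℤ} (hj : j < 0) : (toLaurent p).coeff j = 0 := by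
  rw [LaurentPolynomial.coeff_toLaurent]
  refine Finsupp.mapDomain_of_notMem_range _ _ ?_
  rintro ⟨n, hn⟩
  have : (n : ℤ) = j := hn
  omega

/-- The Laurent polynomials as a graded module, with `1` in degree `k`. -/
abbrev laurentGr (S : Type) (k : ℤ) : GrMod (S → ℚ)[X] (degC S) where
  carrier := LaurentPolynomial (S → ℚ)
  gr i :=
    { carrier := {f | ∀ j, f.coeff j ≠ 0 → i = k - 2 * j}
      zero_mem' := fun j hj => absurd rfl hj
      add_mem' := fun {f g} hf hg j hj => by
        by_contra h
        have h1 : f.coeff j = 0 := by by_contra h'; exact h (hf j h')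
        have h2 : g.coeff j = 0 := by by_contra h'; exact h (hg j h')
        apply hj
        rw [AddMonoidAlgebra.coeff_add, Finsupp.add_apply, h1, h2, add_zero]
      neg_mem' := fun {f} hf j hj => hf j (by
        intro h; apply hj
        rw [AddMonoidAlgebra.coeff_neg, Finsupp.neg_apply, h, neg_zero]) }
  internal := by
    classical
    refine GrMod.internal_of_proj _ (fun i =>
      (AddMonoidAlgebra.coeffAddEquiv.symm.toAddMonoidHom.comp
        (Finsupp.filterAddHom (fun j => i = k - 2 * j))).comp
        AddMonoidAlgebra.coeffAddEquiv.toAddMonoidHom) ?_ ?_ ?_ ?_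
    · intro i f j hj
      by_contra h
      exact hj (Finsupp.filter_apply_neg _ _ h)
    · intro i f hf
      refine LaurentPolynomial.ext fun j => ?_
      change (Finsupp.filter _ f.coeff) j = _
      by_cases h : f.coeff j = 0
      · rw [h, Finsupp.filter_apply]; split_ifs <;> simp [h]
      · exact Finsupp.filter_apply_pos _ _ (hf j h)
    · intro i i' hi f hf
      refine LaurentPolynomial.ext fun j => ?_
      change (Finsupp.filter _ f.coeff) j = 0
      by_cases h : f.coeff j = 0
      · rw [Finsupp.filter_apply]; split_ifs <;> simp [h]
      · exact Finsupp.filter_apply_neg _ _ fun h' => hi (h'.trans (hf j h).symm)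
    · intro f
      refine ⟨f.coeff.support.image fun j => k - 2 * j, LaurentPolynomial.ext fun j => ?_⟩
      rw [AddMonoidAlgebra.coeff_sum, Finsupp.finsetSum_apply]
      change _ = ∑ i ∈ _, (Finsupp.filter (fun j => i = k - 2 * j) f.coeff) j
      simp only [Finsupp.filter_apply]
      rw [Finset.sum_ite_eq']
      split_ifs with h
      · rfl
      · by_contra h'
        exact h (Finset.mem_image_of_mem _ (Finsupp.mem_support_iff.2 h'))
  smul_mem := by
    intro i i' a x ha hx
    rw [laurent_smul_def, a.as_sum_support_C_mul_X_pow, map_sum, Finset.sum_mul]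
    refine sum_mem fun n hn => ?_
    rw [toLaurent_C_mul_X_pow]
    intro j hj
    rw [coeff_C_mul_T_mul] at hj
    have h1 := ha n (mem_support_iff.1 hn)
    have h2 := hx _ (right_ne_zero_of_mul hj)
    rw [h1, h2]; ring

theorem toLaurent_mem_gr {k i : ℤ} {p : (S → ℚ)[X]} :
    toLaurent p ∈ (laurentGr S k).gr i ↔ p ∈ degC S (i - k) := by
  constructor
  · intro h n hn
    have := h n (by rwa [coeff_toLaurent_nat])
    omega
  · intro h j hj
    rcases lt_or_ge j 0 with hj' | hj'
    · exact absurd (coeff_toLaurent_neg p hj') hj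
    · lift j to ℕ using hj'
      rw [coeff_toLaurent_nat] at hj
      have := h j hj
      omega

/-- The Laurent polynomials that some Euler class carries to polynomials. -/
def eulerHull (τ : S → OverT) : Submodule (S → ℚ)[X] (LaurentPolynomial (S → ℚ)) where
  carrier := {f | ∃ (T : Finset OverT) (m : ℕ) (p : (S → ℚ)[X]),
    eulerElt (τ ⁻¹' (T : Set OverT)) m • f = toLaurent p}
  zero_mem' := ⟨∅, 0, 0, by rw [smul_zero, map_zero]⟩
  add_mem' := by
    classical
    rintro f g ⟨T, m, p, hp⟩ ⟨T', m', p', hp'⟩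
    have key : ∀ (T T' : Finset OverT) (m m' : ℕ), ∃ r : (S → ℚ)[X],
        eulerElt (τ ⁻¹' ((T ∪ T' : Finset OverT) : Set OverT)) (m + m') =
          r * eulerElt (τ ⁻¹' (T : Set OverT)) m := by
      intro T T' m m'
      obtain ⟨r, hr⟩ := (eulerElt_dvd_of_subset (Set.preimage_mono (f := τ)
        (Finset.coe_subset.2 (Finset.subset_union_left (s₁ := T) (s₂ := T')))) m).trans
        (eulerElt_dvd_of_le _ (Nat.le_add_right m m'))
      exact ⟨r, by rw [hr, mul_comm]⟩
    obtain ⟨r, hr⟩ := key T T' m m'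
    obtain ⟨r', hr'⟩ := key T' T m' m
    rw [Finset.union_comm, add_comm m'] at hr'
    refine ⟨T ∪ T', m + m', r * p + r' * p', ?_⟩
    rw [smul_add, map_add, map_mul, map_mul, ← hp, ← hp']
    nth_rw 1 [hr]
    rw [hr', mul_smul, mul_smul]
    rfl
  smul_mem' := by
    rintro a f ⟨T, m, p, hp⟩
    exact ⟨T, m, a * p, by rw [smul_comm, hp, map_mul]; rfl⟩

theorem exists_proj_toLaurent (k i : ℤ) (p : (S → ℚ)[X]) :
    ∃ p' : (S → ℚ)[X], (laurentGr S k).proj i (toLaurent p) = toLaurent p' := by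
  refine Polynomial.induction_on' p (fun p q hp hq => ?_) fun n a => ?_
  · obtain ⟨p', hp'⟩ := hp
    obtain ⟨q', hq'⟩ := hq
    refine ⟨p' + q', ?_⟩
    have h := map_add ((laurentGr S k).proj i) (toLaurent p) (toLaurent q)
    rw [hp', hq', ← map_add, ← map_add] at h
    exact h
  · have hmem : toLaurent (Polynomial.monomial n a) ∈ (laurentGr S k).gr (k - 2 * n) := by
      rw [toLaurent_mem_gr]
      intro j hj
      rw [Polynomial.coeff_monomial] at hj
      split_ifs at hj with h
      · rw [← h]; ring
      · exact absurd rfl hj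
    by_cases h : i = k - 2 * n
    · exact ⟨_, by rw [h]; exact GrMod.proj_of_mem hmem⟩
    · exact ⟨0, by rw [map_zero]; exact GrMod.proj_of_mem_ne h hmem⟩

theorem homogeneous_eulerHull (τ : S → OverT) (k : ℤ) :
    GrMod.Homogeneous (M := laurentGr S k) (eulerHull τ) := by
  rintro i f ⟨T, m, p, hp⟩
  have h1 : (idem (τ ⁻¹' (T : Set OverT)) * X ^ m) • f =
      toLaurent (idem (τ ⁻¹' (T : Set OverT)) * p) := by
    rw [← idem_mul_eulerElt, mul_smul, hp, laurent_smul_def, ← map_mul]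
  have h2 : idem (τ ⁻¹' (T : Set OverT))ᶜ • f = toLaurent (idem (τ ⁻¹' (T : Set OverT))ᶜ * p) := by
    rw [← idem_compl_mul_eulerElt _ m, mul_smul, hp, laurent_smul_def, ← map_mul,
      idem_compl_mul_eulerElt]
  obtain ⟨p₁, hp₁⟩ := exists_proj_toLaurent k (-2 * (m : ℤ) + i)
    (idem (τ ⁻¹' (T : Set OverT)) * p)
  obtain ⟨p₂, hp₂⟩ := exists_proj_toLaurent k i (idem (τ ⁻¹' (T : Set OverT))ᶜ * p)
  have h3 := GrMod.proj_smul (M := laurentGr S k) (j := i)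
    (idem_mul_X_pow_mem_degC (τ ⁻¹' (T : Set OverT)) m) f
  have h4 := GrMod.proj_smul_zero (M := laurentGr S k) (j := i)
    (idem_mem_degC (τ ⁻¹' (T : Set OverT))ᶜ) f
  refine ⟨T, m, p₁ + p₂, ?_⟩
  rw [eulerElt, add_smul, map_add]
  exact congrArg₂ (· + ·) (h3.symm.trans ((congrArg _ h1).trans hp₁))
    (h4.symm.trans ((congrArg _ h2).trans hp₂))

/-- The localization of the polynomials at the Euler classes, with `1` in degree `k`. -/
abbrev hullGr (τ : S → OverT) (k : ℤ) : GrMod (S → ℚ)[X] (degC S) :=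
  GrMod.ofSub (M := laurentGr S k) (eulerHull τ) (homogeneous_eulerHull τ k)

theorem toLaurent_mem_hull (τ : S → OverT) (p : (S → ℚ)[X]) : toLaurent p ∈ eulerHull τ :=
  ⟨∅, 0, p, by simp⟩

theorem eulerInv_mem_hull (τ : S → OverT) (T : Finset OverT) (m : ℕ) :
    eulerInv (τ ⁻¹' (T : Set OverT)) m ∈ eulerHull τ :=
  ⟨T, m, 1, by rw [laurent_smul_def, eulerElt_mul_eulerInv, map_one]⟩

theorem mul_eulerInv_mem_hull (τ : S → OverT) (T' : Finset OverT) (m' : ℕ)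
    {f : LaurentPolynomial (S → ℚ)} (hf : f ∈ eulerHull τ) :
    eulerInv (τ ⁻¹' (T' : Set OverT)) m' * f ∈ eulerHull τ := by
  classical
  obtain ⟨T, m, p, hp⟩ := hf
  obtain ⟨r, hr⟩ := eulerElt_dvd_of_subset (Set.preimage_mono (f := τ)
    (Finset.coe_subset.2 (Finset.subset_union_left (s₁ := T) (s₂ := T')))) m
  obtain ⟨r', hr'⟩ := eulerElt_dvd_of_subset (Set.preimage_mono (f := τ)
    (Finset.coe_subset.2 (Finset.subset_union_right (s₁ := T) (s₂ := T')))) m'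
  refine ⟨T ∪ T', m + m', r * r' * p, ?_⟩
  rw [← eulerElt_mul, hr, hr', laurent_smul_def, map_mul, map_mul, map_mul, map_mul, map_mul, ← hp,
    laurent_smul_def]
  linear_combination toLaurent r * toLaurent r' *
    toLaurent (eulerElt (τ ⁻¹' (T : Set OverT)) m) * f *
    eulerElt_mul_eulerInv (τ ⁻¹' (T' : Set OverT)) m'

/-- The inclusion of the polynomials. -/
def ofPoly (τ : S → OverT) (p : (S → ℚ)[X]) : eulerHull τ := ⟨toLaurent p, toLaurent_mem_hull τ p⟩

theorem smul_ofPoly (τ : S → OverT) (a p : (S → ℚ)[X]) : a • ofPoly τ p = ofPoly τ (a * p) :=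
  Subtype.ext (map_mul toLaurent a p).symm

end Laurent

/-- A ring as a graded module concentrated in degree `k`. -/
abbrev concGr (R : Type) [CommRing R] (k : ℤ) : GrMod R (degZero R) where
  carrier := R
  gr i :=
    { carrier := {a | a ≠ 0 → i = k}
      zero_mem' := fun h => absurd rfl h
      add_mem' := fun {a b} ha hb h => by
        by_cases h' : a = 0
        · exact hb fun h'' => h (by rw [h', h'', add_zero])
        · exact ha h'
      neg_mem' := fun {a} ha h => ha fun h' => h (by rw [h', neg_zero]) }
  internal := by
    classical
    refine GrMod.internal_of_proj _ (fun i => if i = k then AddMonoidHom.id R else 0) ?_ ?_ ?_ ?_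
    · intro i a
      by_cases h : i = k
      · exact fun _ => h
      · rw [if_neg h]; exact fun h => absurd rfl h
    · intro i a ha
      by_cases h : i = k
      · rw [if_pos h]; rfl
      · have : a = 0 := by by_contra h'; exact h (ha h')
        rw [this, map_zero]
    · intro i j h a ha
      by_cases h' : i = k
      · have : a = 0 := by by_contra h''; exact h (h'.trans (ha h'').symm)
        rw [this, map_zero]
      · rw [if_neg h']; rfl
    · intro a
      exact ⟨{k}, by rw [Finset.sum_singleton, if_pos rfl]; rfl⟩
  smul_mem := fun {i j a x} ha hx h => by
    have h1 : a ≠ 0 := fun h' => h (by rw [h', zero_smul])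
    have h2 : x ≠ 0 := fun h' => h (by rw [h', smul_zero])
    rw [ha h1, hx h2, zero_add]

theorem mk_mem_eulerLocGr {R : Type} [CommRing R] {A : ℤ → Set R} {θ : RingT →+* R}
    {S : Submonoid R} {M : GrMod R A} {k : ℤ} {x : M} (hx : x ∈ M.gr k) :
    LocalizedModule.mk x 1 ∈ eulerLocGr θ S M k := by
  refine ⟨∅, 0, 0, zero_mem _, x, hx, ?_, ?_⟩
  · have : (Polynomial.C (charFun ((∅ : Finset OverT) : Set OverT)) : RingT) = 0 := by
      rw [Finset.coe_empty]; exact idem_empty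
    rw [this, zero_mul, map_zero, zero_smul, LocalizedModule.zero_mk]
  · have : (Polynomial.C (charFun ((∅ : Finset OverT) : Set OverT)ᶜ) : RingT) = 1 := by
      rw [Finset.coe_empty, Set.compl_empty]; exact idem_univ
    rw [this, map_one, one_smul]

/-- The inflation of Laurent polynomials. -/
def laurentInfl (D : FullSubgroups) :
    LaurentPolynomial (OverT → ℚ) →+* LaurentPolynomial (FiniteSubgroup D → ℚ) :=
  AddMonoidAlgebra.mapRingHom ℤ
    (RingHom.pi fun F : FiniteSubgroup D => Pi.evalRingHom (fun _ => ℚ) F.mulT)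

theorem laurentInfl_toLaurent (D : FullSubgroups) (p : RingT) :
    laurentInfl D (toLaurent p) = toLaurent (inflT D p) := by
  induction p using Polynomial.induction_on' with
  | add p q hp hq => simp only [map_add, hp, hq]
  | monomial n a =>
    rw [inflT, coe_mapRingHom, map_monomial, toLaurent_C_mul_T, toLaurent_C_mul_T,
      ← LaurentPolynomial.single_eq_C_mul_T, ← LaurentPolynomial.single_eq_C_mul_T, laurentInfl,
      AddMonoidAlgebra.mapRingHom_single]

theorem laurentInfl_smul (D : FullSubgroups) (a : RingT) (f : LaurentPolynomial (OverT → ℚ)) :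
    laurentInfl D (a • f) = inflT D a • laurentInfl D f := by
  rw [laurent_smul_def, laurent_smul_def, map_mul, laurentInfl_toLaurent]

theorem laurentInfl_mem_hull (D : FullSubgroups) {f : LaurentPolynomial (OverT → ℚ)}
    (hf : f ∈ eulerHull id) : laurentInfl D f ∈ eulerHull (FiniteSubgroup.mulT (D := D)) := by
  obtain ⟨T, m, p, hp⟩ := hf
  refine ⟨T, m, inflT D p, ?_⟩
  rw [← laurentInfl_toLaurent, ← hp, ← inflT_eulerElt, laurentInfl_smul]
  rfl

end

noncomputable section

theorem locInfl_smul {R A : Type} [CommRing R] [CommRing A] {S : Submonoid A} {M : Type}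
    [AddCommGroup M] [Module A M] (σ : R →+* A) (r : R) (x : M) (s : S) :
    ((algebraMap A (Localization S)).comp σ) r • (LocalizedModule.mk x s : LocalizedModule S M) =
      LocalizedModule.mk (σ r • x) s := by
  rw [← LocalizedModule.smul'_mk]
  exact algebraMap_smul (Localization S) (σ r) (LocalizedModule.mk x s : LocalizedModule S M)

theorem laurentInfl_eulerInv (D : FullSubgroups) (T : Set OverT) (m : ℕ) :
    laurentInfl D (eulerInv T m) = eulerInv (FiniteSubgroup.mulT ⁻¹' T) m := by
  have h : laurentInfl D (LaurentPolynomial.T (-m)) = LaurentPolynomial.T (-m) := by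
    change AddMonoidAlgebra.mapRingHom ℤ _ (AddMonoidAlgebra.single _ _) = _
    rw [AddMonoidAlgebra.mapRingHom_single, map_one]
    rfl
  rw [eulerInv, map_add, map_mul, h, laurentInfl_toLaurent, laurentInfl_toLaurent, inflT_idem,
    inflT_idem]
  rfl

theorem eq_smul_eulerInv {S : Type} {U : Set S} {m : ℕ} {f : LaurentPolynomial (S → ℚ)}
    {p : (S → ℚ)[X]} (h : eulerElt U m • f = toLaurent p) : f = p • eulerInv U m := by
  rw [laurent_smul_def, ← h, laurent_smul_def]
  linear_combination (-f) * eulerElt_mul_eulerInv U m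

theorem eulerHull_smul_eq_zero {S : Type} {U : Set S} {m : ℕ} (r : (S → ℚ)[X])
    (h : r • eulerInv U m = 0) : r = 0 := by
  have h1 : eulerElt U m • r • eulerInv U m = 0 := by rw [h, smul_zero]
  rw [smul_comm, laurent_smul_def (eulerElt U m), eulerElt_mul_eulerInv, laurent_smul_def,
    mul_one] at h1
  exact toLaurent_injective (by rw [h1, map_zero])

theorem exists_eulerElt_smul {S : Type} {τ : S → OverT} (f : eulerHull τ) :
    ∃ (T : Finset OverT) (m : ℕ) (p : (S → ℚ)[X]),
      eulerElt (τ ⁻¹' (T : Set OverT)) m • f = ofPoly τ p := by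
  obtain ⟨f, T, m, p, hp⟩ := f
  exact ⟨T, m, p, Subtype.ext hp⟩

theorem smul_ofPoly_one {S : Type} (τ : S → OverT) (a : (S → ℚ)[X]) :
    a • ofPoly τ 1 = ofPoly τ a := by rw [smul_ofPoly, mul_one]

theorem ofPoly_injective {S : Type} (τ : S → OverT) : Function.Injective (ofPoly τ) :=
  fun _ _ h => toLaurent_injective (congrArg Subtype.val h)

theorem ofPoly_zero {S : Type} (τ : S → OverT) : ofPoly τ 0 = 0 :=
  Subtype.ext (map_zero toLaurent)

theorem ofPoly_one_ann {S : Type} (τ : S → OverT) (a : (S → ℚ)[X]) (h : a • ofPoly τ 1 = 0) :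
    a = 0 := ofPoly_injective τ (by rw [← smul_ofPoly_one, h, ofPoly_zero])

namespace StandardModel

variable {D : FullSubgroups}

section

variable {V P Q N : Type} [AddCommGroup V] [Module ℚ V] [AddCommGroup P] [Module RingZ P]
  [AddCommGroup Q] [Module RingT Q] [AddCommGroup N] [Module (RingF D) N]
  {extP : P →ₛₗ[locInflZ D] LocalizedModule (eulerF D) N}
  {extQ : Q →ₛₗ[locInflT D] LocalizedModule (cofF D) N}
  {extVP : V →ₛₗ[unitZ] LocalizedModule cofZ P} {extVQ : V →ₛₗ[unitT] LocalizedModule eulerT Q}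

end

section Large

variable (D) (k : ℤ)

/-- `Q ⟶ ℐ⁻¹ N` for the divisible hull of the sphere. -/
def largeExtQ : (hullGr id k : GrMod RingT (degC OverT)) →ₛₗ[locInflT D]
    LocalizedModule (cofF D)
      (hullGr FiniteSubgroup.mulT k : GrMod (RingF D) (degC (FiniteSubgroup D))) where
  toFun q := LocalizedModule.mk ⟨laurentInfl D q.1, laurentInfl_mem_hull D q.2⟩ 1
  map_add' q q' := by
    rw [← mk_one_add]
    exact congrArg (LocalizedModule.mk · 1) (Subtype.ext (map_add (laurentInfl D) q.1 q'.1))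
  map_smul' a q := by
    refine Eq.trans ?_ (locInfl_smul (inflT D) a _ 1).symm
    exact congrArg (LocalizedModule.mk · (1 : cofF D)) (Subtype.ext (laurentInfl_smul D a q.1))

theorem largeExtQ_baseChange : ExhibitsBaseChange (A := Localization (cofF D)) (locInflT D)
    (largeExtQ D k) := by
  classical
  refine ExhibitsBaseChange.of_directed
    {g | ∃ (T : Finset OverT) (m : ℕ), g.1 = eulerInv (T : Set OverT) m} ?_ ?_ ?_
  · rintro ⟨f, T, m, p, hp⟩ ⟨f', T', m', p', hp'⟩
    have key : ∀ (T T' : Finset OverT) (m m' : ℕ) (f : LaurentPolynomial (OverT → ℚ)) (p : RingT),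
        eulerElt (id ⁻¹' (T : Set OverT)) m • f = toLaurent p → ∃ p' : RingT,
        f = p' • eulerInv ((T ∪ T' : Finset OverT) : Set OverT) (m + m') := by
      intro T T' m m' f p hp
      obtain ⟨r, hr⟩ := (eulerElt_dvd_of_subset 
        (Finset.coe_subset.2 (Finset.subset_union_left (s₁ := T) (s₂ := T'))) m).trans
        (eulerElt_dvd_of_le _ (Nat.le_add_right m m'))
      refine ⟨r * p, eq_smul_eulerInv ?_⟩
      rw [hr, mul_comm, mul_smul, map_mul, ← hp]; rfl
    obtain ⟨r, hr⟩ := key T T' m m' f p hp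
    obtain ⟨r', hr'⟩ := key T' T m' m f' p' hp'
    rw [Finset.union_comm, add_comm m'] at hr'
    exact ⟨⟨_, eulerInv_mem_hull id (T ∪ T') (m + m')⟩, ⟨_, _, rfl⟩, r, r', Subtype.ext hr,
      Subtype.ext hr'⟩
  · rintro ⟨_, hg⟩ ⟨T, m, rfl⟩ a ha
    refine eq_zero_of_smul_mk _ (fun r hr => ?_) a ha
    have h1 := congrArg Subtype.val hr
    have h2 : r • eulerInv ((FiniteSubgroup.mulT (D := D)) ⁻¹' (T : Set OverT)) m = 0 := by
      rw [← laurentInfl_eulerInv]; exact h1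
    exact eulerHull_smul_eq_zero r h2
  · rw [eq_top_iff]
    rintro y -
    induction y using LocalizedModule.induction_on with
    | h y s =>
      obtain ⟨f, T, m, p, hp⟩ := y
      have h1 : (⟨f, T, m, p, hp⟩ : eulerHull FiniteSubgroup.mulT) = p •
          ⟨laurentInfl D (eulerInv (T : Set OverT) m),
            laurentInfl_mem_hull D (eulerInv_mem_hull id T m)⟩ := by
        refine Subtype.ext ((eq_smul_eulerInv hp).trans ?_)
        rw [← laurentInfl_eulerInv]; rfl
      rw [h1]
      have h2 := LocalizedModule.mk_smul_mk p (⟨laurentInfl D (eulerInv (T : Set OverT) m),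
            laurentInfl_mem_hull D (eulerInv_mem_hull id T m)⟩ : eulerHull FiniteSubgroup.mulT)
            s (1 : cofF D)
      rw [mul_one] at h2
      rw [← h2]
      exact Submodule.smul_mem _ _ (Submodule.subset_span
        ⟨⟨eulerInv (T : Set OverT) m, eulerInv_mem_hull id T m⟩, rfl⟩)

/-- `P ⟶ ℰ⁻¹ N` for the divisible hull of the sphere. -/
def largeExtP : (concGr RingZ k : GrMod RingZ (degZero RingZ)) →ₛₗ[locInflZ D]
    LocalizedModule (eulerF D)
      (hullGr FiniteSubgroup.mulT k : GrMod (RingF D) (degC (FiniteSubgroup D))) :=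
  semilinearOfOne (R := RingZ) (A := Localization (eulerF D))
    (L := LocalizedModule (eulerF D) (eulerHull (FiniteSubgroup.mulT (D := D))))
    (locInflZ D) (LocalizedModule.mk (ofPoly FiniteSubgroup.mulT 1) 1)

/-- `V ⟶ ℐ⁻¹ P` for the divisible hull of the sphere. -/
def largeExtVP : (concGr ℚ k : GrMod ℚ (degZero ℚ)) →ₛₗ[unitZ]
    LocalizedModule cofZ (concGr RingZ k : GrMod RingZ (degZero RingZ)) :=
  semilinearOfOne (R := ℚ) (A := Localization cofZ) (L := LocalizedModule cofZ RingZ)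
    unitZ (LocalizedModule.mk 1 1)

/-- `V ⟶ ℰ⁻¹ Q` for the divisible hull of the sphere. -/
def largeExtVQ : (concGr ℚ k : GrMod ℚ (degZero ℚ)) →ₛₗ[unitT]
    LocalizedModule eulerT (hullGr id k : GrMod RingT (degC OverT)) :=
  semilinearOfOne (R := ℚ) (A := Localization eulerT)
    (L := LocalizedModule eulerT (eulerHull (S := OverT) id)) unitT
    (LocalizedModule.mk (ofPoly id 1) 1)

theorem largeExtP_apply (p : RingZ) : largeExtP D k p =
    LocalizedModule.mk (ofPoly FiniteSubgroup.mulT (inflZ D p)) 1 :=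
  (locInfl_smul (inflZ D) p (ofPoly FiniteSubgroup.mulT 1) 1).trans
    (congrArg (LocalizedModule.mk · (1 : eulerF D)) (smul_ofPoly_one _ _))

theorem largeExtVP_apply (v : ℚ) :
    largeExtVP k v = LocalizedModule.mk (algebraMap ℚ RingZ v : RingZ) 1 :=
  (locInfl_smul (algebraMap ℚ RingZ) v (1 : RingZ) 1).trans
    (congrArg (LocalizedModule.mk · (1 : cofZ)) (mul_one _))

theorem largeExtVQ_apply (v : ℚ) :
    largeExtVQ k v = LocalizedModule.mk (ofPoly id (algebraMap ℚ RingT v)) 1 :=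
  (locInfl_smul (algebraMap ℚ RingT) v (ofPoly id 1) 1).trans
    (congrArg (LocalizedModule.mk · (1 : eulerT)) (smul_ofPoly_one _ _))

theorem largeExtQ_ofPoly (q : RingT) :
    largeExtQ D k (ofPoly id q) = LocalizedModule.mk (ofPoly FiniteSubgroup.mulT (inflT D q)) 1 :=
  congrArg (LocalizedModule.mk · (1 : cofF D)) (Subtype.ext (laurentInfl_toLaurent D q))

theorem largeCompat (v : ℚ) :
    Compat (largeExtP D k) (largeExtQ D k) (largeExtVP k) (largeExtVQ k) v := by
  refine ⟨algebraMap ℚ RingZ v, ofPoly id (algebraMap ℚ RingT v),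
    ofPoly _ (algebraMap ℚ (RingF D) v), 1, largeExtVP_apply k v, largeExtVQ_apply k v, ?_, ?_⟩
  · refine (largeExtP_apply D k _).trans ?_
    congr 1
    exact Subtype.ext (map_one (inflT D)).symm
  · refine (largeExtQ_ofPoly D k _).trans ?_
    congr 2
    exact RingHom.congr_fun (RingHom.ext_rat ((inflT D).comp (algebraMap ℚ RingT))
      (algebraMap ℚ (RingF D))) v

/-- The divisible hull of the sphere in degree `k`. -/
def large : StandardModel D where
  V := concGr ℚ k
  P := concGr RingZ k
  Q := hullGr id k
  N := hullGr FiniteSubgroup.mulT k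
  extP := largeExtP D k
  extQ := largeExtQ D k
  extVP := largeExtVP k
  extVQ := largeExtVQ k
  extP_baseChange := by
    refine ExhibitsBaseChange.of_generator (R := RingZ) ?_
    rw [largeExtP_apply, map_one]
    refine bijective_smul_mk (ofPoly FiniteSubgroup.mulT 1) (ofPoly_one_ann _) fun y => ?_
    obtain ⟨T, m, p, hp⟩ := exists_eulerElt_smul y
    refine ⟨_, ⟨_, eulerElt_mem T m, inflT_eulerElt D T m⟩, p, hp.trans (smul_ofPoly_one _ _).symm⟩
  extQ_baseChange := largeExtQ_baseChange D k
  extVP_baseChange := by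
    refine ExhibitsBaseChange.of_generator (R := ℚ) ?_
    rw [largeExtVP_apply, map_one]
    exact bijective_smul_mk (1 : RingZ) (fun r hr => by rwa [smul_eq_mul, mul_one] at hr)
      fun y => ⟨1, one_mem _, y, by rw [one_smul, smul_eq_mul, mul_one]⟩
  extVQ_baseChange := by
    refine ExhibitsBaseChange.of_generator (R := ℚ) ?_
    rw [largeExtVQ_apply, map_one]
    refine bijective_smul_mk (ofPoly id 1) (ofPoly_one_ann _) fun y => ?_
    obtain ⟨T, m, p, hp⟩ := exists_eulerElt_smul y
    exact ⟨_, eulerElt_mem T m, p, hp.trans (smul_ofPoly_one _ _).symm⟩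
  extP_gr := by
    intro i p hp
    rw [largeExtP_apply]
    refine mk_mem_eulerLocGr (toLaurent_mem_gr.2 ?_)
    by_cases h : p = 0
    · rw [h, map_zero]; intro j hj; exact absurd rfl hj
    · rw [hp h, sub_self]; exact inflZ_mem_degC D p
  extQ_gr := by
    rintro i ⟨q, hq'⟩ hq
    refine ⟨⟨laurentInfl D q, laurentInfl_mem_hull D hq'⟩, ?_, rfl⟩
    intro j hj
    apply hq j
    intro h
    apply hj
    change (AddMonoidAlgebra.mapRingHom ℤ _ q).coeff j = 0
    rw [AddMonoidAlgebra.coeff_mapRingHom]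
    exact (congrArg _ h).trans (map_zero _)
  extVP_gr := by
    intro i v hv
    refine ⟨algebraMap ℚ RingZ v, ?_, largeExtVP_apply k v⟩
    intro h
    exact hv fun h' => h (by rw [h', map_zero])
  extVQ_gr := by
    intro i v hv
    rw [largeExtVQ_apply]
    refine mk_mem_eulerLocGr (toLaurent_mem_gr.2 ?_)
    by_cases h : v = 0
    · rw [h, map_zero]; intro j hj; exact absurd rfl hj
    · rw [hv h, sub_self]; exact C_mem_degC _
  square v p i q e x e' y i' hp hq hx hy :=
    square_of_compat (largeCompat D k v) p i q e x e' y i' hp hq hx hy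
  actP := LinearMap.id
  actN := LinearMap.id
  actP_gr _ _ h := h
  actN_gr _ _ h := h
  actP_actP _ := rfl
  actN_actN _ := rfl
  actN_connected _ := rfl
  extP_act p x e h := congrArg _ h
  actN_cof _ := rfl
  actP_cof _ := rfl

end Large

end StandardModel

end

noncomputable section

/-! ### Generators in twisted degrees -/

section Twisted

variable {R : Type} [CommRing R] {A : ℤ → Set R}

/-- Every element is a sum of homogeneous ones. -/
def SumOfHomogeneous (A : ℤ → Set R) : Prop :=
  ∀ a : R, a ∈ AddSubmonoid.closure {b | ∃ i, b ∈ A i}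

theorem sumOfHomogeneous_degC (S : Type) : SumOfHomogeneous (degC S) := by
  intro a
  rw [a.as_sum_support_C_mul_X_pow]
  refine sum_mem fun n _ => AddSubmonoid.subset_closure ⟨0 + -2 * (n : ℤ), ?_⟩
  exact mul_mem_degC (C_mem_degC _) (X_pow_mem_degC S n)

theorem sumOfHomogeneous_degZero (R : Type) [CommRing R] : SumOfHomogeneous (degZero R) :=
  fun _ => AddSubmonoid.subset_closure ⟨0, fun _ => rfl⟩

namespace GrMod

variable {M M' : GrMod R A}

theorem span_induction_gr (hA : SumOfHomogeneous A) {s : Set M} (hs : ∀ x ∈ s, ∃ k, x ∈ M.gr k)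
    {H : ℤ → AddSubgroup M} (hH : ∀ i j a x, a ∈ A i → x ∈ H j → a • x ∈ H (i + j))
    (h : ∀ k, ∀ x ∈ s, x ∈ M.gr k → x ∈ H k) {x : M} (hx : x ∈ Submodule.span R s) (i : ℤ) :
    M.proj i x ∈ H i := by
  revert i
  induction hx using Submodule.span_induction with
  | mem x hx =>
    intro i
    obtain ⟨k, hk⟩ := hs x hx
    by_cases hik : i = k
    · subst hik
      rw [proj_of_mem hk]; exact h _ x hx hk
    · rw [proj_of_mem_ne hik hk]; exact zero_mem _
  | zero => intro i; rw [map_zero]; exact zero_mem _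
  | add x y _ _ hx hy => intro i; rw [map_add]; exact add_mem (hx i) (hy i)
  | smul a x _ hx =>
    intro i
    refine AddSubmonoid.closure_induction (motive := fun a _ => M.proj i (a • x) ∈ H i)
      ?_ ?_ ?_ (hA a)
    · rintro b ⟨l, hb⟩
      have := proj_smul (j := i - l) hb x
      rw [add_sub_cancel] at this
      rw [this]
      have := hH l (i - l) b _ hb (hx (i - l))
      rwa [add_sub_cancel] at this
    · rw [zero_smul, map_zero]; exact zero_mem _
    · intro a b _ _ ha hb
      rw [add_smul, map_add]; exact add_mem ha hb

theorem homogeneous_span (hA : SumOfHomogeneous A) {s : Set M} (hs : ∀ x ∈ s, ∃ k, x ∈ M.gr k) :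
    Homogeneous (Submodule.span R s) := fun i _ hx =>
  span_induction_gr hA hs (H := fun _ => (Submodule.span R s).toAddSubgroup)
    (fun _ _ a _ _ hx => Submodule.smul_mem _ a hx) (fun _ _ hx _ => Submodule.subset_span hx) hx i

theorem map_mem_gr_of_span (hA : SumOfHomogeneous A) {s : Set M} (hs : ∀ x ∈ s, ∃ k, x ∈ M.gr k)
    (hspan : Submodule.span R s = ⊤) (f : M →ₗ[R] M')
    (h : ∀ k, ∀ x ∈ s, x ∈ M.gr k → f x ∈ M'.gr k) (k : ℤ) (x : M) (hx : x ∈ M.gr k) :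
    f x ∈ M'.gr k := by
  have := span_induction_gr hA hs (H := fun k => (M'.gr k).comap f.toAddMonoidHom)
    (fun i j a x ha hx => by
      change f (a • x) ∈ M'.gr (i + j)
      rw [map_smul]; exact M'.smul_mem ha hx) h (hspan ▸ trivial : x ∈ _) k
  rw [proj_of_mem hx] at this
  exact this

theorem _root_.idem_union_mul {S : Type} (U U' : Set S) (m m' : ℕ) :
    idem (U ∪ U') * (eulerElt (U ∪ U') m' * eulerElt (U' \ U) m) =
      X ^ m' * idem U + idem (U' \ U) * X ^ (m + m') * idem Uᶜ := by
  refine ext_factorAt fun i => ?_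
  simp only [map_mul, map_add, map_pow, factorAt_X, factorAt_idem, factorAt_eulerElt]
  by_cases h : i ∈ U <;> by_cases h' : i ∈ U' <;> simp [h, h', pow_add, mul_comm]

theorem _root_.idem_compl_union_mul {S : Type} (U U' : Set S) (m m' : ℕ) :
    idem (U ∪ U')ᶜ * (eulerElt (U ∪ U') m' * eulerElt (U' \ U) m) = idem (U ∪ U')ᶜ * idem Uᶜ := by
  refine ext_factorAt fun i => ?_
  simp only [map_mul, factorAt_idem, factorAt_eulerElt]
  by_cases h : i ∈ U <;> by_cases h' : i ∈ U' <;> simp [h, h']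

/-- The part of `x` at `U` is homogeneous of degree `k - 2 m`, the rest of degree `k`. -/
structure Twisted (M : GrMod R A) (θ : RingT →+* R) (U : Set OverT) (m : ℕ) (k : ℤ) (x : M) :
    Prop where
  inner : θ (idem U) • x ∈ M.gr (k - 2 * m)
  outer : θ (idem Uᶜ) • x ∈ M.gr k

namespace Twisted

variable {θ : RingT →+* R} {U U' : Set OverT} {m m' : ℕ} {k : ℤ} {x y : M}

theorem add (hx : M.Twisted θ U m k x) (hy : M.Twisted θ U m k y) :
    M.Twisted θ U m k (x + y) :=
  ⟨by rw [smul_add]; exact add_mem hx.1 hy.1, by rw [smul_add]; exact add_mem hx.2 hy.2⟩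

theorem map (hx : M.Twisted θ U m k x) (f : M →ₗ[R] M') (hf : ∀ k, ∀ x ∈ M.gr k, f x ∈ M'.gr k) :
    M'.Twisted θ U m k (f x) :=
  ⟨by rw [← map_smul]; exact hf _ _ hx.1, by rw [← map_smul]; exact hf _ _ hx.2⟩

theorem smul_zero (hx : M.Twisted θ U m k x) {a : R} (ha : a ∈ A 0) :
    M.Twisted θ U m k (a • x) :=
  ⟨by rw [smul_comm]; simpa using M.smul_mem ha hx.1,
    by rw [smul_comm]; simpa using M.smul_mem ha hx.2⟩

theorem zero : M.Twisted θ U m k 0 :=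
  ⟨by rw [_root_.smul_zero]; exact zero_mem _, by rw [_root_.smul_zero]; exact zero_mem _⟩

theorem of_mem (hx : x ∈ M.gr k) : M.Twisted θ ∅ 0 k x :=
  ⟨by rw [idem_empty, map_zero, zero_smul]; exact zero_mem _,
    by rw [Set.compl_empty, idem_univ, map_one, one_smul]; exact hx⟩

theorem of_parts (hθ : PreservesDegree θ A) {x₁ x₂ : M} (h₁ : x₁ ∈ M.gr (k - 2 * m))
    (h₂ : x₂ ∈ M.gr k) : M.Twisted θ U m k (θ (idem U) • x₁ + θ (idem Uᶜ) • x₂) := by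
  have h : idem U * idem Uᶜ = (0 : RingT) := by
    rw [idem_mul, Set.inter_compl_self, idem_empty]
  constructor
  · rw [smul_add, smul_smul, smul_smul, ← map_mul, ← map_mul, idem_mul_self, h, map_zero, zero_smul,
      add_zero]
    simpa using M.smul_mem (hθ _ _ (idem_mem_degC U)) h₁
  · rw [smul_add, smul_smul, smul_smul, ← map_mul, ← map_mul, idem_mul_self, mul_comm (idem Uᶜ), h,
      map_zero, zero_smul, zero_add]
    simpa using M.smul_mem (hθ _ _ (idem_mem_degC Uᶜ)) h₂

/-- Multiplication with an Euler element that is supported in a larger set. -/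
theorem enlarge (hθ : PreservesDegree θ A) (hx : M.Twisted θ U m k x) :
    M.Twisted θ (U ∪ U') (m + m') k
      (θ (eulerElt (U ∪ U') m' * eulerElt (U' \ U) m) • x) := by
  have h1 := M.smul_mem (hθ _ _ (X_pow_mem_degC OverT m')) hx.1
  have h2 := M.smul_mem (hθ _ _ (idem_mul_X_pow_mem_degC (U' \ U) (m + m'))) hx.2
  have h3 := M.smul_mem (hθ _ _ (idem_mem_degC (U ∪ U')ᶜ)) hx.2
  rw [smul_smul, ← map_mul] at h1 h2 h3
  constructor
  · rw [smul_smul, ← map_mul, idem_union_mul, map_add, add_smul]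
    refine add_mem ?_ ?_
    · convert h1 using 2; push_cast; ring
    · convert h2 using 2; push_cast; ring
  · rw [smul_smul, ← map_mul, idem_compl_union_mul]
    simpa using h3

theorem span_eq : Submodule.span R {x} =
    Submodule.span R {θ (idem U) • x, θ (idem Uᶜ) • x} := by
  refine le_antisymm ?_ ?_
  · have h : x = θ (idem U) • x + θ (idem Uᶜ) • x := by
      rw [← add_smul, ← map_add, idem_add_compl, map_one, one_smul]
    rw [Submodule.span_singleton_le_iff_mem]
    refine Set.mem_of_eq_of_mem h (add_mem (Submodule.subset_span (Or.inl rfl))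
      (Submodule.subset_span (Or.inr rfl)))
  · rw [Submodule.span_le]
    rintro _ (rfl | rfl)
    · exact Submodule.smul_mem _ _ (Submodule.mem_span_singleton_self x)
    · exact Submodule.smul_mem _ _ (Submodule.mem_span_singleton_self x)

theorem exists_mem (hx : M.Twisted θ U m k x) :
    ∀ y ∈ ({θ (idem U) • x, θ (idem Uᶜ) • x} : Set M), ∃ k, y ∈ M.gr k := by
  rintro _ (rfl | rfl)
  · exact ⟨_, hx.1⟩
  · exact ⟨_, hx.2⟩

theorem homogeneous (hA : SumOfHomogeneous A) (hx : M.Twisted θ U m k x) :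
    Homogeneous (Submodule.span R {x}) := by
  rw [span_eq (θ := θ) (U := U)]
  exact homogeneous_span hA hx.exists_mem

theorem eq_zero_of_ne {i j : ℤ} {x : M} (h : i ≠ j) (hi : x ∈ M.gr i) (hj : x ∈ M.gr j) : x = 0 := by
  rw [← proj_of_mem hi, proj_of_mem_ne h hj]

theorem map_mem_gr (hA : SumOfHomogeneous A) (hx : M.Twisted θ U m k x)
    (hspan : Submodule.span R {x} = ⊤) (f : M →ₗ[R] M') (hf : M'.Twisted θ U m k (f x)) (i : ℤ)
    (y : M) (hy : y ∈ M.gr i) : f y ∈ M'.gr i := by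
  rw [span_eq (θ := θ) (U := U)] at hspan
  refine map_mem_gr_of_span hA hx.exists_mem hspan f ?_ i y hy
  rintro j _ (rfl | rfl) hj
  · by_cases h : j = k - 2 * m
    · rw [h, map_smul]; exact hf.1
    · rw [eq_zero_of_ne h hj hx.1, map_zero]; exact zero_mem _
  · by_cases h : j = k
    · rw [h, map_smul]; exact hf.2
    · rw [eq_zero_of_ne h hj hx.2, map_zero]; exact zero_mem _

end Twisted

end GrMod

theorem Spans.of_singleton {R₁ : Type} [CommRing R₁] {S : Submonoid R} {M N : Type}
    [AddCommGroup M] [Module R₁ M] [AddCommGroup N] [Module R N] {σ : R₁ →+* Localization S}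
    {f : M →ₛₗ[σ] LocalizedModule S N} {m : M} {x : N} {s : S} (h : f m = LocalizedModule.mk x s) :
    Spans f (Submodule.span R₁ {m}) (Submodule.span R {x}) := by
  rw [Spans, Spans.span_image_span, Set.image_singleton, locSub_span_singleton, h]
  refine le_antisymm ?_ ?_
  · rw [Submodule.span_singleton_le_iff_mem]
    exact Submodule.mem_span_singleton.2 ⟨_, (loc_smul_mk x s).symm⟩
  · rw [Submodule.span_singleton_le_iff_mem, ← smul_mk_self s x]
    rw [← algebraMap_smul (Localization S) (s : R) (LocalizedModule.mk x s : LocalizedModule S N)]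
    exact Submodule.mem_span_singleton.2 ⟨_, rfl⟩

end Twisted

namespace StandardModel

open GrMod

variable {D : FullSubgroups}

/-- The Euler element of a finite set, in `ℰ`. -/
def eulerOf (T : Finset OverT) (m : ℕ) : eulerT := ⟨eulerElt (T : Set OverT) m, eulerElt_mem T m⟩

@[simp] theorem coe_eulerOf (T : Finset OverT) (m : ℕ) :
    (eulerOf T m : RingT) = eulerElt (T : Set OverT) m := rfl

/-- Elements of the four modules that define a morphism from a sphere. -/
structure Gen (X : StandardModel D) (T : Finset OverT) (m : ℕ) (k : ℤ) where
  v : X.V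
  p : X.P
  q : X.Q
  x : X.N
  v_mem : v ∈ X.V.gr k
  p_mem : p ∈ X.P.gr k
  q_mem : X.Q.Twisted (RingHom.id _) T m k q
  x_mem : X.N.Twisted (inflT D) T m k x
  extVP : X.extVP v = LocalizedModule.mk p 1
  extVQ : X.extVQ v = LocalizedModule.mk q (eulerOf T m)
  extP : X.extP p = LocalizedModule.mk x (inflE D (eulerOf T m))
  extQ : X.extQ q = LocalizedModule.mk x 1
  actP : X.actP p = p
  actN : X.actN x = x

namespace Gen

variable {X Y : StandardModel D} {T : Finset OverT} {m : ℕ} {k : ℤ}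

/-- The subobject that is generated by the elements. -/
def sub (g : Gen X T m k) : Sub X where
  V := Submodule.span ℚ {g.v}
  P := Submodule.span RingZ {g.p}
  Q := Submodule.span RingT {g.q}
  N := Submodule.span (RingF D) {g.x}
  homV := homogeneous_span (sumOfHomogeneous_degZero _) fun _ h => ⟨k, h ▸ g.v_mem⟩
  homP := homogeneous_span (sumOfHomogeneous_degZero _) fun _ h => ⟨k, h ▸ g.p_mem⟩
  homQ := g.q_mem.homogeneous (sumOfHomogeneous_degC _)
  homN := g.x_mem.homogeneous (sumOfHomogeneous_degC _)
  spanP := .of_singleton g.extP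
  spanQ := .of_singleton g.extQ
  spanVP := .of_singleton g.extVP
  spanVQ := .of_singleton g.extVQ
  actP_mem p hp := by
    obtain ⟨a, rfl⟩ := Submodule.mem_span_singleton.1 hp
    rw [map_smul, g.actP]
    exact Submodule.smul_mem _ _ (Submodule.mem_span_singleton_self _)
  actN_mem p hp := by
    obtain ⟨a, rfl⟩ := Submodule.mem_span_singleton.1 hp
    rw [map_smul, g.actN]
    exact Submodule.smul_mem _ _ (Submodule.mem_span_singleton_self _)

/-- The generators form a basis. -/
structure Free (g : Gen X T m k) : Prop where
  V : Function.Bijective fun a : ℚ => a • g.v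
  P : Function.Bijective fun a : RingZ => a • g.p
  Q : Function.Bijective fun a : RingT => a • g.q
  N : Function.Bijective fun a : RingF D => a • g.x

theorem _root_.exists_linear_of_free {R M L : Type} [CommRing R] [AddCommGroup M] [Module R M]
    [AddCommGroup L] [Module R L] {m : M} (h : Function.Bijective fun a : R => a • m) (l : L) :
    ∃ f : M →ₗ[R] L, f m = l ∧ ∀ y : M, ∃ a : R, y = a • m := by
  let e : R ≃ₗ[R] M := LinearEquiv.ofBijective (LinearMap.toSpanSingleton R M m) h
  refine ⟨(LinearMap.toSpanSingleton R L l).comp e.symm.toLinearMap, ?_, fun y => ?_⟩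
  · have : e 1 = m := one_smul R m
    rw [LinearMap.comp_apply, LinearEquiv.coe_coe, ← this, LinearEquiv.symm_apply_apply]
    exact one_smul R l
  · exact ⟨e.symm y, (e.apply_symm_apply y).symm⟩

theorem _root_.span_eq_top_of_exists {R M : Type} [CommRing R] [AddCommGroup M] [Module R M] {m : M}
    (h : ∀ y : M, ∃ a : R, y = a • m) : Submodule.span R {m} = ⊤ := by
  rw [eq_top_iff]
  rintro y -
  obtain ⟨a, rfl⟩ := h y
  exact Submodule.smul_mem _ _ (Submodule.mem_span_singleton_self _)

theorem exists_hom (g : Gen X T m k) (hg : g.Free) (g' : Gen Y T m k) :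
    ∃ f : X ⟶ Y, onV f g.v = g'.v ∧ onP f g.p = g'.p ∧ onQ f g.q = g'.q ∧ onN f g.x = g'.x := by
  obtain ⟨v, hv, sV⟩ := exists_linear_of_free hg.V g'.v
  obtain ⟨p, hp, sP⟩ := exists_linear_of_free hg.P g'.p
  obtain ⟨q, hq, sQ⟩ := exists_linear_of_free hg.Q g'.q
  obtain ⟨x, hx, sN⟩ := exists_linear_of_free hg.N g'.x
  refine ⟨homMk (X := X) (Y := Y) v p q x ?_ ?_ ?_ ?_ ?_ ?_ ?_ ?_ ?_ ?_, hv, hp, hq, hx⟩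
  · refine map_mem_gr_of_span (sumOfHomogeneous_degZero _) (s := {g.v})
      (fun _ h => ⟨k, h ▸ g.v_mem⟩) (span_eq_top_of_exists sV) v ?_
    rintro i _ rfl hi
    by_cases h : i = k
    · rw [h, hv]; exact g'.v_mem
    · rw [Twisted.eq_zero_of_ne h hi g.v_mem, map_zero]; exact zero_mem _
  · refine map_mem_gr_of_span (sumOfHomogeneous_degZero _) (s := {g.p})
      (fun _ h => ⟨k, h ▸ g.p_mem⟩) (span_eq_top_of_exists sP) p ?_
    rintro i _ rfl hi
    by_cases h : i = k
    · rw [h, hp]; exact g'.p_mem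
    · rw [Twisted.eq_zero_of_ne h hi g.p_mem, map_zero]; exact zero_mem _
  · exact g.q_mem.map_mem_gr (sumOfHomogeneous_degC _) (span_eq_top_of_exists sQ) q
      (by rw [hq]; exact g'.q_mem)
  · exact g.x_mem.map_mem_gr (sumOfHomogeneous_degC _) (span_eq_top_of_exists sN) x
      (by rw [hx]; exact g'.x_mem)
  · intro a
    obtain ⟨a, rfl⟩ := sP a
    rw [map_smul, ext_smul_locInflZ, ext_smul_locInflZ, loc_map_smul, hp, g'.extP, g.extP,
      LocalizedModule.map_mk, hx]
  · intro a
    obtain ⟨a, rfl⟩ := sQ a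
    rw [map_smul, ext_smul_locInflT, ext_smul_locInflT, loc_map_smul, hq, g'.extQ, g.extQ,
      LocalizedModule.map_mk, hx]
  · intro a
    obtain ⟨a, rfl⟩ := sV a
    rw [map_smul, Y.extVP.map_smulₛₗ, X.extVP.map_smulₛₗ, map_smul, hv, g'.extVP, g.extVP,
      LocalizedModule.map_mk, hp]
  · intro a
    obtain ⟨a, rfl⟩ := sV a
    rw [map_smul, Y.extVQ.map_smulₛₗ, X.extVQ.map_smulₛₗ, map_smul, hv, g'.extVQ, g.extVQ,
      LocalizedModule.map_mk, hq]
  · intro a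
    obtain ⟨a, rfl⟩ := sP a
    rw [map_smul, map_smul, map_smul, map_smul, g.actP, hp, g'.actP]
  · intro a
    obtain ⟨a, rfl⟩ := sN a
    rw [map_smul, map_smul, map_smul, map_smul, g.actN, hx, g'.actN]

/-- The generators of the subobject that they generate. -/
def gen (g : Gen X T m k) : Gen g.sub.toModel T m k where
  v := ⟨g.v, Submodule.mem_span_singleton_self _⟩
  p := ⟨g.p, Submodule.mem_span_singleton_self _⟩
  q := ⟨g.q, Submodule.mem_span_singleton_self _⟩
  x := ⟨g.x, Submodule.mem_span_singleton_self _⟩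
  v_mem := g.v_mem
  p_mem := g.p_mem
  q_mem := ⟨g.q_mem.1, g.q_mem.2⟩
  x_mem := ⟨g.x_mem.1, g.x_mem.2⟩
  extVP := LocalizedModule.map_injective _ g.sub.P.subtype g.sub.P.injective_subtype
    (((extVP_onV g.sub.ι _).symm.trans g.extVP).trans (LocalizedModule.map_mk _ _ _ _).symm)
  extVQ := LocalizedModule.map_injective _ g.sub.Q.subtype g.sub.Q.injective_subtype
    (((extVQ_onV g.sub.ι _).symm.trans g.extVQ).trans (LocalizedModule.map_mk _ _ _ _).symm)
  extP := LocalizedModule.map_injective _ g.sub.N.subtype g.sub.N.injective_subtype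
    (((extP_onP g.sub.ι _).symm.trans g.extP).trans (LocalizedModule.map_mk _ _ _ _).symm)
  extQ := LocalizedModule.map_injective _ g.sub.N.subtype g.sub.N.injective_subtype
    (((extQ_onQ g.sub.ι _).symm.trans g.extQ).trans (LocalizedModule.map_mk _ _ _ _).symm)
  actP := Subtype.ext g.actP
  actN := Subtype.ext g.actN

/-- The image of generators. -/
def map (g : Gen X T m k) (f : X ⟶ Y) : Gen Y T m k where
  v := onV f g.v
  p := onP f g.p
  q := onQ f g.q
  x := onN f g.x
  v_mem := onV_mem f g.v_mem
  p_mem := onP_mem f g.p_mem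
  q_mem := g.q_mem.map _ (Hom.onQ_gr f)
  x_mem := g.x_mem.map _ (Hom.onN_gr f)
  extVP := by rw [extVP_onV, g.extVP, LocalizedModule.map_mk]
  extVQ := by rw [extVQ_onV, g.extVQ, LocalizedModule.map_mk]
  extP := by rw [extP_onP, g.extP, LocalizedModule.map_mk]
  extQ := by rw [extQ_onQ, g.extQ, LocalizedModule.map_mk]
  actP := by rw [← onP_actP, g.actP]
  actN := by rw [← onN_actN, g.actN]

end Gen

theorem bijective_smul_span {R M : Type} [CommRing R] [AddCommGroup M] [Module R M] {m : M}
    (h : ∀ a : R, a • m = 0 → a = 0) : Function.Bijective fun a : R =>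
      a • (⟨m, Submodule.mem_span_singleton_self m⟩ : Submodule.span R {m}) := by
  constructor
  · change Function.Injective (LinearMap.toSpanSingleton R _
      (⟨m, Submodule.mem_span_singleton_self m⟩ : Submodule.span R {m}))
    rw [injective_iff_map_eq_zero]
    exact fun a ha => h a (congrArg Subtype.val ha)
  · rintro ⟨y, hy⟩
    obtain ⟨a, rfl⟩ := Submodule.mem_span_singleton.1 hy
    exact ⟨a, rfl⟩

theorem eulerElt_cancel {S : Type} {U : Set S} {m : ℕ} {a : (S → ℚ)[X]}
    (h : a * eulerElt U m = 0) : a = 0 := by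
  refine toLaurent_injective ?_
  have h1 : toLaurent a * toLaurent (eulerElt U m) = 0 := by rw [← map_mul, h, map_zero]
  rw [map_zero]
  linear_combination h1 * eulerInv U m - toLaurent a * eulerElt_mul_eulerInv U m

variable (D)

theorem toLaurent_mem_gr_of {S : Type} {k i d : ℤ} {p : (S → ℚ)[X]} (h : p ∈ degC S d)
    (hd : i = d + k) : toLaurent p ∈ (laurentGr S k).gr i := by
  rw [toLaurent_mem_gr, hd, add_sub_cancel_right]; exact h

/-- The generators of a sphere inside its divisible hull. -/
def sphereGen (T : Finset OverT) (m : ℕ) (k : ℤ) : Gen (large D k) T m k where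
  v := (1 : ℚ)
  p := (1 : RingZ)
  q := ofPoly id (eulerElt (T : Set OverT) m)
  x := ofPoly FiniteSubgroup.mulT (inflT D (eulerElt (T : Set OverT) m))
  v_mem _ := rfl
  p_mem _ := rfl
  q_mem := by
    constructor
    · have h : idem (T : Set OverT) * eulerElt (T : Set OverT) m ∈ degC _ (-2 * (m : ℤ)) := by
        rw [idem_mul_eulerElt]; exact idem_mul_X_pow_mem_degC _ _
      have h2 := toLaurent_mem_gr_of (k := k) (i := k - 2 * m) h (by ring)
      rw [map_mul] at h2
      exact h2
    · have h : idem (T : Set OverT)ᶜ * eulerElt (T : Set OverT) m ∈ degC _ 0 := by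
        rw [idem_compl_mul_eulerElt]; exact idem_mem_degC _
      have h2 := toLaurent_mem_gr_of (k := k) (i := k) h (by ring)
      rw [map_mul] at h2
      exact h2
  x_mem := by
    constructor
    · have h : inflT D (idem (T : Set OverT) * eulerElt (T : Set OverT) m) ∈ degC _ (-2 * (m : ℤ)) :=
        inflT_mem_degC D (by rw [idem_mul_eulerElt]; exact idem_mul_X_pow_mem_degC _ _)
      have h2 := toLaurent_mem_gr_of (k := k) (i := k - 2 * m) h (by ring)
      rw [map_mul, map_mul] at h2
      exact h2
    · have h : inflT D (idem (T : Set OverT)ᶜ * eulerElt (T : Set OverT) m) ∈ degC _ 0 :=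
        inflT_mem_degC D (by rw [idem_compl_mul_eulerElt]; exact idem_mem_degC _)
      have h2 := toLaurent_mem_gr_of (k := k) (i := k) h (by ring)
      rw [map_mul, map_mul] at h2
      exact h2
  extVP := (largeExtVP_apply k 1).trans (congrArg (LocalizedModule.mk · (1 : cofZ)) (map_one _))
  extVQ := by
    refine (largeExtVQ_apply k 1).trans ?_
    rw [map_one]
    refine LocalizedModule.mk_eq.2 ⟨1, ?_⟩
    simp only [Submonoid.smul_def, one_smul, coe_eulerOf, smul_ofPoly_one]
  extP := by
    refine (largeExtP_apply D k 1).trans ?_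
    rw [map_one]
    refine LocalizedModule.mk_eq.2 ⟨1, ?_⟩
    simp only [Submonoid.smul_def, one_smul, coe_inflE, coe_eulerOf,
      smul_ofPoly_one]
  extQ := largeExtQ_ofPoly D k _
  actP := rfl
  actN := rfl

/-- The sphere with generators in degree `k`, twisted by `m` at `T`. -/
def sphere (T : Finset OverT) (m : ℕ) (k : ℤ) : StandardModel D := (sphereGen D T m k).sub.toModel

theorem sphere_free (T : Finset OverT) (m : ℕ) (k : ℤ) : (sphereGen D T m k).gen.Free where
  V := bijective_smul_span fun (a : ℚ) ha => by
    have : a * 1 = 0 := ha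
    rwa [mul_one] at this
  P := bijective_smul_span fun (a : RingZ) ha => by
    have : a * 1 = 0 := ha
    rwa [mul_one] at this
  Q := bijective_smul_span (fun (a : RingT) ha => by
    refine eulerElt_cancel (U := (T : Set OverT)) (m := m) (ofPoly_injective id ?_)
    rw [← smul_ofPoly, ofPoly_zero]
    exact ha)
  N := bijective_smul_span (fun (a : RingF D) ha => by
    refine eulerElt_cancel (U := FiniteSubgroup.mulT ⁻¹' (T : Set OverT)) (m := m)
      (ofPoly_injective FiniteSubgroup.mulT ?_)
    rw [← smul_ofPoly, ofPoly_zero, ← inflT_eulerElt]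
    exact ha)

end StandardModel

end

noncomputable section

namespace StandardModel

open GrMod

variable {D : FullSubgroups}

theorem half_mem_degC (S : Type) : algebraMap ℚ (S → ℚ)[X] (1 / 2) ∈ degC S 0 := C_mem_degC _

theorem half_smul_add_self {R M : Type} [CommRing R] [Algebra ℚ R] [AddCommGroup M] [Module R M]
    (x : M) : algebraMap ℚ R (1 / 2) • (x + x) = x := by
  rw [← two_smul R x, smul_smul, ← map_ofNat (algebraMap ℚ R) 2, ← map_mul]
  norm_num

section Average

variable (X : StandardModel D)

/-- The average of an element and its translate. -/
def avgN (x : X.N) : X.N := algebraMap ℚ (RingF D) (1 / 2) • (x + X.actN x)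

/-- The average of an element and its translate. -/
def avgP (p : X.P) : X.P := algebraMap ℚ RingZ (1 / 2) • (p + X.actP p)

variable {X}

theorem actN_avgN (x : X.N) : X.actN (avgN X x) = avgN X x := by
  rw [avgN, map_smul, map_add, X.actN_actN, add_comm]

theorem actP_avgP (p : X.P) : X.actP (avgP X p) = avgP X p := by
  rw [avgP, map_smul, map_add, X.actP_actP, add_comm]

theorem avgP_mem {k : ℤ} {p : X.P} (h : p ∈ X.P.gr k) : avgP X p ∈ X.P.gr k := by
  have := X.P.smul_mem (i := 0) (a := algebraMap ℚ RingZ (1 / 2)) (fun _ => rfl)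
    (add_mem h (X.actP_gr k p h))
  rwa [zero_add] at this

theorem avgN_twisted {T : Set OverT} {m : ℕ} {k : ℤ} {x : X.N}
    (h : X.N.Twisted (inflT D) T m k x) : X.N.Twisted (inflT D) T m k (avgN X x) :=
  (h.add (h.map X.actN X.actN_gr)).smul_zero (half_mem_degC _)

theorem avgN_mem {k : ℤ} {x : X.N} (h : x ∈ X.N.gr k) : avgN X x ∈ X.N.gr k := by
  have := X.N.smul_mem (half_mem_degC _) (add_mem h (X.actN_gr k x h))
  rwa [zero_add] at this

theorem mk_avgN {S : Submonoid (RingF D)} {x : X.N} {s : S}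
    (h : (LocalizedModule.mk (X.actN x) 1 : LocalizedModule S X.N) = LocalizedModule.mk x 1) :
    (LocalizedModule.mk (avgN X x) s : LocalizedModule S X.N) = LocalizedModule.mk x s := by
  have h' : (LocalizedModule.mk (avgN X x) 1 : LocalizedModule S X.N) = LocalizedModule.mk x 1 := by
    rw [avgN, ← smul_mk_one, mk_one_add, h, half_smul_add_self]
  rw [loc_smul_mk, h', ← loc_smul_mk]

theorem mk_avgP (p : X.P) :
    (LocalizedModule.mk (avgP X p) 1 : LocalizedModule cofZ X.P) = LocalizedModule.mk p 1 := by
  rw [avgP, ← smul_mk_one, mk_one_add, X.actP_cof, half_smul_add_self]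

theorem mk_actN_of_extP {p : X.P} (hp : X.actP p = p) {x : X.N} {e : eulerF D}
    (h : X.extP p = LocalizedModule.mk x e) :
    (LocalizedModule.mk (X.actN x) 1 : LocalizedModule (eulerF D) X.N) =
      LocalizedModule.mk x 1 := by
  have h1 := X.extP_act p x e h
  rw [hp, h] at h1
  have h2 : conn D • (LocalizedModule.mk (X.actN x) e : LocalizedModule (eulerF D) X.N) =
      conn D • LocalizedModule.mk x e := by
    rw [LocalizedModule.smul'_mk, LocalizedModule.smul'_mk, X.conn_smul_actN]
  have h3 : (LocalizedModule.mk (X.actN x) e : LocalizedModule (eulerF D) X.N) =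
      LocalizedModule.mk x e := by
    rw [← one_smul (RingF D) (LocalizedModule.mk (X.actN x) e),
      ← one_smul (RingF D) (LocalizedModule.mk x e : LocalizedModule (eulerF D) X.N),
      ← disc_add_conn, add_smul, add_smul, h2]
    exact congrArg (· + _) h1.symm
  rw [← smul_mk_self e, h3, smul_mk_self]

end Average

variable {X : StandardModel D} {T : Finset OverT} {m : ℕ} {k : ℤ}

theorem exists_gen_of {v : X.V} {p : X.P} {q : X.Q} {x : X.N} (hv : v ∈ X.V.gr k)
    (hp : p ∈ X.P.gr k) (hq : X.Q.Twisted (RingHom.id _) T m k q)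
    (hx : X.N.Twisted (inflT D) T m k x) (hvp : X.extVP v = LocalizedModule.mk p 1)
    (hvq : X.extVQ v = LocalizedModule.mk q (eulerOf T m))
    (hpx : X.extP p = LocalizedModule.mk x (inflE D (eulerOf T m)))
    (hqx : X.extQ q = LocalizedModule.mk x 1) (act : X.actP p = p) :
    ∃ g : Gen X T m k, g.v = v ∧ g.p = p ∧ g.q = q ∧ g.x = avgN X x :=
  ⟨{  v := v
      p := p
      q := q
      x := avgN X x
      v_mem := hv
      p_mem := hp
      q_mem := hq
      x_mem := avgN_twisted hx
      extVP := hvp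
      extVQ := hvq
      extP := by rw [hpx, mk_avgN (mk_actN_of_extP act hpx)]
      extQ := by rw [hqx, mk_avgN (X.actN_cof x)]
      actP := act
      actN := actN_avgN x }, rfl, rfl, rfl, rfl⟩

/-- An element of an `ℰ`-localization is a twisted homogeneous element over an Euler element. -/
theorem exists_twisted {R : Type} [CommRing R] {A : ℤ → Set R} {θ : RingT →+* R} {S : Submonoid R}
    (hθ : PreservesDegree θ A) {M : GrMod R A} {y : LocalizedModule S M}
    (hy : y ∈ eulerLocGr θ S M k) : ∃ (T : Finset OverT) (m : ℕ), ∃ x : M,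
      M.Twisted θ T m k x ∧ θ (eulerElt (T : Set OverT) m) • y = LocalizedModule.mk x 1 := by
  obtain ⟨T, m, x₁, hx₁, x₂, hx₂, h₁, h₂⟩ := hy
  refine ⟨T, m, _, .of_parts hθ hx₁ hx₂, ?_⟩
  change θ (idem (T : Set OverT) * X ^ m) • y = _ at h₁
  change θ (idem (T : Set OverT)ᶜ) • y = _ at h₂
  rw [mk_one_add, ← smul_mk_one, ← smul_mk_one, ← h₁, ← h₂, smul_smul, smul_smul, ← map_mul,
    ← map_mul, ← mul_assoc, idem_mul_self, idem_mul_self, ← add_smul, ← map_add]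
  rfl

theorem enlarge_mul (T T' : Finset OverT) (m m' : ℕ) [DecidableEq OverT] :
    eulerElt ((T : Set OverT) ∪ T') m' * eulerElt ((T' : Set OverT) \ T) m *
      eulerElt (T : Set OverT) m = eulerElt ((T ∪ T' : Finset OverT) : Set OverT) (m + m') := by
  rw [mul_assoc, eulerElt_mul_of_disjoint Set.disjoint_sdiff_left, Set.sdiff_union_self,
    Set.union_comm (T' : Set OverT), eulerElt_mul, Finset.coe_union, add_comm]

theorem eq_mk_of_smul_eq {R : Type} [CommRing R] {S : Submonoid R} {M : Type} [AddCommGroup M]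
    [Module R M] {y : LocalizedModule S M} {x : M} {s : S}
    (h : (s : R) • y = LocalizedModule.mk x 1) : y = LocalizedModule.mk x s := by
  refine smul_left_cancel_of_mem s.2 ?_
  rw [h, smul_mk_self]

theorem Twisted.exists_extQ {q : X.Q} (hq : X.Q.Twisted (RingHom.id _) T m k q) :
    ∃ x, X.N.Twisted (inflT D) T m k x ∧ X.extQ q = LocalizedModule.mk x 1 := by
  obtain ⟨x₁, hx₁, h₁⟩ := X.extQ_gr _ _ hq.inner
  obtain ⟨x₂, hx₂, h₂⟩ := X.extQ_gr _ _ hq.outer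
  refine ⟨_, .of_parts (preservesDegree_inflT D) hx₁ hx₂, ?_⟩
  rw [RingHom.id_apply, ext_smul_locInflT] at h₁ h₂
  rw [mk_one_add, ← smul_mk_one, ← smul_mk_one, ← h₁, ← h₂, smul_smul, smul_smul, ← map_mul,
    ← map_mul, idem_mul_self, idem_mul_self, ← add_smul, ← map_add, idem_add_compl, map_one,
    one_smul]

/-- Every homogeneous element of `V` is the image of the generator of a sphere. -/
theorem exists_gen_v {v : X.V} (hv : v ∈ X.V.gr k) :
    ∃ (T : Finset OverT) (m : ℕ) (g : Gen X T m k), g.v = v := by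
  classical
  obtain ⟨p₀, hp₀, hvp₀⟩ := X.extVP_gr k v hv
  obtain ⟨p, hp, act, hvp⟩ : ∃ p ∈ X.P.gr k, X.actP p = p ∧ X.extVP v = LocalizedModule.mk p 1 :=
    ⟨_, avgP_mem hp₀, actP_avgP _, by rw [hvp₀, mk_avgP]⟩
  obtain ⟨T₁, m₁, q₁, hq₁, hvq₁⟩ := exists_twisted preservesDegree_id (X.extVQ_gr k v hv)
  obtain ⟨T₂, m₂, x₂, hx₂, hpx₂⟩ := exists_twisted (preservesDegree_inflT D) (X.extP_gr k p hp)
  obtain ⟨y₁, hy₁, hqy₁⟩ := Twisted.exists_extQ hq₁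
  obtain ⟨T₃, m₃, U, hU, hxy⟩ : ∃ (T₃ : Finset OverT) (m₃ : ℕ) (U : Set OverZ), Uᶜ.Finite ∧
      inflZ D (charFun U) • inflT D (eulerElt (T₃ : Set OverT) m₃) •
        inflT D (eulerElt (T₁ : Set OverT) m₁) • x₂ =
      inflZ D (charFun U) • inflT D (eulerElt (T₃ : Set OverT) m₃) •
        inflT D (eulerElt (T₂ : Set OverT) m₂) • y₁ := by
    have hq := eq_mk_of_smul_eq (s := eulerOf T₁ m₁) hvq₁
    have hx := eq_mk_of_smul_eq (s := inflE D (eulerOf T₂ m₂)) hpx₂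
    obtain ⟨c, hc, h⟩ := (loc_mk_eq_iff _ _).1 (X.square v p 1 q₁ _ x₂ _ y₁ 1 hvp hq hx hqy₁)
    obtain ⟨_, ⟨e, he, rfl⟩, _, ⟨_, ⟨U, hU, rfl⟩, rfl⟩, rfl⟩ := Submonoid.mem_sup.1 hc
    obtain ⟨T₃, m₃, r, hr⟩ := exists_dvd_eulerElt he
    refine ⟨T₃, m₃, U, hU, ?_⟩
    simp only [Submonoid.coe_one, map_one, mul_one, coe_inflE, coe_eulerOf] at h
    have h' := congrArg (fun z => inflT D r • z) h
    simp only [smul_smul] at h'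
    rw [hr, map_mul, smul_smul, smul_smul, smul_smul, smul_smul]
    refine Eq.trans (congrArg (· • x₂) ?_) (h'.trans (congrArg (· • y₁) ?_)) <;> ring
  -- the three Euler elements are made equal
  obtain ⟨T, m, r₁, r₂, hq', hx', hy', hr₁, hr₂, hd⟩ : ∃ (T : Finset OverT) (m : ℕ) (r₁ r₂ : RingT),
      X.Q.Twisted (RingHom.id _) T m k (r₁ • q₁) ∧ X.N.Twisted (inflT D) T m k (inflT D r₂ • x₂) ∧
      X.N.Twisted (inflT D) T m k (inflT D r₁ • y₁) ∧
      r₁ * eulerElt (T₁ : Set OverT) m₁ = eulerElt (T : Set OverT) m ∧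
      r₂ * eulerElt (T₂ : Set OverT) m₂ = eulerElt (T : Set OverT) m ∧
      (∃ r : RingT, r₁ = r * (eulerElt (T₃ : Set OverT) m₃ * eulerElt (T₂ : Set OverT) m₂) ∧
        r₂ = r * (eulerElt (T₃ : Set OverT) m₃ * eulerElt (T₁ : Set OverT) m₁)) := by
    have key : ∀ (T₁ T' : Finset OverT) (m₁ m' : ℕ), ∃ r : RingT,
        r * eulerElt (T₁ : Set OverT) m₁ = eulerElt ((T₁ ∪ T' : Finset OverT) : Set OverT) (m₁ + m') ∧
        (∀ q, X.Q.Twisted (RingHom.id _) T₁ m₁ k q →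
          X.Q.Twisted (RingHom.id _) ↑(T₁ ∪ T' : Finset OverT) (m₁ + m') k (r • q)) ∧
        ∀ x, X.N.Twisted (inflT D) T₁ m₁ k x →
          X.N.Twisted (inflT D) ↑(T₁ ∪ T' : Finset OverT) (m₁ + m') k (inflT D r • x) := by
      intro T₁ T' m₁ m'
      refine ⟨_, enlarge_mul T₁ T' m₁ m', fun q hq => ?_, fun x hx => ?_⟩
      · rw [Finset.coe_union]; exact hq.enlarge preservesDegree_id
      · rw [Finset.coe_union]; exact hx.enlarge (preservesDegree_inflT D)
    obtain ⟨r₁, hr₁, hQ, hN⟩ := key T₁ (T₂ ∪ T₃) m₁ (m₂ + m₃)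
    obtain ⟨r₂, hr₂, -, hN'⟩ := key T₂ (T₁ ∪ T₃) m₂ (m₁ + m₃)
    have hT : T₂ ∪ (T₁ ∪ T₃) = T₁ ∪ (T₂ ∪ T₃) := by
      rw [← Finset.union_assoc, ← Finset.union_assoc, Finset.union_comm T₂]
    have hm : m₂ + (m₁ + m₃) = m₁ + (m₂ + m₃) := by omega
    rw [hT, hm] at hr₂ hN'
    have hd : ∀ (T' : Finset OverT) (m' : ℕ), T' ⊆ T₁ ∪ (T₂ ∪ T₃) → eulerElt (T' : Set OverT) m' ∣
        eulerElt ((T₁ ∪ (T₂ ∪ T₃) : Finset OverT) : Set OverT) m' :=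
      fun T' m' h => eulerElt_dvd_of_subset (Finset.coe_subset.2 h) m'
    obtain ⟨r, hr⟩ := mul_dvd_mul (hd T₁ m₁ Finset.subset_union_left) (mul_dvd_mul
      (hd T₂ m₂ (Finset.subset_union_left.trans Finset.subset_union_right))
      (hd T₃ m₃ (Finset.subset_union_right.trans Finset.subset_union_right)))
    rw [eulerElt_mul, eulerElt_mul] at hr
    refine ⟨_, _, r₁, r₂, hQ _ hq₁, hN' _ hx₂, hN _ hy₁, hr₁, hr₂, r, ?_, ?_⟩
    · refine sub_eq_zero.1 (eulerElt_cancel (U := (T₁ : Set OverT)) (m := m₁) ?_)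
      rw [sub_mul, hr₁, hr]; ring
    · refine sub_eq_zero.1 (eulerElt_cancel (U := (T₂ : Set OverT)) (m := m₂) ?_)
      rw [sub_mul, hr₂, hr]; ring
  obtain ⟨r, hr, hr'⟩ := hd
  obtain ⟨g, hg, -⟩ := exists_gen_of (T := T) (m := m) (v := v) (p := charFun U • p)
    (q := r₁ • q₁) (x := inflZ D (charFun U) • inflT D r₂ • x₂) hv
    (by simpa using X.P.smul_mem (i := 0) (a := charFun U) (fun _ => rfl) hp) hq'
    (hx'.smul_zero (inflZ_mem_degC D _))
    (by rw [hvp, mk_cofZ_eq_iff]; exact ⟨U, hU, by rw [smul_smul, charFun_mul_self]⟩)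
    (by
      refine eq_mk_of_smul_eq ?_
      rw [coe_eulerOf, ← hr₁, mul_smul, ← smul_mk_one, ← hvq₁]; rfl)
    (by
      refine eq_mk_of_smul_eq ?_
      rw [ext_smul_locInflZ, coe_inflE, coe_eulerOf, smul_comm, ← hr₂, ← smul_mk_one, map_mul,
        mul_smul, hpx₂, smul_mk_one])
    (by
      rw [ext_smul_locInflT, hqy₁, smul_mk_one, mk_cofF_eq_iff]
      refine ⟨U, hU, ?_⟩
      rw [smul_smul (inflZ D (charFun U)) (inflZ D (charFun U)), ← map_mul (inflZ D),
        charFun_mul_self, hr, hr', map_mul, map_mul, map_mul, map_mul, mul_smul, mul_smul,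
        mul_smul, mul_smul, smul_comm _ (inflT D r), smul_comm _ (inflT D r), hxy])
    (by rw [map_smul, act])
  exact ⟨T, m, g, hg⟩

theorem twisted_empty {R : Type} [CommRing R] {A : ℤ → Set R} {M : GrMod R A} {θ : RingT →+* R}
    {x : M} (hx : x ∈ M.gr k) : M.Twisted θ ((∅ : Finset OverT) : Set OverT) 0 k x := by
  rw [Finset.coe_empty]; exact .of_mem hx

theorem mk_euler_eq_zero {x : X.N} (e : eulerT) (h : inflT D e • x = 0) (s : eulerF D) :
    (LocalizedModule.mk x s : LocalizedModule (eulerF D) X.N) = 0 := by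
  rw [← LocalizedModule.zero_mk s]
  refine LocalizedModule.mk_eq.2 ⟨inflE D e, ?_⟩
  simp only [Submonoid.smul_def, coe_inflE]
  rw [smul_comm, h, smul_zero, smul_zero]

theorem mk_cofF_eq_zero {x : X.N} {n : OverZ} (h : inflZ D (charFun {n}) • x = x) :
    (LocalizedModule.mk x 1 : LocalizedModule (cofF D) X.N) = 0 := by
  rw [← LocalizedModule.zero_mk 1, mk_cofF_eq_iff]
  refine ⟨{n}ᶜ, by rw [compl_compl]; exact Set.finite_singleton n, ?_⟩
  rw [smul_zero, ← h, smul_smul, ← map_mul, charFun_mul, Set.compl_inter_self]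
  have : charFun (∅ : Set OverZ) = 0 := Set.indicator_empty 1
  rw [this, map_zero, zero_smul]

theorem mk_cofZ_eq_zero {p : X.P} {n : OverZ} (h : charFun {n} • p = p) :
    (LocalizedModule.mk p 1 : LocalizedModule cofZ X.P) = 0 := by
  rw [← LocalizedModule.zero_mk 1, mk_cofZ_eq_iff]
  refine ⟨{n}ᶜ, by rw [compl_compl]; exact Set.finite_singleton n, ?_⟩
  rw [smul_zero, ← h, smul_smul, charFun_mul, Set.compl_inter_self]
  have : charFun (∅ : Set OverZ) = 0 := Set.indicator_empty 1
  rw [this, zero_smul]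

theorem exists_gen_p {p : X.P} (hp : p ∈ X.P.gr k) {n : OverZ} (hn : charFun {n} • p = p)
    (act : X.actP p = p) :
    ∃ (T : Finset OverT) (m : ℕ) (g : Gen X T m k), g.v = 0 ∧ g.p = p ∧ g.q = 0 := by
  obtain ⟨T, m, x, hx, hpx⟩ := exists_twisted (preservesDegree_inflT D) (X.extP_gr k p hp)
  obtain ⟨g, h1, h2, h3, -⟩ := exists_gen_of (T := T) (m := m) (v := (0 : X.V)) (q := (0 : X.Q))
    (x := inflZ D (charFun {n}) • x) (zero_mem _) hp .zero
    (hx.smul_zero (inflZ_mem_degC D _)) (by rw [map_zero, mk_cofZ_eq_zero hn])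
    (by rw [map_zero, LocalizedModule.zero_mk])
    (by
      refine eq_mk_of_smul_eq ?_
      rw [coe_inflE, coe_eulerOf, ← smul_mk_one, ← hpx, smul_comm, ← ext_smul_locInflZ, hn])
    (by
      rw [map_zero, mk_cofF_eq_zero (n := n)]
      rw [smul_smul, ← map_mul, charFun_mul_self]) act
  exact ⟨T, m, g, h1, h2, h3⟩

theorem exists_gen_q {q : X.Q} (hq : q ∈ X.Q.gr k) (e : eulerT) (he : (e : RingT) • q = 0) :
    ∃ g : Gen X ∅ 0 k, g.v = 0 ∧ g.p = 0 ∧ g.q = q ∧ inflT D e • g.x = 0 := by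
  obtain ⟨x, hx, hqx⟩ := X.extQ_gr k q hq
  have h1 : X.extQ ((e : RingT) • q) = 0 := by rw [he, map_zero]
  rw [ext_smul_locInflT, hqx, smul_mk_one, ← LocalizedModule.zero_mk 1, mk_cofF_eq_iff] at h1
  obtain ⟨U, hU, h⟩ := h1
  have h2 : inflT D e • inflZ D (charFun U) • x = 0 := by rw [smul_comm, h, smul_zero]
  have hx' : inflZ D (charFun U) • x ∈ X.N.gr k := by
    simpa using X.N.smul_mem (inflZ_mem_degC D (charFun U)) hx
  obtain ⟨g, hv, hp, h3, h4⟩ := exists_gen_of (T := ∅) (m := 0) (v := (0 : X.V)) (p := (0 : X.P))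
    (q := q) (x := inflZ D (charFun U) • x) (zero_mem _) (zero_mem _) (twisted_empty hq)
    (twisted_empty hx') (by rw [map_zero, LocalizedModule.zero_mk])
    (by
      rw [map_zero, eq_comm, ← LocalizedModule.zero_mk (eulerOf ∅ 0)]
      refine LocalizedModule.mk_eq.2 ⟨e, ?_⟩
      simp only [Submonoid.smul_def]
      rw [smul_comm, he, smul_zero, smul_zero])
    (by rw [map_zero, mk_euler_eq_zero e h2])
    (by
      rw [hqx, mk_cofF_eq_iff]
      exact ⟨U, hU, by rw [smul_smul, ← map_mul, charFun_mul_self]⟩) (map_zero _)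
  refine ⟨g, hv, hp, h3, ?_⟩
  rw [h4, avgN, smul_comm, smul_add, ← map_smul, h2, map_zero, add_zero, smul_zero]

/-- The generators given by an element of `N` alone. -/
def genN {x : X.N} (hx : x ∈ X.N.gr k) {n : OverZ} (hn : inflZ D (charFun {n}) • x = x)
    (e : eulerT) (he : inflT D e • x = 0) (act : X.actN x = x) : Gen X ∅ 0 k where
  v := 0
  p := 0
  q := 0
  x := x
  v_mem := zero_mem _
  p_mem := zero_mem _
  q_mem := .zero
  x_mem := twisted_empty hx
  extVP := by rw [map_zero, LocalizedModule.zero_mk]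
  extVQ := by rw [map_zero, LocalizedModule.zero_mk]
  extP := by rw [map_zero, mk_euler_eq_zero e he]
  extQ := by rw [map_zero, mk_cofF_eq_zero hn]
  actP := map_zero _
  actN := act

end StandardModel

end

noncomputable section

namespace StandardModel

variable {D : FullSubgroups} {X Y Z : StandardModel D}

/-! ### The factors at the subgroups `H(∞, n)` -/

theorem idem_cofZ (n : OverZ) (y : LocalizedModule cofZ X.P) : charFun {n} • y = 0 := by
  obtain ⟨p, rfl⟩ := exists_mk_cofZ y
  rw [smul_mk_one]
  exact mk_cofZ_eq_zero (n := n) (by rw [smul_smul, charFun_mul_self])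

theorem idem_cofF (n : OverZ) (y : LocalizedModule (cofF D) X.N) :
    inflZ D (charFun {n}) • y = 0 := by
  obtain ⟨p, rfl⟩ := exists_mk_cofF y
  rw [smul_mk_one]
  exact mk_cofF_eq_zero (n := n) (by rw [smul_smul, ← map_mul, charFun_mul_self])

theorem loc_map_lsmul {R : Type} [CommRing R] {S : Submonoid R} {N : Type} [AddCommGroup N]
    [Module R N] (r : R) (y : LocalizedModule S N) :
    LocalizedModule.map S (LinearMap.lsmul R N r) y = r • y := by
  induction y using LocalizedModule.induction_on with
  | h x s => rw [LocalizedModule.map_mk, LocalizedModule.smul'_mk]; rfl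

/-- The projection to the factor at `H(∞, n)`. -/
def eHom (n : OverZ) (X : StandardModel D) : X ⟶ X :=
  homMk (X := X) (Y := X) 0 (LinearMap.lsmul RingZ X.P (charFun {n})) 0
    (LinearMap.lsmul (RingF D) X.N (inflZ D (charFun {n})))
    (fun _ _ _ => zero_mem _)
    (fun k p hp => by
      have := X.P.smul_mem (i := 0) (a := charFun {n}) (fun _ => rfl) hp
      rwa [zero_add] at this)
    (fun _ _ _ => zero_mem _)
    (fun k x hx => by
      have := X.N.smul_mem (inflZ_mem_degC D (charFun {n})) hx
      rwa [zero_add] at this)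
    (fun p => by rw [loc_map_lsmul, LinearMap.lsmul_apply, ext_smul_locInflZ])
    (fun q => by rw [loc_map_lsmul, LinearMap.zero_apply, map_zero, idem_cofF])
    (fun v => by rw [loc_map_lsmul, LinearMap.zero_apply, map_zero, idem_cofZ])
    (fun v => by rw [loc_map_zero, LinearMap.zero_apply, map_zero])
    (fun p => by rw [LinearMap.lsmul_apply, LinearMap.lsmul_apply, map_smul])
    (fun x => by rw [LinearMap.lsmul_apply, LinearMap.lsmul_apply, map_smul])

@[simp] theorem onP_eHom (n : OverZ) (p : X.P) : onP (eHom n X) p = charFun {n} • p := rfl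
@[simp] theorem onN_eHom (n : OverZ) (x : X.N) :
    onN (eHom n X) x = inflZ D (charFun {n}) • x := rfl

theorem eHom_comp (n : OverZ) (f : X ⟶ Y) : eHom n X ≫ f = f ≫ eHom n Y :=
  hom_ext (fun _ => map_zero (onV f)) (fun p => map_smul (onP f) _ p) (fun _ => map_zero (onQ f))
    (fun x => map_smul (onN f) _ x)

theorem eHom_eHom (n : OverZ) : eHom n X ≫ eHom n X = eHom n X :=
  hom_ext (fun _ => rfl)
    (fun p => by rw [onP_comp, onP_eHom, onP_eHom, smul_smul, charFun_mul_self]) (fun _ => rfl)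
    (fun p => by rw [onN_comp, onN_eHom, onN_eHom, smul_smul, ← map_mul, charFun_mul_self])

theorem charFun_empty {S : Type} : charFun (∅ : Set S) = 0 := Set.indicator_empty 1

theorem charFun_mul_of_ne {n n' : OverZ} (h : n ≠ n') :
    charFun {n} * charFun {n'} = (0 : RingZ) := by
  rw [charFun_mul, Set.singleton_inter_eq_empty.2 (by simpa using h), charFun_empty]

theorem eHom_eHom_of_ne {n n' : OverZ} (h : n ≠ n') : eHom n X ≫ eHom n' X = 0 :=
  hom_ext (fun _ => rfl)
    (fun p => by
      rw [onP_comp, onP_eHom, onP_eHom, smul_smul, charFun_mul_of_ne h.symm, zero_smul]; rfl)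
    (fun _ => rfl)
    (fun p => by
      rw [onN_comp, onN_eHom, onN_eHom, smul_smul, ← map_mul, charFun_mul_of_ne h.symm, map_zero,
        zero_smul]; rfl)

/-- The factor of `X` at `H(∞, n)`. -/
def part (n : OverZ) (X : StandardModel D) : StandardModel D := (Sub.range (eHom n X)).toModel

/-- The inclusion of the factor. -/
def partι (n : OverZ) (X : StandardModel D) : part n X ⟶ X := (Sub.range (eHom n X)).ι

theorem inj_partι (n : OverZ) (X : StandardModel D) : Inj (partι n X) := Sub.inj_ι _

theorem exists_partπ (n : OverZ) (X : StandardModel D) :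
    ∃ f : X ⟶ part n X, f ≫ partι n X = eHom n X :=
  Sub.exists_lift_ι _ _ (fun z => ⟨z, trivial, rfl⟩) (fun z => ⟨z, trivial, rfl⟩)
    (fun z => ⟨z, trivial, rfl⟩) (fun z => ⟨z, trivial, rfl⟩)

/-- The projection to the factor. -/
def partπ (n : OverZ) (X : StandardModel D) : X ⟶ part n X := (exists_partπ n X).choose

@[simp]
theorem partπ_ι (n : OverZ) (X : StandardModel D) : partπ n X ≫ partι n X = eHom n X :=
  (exists_partπ n X).choose_spec

theorem partι_eHom (n : OverZ) (X : StandardModel D) : partι n X ≫ eHom n X = partι n X := by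
  refine hom_ext ?_ ?_ ?_ ?_
  · rintro ⟨_, v, -, rfl⟩; rfl
  · rintro ⟨_, p, -, rfl⟩
    exact congrArg (fun f => onP f p) (eHom_eHom n)
  · rintro ⟨_, v, -, rfl⟩; rfl
  · rintro ⟨_, p, -, rfl⟩
    exact congrArg (fun f => onN f p) (eHom_eHom n)

@[simp]
theorem partι_π (n : OverZ) (X : StandardModel D) : partι n X ≫ partπ n X = 𝟙 _ := by
  have := (inj_partι n X).mono
  rw [← cancel_mono (partι n X), Category.assoc, partπ_ι, partι_eHom, Category.id_comp]

theorem eHom_part (n : OverZ) (X : StandardModel D) : eHom n (part n X) = 𝟙 _ := by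
  have := (inj_partι n X).mono
  rw [← cancel_mono (partι n X), eHom_comp, partι_eHom, Category.id_comp]

theorem eHom_part_of_ne {n n' : OverZ} (h : n ≠ n') (X : StandardModel D) :
    eHom n' (part n X) = 0 := by
  have := (inj_partι n X).mono
  rw [← cancel_mono (partι n X), eHom_comp, ← partι_eHom, Category.assoc, eHom_eHom_of_ne h,
    Limits.comp_zero, Limits.zero_comp]

theorem surj_partπ (n : OverZ) (X : StandardModel D) : Surj (partπ n X) := by
  have h := partι_π n X
  exact ⟨fun y => ⟨_, congrArg (fun f => onV f y) h⟩, fun y => ⟨_, congrArg (fun f => onP f y) h⟩,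
    fun y => ⟨_, congrArg (fun f => onQ f y) h⟩, fun y => ⟨_, congrArg (fun f => onN f y) h⟩⟩

/-- `X` is its own factor at `H(∞, n)`. -/
def AtZ (n : OverZ) (X : StandardModel D) : Prop := eHom n X = 𝟙 X

theorem atZ_part (n : OverZ) (X : StandardModel D) : AtZ n (part n X) := eHom_part n X

theorem AtZ.V {n : OverZ} (h : AtZ n X) : Subsingleton X.V :=
  subsingleton_of_forall_eq 0 fun v => (congrArg (fun f => onV f v) h).symm
theorem AtZ.Q {n : OverZ} (h : AtZ n X) : Subsingleton X.Q :=
  subsingleton_of_forall_eq 0 fun v => (congrArg (fun f => onQ f v) h).symm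
theorem AtZ.P {n : OverZ} (h : AtZ n X) (p : X.P) : charFun {n} • p = p :=
  congrArg (fun f => onP f p) h
theorem AtZ.N {n : OverZ} (h : AtZ n X) (x : X.N) : inflZ D (charFun {n}) • x = x :=
  congrArg (fun f => onN f x) h

theorem atZ_of {n : OverZ} (hV : Subsingleton X.V) (hQ : Subsingleton X.Q)
    (hP : ∀ p : X.P, charFun {n} • p = p) (hN : ∀ x : X.N, inflZ D (charFun {n}) • x = x) :
    AtZ n X :=
  hom_ext (fun _ => Subsingleton.elim _ _) hP (fun _ => Subsingleton.elim _ _) hN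

theorem AtZ.of_inj {n : OverZ} {f : X ⟶ Y} (hf : Inj f) (h : AtZ n Y) : AtZ n X := by
  have := hf.mono
  rw [AtZ, ← cancel_mono f, eHom_comp, h, Category.comp_id, Category.id_comp]

theorem AtZ.of_surj {n : OverZ} {f : X ⟶ Y} (hf : Surj f) (h : AtZ n X) : AtZ n Y := by
  have := hf.epi
  rw [AtZ, ← cancel_epi f, ← eHom_comp, h, Category.comp_id, Category.id_comp]

/-! ### The sign twist -/

theorem sub_mem_degC {S : Type} {i : ℤ} {a b : (S → ℚ)[X]} (ha : a ∈ degC S i) (hb : b ∈ degC S i) :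
    a - b ∈ degC S i := fun k hk => by
  by_cases h : a.coeff k = 0
  · exact hb k fun h' => hk (by rw [coeff_sub, h, h', sub_zero])
  · exact ha k h

theorem disc_mul_self : disc D * disc D = disc D := idem_mul_self _
theorem conn_mul_self : conn D * conn D = conn D := idem_mul_self _
theorem disc_mul_conn : disc D * conn D = 0 := by
  rw [disc, conn, idem_mul, Set.inter_compl_self, idem_empty]

theorem conn_sub_disc_mul_self : (conn D - disc D) * (conn D - disc D) = 1 := by
  rw [← disc_add_conn]
  linear_combination (conn_mul_self (D := D)) + (disc_mul_self (D := D)) -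
    2 * (disc_mul_conn (D := D))

theorem _root_.ExhibitsBaseChange.eq_zero {R A : Type} [CommRing R] [CommRing A] {σ : R →+* A}
    {M L : Type} [AddCommGroup M] [Module R M] [AddCommGroup L] [Module A L] {f : M →ₛₗ[σ] L}
    (h : ExhibitsBaseChange σ f) (hM : Subsingleton M) (y : L) : y = 0 := by
  have h' : Set.range f ⊆ {0} := by
    rintro _ ⟨q, rfl⟩
    rw [Subsingleton.elim q 0, map_zero]; rfl
  have h2 : y ∈ Submodule.span A (Set.range f) := h.span_range ▸ trivial
  exact (Submodule.mem_bot A).1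
    ((Submodule.span_le.2 (h'.trans (Set.singleton_subset_iff.2 (zero_mem ⊥)))) h2)

/-- The object with the action of the component groups twisted by the sign. -/
def twist (X : StandardModel D) [hV : Subsingleton X.V] [hQ : Subsingleton X.Q] :
    StandardModel D where
  V := X.V
  P := X.P
  Q := X.Q
  N := X.N
  extP := X.extP
  extQ := X.extQ
  extVP := X.extVP
  extVQ := X.extVQ
  extP_baseChange := X.extP_baseChange
  extQ_baseChange := X.extQ_baseChange
  extVP_baseChange := X.extVP_baseChange
  extVQ_baseChange := X.extVQ_baseChange
  extP_gr := X.extP_gr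
  extQ_gr := X.extQ_gr
  extVP_gr := X.extVP_gr
  extVQ_gr := X.extVQ_gr
  square := X.square
  actP := -X.actP
  actN := (LinearMap.lsmul (RingF D) X.N (conn D - disc D)).comp X.actN
  actP_gr k p hp := neg_mem (X.actP_gr k p hp)
  actN_gr k x hx := by
    have := X.N.smul_mem (show conn D - disc D ∈ degC _ 0 from
      sub_mem_degC (idem_mem_degC _) (idem_mem_degC _))
      (X.actN_gr k x hx)
    rw [zero_add] at this
    exact this
  actP_actP p := by
    rw [LinearMap.neg_apply, LinearMap.neg_apply, map_neg, X.actP_actP, neg_neg]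
  actN_actN x := by
    simp only [LinearMap.comp_apply, LinearMap.lsmul_apply, map_smul]
    rw [smul_smul, conn_sub_disc_mul_self, one_smul, X.actN_actN]
  actN_connected x := by
    change conn D • (conn D - disc D) • X.actN x = conn D • x
    have h : conn D * (conn D - disc D) = conn D := by
      linear_combination (conn_mul_self (D := D)) - disc_mul_conn (D := D)
    rw [smul_smul, h, conn_smul_actN]
  extP_act p x e h := by
    have h1 := X.extP_act p x e h
    change disc D • X.extP (-X.actP p) = disc D • LocalizedModule.mk ((conn D - disc D) • X.actN x) e
    have h2 : disc D * (conn D - disc D) = -disc D := by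
      linear_combination (disc_mul_conn (D := D)) - disc_mul_self (D := D)
    rw [map_neg, smul_neg, ← LocalizedModule.smul'_mk, smul_smul, h2, neg_smul]
    exact congrArg Neg.neg h1
  actN_cof x :=
    (X.extQ_baseChange.eq_zero hQ _).trans (X.extQ_baseChange.eq_zero hQ _).symm
  actP_cof p :=
    (X.extVP_baseChange.eq_zero hV _).trans (X.extVP_baseChange.eq_zero hV _).symm

section Twist

variable [Subsingleton X.V] [Subsingleton X.Q] [Subsingleton Y.V] [Subsingleton Y.Q]

instance : Subsingleton (twist X).V := inferInstanceAs (Subsingleton X.V)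
instance : Subsingleton (twist X).Q := inferInstanceAs (Subsingleton X.Q)

/-- The twist of a morphism. -/
def twistHom (f : X ⟶ Y) : twist X ⟶ twist Y :=
  homMk (X := twist X) (Y := twist Y) (onV (X := X) (Y := Y) f)
    (onP (X := X) (Y := Y) f) (onQ (X := X) (Y := Y) f) (onN (X := X) (Y := Y) f) (Hom.onV_gr f) (Hom.onP_gr f)
    (Hom.onQ_gr f) (Hom.onN_gr f) (extP_onP f) (extQ_onQ f) (extVP_onV f) (extVQ_onV f)
    (fun p => (map_neg (onP (X := X) (Y := Y) f) _).trans (congrArg Neg.neg (onP_actP f p)))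
    (fun x => (map_smul (onN (X := X) (Y := Y) f) _ _).trans
      (congrArg ((conn D - disc D) • ·) (onN_actN f x)))

/-- Twisting twice changes nothing. -/
def twistTwist (X : StandardModel D) [Subsingleton X.V] [Subsingleton X.Q] :
    twist (twist X) ⟶ X :=
  homMk (X := twist (twist X)) (Y := X) LinearMap.id LinearMap.id LinearMap.id LinearMap.id
    (fun _ _ h => h) (fun _ _ h => h) (fun _ _ h => h) (fun _ _ h => h)
    (fun _ => (loc_map_id _).symm) (fun _ => (loc_map_id _).symm) (fun _ => (loc_map_id _).symm)
    (fun _ => (loc_map_id _).symm)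
    (fun p => by
      change -(-X.actP p) = X.actP p
      rw [neg_neg])
    (fun x => by
      change (conn D - disc D) • (conn D - disc D) • X.actN x = X.actN x
      rw [smul_smul, conn_sub_disc_mul_self, one_smul])

theorem inj_twistHom {f : X ⟶ Y} (hf : Inj f) : Inj (twistHom f) :=
  ⟨fun _ _ h => hf.V h, fun _ _ h => hf.P h, fun _ _ h => hf.Q h, fun _ _ h => hf.N h⟩

end Twist

instance (n : OverZ) : Subsingleton (part n X).V := (atZ_part n X).V
instance (n : OverZ) : Subsingleton (part n X).Q := (atZ_part n X).Q

end StandardModel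

end

noncomputable section

namespace StandardModel

variable {D : FullSubgroups} {X Y Z : StandardModel D}

/-! ### Torsion -/

theorem exists_smul_eq_zero {R : Type} [CommRing R] {S : Submonoid R} {M : Type} [AddCommGroup M]
    [Module R M] {x : M} (h : (LocalizedModule.mk x 1 : LocalizedModule S M) = 0) :
    ∃ s ∈ S, s • x = 0 := by
  rw [← LocalizedModule.zero_mk 1, LocalizedModule.mk_eq] at h
  obtain ⟨u, hu⟩ := h
  rw [one_smul, smul_zero, smul_zero] at hu
  exact ⟨u, u.2, hu⟩

theorem exists_euler_smul_Q (hV : Subsingleton X.V) (q : X.Q) :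
    ∃ e ∈ eulerT, e • q = 0 :=
  exists_smul_eq_zero (X.extVQ_baseChange.eq_zero hV _)

theorem exists_euler_smul_N (hP : Subsingleton X.P) (x : X.N) :
    ∃ e ∈ eulerT, inflT D e • x = 0 := by
  obtain ⟨_, ⟨e, he, rfl⟩, h⟩ := exists_smul_eq_zero (X.extP_baseChange.eq_zero hP
    (LocalizedModule.mk x 1))
  exact ⟨e, he, h⟩

theorem sum_charFun {S : Type} (K : Finset S) :
    ∑ n ∈ K, charFun {n} = charFun (K : Set S) := by
  classical
  funext i
  simp [Finset.sum_apply, charFun_apply]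

theorem eq_sum_of_cof {R M : Type} [CommRing R] [AddCommGroup M] [Module R M] (σ : RingZ →+* R)
    {T : Set OverZ} (hT : Tᶜ.Finite) {x : M} (h : σ (charFun T) • x = 0) :
    ∃ K : Finset OverZ, x = ∑ n ∈ K, σ (charFun {n}) • x := by
  refine ⟨hT.toFinset, ?_⟩
  rw [← Finset.sum_smul, ← map_sum, sum_charFun, hT.coe_toFinset]
  conv_lhs => rw [← one_smul R x, ← map_one σ, ← charFun_add_compl T, map_add, add_smul, h, zero_add]

theorem exists_eq_sum_P (hV : Subsingleton X.V) (p : X.P) :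
    ∃ K : Finset OverZ, p = ∑ n ∈ K, charFun {n} • p := by
  obtain ⟨_, ⟨T, hT, rfl⟩, h⟩ := exists_smul_eq_zero (X.extVP_baseChange.eq_zero hV
    (LocalizedModule.mk p 1))
  exact eq_sum_of_cof (RingHom.id RingZ) hT h

theorem exists_eq_sum_N (hQ : Subsingleton X.Q) (x : X.N) :
    ∃ K : Finset OverZ, x = ∑ n ∈ K, inflZ D (charFun {n}) • x := by
  obtain ⟨_, ⟨_, ⟨T, hT, rfl⟩, rfl⟩, h⟩ := exists_smul_eq_zero (X.extQ_baseChange.eq_zero hQ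
    (LocalizedModule.mk x 1))
  exact eq_sum_of_cof (inflZ D) hT h

/-- Morphisms from an object without `V` and `Q` are determined on the factors. -/
theorem hom_ext_eHom (hV : Subsingleton X.V) (hQ : Subsingleton X.Q) {f g : X ⟶ Y}
    (h : ∀ n, eHom n X ≫ f = eHom n X ≫ g) : f = g := by
  refine hom_ext (fun v => ?_) (fun p => ?_) (fun q => ?_) (fun x => ?_)
  · rw [Subsingleton.elim v 0, map_zero, map_zero]
  · obtain ⟨K, hK⟩ := exists_eq_sum_P hV p
    rw [hK, map_sum, map_sum]
    exact Finset.sum_congr rfl fun n _ => congrArg (fun f => onP f p) (h n)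
  · rw [Subsingleton.elim q 0, map_zero, map_zero]
  · obtain ⟨K, hK⟩ := exists_eq_sum_N hQ x
    rw [hK, map_sum, map_sum]
    exact Finset.sum_congr rfl fun n _ => congrArg (fun f => onN f x) (h n)

/-! ### Divisible objects -/

/-- The Euler classes act surjectively. -/
structure Divisible (X : StandardModel D) : Prop where
  Q : ∀ (H : OverT) (q : X.Q), ∃ q', eulerClass H • q' = q
  N : ∀ (H : OverT) (x : X.N), ∃ x', inflT D (eulerClass H) • x' = x

theorem Divisible.of_joint {f : X ⟶ Z} {g : Y ⟶ Z} (hX : Divisible X) (hY : Divisible Y)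
    (hQ : ∀ z, ∃ x y, onQ f x + onQ g y = z) (hN : ∀ z, ∃ x y, onN f x + onN g y = z) :
    Divisible Z where
  Q H z := by
    obtain ⟨x, y, rfl⟩ := hQ z
    obtain ⟨x, rfl⟩ := hX.Q H x
    obtain ⟨y, rfl⟩ := hY.Q H y
    exact ⟨onQ f x + onQ g y, by rw [smul_add, map_smul, map_smul]⟩
  N H z := by
    obtain ⟨x, y, rfl⟩ := hN z
    obtain ⟨x, rfl⟩ := hX.N H x
    obtain ⟨y, rfl⟩ := hY.N H y
    exact ⟨onN f x + onN g y, by rw [smul_add, map_smul, map_smul]⟩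

theorem Divisible.of_surj {f : X ⟶ Y} (hf : Surj f) (h : Divisible X) : Divisible Y :=
  h.of_joint (f := f) (g := f) h
    (fun z => (hf.Q z).imp fun x hx => ⟨0, by rw [map_zero, add_zero, hx]⟩)
    (fun z => (hf.N z).imp fun x hx => ⟨0, by rw [map_zero, add_zero, hx]⟩)

theorem Divisible.part (h : Divisible X) (n : OverZ) : Divisible (part n X) :=
  h.of_surj (surj_partπ n X)

theorem Divisible.twist [Subsingleton X.V] [Subsingleton X.Q] (h : Divisible X) :
    Divisible (twist X) := ⟨h.Q, h.N⟩

theorem Divisible.dsum {J : Type} {X : J → StandardModel D} (h : ∀ j, Divisible (X j)) :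
    Divisible (dsum X) where
  Q H q := by
    refine dsum_inductionQ q ⟨0, smul_zero _⟩ (fun j m => ?_) ?_
    · obtain ⟨m, rfl⟩ := (h j).Q H m
      exact ⟨onQ (inj X j) m, (map_smul _ _ _).symm⟩
    · rintro _ _ ⟨a, rfl⟩ ⟨b, rfl⟩
      exact ⟨a + b, smul_add _ _ _⟩
  N H q := by
    refine dsum_inductionN q ⟨0, smul_zero _⟩ (fun j m => ?_) ?_
    · obtain ⟨m, rfl⟩ := (h j).N H m
      exact ⟨onN (inj X j) m, (map_smul _ _ _).symm⟩
    · rintro _ _ ⟨a, rfl⟩ ⟨b, rfl⟩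
      exact ⟨a + b, smul_add _ _ _⟩

theorem divisible_of_generators {M : Type} [AddCommGroup M] [Module RingT M]
    (h : ∀ (H : OverT) (x : M), ∃ x', eulerClass H • x' = x) {e : RingT} (he : e ∈ eulerT) :
    ∀ x : M, ∃ x', e • x' = x := by
  induction he using Submonoid.closure_induction with
  | mem e he => obtain ⟨H, rfl⟩ := he; exact h H
  | one => exact fun x => ⟨x, one_smul _ x⟩
  | mul a b _ _ ha hb =>
    intro x
    obtain ⟨x, rfl⟩ := ha x
    obtain ⟨x, rfl⟩ := hb x
    exact ⟨x, mul_smul _ _ _⟩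

theorem Divisible.exists_Q (h : Divisible X) {e : RingT} (he : e ∈ eulerT) (q : X.Q) :
    ∃ q', e • q' = q := divisible_of_generators h.Q he q

theorem Divisible.exists_N (h : Divisible X) {e : RingT} (he : e ∈ eulerT) (x : X.N) :
    ∃ x', inflT D e • x' = x := by
  let : Module RingT X.N := Module.compHom X.N (inflT D)
  exact divisible_of_generators h.N he x

theorem divisible_large (k : ℤ) : Divisible (large D k) where
  Q H q := ⟨⟨_, mul_eulerInv_mem_hull id {H} 1 q.2⟩, Subtype.ext (by
    rw [eulerClass_eq]
    change toLaurent (eulerElt {H} 1) * (eulerInv (id ⁻¹' (({H} : Finset OverT) : Set OverT)) 1 * q.1) = q.1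
    rw [← mul_assoc, Finset.coe_singleton]
    exact (congrArg (· * q.1) (eulerElt_mul_eulerInv {H} 1)).trans (one_mul _))⟩
  N H q := ⟨⟨_, mul_eulerInv_mem_hull FiniteSubgroup.mulT {H} 1 q.2⟩, Subtype.ext (by
    rw [eulerClass_eq, inflT_eulerElt]
    change toLaurent (eulerElt (FiniteSubgroup.mulT ⁻¹' {H}) 1) *
      (eulerInv (FiniteSubgroup.mulT ⁻¹' (({H} : Finset OverT) : Set OverT)) 1 * q.1) = q.1
    rw [← mul_assoc, Finset.coe_singleton]
    exact (congrArg (· * q.1) (eulerElt_mul_eulerInv _ 1)).trans (one_mul _))⟩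

/-! ### Essential extensions -/

/-- Every morphism into `Y` whose range meets `X` trivially vanishes. -/
structure Essential (i : X ⟶ Y) : Prop where
  inj : Inj i
  eq_zero : ∀ {W : StandardModel D} (d : W ⟶ Y),
    (Sub.ker (d ≫ (Sub.range i).π)).ι ≫ d = 0 → d = 0

/-- A morphism into an essential extension of `X` that agrees on the preimage of `X` with a morphism
into `X` is equal to it. -/
theorem Essential.eq_comp {i : X ⟶ Y} (hi : Essential i) {W : StandardModel D} (f : W ⟶ Y)
    (h : W ⟶ X) (hh : (Sub.ker (f ≫ (Sub.range i).π)).ι ≫ f =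
      (Sub.ker (f ≫ (Sub.range i).π)).ι ≫ h ≫ i) : f = h ≫ i := by
  rw [← sub_eq_zero]
  apply hi.eq_zero
  have h1 : (f - h ≫ i) ≫ (Sub.range i).π = f ≫ (Sub.range i).π := by
    rw [Preadditive.sub_comp, Category.assoc, comp_π_range, Limits.comp_zero, sub_zero]
  rw [h1, Preadditive.comp_sub, hh, sub_self]

instance (X : StandardModel D) : Preorder (Sub X) :=
  Preorder.lift fun Γ => (Γ.V, Γ.P, Γ.Q, Γ.N)

theorem exists_of_mem_iSup {R M J : Type} [CommRing R] [AddCommGroup M] [Module R M] [Nonempty J]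
    {N : J → Submodule R M} (hN : Directed (· ≤ ·) N) {x : M} (hx : x ∈ ⨆ j, N j) :
    ∃ j, x ∈ N j := (Submodule.mem_iSup_of_directed N hN).1 hx

theorem inj_comp_π {i : X ⟶ Y} (Γ : Sub Y) (hV : ∀ x, onV i x ∈ Γ.V → x = 0)
    (hP : ∀ x, onP i x ∈ Γ.P → x = 0) (hQ : ∀ x, onQ i x ∈ Γ.Q → x = 0)
    (hN : ∀ x, onN i x ∈ Γ.N → x = 0) : Inj (i ≫ Γ.π) :=
  ⟨(injective_iff_map_eq_zero _).2 fun x hx => hV x ((Sub.onV_π Γ).1 hx),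
    (injective_iff_map_eq_zero _).2 fun x hx => hP x ((Sub.onP_π Γ).1 hx),
    (injective_iff_map_eq_zero _).2 fun x hx => hQ x ((Sub.onQ_π Γ).1 hx),
    (injective_iff_map_eq_zero _).2 fun x hx => hN x ((Sub.onN_π Γ).1 hx)⟩

/-- Every extension has an essential quotient. -/
theorem exists_essential {i : X ⟶ Y} (hi : Inj i) : ∃ Γ : Sub Y, Essential (i ≫ Γ.π) := by
  obtain ⟨Γ, -, hΓ⟩ := zorn_le_nonempty₀ {Γ : Sub Y | Inj (i ≫ Γ.π)} (fun c hc hchain Γ₀ hΓ₀ => by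
      have : Nonempty c := ⟨⟨Γ₀, hΓ₀⟩⟩
      have hd : Directed (· ≤ ·) fun Γ : c => Γ.1 := hchain.directed
      refine ⟨Sub.iSup fun Γ : c => Γ.1, ?_, fun Γ hΓ => ⟨le_iSup (fun Γ : c => Γ.1.V) ⟨Γ, hΓ⟩,
        le_iSup (fun Γ : c => Γ.1.P) ⟨Γ, hΓ⟩, le_iSup (fun Γ : c => Γ.1.Q) ⟨Γ, hΓ⟩,
        le_iSup (fun Γ : c => Γ.1.N) ⟨Γ, hΓ⟩⟩⟩
      refine inj_comp_π _ (fun x hx => ?_) (fun x hx => ?_) (fun x hx => ?_) (fun x hx => ?_)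
      · obtain ⟨Γ, hx⟩ := exists_of_mem_iSup (hd.mono_comp _ fun _ _ h => h.1) hx
        exact (injective_iff_map_eq_zero _).1 (hc Γ.2).V x ((Sub.onV_π Γ.1).2 hx)
      · obtain ⟨Γ, hx⟩ := exists_of_mem_iSup (hd.mono_comp _ fun _ _ h => h.2.1) hx
        exact (injective_iff_map_eq_zero _).1 (hc Γ.2).P x ((Sub.onP_π Γ.1).2 hx)
      · obtain ⟨Γ, hx⟩ := exists_of_mem_iSup (hd.mono_comp _ fun _ _ h => h.2.2.1) hx
        exact (injective_iff_map_eq_zero _).1 (hc Γ.2).Q x ((Sub.onQ_π Γ.1).2 hx)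
      · obtain ⟨Γ, hx⟩ := exists_of_mem_iSup (hd.mono_comp _ fun _ _ h => h.2.2.2) hx
        exact (injective_iff_map_eq_zero _).1 (hc Γ.2).N x ((Sub.onN_π Γ.1).2 hx))
    (Sub.ker (𝟙 Y)) (inj_comp_π _ (fun x hx => hi.V (hx.trans (map_zero _).symm))
      (fun x hx => hi.P (hx.trans (map_zero _).symm)) (fun x hx => hi.Q (hx.trans (map_zero _).symm))
      (fun x hx => hi.N (hx.trans (map_zero _).symm)))
  refine ⟨Γ, hΓ.1, fun {W} d hd => ?_⟩
  have kV (w) (x) (h : onV (i ≫ Γ.π) x = onV d w) : onV d w = 0 :=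
    congrArg (fun f => onV f (⟨w, (Sub.onV_π (Sub.range (i ≫ Γ.π))).2 ⟨x, trivial, h⟩⟩ :
      (Sub.ker (d ≫ (Sub.range (i ≫ Γ.π)).π)).V)) hd
  have kP (w) (x) (h : onP (i ≫ Γ.π) x = onP d w) : onP d w = 0 :=
    congrArg (fun f => onP f (⟨w, (Sub.onP_π (Sub.range (i ≫ Γ.π))).2 ⟨x, trivial, h⟩⟩ :
      (Sub.ker (d ≫ (Sub.range (i ≫ Γ.π)).π)).P)) hd
  have kQ (w) (x) (h : onQ (i ≫ Γ.π) x = onQ d w) : onQ d w = 0 :=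
    congrArg (fun f => onQ f (⟨w, (Sub.onQ_π (Sub.range (i ≫ Γ.π))).2 ⟨x, trivial, h⟩⟩ :
      (Sub.ker (d ≫ (Sub.range (i ≫ Γ.π)).π)).Q)) hd
  have kN (w) (x) (h : onN (i ≫ Γ.π) x = onN d w) : onN d w = 0 :=
    congrArg (fun f => onN f (⟨w, (Sub.onN_π (Sub.range (i ≫ Γ.π))).2 ⟨x, trivial, h⟩⟩ :
      (Sub.ker (d ≫ (Sub.range (i ≫ Γ.π)).π)).N)) hd
  have hle : Γ ≤ Sub.ker (Γ.π ≫ (Sub.range d).π) :=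
    ⟨fun x hx => (congrArg (onV (Sub.range d).π) ((Sub.onV_π Γ).2 hx)).trans (map_zero _),
      fun x hx => (congrArg (onP (Sub.range d).π) ((Sub.onP_π Γ).2 hx)).trans (map_zero _),
      fun x hx => (congrArg (onQ (Sub.range d).π) ((Sub.onQ_π Γ).2 hx)).trans (map_zero _),
      fun x hx => (congrArg (onN (Sub.range d).π) ((Sub.onN_π Γ).2 hx)).trans (map_zero _)⟩
  have hge := hΓ.2 (y := Sub.ker (Γ.π ≫ (Sub.range d).π)) (inj_comp_π _
    (fun x hx => by
      obtain ⟨w, -, hw⟩ := (Sub.onV_π _).1 (show onV (Sub.range d).π (onV Γ.π (onV i x)) = 0 from hx)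
      exact (injective_iff_map_eq_zero _).1 hΓ.1.V x (hw.symm.trans (kV w x hw.symm)))
    (fun x hx => by
      obtain ⟨w, -, hw⟩ := (Sub.onP_π _).1 (show onP (Sub.range d).π (onP Γ.π (onP i x)) = 0 from hx)
      exact (injective_iff_map_eq_zero _).1 hΓ.1.P x (hw.symm.trans (kP w x hw.symm)))
    (fun x hx => by
      obtain ⟨w, -, hw⟩ := (Sub.onQ_π _).1 (show onQ (Sub.range d).π (onQ Γ.π (onQ i x)) = 0 from hx)
      exact (injective_iff_map_eq_zero _).1 hΓ.1.Q x (hw.symm.trans (kQ w x hw.symm)))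
    (fun x hx => by
      obtain ⟨w, -, hw⟩ := (Sub.onN_π _).1 (show onN (Sub.range d).π (onN Γ.π (onN i x)) = 0 from hx)
      exact (injective_iff_map_eq_zero _).1 hΓ.1.N x (hw.symm.trans (kN w x hw.symm)))) hle
  refine hom_ext (fun w => ?_) (fun w => ?_) (fun w => ?_) (fun w => ?_)
  · obtain ⟨y, hy⟩ := (Sub.surj_π Γ).V (onV d w)
    exact hy.symm.trans ((Sub.onV_π Γ).2 (hge.1 ((Sub.onV_π _).2 ⟨w, trivial, hy.symm⟩)))
  · obtain ⟨y, hy⟩ := (Sub.surj_π Γ).P (onP d w)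
    exact hy.symm.trans ((Sub.onP_π Γ).2 (hge.2.1 ((Sub.onP_π _).2 ⟨w, trivial, hy.symm⟩)))
  · obtain ⟨y, hy⟩ := (Sub.surj_π Γ).Q (onQ d w)
    exact hy.symm.trans ((Sub.onQ_π Γ).2 (hge.2.2.1 ((Sub.onQ_π _).2 ⟨w, trivial, hy.symm⟩)))
  · obtain ⟨y, hy⟩ := (Sub.surj_π Γ).N (onN d w)
    exact hy.symm.trans ((Sub.onN_π Γ).2 (hge.2.2.2 ((Sub.onN_π _).2 ⟨w, trivial, hy.symm⟩)))

/-- An object all of whose extensions split is injective. -/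
theorem injective_of_split
    (h : ∀ (Y : StandardModel D) (i : X ⟶ Y), Inj i →
      ∃ (Z : StandardModel D) (j : Y ⟶ Z), Inj (i ≫ j) ∧ Surj (i ≫ j)) : Injective X where
  factors {A B} g f hf := by
    have : Mono (pushout.inl g f) := Abelian.mono_pushout_of_mono_g g f
    obtain ⟨Z, j, hj, hj'⟩ := h _ _ (mono_iff.1 this)
    have := isIso_of_inj_surj hj hj'
    refine ⟨pushout.inr g f ≫ j ≫ inv (pushout.inl g f ≫ j), ?_⟩
    rw [← Category.assoc, ← pushout.condition, Category.assoc, ← Category.assoc _ j,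
      IsIso.hom_inv_id, Category.comp_id]

/-- The range of `i` is everything as soon as the cokernel is zero. -/
theorem surj_of_π_eq_zero {i : X ⟶ Y} (h : (Sub.range i).π = 0) : Surj i where
  V y := ((Sub.onV_π _).1 (congrArg (fun f => onV f y) h)).imp fun _ h => h.2
  P y := ((Sub.onP_π _).1 (congrArg (fun f => onP f y) h)).imp fun _ h => h.2
  Q y := ((Sub.onQ_π _).1 (congrArg (fun f => onQ f y) h)).imp fun _ h => h.2
  N y := ((Sub.onN_π _).1 (congrArg (fun f => onN f y) h)).imp fun _ h => h.2

end StandardModel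

end

noncomputable section

namespace StandardModel

variable {D : FullSubgroups} {X Y Z : StandardModel D}

/-! ### Homogeneous components of torsion elements -/

theorem eulerElt_smul_proj {R : Type} [CommRing R] {A : ℤ → Set R} {θ : RingT →+* R}
    (hθ : PreservesDegree θ A) {M : GrMod R A} {U : Set OverT} {m : ℕ} {x : M}
    (h : θ (eulerElt U m) • x = 0) (k : ℤ) : θ (eulerElt U m) • M.proj k x = 0 := by
  have h1 : θ (idem U * X ^ m) • x = 0 := by
    rw [← idem_mul_eulerElt, map_mul, mul_smul, h, smul_zero]
  have h2 : θ (idem Uᶜ) • x = 0 := by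
    rw [← idem_compl_mul_eulerElt U m, map_mul, mul_smul, h, smul_zero]
  rw [eulerElt, map_add, add_smul, ← GrMod.proj_smul (hθ _ _ (idem_mul_X_pow_mem_degC U m)), h1,
    ← GrMod.proj_smul_zero (hθ _ _ (idem_mem_degC Uᶜ)), h2, map_zero, map_zero, add_zero]

theorem exists_eulerElt_smul_proj {R : Type} [CommRing R] {A : ℤ → Set R} {θ : RingT →+* R}
    (hθ : PreservesDegree θ A) {M : GrMod R A} {e : RingT} (he : e ∈ eulerT) {x : M}
    (h : θ e • x = 0) : ∃ e' ∈ eulerT, ∀ k, θ e' • M.proj k x = 0 := by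
  obtain ⟨T, m, r, hr⟩ := exists_dvd_eulerElt he
  refine ⟨_, eulerElt_mem T m, eulerElt_smul_proj hθ ?_⟩
  rw [hr, mul_comm, map_mul, mul_smul, h, smul_zero]

theorem eq_zero_of_classes {M : Type} [AddCommGroup M] [Module RingT M]
    (h : ∀ (H : OverT) (x : M), eulerClass H • x = 0 → x = 0) {e : RingT} (he : e ∈ eulerT) :
    ∀ x : M, e • x = 0 → x = 0 := by
  induction he using Submonoid.closure_induction with
  | mem e he => obtain ⟨H, rfl⟩ := he; exact h H
  | one => exact fun x hx => (one_smul RingT x).symm.trans hx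
  | mul a b _ _ ha hb => exact fun x hx => hb x (ha _ ((mul_smul a b x).symm.trans hx))

/-! ### Elements detected by morphisms from spheres -/

/-- The free generators of a sphere. -/
def sphereUnit (D : FullSubgroups) (T : Finset OverT) (m : ℕ) (k : ℤ) :
    Gen (sphere D T m k) T m k := (sphereGen D T m k).gen

theorem exists_sphere_hom {T : Finset OverT} {m : ℕ} {k : ℤ} (g : Gen X T m k) :
    ∃ f : sphere D T m k ⟶ X, onV f (sphereUnit D T m k).v = g.v ∧
      onP f (sphereUnit D T m k).p = g.p ∧ onQ f (sphereUnit D T m k).q = g.q ∧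
      onN f (sphereUnit D T m k).x = g.x :=
  (sphereGen D T m k).gen.exists_hom (sphere_free D T m k) g

theorem onP_partι_comp (n : OverZ) (f : Z ⟶ X) (z : Z.P) :
    onP (partι n Z ≫ f) (onP (partπ n Z) z) = charFun {n} • onP f z :=
  (congrArg (fun u => onP (u ≫ f) z) (partπ_ι n Z)).trans (map_smul (onP f) _ z)

theorem onN_partι_comp (n : OverZ) (f : Z ⟶ X) (z : Z.N) :
    onN (partι n Z ≫ f) (onN (partπ n Z) z) = inflZ D (charFun {n}) • onN f z :=
  (congrArg (fun u => onN (u ≫ f) z) (partπ_ι n Z)).trans (map_smul (onN f) _ z)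

/-- The morphism out of a twisted factor that corresponds to one into a twisted factor. -/
def untwist {n : OverZ} (f : Z ⟶ twist (part n X)) : twist (part n Z) ⟶ X :=
  twistHom (partι n Z ≫ f) ≫ twistTwist (part n X) ≫ partι n X

theorem onP_untwist {n : OverZ} (f : Z ⟶ twist (part n X)) {z : Z.P} {x : X.P}
    (h : onP f z = onP (partπ n X) x) (hx : charFun {n} • x = x) :
    onP (untwist f) (onP (partπ n Z) z) = x := by
  have h1 : onP (partι n Z ≫ f) (onP (partπ n Z) z) = onP (partπ n X) x := by
    rw [onP_partι_comp, h]
    exact (map_smul (onP (partπ n X)) _ _).symm.trans (congrArg _ hx)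
  exact (congrArg (onP (partι n X)) h1).trans ((congrArg (fun u => onP u x) (partπ_ι n X)).trans hx)

theorem onN_untwist {n : OverZ} (f : Z ⟶ twist (part n X)) {z : Z.N} {x : X.N}
    (h : onN f z = onN (partπ n X) x) (hx : inflZ D (charFun {n}) • x = x) :
    onN (untwist f) (onN (partπ n Z) z) = x := by
  have h1 : onN (partι n Z ≫ f) (onN (partπ n Z) z) = onN (partπ n X) x := by
    rw [onN_partι_comp, h]
    exact (map_smul (onN (partπ n X)) _ _).symm.trans (congrArg _ hx)
  exact (congrArg (onN (partι n X)) h1).trans ((congrArg (fun u => onN u x) (partπ_ι n X)).trans hx)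

theorem onV_eq_zero_of_sphere {c : X ⟶ Y}
    (h : ∀ (T : Finset OverT) (m : ℕ) (k : ℤ) (f : sphere D T m k ⟶ X),
      onV c (onV f (sphereUnit D T m k).v) = 0) (v : X.V) : onV c v = 0 := by
  refine GrMod.mem_of_forall_proj (H := (LinearMap.ker (onV c)).toAddSubgroup) fun k => ?_
  obtain ⟨T, m, g, hg⟩ := exists_gen_v (X.V.proj_mem k v)
  obtain ⟨f, hf, -⟩ := exists_sphere_hom g
  exact (congrArg (onV c) (hf.trans hg)).symm.trans (h T m k f)

theorem onQ_eq_zero_of_sphere {c : X ⟶ Y}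
    (h : ∀ (T : Finset OverT) (m : ℕ) (k : ℤ) (f : sphere D T m k ⟶ X), f ≫ c = 0) {e : RingT}
    (he : e ∈ eulerT) {q : X.Q} (hq : e • q = 0) : onQ c q = 0 := by
  obtain ⟨e', he', hq'⟩ := exists_eulerElt_smul_proj (preservesDegree_id) he hq
  refine GrMod.mem_of_forall_proj (H := (LinearMap.ker (onQ c)).toAddSubgroup) fun k => ?_
  obtain ⟨g, -, -, hg, -⟩ := exists_gen_q (X.Q.proj_mem k q) ⟨e', he'⟩ (hq' k)
  obtain ⟨f, -, -, hf, -⟩ := exists_sphere_hom g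
  exact (congrArg (onQ c) (hf.trans hg)).symm.trans (congrArg (fun f => onQ f _) (h _ _ k f))

theorem sub_half_smul {R M : Type} [CommRing R] [Algebra ℚ R] [AddCommGroup M] [Module R M]
    (x y : M) :
    x = algebraMap ℚ R (1 / 2) • (x + y) + algebraMap ℚ R (1 / 2) • (x - y) := by
  rw [← smul_add, add_add_sub_cancel, half_smul_add_self]

theorem neg_act_half_sub {R M : Type} [CommRing R] [Algebra ℚ R] [AddCommGroup M] [Module R M]
    (f : M →ₗ[R] M) (hf : ∀ x, f (f x) = x) (x : M) :
    -f (algebraMap ℚ R (1 / 2) • (x - f x)) = algebraMap ℚ R (1 / 2) • (x - f x) := by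
  rw [map_smul, map_sub, hf, ← smul_neg, neg_sub]

theorem onP_eq_zero_of_part {c : X ⟶ Y} {n : OverZ}
    (h : ∀ (T : Finset OverT) (m : ℕ) (k : ℤ) (f : part n (sphere D T m k) ⟶ X) (w),
      onP c (onP f w) = 0)
    (h' : ∀ (T : Finset OverT) (m : ℕ) (k : ℤ) (f : twist (part n (sphere D T m k)) ⟶ X) (w),
      onP c (onP f w) = 0) {p : X.P} (hp : charFun {n} • p = p) : onP c p = 0 := by
  refine GrMod.mem_of_forall_proj (H := (LinearMap.ker (onP c)).toAddSubgroup) fun k => ?_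
  have hpn : charFun {n} • X.P.proj k p = X.P.proj k p := by
    rw [← GrMod.proj_smul_zero (A := degZero RingZ) (fun _ => rfl), hp]
  have hk := X.P.proj_mem k p
  generalize X.P.proj k p = p' at hpn hk
  change onP c p' = 0
  have fixed : onP c (avgP X p') = 0 := by
    have hn : charFun {n} • avgP X p' = avgP X p' := by
      rw [avgP, smul_comm, smul_add, hpn, ← map_smul, hpn]
    obtain ⟨T, m, g, -, hg, -⟩ := exists_gen_p (avgP_mem hk) hn (actP_avgP p')
    obtain ⟨f, -, hf, -⟩ := exists_sphere_hom g
    have h2 := onP_partι_comp n f (sphereUnit D T m k).p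
    rw [hf, hg, hn] at h2
    exact (congrArg (onP c) h2).symm.trans (h T m k _ _)
  have anti : onP c (algebraMap ℚ RingZ (1 / 2) • (p' - X.actP p')) = 0 := by
    have ha := neg_act_half_sub X.actP X.actP_actP p'
    have han : charFun {n} • algebraMap ℚ RingZ (1 / 2) • (p' - X.actP p') =
        algebraMap ℚ RingZ (1 / 2) • (p' - X.actP p') := by
      rw [smul_comm, smul_sub, hpn, ← map_smul, hpn]
    have hak := X.P.smul_mem (i := 0) (a := algebraMap ℚ RingZ (1 / 2)) (fun _ => rfl)
      (sub_mem hk (X.actP_gr k p' hk))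
    rw [zero_add] at hak
    generalize algebraMap ℚ RingZ (1 / 2) • (p' - X.actP p') = a at ha han hak
    obtain ⟨T, m, g, -, hg, -⟩ := exists_gen_p (X := twist (part n X)) (k := k)
      (p := onP (partπ n X) a) (onP_mem (partπ n X) hak) (n := n)
      ((map_smul (onP (partπ n X)) _ _).symm.trans (congrArg _ han))
      ((congrArg Neg.neg (onP_actP (partπ n X) a).symm).trans
        ((map_neg (onP (partπ n X)) _).symm.trans (congrArg (onP (partπ n X)) ha)))
    obtain ⟨f, -, hf, -⟩ := exists_sphere_hom g
    exact (congrArg (onP c) (onP_untwist f (hf.trans hg) han)).symm.trans (h' T m k _ _)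
  rw [sub_half_smul (R := RingZ) p' (X.actP p'), map_add]
  exact (congrArg₂ (· + ·) fixed anti).trans (add_zero 0)

theorem onN_eq_zero_of_part {c : X ⟶ Y} {n : OverZ}
    (h : ∀ (T : Finset OverT) (m : ℕ) (k : ℤ) (f : part n (sphere D T m k) ⟶ X) (w),
      onN c (onN f w) = 0)
    (h' : ∀ (T : Finset OverT) (m : ℕ) (k : ℤ) (f : twist (part n (sphere D T m k)) ⟶ X) (w),
      onN c (onN f w) = 0) {x : X.N} (hx : inflZ D (charFun {n}) • x = x) {e : RingT}
    (he : e ∈ eulerT) (hex : inflT D e • x = 0) : onN c x = 0 := by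
  obtain ⟨e', he', hq'⟩ := exists_eulerElt_smul_proj (preservesDegree_inflT D) he hex
  refine GrMod.mem_of_forall_proj (H := (LinearMap.ker (onN c)).toAddSubgroup) fun k => ?_
  have hpn : inflZ D (charFun {n}) • X.N.proj k x = X.N.proj k x := by
    rw [← GrMod.proj_smul_zero (inflZ_mem_degC D _), hx]
  have hpe := hq' k
  have hk := X.N.proj_mem k x
  generalize X.N.proj k x = p' at hpn hpe hk
  change onN c p' = 0
  have fixed : onN c (avgN X p') = 0 := by
    have hn : inflZ D (charFun {n}) • avgN X p' = avgN X p' := by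
      rw [avgN, smul_comm, smul_add, hpn, ← map_smul, hpn]
    obtain ⟨f, -, -, -, hf⟩ := exists_sphere_hom (genN (avgN_mem hk) hn ⟨e', he'⟩
      (by rw [avgN, smul_comm, smul_add, hpe, ← map_smul, hpe, map_zero, add_zero, smul_zero])
      (actN_avgN p'))
    have h2 := onN_partι_comp n f (sphereUnit D ∅ 0 k).x
    rw [hf] at h2
    exact (congrArg (onN c) (h2.trans hn)).symm.trans (h _ _ k _ _)
  have anti : onN c (algebraMap ℚ (RingF D) (1 / 2) • (p' - X.actN p')) = 0 := by
    have hc : conn D • algebraMap ℚ (RingF D) (1 / 2) • (p' - X.actN p') = 0 := by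
      rw [smul_comm, smul_sub, conn_smul_actN, sub_self, smul_zero]
    have ha : (conn D - disc D) • X.actN (algebraMap ℚ (RingF D) (1 / 2) • (p' - X.actN p')) =
        algebraMap ℚ (RingF D) (1 / 2) • (p' - X.actN p') := by
      have h1 := neg_act_half_sub X.actN X.actN_actN p'
      have h2 : disc D = 1 - conn D := by rw [← disc_add_conn, add_sub_cancel_right]
      rw [neg_eq_iff_eq_neg.1 h1, smul_neg, h2, sub_smul, sub_smul, one_smul, hc, sub_zero,
        zero_sub, neg_neg]
    have han : inflZ D (charFun {n}) • algebraMap ℚ (RingF D) (1 / 2) • (p' - X.actN p') =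
        algebraMap ℚ (RingF D) (1 / 2) • (p' - X.actN p') := by
      rw [smul_comm, smul_sub, hpn, ← map_smul, hpn]
    have hae : inflT D e' • algebraMap ℚ (RingF D) (1 / 2) • (p' - X.actN p') = 0 := by
      rw [smul_comm, smul_sub, hpe, ← map_smul, hpe, map_zero, sub_zero, smul_zero]
    have hak := X.N.smul_mem (half_mem_degC _) (sub_mem hk (X.actN_gr k p' hk))
    rw [zero_add] at hak
    generalize algebraMap ℚ (RingF D) (1 / 2) • (p' - X.actN p') = a at ha han hak hae
    obtain ⟨f, -, -, -, hf⟩ := exists_sphere_hom (genN (X := twist (part n X)) (k := k)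
      (x := onN (partπ n X) a) (onN_mem (partπ n X) hak) (n := n)
      ((map_smul (onN (partπ n X)) _ _).symm.trans (congrArg _ han)) ⟨e', he'⟩
      ((map_smul (onN (partπ n X)) _ _).symm.trans ((congrArg _ hae).trans (map_zero _)))
      ((congrArg ((conn D - disc D) • ·) (onN_actN (partπ n X) a).symm).trans
        ((map_smul (onN (partπ n X)) _ _).symm.trans (congrArg (onN (partπ n X)) ha))))
    exact (congrArg (onN c) (onN_untwist f hf han)).symm.trans (h' _ _ k _ _)
  rw [sub_half_smul (R := RingF D) p' (X.actN p'), map_add]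
  exact (congrArg₂ (· + ·) fixed anti).trans (add_zero 0)

/-! ### Divisible objects at a single `H(∞, n)` -/

/-- An object whose Euler classes act injectively on `N`. -/
def TorsionFreeN (X : StandardModel D) : Prop :=
  ∀ e ∈ eulerT, ∀ x : X.N, inflT D e • x = 0 → x = 0

theorem torsionFreeN_sphere (T : Finset OverT) (m : ℕ) (k : ℤ) :
    TorsionFreeN (sphere D T m k) := by
  intro e he x hx
  obtain ⟨a, rfl⟩ := (sphere_free D T m k).N.2 x
  obtain ⟨T', m', r, hr⟩ := exists_dvd_eulerElt he
  have h1 : inflT D e * a = 0 := (sphere_free D T m k).N.1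
    ((mul_smul _ _ _).trans (hx.trans (zero_smul _ _).symm))
  have h2 : a * inflT D (eulerElt (T' : Set OverT) m') = 0 := by
    rw [hr, map_mul]; linear_combination inflT D r * h1
  rw [inflT_eulerElt] at h2
  exact (congrArg (· • (sphereUnit D T m k).x) (eulerElt_cancel h2)).trans (zero_smul _ _)

theorem TorsionFreeN.of_inj {f : X ⟶ Y} (hf : Inj f) (h : TorsionFreeN Y) : TorsionFreeN X :=
  fun e he x hx => (injective_iff_map_eq_zero _).1 hf.N x
    (h e he _ (by rw [← map_smul, hx, map_zero]))

theorem exists_smul_part (n : OverZ) (T : Finset OverT) (m : ℕ) (k : ℤ)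
    (w : (part n (sphere D T m k)).P) :
    ∃ r : RingZ, w = r • onP (partπ n _) (sphereUnit D T m k).p := by
  obtain ⟨z, rfl⟩ := (surj_partπ n _).P w
  obtain ⟨a, rfl⟩ := (sphere_free D T m k).P.2 z
  exact ⟨a, map_smul _ _ _⟩

theorem charFun_singleton_mul {S : Type} (n : S) (r : S → ℚ) :
    charFun {n} * r = algebraMap ℚ (S → ℚ) (r n) * charFun {n} := by
  funext i
  by_cases h : i = n <;> simp [charFun_apply, h, Pi.algebraMap_apply]

theorem Essential.onP_mem {n : OverZ} {i : X ⟶ Y} (hi : Essential i) (hY : AtZ n Y)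
    {W : StandardModel D} (hW : AtZ n W) (tf : TorsionFreeN W) {w₀ : W.P}
    (hw : ∀ w : W.P, ∃ r : RingZ, w = r • w₀) (f : W ⟶ Y) (w : W.P) :
    onP (Sub.range i).π (onP f w) = 0 := by
  have key : onP (Sub.range i).π (onP f w₀) = 0 := by
    by_contra h0
    have hP (p : (Sub.ker (f ≫ (Sub.range i).π)).toModel.P) : p = 0 := by
      obtain ⟨w, hwk⟩ := p
      obtain ⟨r, rfl⟩ := hw w
      refine Subtype.ext ?_
      change r • w₀ = 0
      have h1 : r • onP (Sub.range i).π (onP f w₀) = 0 := by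
        rw [← map_smul, ← map_smul]; exact hwk
      rw [← hY.P (onP f w₀), map_smul, smul_smul, mul_comm, charFun_singleton_mul, mul_smul,
        ← map_smul, hY.P] at h1
      have h2 : r n = 0 := by
        by_contra h3
        apply h0
        have h4 := congrArg (algebraMap ℚ RingZ (r n)⁻¹ • ·) h1
        simp only [smul_smul, ← map_mul, inv_mul_cancel₀ h3, map_one, smul_zero] at h4
        exact (one_smul _ _).symm.trans h4
      rw [← hW.P w₀, smul_smul, mul_comm, charFun_singleton_mul, h2, map_zero, zero_mul, zero_smul]
    have hN (x : (Sub.ker (f ≫ (Sub.range i).π)).toModel.N) : x = 0 := by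
      obtain ⟨e, he, h⟩ := exists_euler_smul_N (subsingleton_of_forall_eq 0 hP) x
      exact tf.of_inj (Sub.inj_ι _) e he x h
    have := hW.V
    have := hW.Q
    have hf : f = 0 := hi.eq_zero f (hom_ext
      (fun v => (congrArg (onV f) (Subsingleton.elim _ 0)).trans (map_zero _))
      (fun p => (congrArg (onP f) (congrArg Subtype.val (hP p))).trans (map_zero _))
      (fun v => (congrArg (onQ f) (Subsingleton.elim _ 0)).trans (map_zero _))
      (fun p => (congrArg (onN f) (congrArg Subtype.val (hN p))).trans (map_zero _)))
    apply h0
    rw [hf]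
    exact map_zero _
  obtain ⟨r, rfl⟩ := hw w
  rw [map_smul, map_smul, key, smul_zero]

end StandardModel

end

noncomputable section

namespace StandardModel

variable {D : FullSubgroups} {X Y Z : StandardModel D}

theorem spans_bot_of {R₁ R : Type} [CommRing R₁] [CommRing R] {S : Submonoid R}
    {σ : R₁ →+* Localization S} {M N : Type} [AddCommGroup M] [Module R₁ M] [AddCommGroup N]
    [Module R N] {f : M →ₛₗ[σ] LocalizedModule S N} {N' : Submodule R N}
    (h : ∀ x ∈ N', (LocalizedModule.mk x 1 : LocalizedModule S N) = 0) : Spans f ⊥ N' := by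
  have h1 : locSub S N' = ⊥ := le_bot_iff.1 (locSub_le fun x hx => by rw [h x hx]; exact zero_mem _)
  have h2 : Spans f ⊥ (⊥ : Submodule R N) := Spans.bot
  rw [Spans, locSub_bot] at h2
  rw [Spans, h1, h2]

/-- A submodule of torsion elements of `N` as a subobject. -/
def Sub.ofN (N : Submodule (RingF D) X.N) (hom : GrMod.Homogeneous N)
    (tors : ∀ x ∈ N, ∃ e ∈ eulerT, inflT D e • x = 0)
    (cof : ∀ x ∈ N, (LocalizedModule.mk x 1 : LocalizedModule (cofF D) X.N) = 0) (act : ∀ x ∈ N, X.actN x ∈ N) : Sub X where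
  V := ⊥
  P := ⊥
  Q := ⊥
  N := N
  homV := Sub.homogeneous_bot
  homP := Sub.homogeneous_bot
  homQ := Sub.homogeneous_bot
  homN := hom
  spanP := spans_bot_of fun x hx => by
    obtain ⟨e, he, h⟩ := tors x hx
    exact mk_euler_eq_zero ⟨e, he⟩ h 1
  spanQ := spans_bot_of cof
  spanVP := Spans.bot
  spanVQ := Spans.bot
  actP_mem p hp := by
    rw [(Submodule.mem_bot RingZ).1 hp, map_zero]; exact zero_mem _
  actN_mem := act

/-- `c` annihilates `y`, which lies in the factor at `F`. -/
structure LineAt (F : FiniteSubgroup D) (y : X.N) : Prop where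
  idem : idem {F} • y = y
  X : (Polynomial.X : RingF D) • y = 0

theorem LineAt.smul {F : FiniteSubgroup D} {y : X.N} (h : LineAt F y) (r : RingF D) :
    r • y = algebraMap ℚ (RingF D) (r.coeff 0 F) • y := by
  have h1 : r * _root_.idem {F} =
      r.divX * _root_.idem {F} * Polynomial.X + algebraMap ℚ (RingF D) (r.coeff 0 F) *
        _root_.idem {F} := by
    have h2 : Polynomial.C (r.coeff 0) * _root_.idem {F} =
        algebraMap ℚ (RingF D) (r.coeff 0 F) * _root_.idem {F} := by
      rw [_root_.idem, ← map_mul, mul_comm, charFun_singleton_mul, map_mul]; rfl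
    rw [← h2]
    conv_lhs => rw [← Polynomial.divX_mul_X_add r]
    ring
  rw [← h.idem, smul_smul, smul_smul, h1, add_smul, mul_smul, h.X, smul_zero, zero_add]

theorem LineAt.eulerClass {F : FiniteSubgroup D} {y : X.N} (h : LineAt F y) :
    inflT D (eulerClass F.mulT) • y = 0 := by
  rw [h.smul, coeff_inflT]
  have : (_root_.eulerClass F.mulT).coeff 0 F.mulT = 0 := by
    simp [_root_.eulerClass, charFun_apply]
  rw [this, map_zero, zero_smul]

theorem LineAt.inflZ {F : FiniteSubgroup D} {y : X.N} (h : LineAt F y) :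
    inflZ D (charFun {F.mulZ}) • y = y := by
  rw [h.smul]
  have : (_root_.inflZ D (charFun {F.mulZ})).coeff 0 F = 1 := by
    simp [_root_.inflZ, charFun_apply]
  rw [this, map_one, one_smul]

theorem LineAt.smul' {F : FiniteSubgroup D} {y : X.N} (h : LineAt F y) (r : RingF D) :
    LineAt F (r • y) :=
  ⟨by rw [smul_comm, h.idem], by rw [smul_comm, h.X, smul_zero]⟩

/-- The subobject generated by an element of `N` that spans a line. -/
def Sub.line {F : FiniteSubgroup D} {y : X.N} (h : LineAt F y) {k : ℤ} (hk : y ∈ X.N.gr k)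
    (act : ∃ r : RingF D, X.actN y = r • y) : Sub X :=
  Sub.ofN (Submodule.span (RingF D) {y})
    (GrMod.homogeneous_span (sumOfHomogeneous_degC _) (by rintro _ rfl; exact ⟨k, hk⟩))
    (fun x hx => by
      obtain ⟨r, rfl⟩ := Submodule.mem_span_singleton.1 hx
      exact ⟨_, Submonoid.subset_closure ⟨F.mulT, rfl⟩, (h.smul' r).eulerClass⟩)
    (fun x hx => by
      obtain ⟨r, rfl⟩ := Submodule.mem_span_singleton.1 hx
      exact mk_cofF_eq_zero (h.smul' r).inflZ)
    (fun x hx => by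
      obtain ⟨r, rfl⟩ := Submodule.mem_span_singleton.1 hx
      obtain ⟨s, hs⟩ := act
      rw [map_smul, hs]
      exact Submodule.smul_mem _ _ (Submodule.smul_mem _ _ (Submodule.mem_span_singleton_self _)))

theorem Essential.onN_line {i : X ⟶ Y} (hi : Essential i) {F : FiniteSubgroup D} {y : Y.N}
    (h : LineAt F y) {k : ℤ} (hk : y ∈ Y.N.gr k) (act : ∃ r : RingF D, Y.actN y = r • y) :
    onN (Sub.range i).π y = 0 := by
  by_contra h0
  have hd : (Sub.line h hk act).ι = 0 := hi.eq_zero _ (hom_ext (fun v => v.1.2) (fun v => v.1.2)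
    (fun v => v.1.2) (fun x => by
      obtain ⟨⟨x, hx⟩, hxk⟩ := x
      obtain ⟨r, rfl⟩ := Submodule.mem_span_singleton.1 hx
      change r • y = 0
      have h1 : onN (Sub.range i).π (r • y) = 0 := hxk
      rw [h.smul] at h1 ⊢
      by_cases h3 : r.coeff 0 F = 0
      · rw [h3, map_zero, zero_smul]
      · refine absurd ?_ h0
        have h4 := congrArg (algebraMap ℚ (RingF D) (r.coeff 0 F)⁻¹ • ·) h1
        simp only [map_smul, smul_smul, ← map_mul, inv_mul_cancel₀ h3, map_one, smul_zero] at h4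
        exact (one_smul _ _).symm.trans h4))
  have h1 : y = 0 := congrArg (fun f : (Sub.line h hk act).toModel ⟶ Y => onN f (⟨y, Submodule.mem_span_singleton_self y⟩ :
    (Sub.line h hk act).toModel.N)) hd
  exact h0 (by rw [h1, map_zero])

instance : Finite SubgroupLabel :=
  Finite.of_injective (β := Fin 3) (fun | .oneS => 0 | .oneNS => 1 | .two => 2)
    (by rintro (_ | _ | _) (_ | _ | _) <;> simp)

theorem finite_setOf_mul (n : OverZ) (H : OverT) :
    {F : FiniteSubgroup D | F.mulZ = n ∧ F.mulT = H}.Finite := by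
  refine Set.Finite.of_finite_image (f := FiniteSubgroup.label) (Set.toFinite _) ?_
  rintro ⟨m, n', l, h⟩ ⟨hF, hF'⟩ ⟨m', n'', l', h'⟩ ⟨hG, hG'⟩ (rfl : l = l')
  obtain rfl : m = m' := congrArg Prod.fst (hF'.trans hG'.symm)
  obtain rfl : n' = n'' := hF.trans hG.symm
  rfl

theorem actN_half {X : StandardModel D} (y : X.N) :
    X.actN (algebraMap ℚ (RingF D) (1 / 2) • (y - X.actN y)) =
      (-1 : RingF D) • algebraMap ℚ (RingF D) (1 / 2) • (y - X.actN y) := by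
  rw [neg_one_smul, ← neg_eq_iff_eq_neg]
  exact neg_act_half_sub X.actN X.actN_actN y

theorem Essential.onN_of_lineAt {i : X ⟶ Y} (hi : Essential i) {F : FiniteSubgroup D} {y : Y.N}
    (h : LineAt F y) {k : ℤ} (hk : y ∈ Y.N.gr k) : onN (Sub.range i).π y = 0 := by
  have h1 := hi.onN_line (y := avgN Y y)
    ⟨by rw [avgN, smul_comm, smul_add, ← map_smul, h.idem],
      by rw [avgN, smul_comm, smul_add, ← map_smul, h.X, map_zero, add_zero, smul_zero]⟩
    (avgN_mem hk) ⟨1, by rw [one_smul, actN_avgN]⟩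
  have hk' := Y.N.smul_mem (half_mem_degC _) (sub_mem hk (Y.actN_gr k y hk))
  rw [zero_add] at hk'
  have h2 := hi.onN_line (y := algebraMap ℚ (RingF D) (1 / 2) • (y - Y.actN y))
    ⟨by rw [smul_comm, smul_sub, ← map_smul, h.idem],
      by rw [smul_comm, smul_sub, ← map_smul, h.X, map_zero, sub_zero, smul_zero]⟩
    hk' ⟨-1, actN_half y⟩
  rw [sub_half_smul (R := RingF D) y (Y.actN y), map_add]
  exact (congrArg₂ (· + ·) h1 h2).trans (add_zero 0)

theorem Essential.onN_of_eulerClass {n : OverZ} {i : X ⟶ Y} (hi : Essential i) (hY : AtZ n Y)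
    {H : OverT} {y : Y.N} (hy : inflT D (eulerClass H) • y = 0) : onN (Sub.range i).π y = 0 := by
  refine GrMod.mem_of_forall_proj (H := (LinearMap.ker (onN (Sub.range i).π)).toAddSubgroup)
    fun k => ?_
  rw [eulerClass_eq] at hy
  have hx := eulerElt_smul_proj (preservesDegree_inflT D) hy k
  have hk := Y.N.proj_mem k y
  generalize Y.N.proj k y = x at hx hk
  change onN (Sub.range i).π x = 0
  rw [inflT_eulerElt] at hx
  have h1 : idem (FiniteSubgroup.mulT (D := D) ⁻¹' {H})ᶜ • x = 0 := by
    rw [← idem_compl_mul_eulerElt _ 1, mul_smul, hx, smul_zero]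
  have h2 : idem (FiniteSubgroup.mulT (D := D) ⁻¹' {H}) • x = x := by
    have := congrArg (· • x) (idem_add_compl (FiniteSubgroup.mulT (D := D) ⁻¹' {H}))
    simp only [add_smul, h1, add_zero, one_smul] at this
    exact this
  have h3 : (Polynomial.X : RingF D) • x = 0 := by
    rw [← h2, smul_smul, mul_comm]
    conv_lhs => rw [← pow_one (Polynomial.X : RingF D)]
    rw [← idem_mul_eulerElt, mul_smul, hx, smul_zero]
  have h4 : idem {F : FiniteSubgroup D | F.mulZ = n ∧ F.mulT = H} • x = x := by
    have : {F : FiniteSubgroup D | F.mulZ = n ∧ F.mulT = H} =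
      FiniteSubgroup.mulZ ⁻¹' {n} ∩ FiniteSubgroup.mulT ⁻¹' {H} := rfl
    rw [this, ← idem_mul, mul_smul, h2]
    exact hY.N x
  have h5 : x = ∑ F ∈ (finite_setOf_mul (D := D) n H).toFinset, idem {F} • x := by
    rw [← Finset.sum_smul]
    simp only [idem]
    rw [← map_sum, sum_charFun, Set.Finite.coe_toFinset]
    exact h4.symm
  rw [h5, map_sum]
  refine Finset.sum_eq_zero fun F _ => ?_
  have hk' := Y.N.smul_mem (idem_mem_degC {F}) hk
  exact hi.onN_of_lineAt ⟨by rw [smul_smul, idem_mul_self], by rw [smul_comm, h3, smul_zero]⟩ hk'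

/-- A divisible object at `H(∞, n)` has no proper essential extension at `H(∞, n)`. -/
theorem Essential.surj_of_atZ {n : OverZ} {i : X ⟶ Y} (hi : Essential i) (hX : Divisible X)
    (hY : AtZ n Y) : Surj i := by
  apply surj_of_π_eq_zero
  have hP (p : Y.P) : onP (Sub.range i).π p = 0 :=
    onP_eq_zero_of_part
      (fun T m k f w => hi.onP_mem hY (atZ_part n _)
        ((torsionFreeN_sphere T m k).of_inj (inj_partι n _)) (exists_smul_part n T m k) f w)
      (fun T m k f w => hi.onP_mem hY
        (atZ_of (X := twist (part n (sphere D T m k))) inferInstance inferInstance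
          (atZ_part n _).P (atZ_part n _).N)
        (fun e he x hx => ((torsionFreeN_sphere T m k).of_inj (inj_partι n _)) e he x hx)
        (exists_smul_part n T m k) f w)
      (hY.P p)
  have hPs : Subsingleton (Sub.range i).quotient.P := subsingleton_of_forall_eq 0 fun p => by
    obtain ⟨p, rfl⟩ := (Sub.surj_π _).P p
    exact hP p
  have := hY.V
  have := hY.Q
  refine hom_ext (fun v => ?_) hP (fun q => ?_) (fun x => ?_)
  · rw [Subsingleton.elim v 0]; exact map_zero _
  · rw [Subsingleton.elim q 0]; exact map_zero _
  · obtain ⟨e, he, h⟩ := exists_euler_smul_N hPs (onN (Sub.range i).π x)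
    let : Module RingT (Sub.range i).quotient.N := Module.compHom _ (inflT D)
    refine eq_zero_of_classes (M := (Sub.range i).quotient.N) (fun H z hz => ?_) he _ h
    obtain ⟨y, rfl⟩ := (Sub.surj_π _).N z
    have hz' : onN (Sub.range i).π (inflT D (eulerClass H) • y) = 0 :=
      (map_smul (onN (Sub.range i).π) _ _).trans hz
    obtain ⟨w, -, hw⟩ := (Sub.onN_π _).1 hz'
    obtain ⟨w, rfl⟩ := hX.N H w
    have h1 : onN (Sub.range i).π (onN i w) = 0 := (Sub.onN_π _).2 ⟨w, trivial, rfl⟩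
    have h2 := hi.onN_of_eulerClass hY (H := H) (y := y - onN i w)
      (by rw [smul_sub, ← map_smul, hw, sub_self])
    rw [map_sub, h1, sub_zero] at h2
    exact h2

/-- Divisible objects at `H(∞, n)` are injective. -/
theorem Divisible.injective_of_atZ {n : OverZ} (hX : Divisible X) (h : AtZ n X) :
    Injective X := by
  refine injective_of_split fun Y i hi => ?_
  have h1 : Inj (i ≫ partπ n Y) := by
    refine Inj.of_comp (g := partι n Y) ?_
    rwa [Category.assoc, partπ_ι, ← eHom_comp, h, Category.id_comp]
  obtain ⟨Γ, hΓ⟩ := exists_essential h1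
  rw [Category.assoc] at hΓ
  exact ⟨_, partπ n Y ≫ Γ.π, hΓ.inj, hΓ.surj_of_atZ hX ((atZ_part n Y).of_surj (Sub.surj_π Γ))⟩

end StandardModel

end

noncomputable section

namespace StandardModel

variable {D : FullSubgroups} {X Y Z : StandardModel D}

/-- The preimage of `X` under a morphism into an extension of `X` maps to `X`. -/
theorem exists_lift_ker {i : X ⟶ Y} (hi : Inj i) {W : StandardModel D} (f : W ⟶ Y) :
    ∃ f' : (Sub.ker (f ≫ (Sub.range i).π)).toModel ⟶ X,
      f' ≫ i = (Sub.ker (f ≫ (Sub.range i).π)).ι ≫ f :=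
  exists_lift hi _ (fun z => ((Sub.onV_π _).1 z.2).imp fun _ h => h.2)
    (fun z => ((Sub.onP_π _).1 z.2).imp fun _ h => h.2)
    (fun z => ((Sub.onQ_π _).1 z.2).imp fun _ h => h.2)
    (fun z => ((Sub.onN_π _).1 z.2).imp fun _ h => h.2)

theorem Essential.comp_π_eq_zero {i : X ⟶ Y} (hi : Essential i) {W : StandardModel D} {f : W ⟶ Y}
    {f' : (Sub.ker (f ≫ (Sub.range i).π)).toModel ⟶ X}
    (hf : f' ≫ i = (Sub.ker (f ≫ (Sub.range i).π)).ι ≫ f) (h : W ⟶ X)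
    (hh : (Sub.ker (f ≫ (Sub.range i).π)).ι ≫ h = f') : f ≫ (Sub.range i).π = 0 := by
  rw [hi.eq_comp f h (by rw [← hf, ← hh, Category.assoc]), Category.assoc, comp_π_range,
    Limits.comp_zero]

theorem Essential.eHom_comp_π {i : X ⟶ Y} (hi : Essential i) (hX : Divisible X) (n : OverZ) :
    eHom n Y ≫ (Sub.range i).π = 0 := by
  obtain ⟨f', hf⟩ := exists_lift_ker hi.inj (partι n Y)
  have := (hX.part n).injective_of_atZ (atZ_part n X)
  have := (Sub.inj_ι (Sub.ker (partι n Y ≫ (Sub.range i).π))).mono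
  have hK : AtZ n (Sub.ker (partι n Y ≫ (Sub.range i).π)).toModel :=
    (atZ_part n Y).of_inj (Sub.inj_ι _)
  have h := hi.comp_π_eq_zero hf
    (Injective.factorThru (f' ≫ partπ n X) (Sub.ker (partι n Y ≫ (Sub.range i).π)).ι ≫ partι n X)
    (by rw [← Category.assoc, Injective.comp_factorThru, Category.assoc, partπ_ι, ← eHom_comp, hK,
      Category.id_comp])
  rw [← partπ_ι, Category.assoc, h, Limits.comp_zero]

/-- Morphisms from quotients of the modules `large D k` to the factors of `X` can be glued. -/
def Glue (X : StandardModel D) : Prop :=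
  ∀ (k : ℤ) (Γ : Sub (large D k)) (g : ∀ n, Γ.quotient ⟶ part n X),
    ∃ h : Γ.quotient ⟶ X, ∀ n, h ≫ partπ n X = g n

theorem Essential.comp_π_eq_zero_of_glue {i : X ⟶ Y} (hi : Essential i) (hX : Divisible X)
    (hG : Glue X) {W : StandardModel D} {k : ℤ} {Γ : Sub (large D k)} {j : W ⟶ Γ.quotient}
    (hj : Inj j) (f : W ⟶ Y) (hV : Subsingleton (Sub.ker (f ≫ (Sub.range i).π)).toModel.V)
    (hQ : Subsingleton (Sub.ker (f ≫ (Sub.range i).π)).toModel.Q) :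
    f ≫ (Sub.range i).π = 0 := by
  obtain ⟨f', hf⟩ := exists_lift_ker hi.inj f
  have hI n : Injective (part n X) := (hX.part n).injective_of_atZ (atZ_part n X)
  have := ((Sub.inj_ι (Sub.ker (f ≫ (Sub.range i).π))).comp hj).mono
  obtain ⟨h, hh⟩ := hG k Γ fun n => Injective.factorThru (f' ≫ partπ n X)
    ((Sub.ker (f ≫ (Sub.range i).π)).ι ≫ j)
  refine hi.comp_π_eq_zero hf (j ≫ h) (hom_ext_eHom hV hQ fun n => ?_)
  rw [eHom_comp, eHom_comp, ← partπ_ι n X, ← Category.assoc, ← Category.assoc f', ← Category.assoc,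
    Category.assoc _ h, hh, Injective.comp_factorThru]

theorem inj_π_bot (X : StandardModel D) : Inj (Sub.ker (𝟙 X)).π :=
  Inj.of_comp (g := 𝟙 _) (inj_comp_π (i := 𝟙 X) _ (fun _ h => h) (fun _ h => h) (fun _ h => h)
    (fun _ h => h))

theorem Essential.onV_π {i : X ⟶ Y} (hi : Essential i) (hX : Divisible X) (hG : Glue X)
    (v : Y.V) : onV (Sub.range i).π v = 0 := by
  refine onV_eq_zero_of_sphere (fun T m k f => ?_) v
  by_contra h0
  have hV (w : (Sub.ker (f ≫ (Sub.range i).π)).toModel.V) : w = 0 := by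
    obtain ⟨w, hw⟩ := w
    obtain ⟨a, rfl⟩ := (sphere_free D T m k).V.2 w
    refine Subtype.ext ?_
    have h1 : onV (f ≫ (Sub.range i).π) (a • (sphereUnit D T m k).v) = 0 := hw
    rw [map_smul] at h1
    have h2 : a = 0 := (smul_eq_zero.1 h1).resolve_right h0
    exact (congrArg (· • (sphereUnit D T m k).v) h2).trans (zero_smul _ _)
  have hVs := subsingleton_of_forall_eq 0 hV
  have hQ (w : (Sub.ker (f ≫ (Sub.range i).π)).toModel.Q) : w = 0 := by
    obtain ⟨e, he, h⟩ := exists_euler_smul_Q hVs w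
    obtain ⟨w, hw⟩ := w
    obtain ⟨a, rfl⟩ := (sphere_free D T m k).Q.2 w
    refine Subtype.ext ?_
    obtain ⟨T', m', r, hr⟩ := exists_dvd_eulerElt he
    have h1 : e * a = 0 := (sphere_free D T m k).Q.1
      ((mul_smul _ _ _).trans ((congrArg Subtype.val h).trans (zero_smul _ _).symm))
    have h2 : a * eulerElt (T' : Set OverT) m' = 0 := by
      rw [hr]; linear_combination r * h1
    exact (congrArg (· • (sphereUnit D T m k).q) (eulerElt_cancel h2)).trans (zero_smul _ _)
  exact h0 (congrArg (fun u => onV u (sphereUnit D T m k).v) (hi.comp_π_eq_zero_of_glue hX hG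
    ((Sub.inj_ι (sphereGen D T m k).sub).comp (inj_π_bot _)) f hVs
    (subsingleton_of_forall_eq 0 hQ)))

theorem eulerElt_zero {S : Type} (U : Set S) : eulerElt U 0 = 1 := by
  rw [eulerElt, pow_zero, mul_one, idem_add_compl]

theorem eulerElt_dvd_iff {S : Type} {U : Set S} {a : (S → ℚ)[X]} :
    eulerElt U 1 ∣ a ↔ ∀ s ∈ U, a.coeff 0 s = 0 := by
  refine ⟨fun ⟨b, hb⟩ s hs => ?_, fun h => ⟨idem Uᶜ * a + idem U * a.divX, ext_factorAt fun i => ?_⟩⟩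
  · rw [← coeff_factorAt, hb, map_mul, factorAt_eulerElt, if_pos hs, pow_one, coeff_X_mul_zero]
  simp only [map_mul, map_add, factorAt_eulerElt, factorAt_idem]
  by_cases hi : i ∈ U
  · have h1 := congrArg (factorAt i) (Polynomial.divX_mul_X_add a)
    have h2 : factorAt i (Polynomial.C (a.coeff 0)) = 0 := by
      ext k
      rw [coeff_factorAt, Polynomial.coeff_C]
      split_ifs <;> simp [h i hi]
    rw [map_add, map_mul, h2, add_zero, factorAt_X] at h1
    rw [if_pos hi, if_pos hi, if_neg (show i ∉ Uᶜ from fun h => h hi), pow_one, ← h1]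
    ring
  · rw [if_neg hi, if_neg hi]
    split_ifs with h'
    · ring
    · exact absurd hi h'

theorem smul_eq_of_eulerElt {S M : Type} [AddCommGroup M] [Module (S → ℚ)[X] M] {s : S} {q : M}
    (h : eulerElt {s} 1 • q = 0) (a : (S → ℚ)[X]) :
    a • q = algebraMap ℚ (S → ℚ)[X] (a.coeff 0 s) • q := by
  obtain ⟨b, hb⟩ := (eulerElt_dvd_iff (U := {s}) (a := a - algebraMap ℚ (S → ℚ)[X] (a.coeff 0 s))).2
    (by
      rintro i rfl
      rw [coeff_sub, Polynomial.algebraMap_apply, coeff_C_zero]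
      exact sub_self (a.coeff 0 i))
  rw [← sub_eq_zero, ← sub_smul, hb, mul_comm, mul_smul, h, smul_zero]

theorem Essential.onQ_of_eulerClass {i : X ⟶ Y} (hi : Essential i) (hX : Divisible X)
    (hG : Glue X) {H : OverT} {q : Y.Q} (hq : eulerClass H • q = 0) :
    onQ (Sub.range i).π q = 0 := by
  refine GrMod.mem_of_forall_proj (H := (LinearMap.ker (onQ (Sub.range i).π)).toAddSubgroup)
    fun k => ?_
  rw [eulerClass_eq] at hq
  have hy := eulerElt_smul_proj (θ := RingHom.id RingT) preservesDegree_id hq k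
  have hk := Y.Q.proj_mem k q
  generalize Y.Q.proj k q = y at hy hk
  change eulerElt {H} 1 • y = 0 at hy
  change onQ (Sub.range i).π y = 0
  by_contra h0
  obtain ⟨g, hv, hp, rfl, hx⟩ := exists_gen_q hk ⟨_, eulerElt_singleton_mem H 1⟩ hy
  obtain ⟨f, hfv, hfp, hfq, hfx⟩ := exists_sphere_hom g
  let s : sphere D ∅ 0 k ⟶ (sphereGen D {H} 1 k).sub.quotient :=
    (sphereGen D ∅ 0 k).sub.ι ≫ (sphereGen D {H} 1 k).sub.π
  have hsQ (a : RingT) : onQ s (a • (sphereUnit D ∅ 0 k).q) = 0 ↔ eulerElt {H} 1 ∣ a := by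
    refine (Sub.onQ_π _).trans (Submodule.mem_span_singleton.trans ⟨?_, ?_⟩)
    · rintro ⟨b, hb⟩
      have h1 : b * eulerElt (({H} : Finset OverT) : Set OverT) 1 =
        a * eulerElt ((∅ : Finset OverT) : Set OverT) 0 := ofPoly_injective id
          ((smul_ofPoly id b _).symm.trans (hb.trans (smul_ofPoly id a _)))
      rw [eulerElt_zero, mul_one, Finset.coe_singleton] at h1
      exact ⟨b, by rw [← h1, mul_comm]⟩
    · rintro ⟨b, rfl⟩
      refine ⟨b, (smul_ofPoly id b _).trans ((congrArg (ofPoly id) (?_ :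
        b * eulerElt (({H} : Finset OverT) : Set OverT) 1 =
        eulerElt {H} 1 * b * eulerElt ((∅ : Finset OverT) : Set OverT) 0)).trans
        (smul_ofPoly id _ _).symm)⟩
      rw [eulerElt_zero, mul_one, Finset.coe_singleton, mul_comm]
  have hsN (a : RingF D) (ha : onN s (a • (sphereUnit D ∅ 0 k).x) = 0) :
      inflT D (eulerElt {H} 1) ∣ a := by
    obtain ⟨b, hb⟩ := Submodule.mem_span_singleton.1 ((Sub.onN_π _).1 ha)
    have h1 : b * inflT D (eulerElt (({H} : Finset OverT) : Set OverT) 1) =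
      a * inflT D (eulerElt ((∅ : Finset OverT) : Set OverT) 0) := ofPoly_injective _
        ((smul_ofPoly _ b _).symm.trans (hb.trans (smul_ofPoly _ a _)))
    rw [eulerElt_zero, map_one, mul_one, Finset.coe_singleton] at h1
    exact ⟨b, by rw [← h1, mul_comm]⟩
  have hsV (v) : onV s v = 0 := (Sub.onV_π _).2 (Submodule.mem_span_singleton.2
    ⟨(v.1 : ℚ), mul_one (M := ℚ) v.1⟩)
  obtain ⟨s', hs'⟩ := (Sub.range s).exists_lift_ι s (fun z => ⟨z, trivial, rfl⟩)
    (fun z => ⟨z, trivial, rfl⟩) (fun z => ⟨z, trivial, rfl⟩) (fun z => ⟨z, trivial, rfl⟩)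
  have hsurj : Surj s' :=
    ⟨by rintro ⟨_, z, -, rfl⟩; exact ⟨z, Subtype.ext (congrArg (fun u => onV u z) hs')⟩,
      by rintro ⟨_, z, -, rfl⟩; exact ⟨z, Subtype.ext (congrArg (fun u => onP u z) hs')⟩,
      by rintro ⟨_, z, -, rfl⟩; exact ⟨z, Subtype.ext (congrArg (fun u => onQ u z) hs')⟩,
      by rintro ⟨_, z, -, rfl⟩; exact ⟨z, Subtype.ext (congrArg (fun u => onN u z) hs')⟩⟩
  obtain ⟨f', hf'⟩ := exists_desc hsurj f
    (fun v _ => by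
      obtain ⟨a, rfl⟩ := (sphere_free D ∅ 0 k).V.2 v
      exact (map_smul (onV f) a (sphereUnit D ∅ 0 k).v).trans (by rw [hfv, hv, smul_zero]))
    (fun v _ => by
      obtain ⟨a, rfl⟩ := (sphere_free D ∅ 0 k).P.2 v
      exact (map_smul (onP f) a (sphereUnit D ∅ 0 k).p).trans (by rw [hfp, hp, smul_zero]))
    (fun v h => by
      obtain ⟨a, rfl⟩ := (sphere_free D ∅ 0 k).Q.2 v
      obtain ⟨b, rfl⟩ := (hsQ a).1 ((congrArg (fun u => onQ u _) hs').symm.trans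
        ((congrArg Subtype.val h).trans rfl))
      exact (map_smul (onQ f) _ (sphereUnit D ∅ 0 k).q).trans
        (by rw [hfq, mul_comm, mul_smul, hy, smul_zero]))
    (fun v h => by
      obtain ⟨a, rfl⟩ := (sphere_free D ∅ 0 k).N.2 v
      obtain ⟨b, rfl⟩ := hsN a ((congrArg (fun u => onN u _) hs').symm.trans
        ((congrArg Subtype.val h).trans rfl))
      exact (map_smul (onN f) _ (sphereUnit D ∅ 0 k).x).trans
        (by rw [hfx, mul_comm, mul_smul, hx, smul_zero]))
  have h1 := hi.comp_π_eq_zero_of_glue hX hG (Sub.inj_ι (Sub.range s)) f'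
    (subsingleton_of_forall_eq 0 fun v => by
      obtain ⟨⟨_, v, -, rfl⟩, -⟩ := v
      exact Subtype.ext (Subtype.ext (hsV v)))
    (subsingleton_of_forall_eq 0 fun w => by
      obtain ⟨w, hw⟩ := w
      obtain ⟨z, rfl⟩ := hsurj.Q w
      obtain ⟨a, rfl⟩ := (sphere_free D ∅ 0 k).Q.2 z
      have h2 : onQ (Sub.range i).π (onQ f (a • (sphereUnit D ∅ 0 k).q)) = 0 :=
        (congrArg (fun u => onQ (Sub.range i).π (onQ u (a • (sphereUnit D ∅ 0 k).q))) hf').symm.trans hw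
      rw [map_smul, hfq, map_smul, smul_eq_of_eulerElt (by rw [← map_smul, hy, map_zero])] at h2
      have h3 : a.coeff 0 H = 0 := by
        by_contra h3
        apply h0
        have h4 := congrArg (algebraMap ℚ RingT (a.coeff 0 H)⁻¹ • ·) h2
        simp only [smul_smul, ← map_mul, inv_mul_cancel₀ h3, map_one, smul_zero] at h4
        exact (one_smul _ _).symm.trans h4
      exact Subtype.ext (Subtype.ext ((congrArg (fun u => onQ u _) hs').trans
        ((hsQ a).2 (eulerElt_dvd_iff.2 (by rintro _ rfl; exact h3))))))
  apply h0
  rw [← hfq]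
  have h2 : f ≫ (Sub.range i).π = 0 := by rw [← hf', Category.assoc, h1, Limits.comp_zero]
  exact congrArg (fun u => onQ u (sphereUnit D ∅ 0 k).q) h2

/-- Divisible objects that admit gluing are injective. -/
theorem Divisible.injective_of_glue (hX : Divisible X) (hG : Glue X) : Injective X := by
  refine injective_of_split fun Y i hi => ?_
  obtain ⟨Γ, hΓ⟩ := exists_essential hi
  refine ⟨_, Γ.π, hΓ.inj, surj_of_π_eq_zero ?_⟩
  generalize i ≫ Γ.π = i at hΓ
  have hV : Subsingleton (Sub.range i).quotient.V := subsingleton_of_forall_eq 0 fun v => by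
    obtain ⟨v, rfl⟩ := (Sub.surj_π _).V v
    exact hΓ.onV_π hX hG v
  have hQ : Subsingleton (Sub.range i).quotient.Q := subsingleton_of_forall_eq 0 fun q => by
    obtain ⟨e, he, h⟩ := exists_euler_smul_Q hV q
    refine eq_zero_of_classes (M := (Sub.range i).quotient.Q) (fun H z hz => ?_) he _ h
    obtain ⟨y, rfl⟩ := (Sub.surj_π _).Q z
    have hz' : onQ (Sub.range i).π (eulerClass H • y) = 0 :=
      (map_smul (onQ (Sub.range i).π) _ _).trans hz
    obtain ⟨w, -, hw⟩ := (Sub.onQ_π _).1 hz'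
    obtain ⟨w, rfl⟩ := hX.Q H w
    have h1 : onQ (Sub.range i).π (onQ i w) = 0 := (Sub.onQ_π _).2 ⟨w, trivial, rfl⟩
    have h2 := hΓ.onQ_of_eulerClass hX hG (H := H) (q := y - onQ i w)
      (by rw [smul_sub, ← map_smul, hw, sub_self])
    rw [map_sub, h1, sub_zero] at h2
    exact h2
  have h1 : 𝟙 (Sub.range i).quotient = 0 := hom_ext_eHom hV hQ fun n => by
    have := (Sub.surj_π (Sub.range i)).epi
    rw [← cancel_epi (Sub.range i).π, ← Category.assoc, ← Category.assoc, ← eHom_comp,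
      hΓ.eHom_comp_π hX, Limits.zero_comp, Limits.zero_comp]
  rw [← Category.comp_id (Sub.range i).π, h1, Limits.comp_zero]

end StandardModel

end

noncomputable section

namespace StandardModel

variable {D : FullSubgroups} {X Y Z : StandardModel D}

/-! ### Gluing extensions -/

theorem exists_lift_of_comp_π {i : X ⟶ Y} (hi : Inj i) {W : StandardModel D} {f : W ⟶ Y}
    (hf : f ≫ (Sub.range i).π = 0) : ∃ f' : W ⟶ X, f' ≫ i = f :=
  exists_lift hi f
    (fun z => ((Sub.onV_π _).1 (congrArg (fun u => onV u z) hf)).imp fun _ h => h.2)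
    (fun z => ((Sub.onP_π _).1 (congrArg (fun u => onP u z) hf)).imp fun _ h => h.2)
    (fun z => ((Sub.onQ_π _).1 (congrArg (fun u => onQ u z) hf)).imp fun _ h => h.2)
    (fun z => ((Sub.onN_π _).1 (congrArg (fun u => onN u z) hf)).imp fun _ h => h.2)

theorem partι_π_of_ne {n n' : OverZ} (h : n ≠ n') (X : StandardModel D) :
    partι n X ≫ partπ n' X = 0 := by
  have := (inj_partι n' X).mono
  rw [← cancel_mono (partι n' X), Category.assoc, partπ_ι, ← eHom_comp, eHom_part_of_ne h,
    Limits.zero_comp, Limits.zero_comp]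

theorem inj_of_proj {J : Type} {X Z : J → StandardModel D} {f : dsum X ⟶ Y} (g : ∀ j, Y ⟶ Z j)
    (i : ∀ j, X j ⟶ Z j) (hi : ∀ j, Inj (i j)) (h : ∀ j, f ≫ g j = proj X j ≫ i j) : Inj f where
  V := (injective_iff_map_eq_zero _).2 fun x hx => dsum_extV fun j => (hi j).V
    ((congrArg (fun u => onV u x) (h j)).symm.trans ((congrArg (onV (g j)) hx).trans (by simp)))
  P := (injective_iff_map_eq_zero _).2 fun x hx => dsum_extP fun j => (hi j).P
    ((congrArg (fun u => onP u x) (h j)).symm.trans ((congrArg (onP (g j)) hx).trans (by simp)))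
  Q := (injective_iff_map_eq_zero _).2 fun x hx => dsum_extQ fun j => (hi j).Q
    ((congrArg (fun u => onQ u x) (h j)).symm.trans ((congrArg (onQ (g j)) hx).trans (by simp)))
  N := (injective_iff_map_eq_zero _).2 fun x hx => dsum_extN fun j => (hi j).N
    ((congrArg (fun u => onN u x) (h j)).symm.trans ((congrArg (onN (g j)) hx).trans (by simp)))

/-- Jointly epimorphic morphisms are jointly surjective. -/
theorem range_sup_of_joint {f : X ⟶ Z} {g : Y ⟶ Z}
    (h : ∀ {W : StandardModel D} (u : Z ⟶ W), f ≫ u = 0 → g ≫ u = 0 → u = 0) :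
    ((Sub.range f).sup (Sub.range g)).π = 0 :=
  h _ (hom_ext (fun v => (Sub.onV_π _).2 (Submodule.mem_sup_left ⟨v, trivial, rfl⟩))
      (fun v => (Sub.onP_π _).2 (Submodule.mem_sup_left ⟨v, trivial, rfl⟩))
      (fun v => (Sub.onQ_π _).2 (Submodule.mem_sup_left ⟨v, trivial, rfl⟩))
      (fun v => (Sub.onN_π _).2 (Submodule.mem_sup_left ⟨v, trivial, rfl⟩)))
    (hom_ext (fun v => (Sub.onV_π _).2 (Submodule.mem_sup_right ⟨v, trivial, rfl⟩))
      (fun v => (Sub.onP_π _).2 (Submodule.mem_sup_right ⟨v, trivial, rfl⟩))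
      (fun v => (Sub.onQ_π _).2 (Submodule.mem_sup_right ⟨v, trivial, rfl⟩))
      (fun v => (Sub.onN_π _).2 (Submodule.mem_sup_right ⟨v, trivial, rfl⟩)))

theorem Divisible.sup_range {f : X ⟶ Z} {g : Y ⟶ Z} (hX : Divisible X) (hY : Divisible Y) :
    Divisible ((Sub.range f).sup (Sub.range g)).toModel where
  Q H z := by
    obtain ⟨z, hz⟩ := z
    obtain ⟨_, ⟨x, -, rfl⟩, _, ⟨y, -, rfl⟩, rfl⟩ := Submodule.mem_sup.1 hz
    obtain ⟨x, rfl⟩ := hX.Q H x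
    obtain ⟨y, rfl⟩ := hY.Q H y
    exact ⟨⟨onQ f x + onQ g y, Submodule.add_mem_sup ⟨x, trivial, rfl⟩ ⟨y, trivial, rfl⟩⟩,
      Subtype.ext ((smul_add _ _ _).trans
        (congrArg₂ (· + ·) (map_smul (onQ f) _ _).symm (map_smul (onQ g) _ _).symm))⟩
  N H z := by
    obtain ⟨z, hz⟩ := z
    obtain ⟨_, ⟨x, -, rfl⟩, _, ⟨y, -, rfl⟩, rfl⟩ := Submodule.mem_sup.1 hz
    obtain ⟨x, rfl⟩ := hX.N H x
    obtain ⟨y, rfl⟩ := hY.N H y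
    exact ⟨⟨onN f x + onN g y, Submodule.add_mem_sup ⟨x, trivial, rfl⟩ ⟨y, trivial, rfl⟩⟩,
      Subtype.ext ((smul_add _ _ _).trans
        (congrArg₂ (· + ·) (map_smul (onN f) _ _).symm (map_smul (onN g) _ _).symm))⟩

theorem divisible_pushout {f : X ⟶ Y} {g : X ⟶ Z} (hY : Divisible Y) (hZ : Divisible Z) :
    Divisible (pushout f g) := by
  have h := range_sup_of_joint (f := pushout.inl f g) (g := pushout.inr f g) fun u h₁ h₂ =>
    pushout.hom_ext (by rw [h₁, Limits.comp_zero]) (by rw [h₂, Limits.comp_zero])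
  refine (hY.sup_range (f := pushout.inl f g) (g := pushout.inr f g) hZ).of_surj
    (f := Sub.ι _) ⟨fun y => ?_, fun y => ?_, fun y => ?_, fun y => ?_⟩
  · exact ⟨⟨y, (Sub.onV_π _).1 (congrArg (fun u => onV u y) h)⟩, rfl⟩
  · exact ⟨⟨y, (Sub.onP_π _).1 (congrArg (fun u => onP u y) h)⟩, rfl⟩
  · exact ⟨⟨y, (Sub.onQ_π _).1 (congrArg (fun u => onQ u y) h)⟩, rfl⟩
  · exact ⟨⟨y, (Sub.onN_π _).1 (congrArg (fun u => onN u y) h)⟩, rfl⟩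

/-- The gluing problems for `X`. -/
structure GlueProblem (X : StandardModel D) where
  k : ℤ
  Γ : Sub (large D k)
  g (n : OverZ) : Γ.quotient ⟶ part n X

variable (X) in
/-- The factors of the sources of all gluing problems. -/
abbrev glueSource : StandardModel D :=
  dsum fun j : GlueProblem X × OverZ => part j.2 j.1.Γ.quotient

variable (X) in
/-- The sources of all gluing problems. -/
abbrev glueTarget : StandardModel D := dsum fun j : GlueProblem X => j.Γ.quotient

variable (X) in
/-- The inclusion of all factors. -/
def glueι : glueSource X ⟶ glueTarget X :=
  desc fun j => partι j.2 j.1.Γ.quotient ≫ inj (fun j : GlueProblem X => j.Γ.quotient) j.1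

variable (X) in
/-- The morphisms of all gluing problems. -/
def glueDesc : glueSource X ⟶ X := desc fun j => partι j.2 j.1.Γ.quotient ≫ j.1.g j.2 ≫ partι j.2 X

theorem inj_glueι (X : StandardModel D) : Inj (glueι X) := by
  classical
  refine inj_of_proj (fun j => proj (fun j : GlueProblem X => j.Γ.quotient) j.1 ≫ partπ j.2 _)
    (fun j => 𝟙 _) (fun j => ⟨fun _ _ h => h, fun _ _ h => h, fun _ _ h => h, fun _ _ h => h⟩)
    fun j => dsum_hom_ext fun j' => ?_
  rw [Category.comp_id, ← Category.assoc, glueι, inj_desc, Category.assoc, ← Category.assoc (inj _ _)]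
  obtain ⟨j, n⟩ := j
  obtain ⟨j', n'⟩ := j'
  by_cases h : j' = j
  · subst h
    rw [inj_proj_self, Category.id_comp]
    by_cases hn : n' = n
    · subst hn
      rw [partι_π, inj_proj_self]
    · rw [partι_π_of_ne hn, inj_proj_of_ne (by simpa using hn)]
  · rw [inj_proj_of_ne h, Limits.zero_comp, Limits.comp_zero, inj_proj_of_ne (by simp [h])]

theorem partι_inj_inr (X : StandardModel D) (j : GlueProblem X) (n : OverZ) :
    partι n j.Γ.quotient ≫ inj (fun j : GlueProblem X => j.Γ.quotient) j ≫
      pushout.inr (glueDesc X) (glueι X) =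
    partι n j.Γ.quotient ≫ j.g n ≫ partι n X ≫ pushout.inl (glueDesc X) (glueι X) := by
  have h1 : inj (fun j : GlueProblem X × OverZ => part j.2 j.1.Γ.quotient) (j, n) ≫ glueι X =
    partι n j.Γ.quotient ≫ inj (fun j : GlueProblem X => j.Γ.quotient) j := inj_desc _ _
  have h2 : inj (fun j : GlueProblem X × OverZ => part j.2 j.1.Γ.quotient) (j, n) ≫ glueDesc X =
    partι n j.Γ.quotient ≫ j.g n ≫ partι n X := inj_desc _ _
  rw [← Category.assoc, ← h1, Category.assoc, ← pushout.condition, ← Category.assoc, h2]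
  simp only [Category.assoc]

/-- A divisible object embeds into an injective one without changing the factors at the
`H(∞, n)`. -/
theorem exists_injective_of_divisible (hX : Divisible X) :
    ∃ (Y : StandardModel D) (i : X ⟶ Y), Inj i ∧ Injective Y ∧ Divisible Y ∧
      ∀ n, eHom n Y ≫ (Sub.range i).π = 0 := by
  have := (inj_glueι X).mono
  have hi : Inj (pushout.inl (glueDesc X) (glueι X)) :=
    mono_iff.1 (Abelian.mono_pushout_of_mono_g _ _)
  have hY : Divisible (pushout (glueDesc X) (glueι X)) :=
    divisible_pushout hX (.dsum fun j : GlueProblem X => (divisible_large j.k).of_surj (Sub.surj_π _))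
  have he (n : OverZ) : eHom n _ ≫ (Sub.range (pushout.inl (glueDesc X) (glueι X))).π = 0 := by
    apply pushout.hom_ext
    · rw [← Category.assoc, ← eHom_comp, Category.assoc, comp_π_range, Limits.comp_zero,
        Limits.comp_zero]
    · rw [← Category.assoc, ← eHom_comp, Limits.comp_zero]
      refine dsum_hom_ext fun j => ?_
      rw [Category.assoc, ← Category.assoc, ← eHom_comp, ← partπ_ι, Limits.comp_zero]
      have := partι_inj_inr X j n
      simp only [Category.assoc]
      rw [← Category.assoc (inj _ _), ← Category.assoc (partι _ _), this]
      simp only [Category.assoc, comp_π_range, Limits.comp_zero]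
  refine ⟨_, _, hi, hY.injective_of_glue fun k Γ g => ?_, hY, he⟩
  have hu (n : OverZ) : ∃ u : part n (pushout (glueDesc X) (glueι X)) ⟶ X,
      u ≫ pushout.inl (glueDesc X) (glueι X) = partι n _ := by
    refine exists_lift_of_comp_π hi ?_
    rw [← partι_eHom, Category.assoc, he, Limits.comp_zero]
  choose u hu using hu
  refine ⟨inj (fun j : GlueProblem X => j.Γ.quotient) ⟨k, Γ, fun n => g n ≫ u n ≫ partπ n X⟩ ≫
    pushout.inr (glueDesc X) (glueι X), fun n => ?_⟩
  have := (inj_partι n (pushout (glueDesc X) (glueι X))).mono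
  have h1 := partι_inj_inr X ⟨k, Γ, fun n => g n ≫ u n ≫ partπ n X⟩ n
  rw [← cancel_mono (partι n _), Category.assoc, partπ_ι, ← eHom_comp, ← partπ_ι, Category.assoc, h1]
  have h2 : u n ≫ eHom n X ≫ pushout.inl (glueDesc X) (glueι X) = partι n _ := by
    rw [eHom_comp, ← Category.assoc, hu, partι_eHom]
  have h3 : partπ n Γ.quotient ≫ partι n Γ.quotient ≫ g n = g n := by
    rw [← Category.assoc, partπ_ι, eHom_comp, eHom_part, Category.comp_id]
  simp only [Category.assoc]
  rw [← Category.assoc (partπ n X), partπ_ι, h2, ← Category.assoc (partι n Γ.quotient),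
    ← Category.assoc (partπ n Γ.quotient), h3]

theorem injective_of_eHom (hX : Divisible X) (h : ∀ n, eHom n X = 0) : Injective X :=
  hX.injective_of_glue fun k Γ g => ⟨0, fun n => by
    have := (inj_partι n X).mono
    rw [← cancel_mono (partι n X), Category.assoc, partπ_ι, h, ← partι_eHom, h, Limits.comp_zero,
      Limits.comp_zero, Limits.comp_zero]⟩

end StandardModel

end

noncomputable section

section Resolution

open scoped ZeroObject

variable {C : Type 1} [Category.{0} C] [Abelian C]

/-- The objects of a complex of three terms. -/
def threeTermX (I₀ I₁ I₂ : C) : ℕ → C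
  | 0 => I₀
  | 1 => I₁
  | 2 => I₂
  | _ => 0

/-- The differentials of a complex of three terms. -/
def threeTermD {I₀ I₁ I₂ : C} (d₀ : I₀ ⟶ I₁) (d₁ : I₁ ⟶ I₂) :
    ∀ n, threeTermX I₀ I₁ I₂ n ⟶ threeTermX I₀ I₁ I₂ (n + 1)
  | 0 => d₀
  | 1 => d₁
  | _ + 2 => 0

theorem threeTermD_comp {I₀ I₁ I₂ : C} {d₀ : I₀ ⟶ I₁} {d₁ : I₁ ⟶ I₂} (w : d₀ ≫ d₁ = 0) :
    ∀ n, threeTermD d₀ d₁ n ≫ threeTermD d₀ d₁ (n + 1) = 0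
  | 0 => w
  | 1 => Limits.comp_zero
  | _ + 2 => Limits.comp_zero

theorem exists_injectiveResolution {X I₀ I₁ I₂ : C} (i : X ⟶ I₀) (d₀ : I₀ ⟶ I₁) (d₁ : I₁ ⟶ I₂)
    [Mono i] [Epi d₁] (w₀ : i ≫ d₀ = 0) (w₁ : d₀ ≫ d₁ = 0) (h₀ : (ShortComplex.mk _ _ w₀).Exact)
    (h₁ : (ShortComplex.mk _ _ w₁).Exact) (hI₀ : Injective I₀) (hI₁ : Injective I₁)
    (hI₂ : Injective I₂) :
    ∃ I : InjectiveResolution X, ∀ k : ℕ, 2 < k → IsZero (I.cocomplex.X k) := by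
  let K : CochainComplex C ℕ :=
    CochainComplex.of (threeTermX I₀ I₁ I₂) (threeTermD d₀ d₁) (threeTermD_comp w₁)
  have hd (n : ℕ) : K.d n (n + 1) = threeTermD d₀ d₁ n := CochainComplex.of_d _ _ n
  have hz (n : ℕ) : IsZero (K.X (n + 3)) := isZero_zero C
  refine ⟨{
    cocomplex := K
    injective := fun n => match n with
      | 0 => hI₀
      | 1 => hI₁
      | 2 => hI₂
      | n + 3 => Injective.zero_injective (C := C)
    ι := (CochainComplex.fromSingle₀Equiv K X).symm ⟨i, by rw [hd 0]; exact w₀⟩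
    quasiIso := ⟨fun n => ?_⟩ }, fun k hk => ?_⟩
  · cases n with
    | zero =>
      rw [CochainComplex.quasiIsoAt₀_iff, ShortComplex.quasiIso_iff_of_zeros]
      · refine (ShortComplex.exact_and_mono_f_iff_of_iso ?_).2 ⟨h₀, ‹Mono i›⟩
        exact ShortComplex.isoMk (Iso.refl _) (Iso.refl _) (Iso.refl _)
          ((Category.id_comp _).trans ((CochainComplex.fromSingle₀Equiv_symm_apply_f_zero
            (C := K) i (by rw [hd 0]; exact w₀)).symm.trans (Category.comp_id _).symm))
          ((Category.id_comp _).trans ((hd 0).symm.trans (Category.comp_id _).symm))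
      all_goals rfl
    | succ n =>
      rw [quasiIsoAt_iff_exactAt]
      · rw [HomologicalComplex.exactAt_iff' _ n (n + 1) (n + 1 + 1) (by simp) (by simp)]
        match n with
        | 0 =>
          refine (ShortComplex.exact_iff_of_iso ?_).1 h₁
          exact ShortComplex.isoMk (Iso.refl _) (Iso.refl _) (Iso.refl _)
            ((Category.id_comp _).trans ((hd 0).trans (Category.comp_id _).symm))
            ((Category.id_comp _).trans ((hd 1).trans (Category.comp_id _).symm))
        | 1 => exact (ShortComplex.exact_iff_epi _ (hd 2)).2 (by
            have h : (K.sc' 1 2 3).f = d₁ := hd 1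
            rw [h]
            exact ‹Epi d₁›)
        | n + 2 => exact ShortComplex.exact_of_isZero_X₂ _ (hz n)
      · exact CochainComplex.exactAt_succ_single_obj _ _
  · obtain ⟨k, rfl⟩ := Nat.exists_eq_add_of_lt hk
    rw [show 2 + k + 1 = k + 3 by ring]
    exact hz k

end Resolution

namespace StandardModel

variable {D : FullSubgroups} {X Y Z : StandardModel D}

/-! ### Embeddings into divisible objects -/

variable (D) in
/-- The spheres and the twists of their factors. -/
def test (T : Finset OverT) (m : ℕ) (k : ℤ) : Option OverZ → StandardModel D
  | none => sphere D T m k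
  | some n => twist (part n (sphere D T m k))

variable (D) in
/-- The divisible hulls of the test objects. -/
def testHull (k : ℤ) : Option OverZ → StandardModel D
  | none => large D k
  | some n => twist (part n (large D k))

theorem exists_part_hom (n : OverZ) (f : X ⟶ Y) : ∃ g : part n X ⟶ part n Y,
    g ≫ partι n Y = partι n X ≫ f := by
  refine ⟨partι n X ≫ f ≫ partπ n Y, ?_⟩
  rw [Category.assoc, Category.assoc, partπ_ι, ← eHom_comp, ← Category.assoc, partι_eHom]

theorem exists_test_hull (T : Finset OverT) (m : ℕ) (k : ℤ) (o : Option OverZ) :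
    ∃ i : test D T m k o ⟶ testHull D k o, Inj i := by
  cases o with
  | none => exact ⟨(sphereGen D T m k).sub.ι, Sub.inj_ι _⟩
  | some n =>
    obtain ⟨g, hg⟩ := exists_part_hom n (sphereGen D T m k).sub.ι
    have h := (inj_partι n _).comp (Sub.inj_ι (sphereGen D T m k).sub)
    rw [← hg] at h
    exact ⟨twistHom g, inj_twistHom h.of_comp⟩

theorem divisible_testHull (k : ℤ) (o : Option OverZ) : Divisible (testHull D k o) := by
  cases o with
  | none => exact divisible_large k
  | some n => exact ((divisible_large k).part n).twist

/-- A morphism from a test object. -/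
structure TestHom (X : StandardModel D) where
  T : Finset OverT
  m : ℕ
  k : ℤ
  o : Option OverZ
  hom : test D T m k o ⟶ X

/-- An object embeds so that the images of all test objects lie in a divisible subobject. -/
theorem exists_cover (X : StandardModel D) :
    ∃ (Y M : StandardModel D) (a : X ⟶ Y) (b : M ⟶ Y), Inj a ∧ Divisible M ∧
      ∀ j : TestHom X, j.hom ≫ a ≫ (Sub.range b).π = 0 := by
  choose i hi using fun j : TestHom X => exists_test_hull (D := D) j.T j.m j.k j.o
  let f : dsum (fun j : TestHom X => test D j.T j.m j.k j.o) ⟶ X := desc fun j => j.hom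
  let g : dsum (fun j : TestHom X => test D j.T j.m j.k j.o) ⟶
      dsum (fun j : TestHom X => testHull D j.k j.o) :=
    desc fun j => i j ≫ inj (fun j : TestHom X => testHull D j.k j.o) j
  have hg : Inj g := by
    classical
    refine inj_of_proj (fun j => proj (fun j : TestHom X => testHull D j.k j.o) j) i hi
      fun j => dsum_hom_ext fun j' => ?_
    rw [← Category.assoc, inj_desc, Category.assoc, ← Category.assoc (inj _ _)]
    by_cases h : j' = j
    · subst h
      rw [inj_proj_self, inj_proj_self, Category.comp_id, Category.id_comp]
    · rw [inj_proj_of_ne h, inj_proj_of_ne h, Limits.comp_zero, Limits.zero_comp]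
  have := hg.mono
  refine ⟨pushout f g, _, pushout.inl f g, pushout.inr f g,
    mono_iff.1 (Abelian.mono_pushout_of_mono_g _ _), .dsum fun j => divisible_testHull j.k j.o,
    fun j => ?_⟩
  have h1 : inj (fun j : TestHom X => test D j.T j.m j.k j.o) j ≫ f = j.hom := inj_desc _ _
  have h2 : inj (fun j : TestHom X => test D j.T j.m j.k j.o) j ≫ g =
    i j ≫ inj (fun j : TestHom X => testHull D j.k j.o) j := inj_desc _ _
  rw [← h1, Category.assoc, ← Category.assoc f, pushout.condition, Category.assoc, comp_π_range,
    Limits.comp_zero, Limits.comp_zero]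

theorem comp_part_eq_zero {c : X ⟶ Y} (h : ∀ j : TestHom X, j.hom ≫ c = 0) {n : OverZ}
    {T : Finset OverT} {m : ℕ} {k : ℤ} (f : part n (sphere D T m k) ⟶ X) : f ≫ c = 0 := by
  have := (surj_partπ n (sphere D T m k)).epi
  rw [← cancel_epi (partπ n _), ← Category.assoc, Limits.comp_zero]
  exact h ⟨T, m, k, none, partπ n _ ≫ f⟩

theorem onV_eq_zero_of_test {c : X ⟶ Y} (h : ∀ j : TestHom X, j.hom ≫ c = 0) (v : X.V) :
    onV c v = 0 :=
  onV_eq_zero_of_sphere (fun T m k f => congrArg (fun u => onV u _) (h ⟨T, m, k, none, f⟩)) v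

theorem onP_eq_zero_of_test {c : X ⟶ Y} (h : ∀ j : TestHom X, j.hom ≫ c = 0) {n : OverZ} {p : X.P}
    (hp : charFun {n} • p = p) : onP c p = 0 :=
  onP_eq_zero_of_part (fun _ _ _ f w => congrArg (fun u => onP u w) (comp_part_eq_zero h f))
    (fun T m k f w => congrArg (fun u => onP u w) (h ⟨T, m, k, some n, f⟩)) hp

theorem onN_eq_zero_of_test {c : X ⟶ Y} (h : ∀ j : TestHom X, j.hom ≫ c = 0) {n : OverZ} {x : X.N}
    (hx : inflZ D (charFun {n}) • x = x) {e : RingT} (he : e ∈ eulerT) (hex : inflT D e • x = 0) :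
    onN c x = 0 :=
  onN_eq_zero_of_part (fun _ _ _ f w => congrArg (fun u => onN u w) (comp_part_eq_zero h f))
    (fun T m k f w => congrArg (fun u => onN u w) (h ⟨T, m, k, some n, f⟩)) hx he hex

theorem comp_eq_zero_of_eHom {c : X ⟶ Y} (hV : ∀ v, onV c v = 0) (hQ : ∀ q, onQ c q = 0)
    (h : ∀ n, eHom n X ≫ c = 0) : c = 0 := by
  have hV' : Subsingleton (Sub.range c).toModel.V := subsingleton_of_forall_eq 0
    (by rintro ⟨_, v, -, rfl⟩; exact Subtype.ext (hV v))
  have hQ' : Subsingleton (Sub.range c).toModel.Q := subsingleton_of_forall_eq 0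
    (by rintro ⟨_, v, -, rfl⟩; exact Subtype.ext (hQ v))
  have h1 : (Sub.range c).ι = 0 := hom_ext_eHom hV' hQ' fun n => hom_ext
    (fun v => map_zero (onV (Sub.range c).ι))
    (by rintro ⟨_, p, -, rfl⟩; exact (map_smul (onP c) _ p).symm.trans (congrArg (fun u => onP u p) (h n)))
    (fun v => map_zero (onQ (Sub.range c).ι))
    (by rintro ⟨_, p, -, rfl⟩; exact (map_smul (onN c) _ p).symm.trans (congrArg (fun u => onN u p) (h n)))
  exact hom_ext hV (fun p => congrArg (fun u : (Sub.range c).toModel ⟶ Y =>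
      onP u (⟨onP c p, p, trivial, rfl⟩ : (Sub.range c).toModel.P)) h1) hQ
    (fun p => congrArg (fun u : (Sub.range c).toModel ⟶ Y =>
      onN u (⟨onN c p, p, trivial, rfl⟩ : (Sub.range c).toModel.N)) h1)

/-- If all test objects over `X` die in `Y / M` with `M` divisible, and all those over `Y` die under
`c`, as well as `M`, then so does `X`. -/
theorem comp_eq_zero_of_test {M W : StandardModel D} {a : X ⟶ Y} {b : M ⟶ Y} {c : Y ⟶ W}
    (hM : Divisible M) (h : ∀ j : TestHom X, j.hom ≫ a ≫ (Sub.range b).π = 0)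
    (hb : b ≫ c = 0) (hc : ∀ j : TestHom Y, j.hom ≫ c = 0) : a ≫ c = 0 := by
  obtain ⟨c', hc'⟩ := Sub.exists_desc_π (Sub.range b) c
    (by rintro _ ⟨v, -, rfl⟩; exact congrArg (fun u => onV u v) hb)
    (by rintro _ ⟨v, -, rfl⟩; exact congrArg (fun u => onP u v) hb)
    (by rintro _ ⟨v, -, rfl⟩; exact congrArg (fun u => onQ u v) hb)
    (by rintro _ ⟨v, -, rfl⟩; exact congrArg (fun u => onN u v) hb)
  have hac (j : TestHom X) : j.hom ≫ a ≫ c = 0 := by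
    rw [← hc', ← Category.assoc a, ← Category.assoc, h, Limits.zero_comp]
  refine comp_eq_zero_of_eHom (onV_eq_zero_of_test hac) (fun q => ?_) fun n => ?_
  · have hV : Subsingleton (Sub.range (a ≫ (Sub.range b).π)).toModel.V :=
      subsingleton_of_forall_eq 0
        (by rintro ⟨_, v, -, rfl⟩; exact Subtype.ext (onV_eq_zero_of_test h v))
    obtain ⟨e, he, hq⟩ := exists_euler_smul_Q hV ⟨_, q, trivial, rfl⟩
    have hq' : onQ (Sub.range b).π (e • onQ a q) = 0 :=
      (map_smul _ _ _).trans (congrArg Subtype.val hq)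
    obtain ⟨d, -, hd⟩ := (Sub.onQ_π _).1 hq'
    obtain ⟨d, rfl⟩ := hM.exists_Q he d
    have h1 := onQ_eq_zero_of_sphere (fun T m k f => hc ⟨T, m, k, none, f⟩) he
      (q := onQ a q - onQ b d) (by rw [smul_sub, ← map_smul (onQ b), hd, sub_self])
    rw [map_sub, show onQ c (onQ b d) = 0 from congrArg (fun u => onQ u d) hb, sub_zero] at h1
    exact h1
  · have hP : Subsingleton (Sub.range (eHom n X ≫ a ≫ (Sub.range b).π)).toModel.P :=
      subsingleton_of_forall_eq 0 (by
        rintro ⟨_, p, -, rfl⟩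
        exact Subtype.ext (onP_eq_zero_of_test h (n := n) (p := charFun {n} • p)
          (by rw [smul_smul, charFun_mul_self])))
    refine hom_ext (fun v => map_zero (onV (a ≫ c))) (fun p => onP_eq_zero_of_test hac (n := n)
      (p := charFun {n} • p) (by rw [smul_smul, charFun_mul_self])) (fun v => map_zero (onQ (a ≫ c)))
      fun x => ?_
    have hx : inflZ D (charFun {n}) • inflZ D (charFun {n}) • x = inflZ D (charFun {n}) • x := by
      rw [smul_smul, ← map_mul, charFun_mul_self]
    obtain ⟨e, he, hq⟩ := exists_euler_smul_N hP ⟨_, x, trivial, rfl⟩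
    have hq' : onN (Sub.range b).π (inflT D e • onN a (inflZ D (charFun {n}) • x)) = 0 :=
      (map_smul _ _ _).trans (congrArg Subtype.val hq)
    obtain ⟨d, -, hd⟩ := (Sub.onN_π _).1 hq'
    obtain ⟨d, rfl⟩ := hM.exists_N he d
    have h1 := onN_eq_zero_of_test hc (n := n) (e := e)
      (x := inflZ D (charFun {n}) • (onN a (inflZ D (charFun {n}) • x) - onN b d))
      (by rw [smul_smul, ← map_mul, charFun_mul_self]) he
      (by rw [smul_comm, smul_sub, ← map_smul (onN b), hd, sub_self, smul_zero])
    rw [smul_sub, ← map_smul, hx, map_sub, map_smul (onN c),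
      show onN c (onN b d) = 0 from congrArg (fun u => onN u d) hb, smul_zero, sub_zero] at h1
    exact h1

/-- Every object embeds into a divisible one. -/
theorem exists_divisible (X : StandardModel D) :
    ∃ (Y : StandardModel D) (i : X ⟶ Y), Inj i ∧ Divisible Y := by
  obtain ⟨Y₁, M₁, a₁, b₁, ha₁, hM₁, h₁⟩ := exists_cover X
  obtain ⟨Y₂, M₂, a₂, b₂, ha₂, hM₂, h₂⟩ := exists_cover Y₁
  set Γ := (Sub.range (b₁ ≫ a₂)).sup (Sub.range b₂) with hΓ
  have hb₁ : b₁ ≫ a₂ ≫ Γ.π = 0 := by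
    rw [← Category.assoc]
    exact hom_ext (fun v => (Sub.onV_π _).2 (Submodule.mem_sup_left ⟨v, trivial, rfl⟩))
      (fun v => (Sub.onP_π _).2 (Submodule.mem_sup_left ⟨v, trivial, rfl⟩))
      (fun v => (Sub.onQ_π _).2 (Submodule.mem_sup_left ⟨v, trivial, rfl⟩))
      (fun v => (Sub.onN_π _).2 (Submodule.mem_sup_left ⟨v, trivial, rfl⟩))
  obtain ⟨c₂, hc₂⟩ := Sub.exists_desc_π (Sub.range b₂) Γ.π
    (fun v hv => (Sub.onV_π _).2 (Submodule.mem_sup_right hv))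
    (fun v hv => (Sub.onP_π _).2 (Submodule.mem_sup_right hv))
    (fun v hv => (Sub.onQ_π _).2 (Submodule.mem_sup_right hv))
    (fun v hv => (Sub.onN_π _).2 (Submodule.mem_sup_right hv))
  have hc := comp_eq_zero_of_test hM₁ h₁ hb₁ fun j => by
    rw [← hc₂, ← Category.assoc a₂, ← Category.assoc, h₂, Limits.zero_comp]
  obtain ⟨f, hf⟩ := Γ.exists_lift_ι (a₁ ≫ a₂)
    (fun z => (Sub.onV_π _).1 (congrArg (fun u => onV u z) hc))
    (fun z => (Sub.onP_π _).1 (congrArg (fun u => onP u z) hc))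
    (fun z => (Sub.onQ_π _).1 (congrArg (fun u => onQ u z) hc))
    (fun z => (Sub.onN_π _).1 (congrArg (fun u => onN u z) hc))
  exact ⟨Γ.toModel, f, Inj.of_comp (g := Γ.ι) (hf ▸ ha₁.comp ha₂), hM₁.sup_range hM₂⟩

/-- Every object has an injective resolution with three terms. -/
theorem exists_resolution (X : StandardModel D) : ∃ I : InjectiveResolution X,
    ∀ k : ℕ, 2 < k → IsZero (I.cocomplex.X k) := by
  obtain ⟨Y, i, hi, hY⟩ := exists_divisible X
  obtain ⟨I₀, i₀, hi₀, hI₀, hI₀', -⟩ := exists_injective_of_divisible hY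
  have h₀ := exactAt_range (i ≫ i₀)
  obtain ⟨I₁, i₁, hi₁, hI₁, hI₁', he⟩ := exists_injective_of_divisible
    (hI₀'.of_surj (Sub.surj_π (Sub.range (i ≫ i₀))))
  have h₁ := exactAt_range i₁
  have := (hi.comp hi₀).mono
  have := hi₁.mono
  have := (Sub.surj_π (Sub.range (i ≫ i₀))).epi
  have := (Sub.surj_π (Sub.range i₁)).epi
  have e₀ := (h₀.shortExact (hi.comp hi₀) (Sub.surj_π _)).exact
  have e₁ := (h₁.shortExact hi₁ (Sub.surj_π _)).exact
  have w₀ : (i ≫ i₀) ≫ (Sub.range (i ≫ i₀)).π ≫ i₁ = 0 := by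
    rw [← Category.assoc, h₀.comp_eq_zero, Limits.zero_comp]
  have w₁ : ((Sub.range (i ≫ i₀)).π ≫ i₁) ≫ (Sub.range i₁).π = 0 := by
    rw [Category.assoc, h₁.comp_eq_zero, Limits.comp_zero]
  refine exists_injectiveResolution _ _ _ w₀ w₁ ?_ ?_ hI₀ hI₁
    (injective_of_eHom (hI₁'.of_surj (Sub.surj_π _)) fun n => ?_)
  · let φ : ShortComplex.mk _ _ h₀.comp_eq_zero ⟶ ShortComplex.mk _ _ w₀ :=
      { τ₁ := 𝟙 _, τ₂ := 𝟙 _, τ₃ := i₁ }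
    have : Epi φ.τ₁ := inferInstanceAs (Epi (𝟙 X))
    have : IsIso φ.τ₂ := inferInstanceAs (IsIso (𝟙 I₀))
    have : Mono φ.τ₃ := ‹Mono i₁›
    exact (ShortComplex.exact_iff_of_epi_of_isIso_of_mono φ).1 e₀
  · let φ : ShortComplex.mk _ _ w₁ ⟶ ShortComplex.mk _ _ h₁.comp_eq_zero :=
      { τ₁ := (Sub.range (i ≫ i₀)).π, τ₂ := 𝟙 _, τ₃ := 𝟙 _ }
    have : Epi φ.τ₁ := ‹Epi (Sub.range (i ≫ i₀)).π›
    have : IsIso φ.τ₂ := inferInstanceAs (IsIso (𝟙 I₁))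
    have : Mono φ.τ₃ := inferInstanceAs (Mono (𝟙 _))
    exact (ShortComplex.exact_iff_of_epi_of_isIso_of_mono φ).2 e₁
  · rw [← cancel_epi (Sub.range i₁).π, ← eHom_comp, he, Limits.comp_zero]

end StandardModel

end

noncomputable section

/-! ### Torsion and thickened cells -/

theorem X_pow_eq_mul_eulerElt {S : Type} (U : Set S) (m : ℕ) :
    (X ^ m : (S → ℚ)[X]) = eulerElt Uᶜ m * eulerElt U m := by
  refine ext_factorAt fun i => ?_
  rw [map_mul, factorAt_eulerElt, factorAt_eulerElt, map_pow, factorAt_X]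
  by_cases h : i ∈ U <;> simp [h]

namespace StandardModel

variable {D : FullSubgroups} {X Y : StandardModel D}

theorem homogeneous_ker_X_pow {S : Type} {M : GrMod (S → ℚ)[X] (degC S)} (m : ℕ) :
    GrMod.Homogeneous (LinearMap.ker (LinearMap.lsmul (S → ℚ)[X] M (Polynomial.X ^ m))) :=
  fun _ x hx => (GrMod.proj_smul (X_pow_mem_degC S m) x).symm.trans
    ((congrArg _ hx).trans (map_zero _))

/-- The elements that `c ^ m` annihilates. -/
def Sub.torsion (X : StandardModel D) [hV : Subsingleton X.V] [hP : Subsingleton X.P] (m : ℕ) :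
    Sub X where
  V := ⊥
  P := ⊥
  Q := LinearMap.ker (LinearMap.lsmul RingT X.Q (Polynomial.X ^ m))
  N := LinearMap.ker (LinearMap.lsmul (RingF D) X.N (Polynomial.X ^ m))
  homV := Sub.homogeneous_bot
  homP := Sub.homogeneous_bot
  homQ := homogeneous_ker_X_pow m
  homN := homogeneous_ker_X_pow m
  spanP := spans_bot_of fun x _ => by
    obtain ⟨e, he, h⟩ := exists_euler_smul_N hP x
    exact mk_euler_eq_zero ⟨e, he⟩ h 1
  spanQ := Spans.ker (flat_locInflT D) X.extQ_baseChange X.extQ_baseChange fun q => by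
    rw [loc_map_lsmul, LinearMap.lsmul_apply, ext_smul_locInflT, map_pow]
    congr 2
    exact Polynomial.map_X _
  spanVP := Spans.bot
  spanVQ := spans_bot_of fun q _ => by
    obtain ⟨e, he, h⟩ := exists_euler_smul_Q hV q
    rw [← LocalizedModule.zero_mk 1, LocalizedModule.mk_eq]
    exact ⟨⟨e, he⟩, by simpa [Submonoid.smul_def] using h⟩
  actP_mem p _ := by rw [Subsingleton.elim p 0, map_zero]; exact zero_mem _
  actN_mem x hx := by
    rw [LinearMap.mem_ker, LinearMap.lsmul_apply, ← map_smul]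
    exact (congrArg _ hx).trans (map_zero _)

/-- The elements of `N` that die in `ℐ⁻¹ N`. -/
def Sub.cofTorsion (X : StandardModel D) [hP : Subsingleton X.P] : Sub X :=
  Sub.ofN (LinearMap.ker (LocalizedModule.mkLinearMap (cofF D) X.N))
    (fun k x hx => by
      obtain ⟨T, hT, h⟩ := mk_cofF_eq_iff.1
        ((LinearMap.mem_ker.1 hx).trans (LocalizedModule.zero_mk 1).symm)
      refine (mk_cofF_eq_iff.2 ⟨T, hT, ?_⟩).trans (LocalizedModule.zero_mk 1)
      rw [← GrMod.proj_smul_zero (inflZ_mem_degC D _), h, smul_zero, map_zero])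
    (fun x _ => exists_euler_smul_N hP x) (fun x hx => hx) fun x hx => (X.actN_cof x).trans hx

/-- The generators that are divisible by `c ^ m` at `H`. -/
def eulerGen (H : OverT) (m : ℕ) (k : ℤ) : Gen (sphere D ∅ 0 k) {H} m k where
  v := (sphereUnit D ∅ 0 k).v
  p := (sphereUnit D ∅ 0 k).p
  q := eulerElt {H} m • (sphereUnit D ∅ 0 k).q
  x := inflT D (eulerElt {H} m) • (sphereUnit D ∅ 0 k).x
  v_mem := (sphereUnit D ∅ 0 k).v_mem
  p_mem := (sphereUnit D ∅ 0 k).p_mem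
  q_mem := by
    have := (sphereUnit D ∅ 0 k).q_mem.enlarge (U' := {H}) (m' := m) preservesDegree_id
    simpa [eulerElt_zero] using this
  x_mem := by
    have := (sphereUnit D ∅ 0 k).x_mem.enlarge (U' := {H}) (m' := m) (preservesDegree_inflT D)
    simpa [eulerElt_zero] using this
  extVP := (sphereUnit D ∅ 0 k).extVP
  extVQ := by
    rw [(sphereUnit D ∅ 0 k).extVQ]
    exact (loc_mk_eq_iff _ _).2 ⟨1, one_mem _, by simp⟩
  extP := by
    rw [(sphereUnit D ∅ 0 k).extP]
    exact (loc_mk_eq_iff _ _).2 ⟨1, one_mem _, by simp [eulerOf]⟩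
  extQ := by
    rw [ext_smul_locInflT, (sphereUnit D ∅ 0 k).extQ, smul_mk_one]
  actP := (sphereUnit D ∅ 0 k).actP
  actN := by rw [map_smul, (sphereUnit D ∅ 0 k).actN]

variable (D) in
/-- The cell at `H ⊇ T̃`, thickened to length `m`. -/
def thick (H : OverT) (m : ℕ) (k : ℤ) : StandardModel D := (eulerGen (D := D) H m k).sub.quotient

variable (D) in
/-- The generators. -/
def thickUnit (H : OverT) (m : ℕ) (k : ℤ) : Gen (thick D H m k) ∅ 0 k :=
  (sphereUnit D ∅ 0 k).map (eulerGen H m k).sub.π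

theorem smul_mem_span_iff {R M : Type} [CommRing R] [AddCommGroup M] [Module R M] {x : M}
    (h : Function.Injective fun a : R => a • x) {a e : R} :
    a • x ∈ Submodule.span R {e • x} ↔ e ∣ a := by
  rw [Submodule.mem_span_singleton]
  refine ⟨fun ⟨r, hr⟩ => ⟨r, h ?_⟩, fun ⟨r, hr⟩ => ⟨r, ?_⟩⟩
  · change a • x = (e * r) • x
    rw [← hr, smul_smul, mul_comm]
  · rw [hr, smul_smul, mul_comm]

section Thick

variable {H : OverT} {m : ℕ} {k : ℤ}

theorem exists_smul_thickUnit_q (y : (thick D H m k).Q) :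
    ∃ a : RingT, y = a • (thickUnit D H m k).q := by
  obtain ⟨y, rfl⟩ := (Sub.surj_π _).Q y
  obtain ⟨a, rfl⟩ := (sphere_free D ∅ 0 k).Q.2 y
  exact ⟨a, map_smul (onQ (eulerGen H m k).sub.π) _ _⟩

theorem exists_smul_thickUnit_x (y : (thick D H m k).N) :
    ∃ a : RingF D, y = a • (thickUnit D H m k).x := by
  obtain ⟨y, rfl⟩ := (Sub.surj_π _).N y
  obtain ⟨a, rfl⟩ := (sphere_free D ∅ 0 k).N.2 y
  exact ⟨a, map_smul (onN (eulerGen H m k).sub.π) _ _⟩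

theorem smul_thickUnit_q {a : RingT} : a • (thickUnit D H m k).q = 0 ↔ eulerElt {H} m ∣ a := by
  rw [← smul_mem_span_iff (sphere_free D ∅ 0 k).Q.1]
  exact (Eq.congr_left (map_smul (onQ (eulerGen H m k).sub.π) _ _).symm).trans (Sub.onQ_π _)

theorem smul_thickUnit_x {a : RingF D} :
    a • (thickUnit D H m k).x = 0 ↔ inflT D (eulerElt {H} m) ∣ a := by
  rw [← smul_mem_span_iff (sphere_free D ∅ 0 k).N.1]
  exact (Eq.congr_left (map_smul (onN (eulerGen H m k).sub.π) _ _).symm).trans (Sub.onN_π _)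

instance : Subsingleton (thick D H m k).V := subsingleton_of_forall_eq 0 fun v => by
  obtain ⟨v, rfl⟩ := (Sub.surj_π _).V v
  obtain ⟨a, rfl⟩ := (sphere_free D ∅ 0 k).V.2 v
  exact (Sub.onV_π _).2 (Submodule.smul_mem _ a (Submodule.mem_span_singleton_self _))

instance : Subsingleton (thick D H m k).P := subsingleton_of_forall_eq 0 fun v => by
  obtain ⟨v, rfl⟩ := (Sub.surj_π _).P v
  obtain ⟨a, rfl⟩ := (sphere_free D ∅ 0 k).P.2 v
  exact (Sub.onP_π _).2 (Submodule.smul_mem _ a (Submodule.mem_span_singleton_self _))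

end Thick

end StandardModel

end

noncomputable section

/-! ### The bound on the injective dimension is attained -/

theorem exists_short_of_injectiveResolution {C : Type*} [Category C] [Abelian C] {X : C}
    (I : InjectiveResolution X) (hI : ∀ k : ℕ, 1 < k → IsZero (I.cocomplex.X k)) :
    ∃ (J₀ J₁ : C) (f : X ⟶ J₀) (g : J₀ ⟶ J₁) (w : f ≫ g = 0), Injective J₀ ∧ Injective J₁ ∧
      Mono f ∧ Epi g ∧ (ShortComplex.mk f g w).Exact :=
  ⟨I.cocomplex.X 0, _, I.ι.f 0, I.cocomplex.d 0 1, I.ι_f_zero_comp_complex_d, I.injective 0, I.injective 1,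
    (inferInstance : Mono (I.ι.f 0)), (I.exact_succ 0).epi_f ((hI 2 one_lt_two).eq_of_tgt _ _), I.exact₀⟩

namespace StandardModel

variable {D : FullSubgroups}

theorem mem_cofTorsion {X : StandardModel D} [Subsingleton X.P] {x : X.N} :
    x ∈ (Sub.cofTorsion X).N ↔ ∃ T : Set OverZ, Tᶜ.Finite ∧ inflZ D (charFun T) • x = 0 := by
  have := mk_cofF_eq_iff (D := D) (x := x) (x' := 0)
  simp only [smul_zero, LocalizedModule.zero_mk] at this
  exact this

theorem inflT_X (D : FullSubgroups) : inflT D Polynomial.X = Polynomial.X := Polynomial.map_X _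

theorem charFun_singleton_smul {T : Set OverZ} {n : OverZ} (hn : n ∈ T) {M : Type} [AddCommGroup M]
    [Module (RingF D) M] {x y : M} (h : inflZ D (charFun T) • x = inflZ D (charFun T) • y) :
    inflZ D (charFun {n}) • x = inflZ D (charFun {n}) • y := by
  rw [← Set.inter_eq_left.2 (Set.singleton_subset_iff.2 hn), ← charFun_mul, map_mul, mul_smul,
    mul_smul, h]

theorem inj_of_surj_comp {X Y Z : StandardModel D} {p : X ⟶ Y} {j : Y ⟶ Z} (hp : Surj p)
    (hV : ∀ x, onV (p ≫ j) x = 0 → onV p x = 0) (hP : ∀ x, onP (p ≫ j) x = 0 → onP p x = 0)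
    (hQ : ∀ x, onQ (p ≫ j) x = 0 → onQ p x = 0) (hN : ∀ x, onN (p ≫ j) x = 0 → onN p x = 0) :
    Inj j where
  V := (injective_iff_map_eq_zero _).2 fun y hy => by obtain ⟨x, rfl⟩ := hp.V y; exact hV x hy
  P := (injective_iff_map_eq_zero _).2 fun y hy => by obtain ⟨x, rfl⟩ := hp.P y; exact hP x hy
  Q := (injective_iff_map_eq_zero _).2 fun y hy => by obtain ⟨x, rfl⟩ := hp.Q y; exact hQ x hy
  N := (injective_iff_map_eq_zero _).2 fun y hy => by obtain ⟨x, rfl⟩ := hp.N y; exact hN x hy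

variable (D) in
/-- Some object has no injective resolution of length one. -/
theorem exists_not_short : ∃ X : StandardModel D, ¬ ∃ I : InjectiveResolution X,
    ∀ k : ℕ, 1 < k → IsZero (I.cocomplex.X k) := by
  let M := thick D (1, Splitting.s) 2 0
  let u : Gen M ∅ 0 0 := thickUnit D _ 2 0
  let A := Sub.torsion M 1
  have : Subsingleton A.toModel.P := inferInstanceAs (Subsingleton (⊥ : Submodule RingZ M.P))
  let B := Sub.cofTorsion A.toModel
  refine ⟨B.toModel, fun ⟨I, hI⟩ => ?_⟩
  obtain ⟨J₀, J₁, f, g, w, hJ₀, hJ₁, hf, hg, ex⟩ := exists_short_of_injectiveResolution I hI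
  have hf' := mono_iff.1 hf
  have ex := exactAt_of_exact w ex hf'
  have := (Sub.inj_ι B).mono
  let a : A.toModel ⟶ J₀ := Injective.factorThru f B.ι
  have ha : B.ι ≫ a = f := Injective.comp_factorThru _ _
  obtain ⟨b, hb⟩ := CokernelCofork.IsColimit.desc' ((exactAt_ι_π B).isColimit (Sub.surj_π B)) (a ≫ g)
    (by rw [← Category.assoc, ha, w])
  change B.π ≫ b = a ≫ g at hb
  obtain ⟨j, hj⟩ := CokernelCofork.IsColimit.desc' ((exactAt_ι_π B).isColimit (Sub.surj_π B))
    (A.ι ≫ (Sub.cofTorsion M).π) (hom_ext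
    (fun v => (Sub.onV_π _).2 (congrArg Subtype.val v.2))
    (fun v => (Sub.onP_π _).2 (congrArg Subtype.val v.2))
    (fun v => (Sub.onQ_π _).2 (congrArg Subtype.val v.2))
    (fun v => (Sub.onN_π _).2 (by
      obtain ⟨T, hT, h⟩ := mem_cofTorsion.1 v.2
      exact mem_cofTorsion.2 ⟨T, hT, congrArg Subtype.val h⟩)))
  change B.π ≫ j = A.ι ≫ (Sub.cofTorsion M).π at hj
  have hj' : Inj j := by
    refine inj_of_surj_comp (Sub.surj_π B) (fun v hv => ?_) (fun v hv => ?_) (fun v hv => ?_) fun x hx => ?_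
    · rw [hj] at hv
      exact (Sub.onV_π _).2 (Subtype.ext ((Sub.onV_π _).1 hv))
    · rw [hj] at hv
      exact (Sub.onP_π _).2 (Subtype.ext ((Sub.onP_π _).1 hv))
    · rw [hj] at hv
      exact (Sub.onQ_π _).2 (Subtype.ext ((Sub.onQ_π _).1 hv))
    · rw [hj] at hx
      obtain ⟨T, hT, h⟩ := mem_cofTorsion.1 ((Sub.onN_π _).1 hx)
      exact (Sub.onN_π _).2 (mem_cofTorsion.2 ⟨T, hT, Subtype.ext h⟩)
  have := hj'.mono
  let φ : (Sub.cofTorsion M).quotient ⟶ J₁ := Injective.factorThru b j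
  have hφ : j ≫ φ = b := Injective.comp_factorThru _ _
  have hag : a ≫ g = A.ι ≫ (Sub.cofTorsion M).π ≫ φ := by
    rw [← hb, ← hφ, ← Category.assoc, hj, Category.assoc]
  let ψ := (Sub.cofTorsion M).π ≫ φ
  have hM : (Polynomial.X : RingT) • (Polynomial.X : RingT) • u.q = 0 := by
    rw [smul_smul, ← pow_two]
    exact smul_thickUnit_q.2 ⟨_, (X_pow_eq_mul_eulerElt _ 2).trans (mul_comm _ _)⟩
  let q₀ : A.toModel.Q := ⟨(Polynomial.X : RingT) • u.q, by
    change (Polynomial.X : RingT) ^ 1 • (Polynomial.X : RingT) • u.q = 0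
    rw [pow_one, hM]⟩
  obtain ⟨r, hr⟩ := (epi_iff.1 hg).Q (onQ ψ u.q)
  have hr' : (Polynomial.X : RingT) • r = onQ a q₀ := by
    rw [← sub_eq_zero]
    obtain ⟨z, hz⟩ := (ex.Q _).1 (show onQ g ((Polynomial.X : RingT) • r - onQ a q₀) = 0 by
      rw [map_sub, map_smul, hr, sub_eq_zero]
      exact (map_smul (onQ ψ) _ _).symm.trans (congrArg (fun f => onQ f q₀) hag).symm)
    have hz' : z = 0 := Subtype.ext ((Submodule.mem_bot RingT).1 z.2)
    rw [← hz, hz', map_zero]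
  obtain ⟨x, hx⟩ := exists_mk_cofF (J₀.extQ r)
  obtain ⟨x₀, hx₀⟩ := exists_mk_cofF (A.toModel.extQ q₀)
  have hu : M.extQ u.q = LocalizedModule.mk u.x 1 := u.extQ
  obtain ⟨T₁, hT₁, h₁⟩ := mk_cofF_eq_iff.1 (show LocalizedModule.mk (onN A.ι x₀) 1 =
      (LocalizedModule.mk ((Polynomial.X : RingF D) • u.x) 1 : LocalizedModule (cofF D) M.N) by
    rw [← smul_mk_one, ← hu, ← LocalizedModule.map_mk, ← hx₀, ← extQ_onQ]
    exact (ext_smul_locInflT _ _).trans (congrArg (· • M.extQ u.q) (inflT_X D)))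
  obtain ⟨T₂, hT₂, h₂⟩ := mk_cofF_eq_iff.1 (show LocalizedModule.mk ((Polynomial.X : RingF D) • x) 1 =
      (LocalizedModule.mk (onN a x₀) 1 : LocalizedModule (cofF D) J₀.N) by
    rw [← smul_mk_one, ← hx, ← LocalizedModule.map_mk, ← hx₀, ← extQ_onQ, ← hr',
      ext_smul_locInflT, inflT_X])
  obtain ⟨T₃, hT₃, h₃⟩ := mk_cofF_eq_iff.1 (show LocalizedModule.mk (onN g x) 1 =
      (LocalizedModule.mk (onN ψ u.x) 1 : LocalizedModule (cofF D) J₁.N) by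
    rw [← LocalizedModule.map_mk, ← LocalizedModule.map_mk, ← hx, ← hu, ← extQ_onQ, ← extQ_onQ, hr])
  obtain ⟨n, hn⟩ : (T₁ ∩ T₂ ∩ T₃).Nonempty := by
    refine Set.Infinite.nonempty (fun h => Set.infinite_univ (α := OverZ) ?_)
    rw [← Set.union_compl_self (T₁ ∩ T₂ ∩ T₃), Set.compl_inter, Set.compl_inter]
    exact h.union ((hT₁.union hT₂).union hT₃)
  have h₁ := charFun_singleton_smul hn.1.1 h₁
  have h₂ := charFun_singleton_smul hn.1.2 h₂
  have h₃ := charFun_singleton_smul hn.2 h₃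
  obtain ⟨w₁, hw₁⟩ := (ex.N _).1 (show onN g (inflZ D (charFun {n}) • x) = 0 by
    rw [map_smul, h₃, ← map_smul]
    refine (congrArg (onN φ) ?_).trans (map_zero _)
    exact (Sub.onN_π _).2 (mk_cofF_eq_zero (n := n) (by rw [smul_smul, ← map_mul, charFun_mul_self])))
  have hw₁' : (Polynomial.X : RingF D) • w₁ = 0 := Subtype.ext (Subtype.ext
    ((congrArg (· • w₁.1.1) (pow_one (Polynomial.X : RingF D))).symm.trans w₁.1.2))
  let y : B.toModel.N := ⟨inflZ D (charFun {n}) • x₀,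
    mk_cofF_eq_zero (n := n) (by rw [smul_smul, ← map_mul, charFun_mul_self])⟩
  have hy : y = 0 := hf'.N (by
    rw [map_zero, ← ha]
    refine (map_smul (onN a) _ x₀).trans ?_
    rw [← h₂, smul_comm, ← hw₁, ← map_smul, hw₁', map_zero])
  have hy' : (inflZ D (charFun {n}) * Polynomial.X) • u.x = 0 := by
    rw [mul_smul, ← h₁]
    exact congrArg (fun z : B.toModel.N => z.1.1) hy
  obtain ⟨s, hs⟩ := smul_thickUnit_x.1 hy'
  let F : FiniteSubgroup D := ⟨1, n, SubgroupLabel.oneS, fun h => by cases h⟩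
  have hF := congrArg (factorAt F) hs
  rw [map_mul, map_mul, inflZ_charFun, factorAt_idem, inflT_eulerElt, factorAt_eulerElt, factorAt_X,
    if_pos (show F ∈ FiniteSubgroup.mulZ ⁻¹' {n} from rfl),
    if_pos (show F ∈ FiniteSubgroup.mulT ⁻¹' {(1, Splitting.s)} from rfl), one_mul] at hF
  have := congrArg (fun p : ℚ[X] => p.coeff 1) hF
  simp [Polynomial.coeff_X_pow_mul'] at this

end StandardModel

end

noncomputable section

/-! ### Telescopes and direct sums of lines -/

section DirectSum

theorem telescope_exact {M : ℕ → Type} [∀ i, AddCommGroup (M i)] {L : Type} [AddCommGroup L]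
    {dec : DecidableEq ℕ} {t : ∀ i, M i →+ M (i + 1)} {u : ∀ i, M i →+ L}
    {φ : DirectSum ℕ M →+ DirectSum ℕ M} {ψ : DirectSum ℕ M →+ L}
    (hφ : ∀ i m, φ (DirectSum.of M i m) = DirectSum.of M i m + -DirectSum.of M (i + 1) (t i m))
    (hψ : ∀ i m, ψ (DirectSum.of M i m) = u i m) (comm : ∀ i m, u (i + 1) (t i m) = u i m)
    (ker : ∀ i m, u i m = 0 → t i m = 0) :
    Function.Injective φ ∧ ∀ y, ψ y = 0 ↔ ∃ x, φ x = y := by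
  simp only [← sub_eq_add_neg] at hφ
  constructor
  · have h0 x : φ x 0 = x 0 := by
      induction x using DirectSum.induction_on with
      | zero => simp
      | of i m => rw [hφ, DirectSum.sub_apply, DirectSum.of_eq_of_ne (i + 1) 0 _ (by simp), sub_zero]
      | add x y hx hy => rw [map_add, DirectSum.add_apply, hx, hy, DirectSum.add_apply]
    have h1 x j : φ x (j + 1) = x (j + 1) - t j (x j) := by
      induction x using DirectSum.induction_on with
      | zero => simp
      | of i m =>
        rw [hφ, DirectSum.sub_apply]
        congr 1
        by_cases h : i = j
        · subst h; rw [DirectSum.of_eq_same, DirectSum.of_eq_same]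
        · rw [DirectSum.of_eq_of_ne _ _ _ (by omega), DirectSum.of_eq_of_ne _ _ _ (by omega),
            map_zero]
      | add x y hx hy =>
        rw [map_add, DirectSum.add_apply, hx, hy, DirectSum.add_apply, DirectSum.add_apply, map_add]
        abel
    refine (injective_iff_map_eq_zero _).2 fun x hx => DFinsupp.ext fun j => ?_
    induction j with
    | zero => rw [← h0, hx]
    | succ j ih =>
      have := h1 x j
      rw [show x j = 0 from ih, map_zero, sub_zero, hx] at this
      exact this.symm
  · have shift i (m : M i) k : ∃ m' x, DirectSum.of M i m = DirectSum.of M (i + k) m' + φ x := by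
      induction k with
      | zero => exact ⟨m, 0, by simp⟩
      | succ k ih =>
        obtain ⟨m', x, h⟩ := ih
        exact ⟨t _ m', x + DirectSum.of M _ m', by
          change _ = DirectSum.of M (i + k + 1) (t (i + k) m') + _
          rw [h, map_add, hφ]; abel⟩
    have key y : ∃ i m x, y = DirectSum.of M i m + φ x := by
      induction y using DirectSum.induction_on with
      | zero => exact ⟨0, 0, 0, by simp⟩
      | of i m => exact ⟨i, m, 0, by simp⟩
      | add y y' hy hy' =>
        obtain ⟨i, m, x, rfl⟩ := hy
        obtain ⟨i', m', x', rfl⟩ := hy'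
        wlog h : i ≤ i' generalizing i m x i' m' x'
        · obtain ⟨j, n, z, hz⟩ := this i' m' x' i m x (le_of_not_ge h)
          exact ⟨j, n, z, by rw [← hz, add_comm]⟩
        · obtain ⟨k, rfl⟩ := Nat.exists_eq_add_of_le h
          obtain ⟨n, z, hz⟩ := shift i m k
          exact ⟨i + k, n + m', z + x + x', by rw [hz]; simp only [map_add]; abel⟩
    have hψφ x : ψ (φ x) = 0 := by
      induction x using DirectSum.induction_on with
      | zero => simp
      | of i m => rw [hφ, map_sub, hψ, hψ, comm, sub_self]
      | add x y hx hy => rw [map_add, map_add, hx, hy, add_zero]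
    refine fun y => ⟨fun h => ?_, fun ⟨x, hx⟩ => hx ▸ hψφ x⟩
    obtain ⟨i, m, x, rfl⟩ := key y
    rw [map_add, hψ, hψφ, add_zero] at h
    exact ⟨DirectSum.of M i m + x, by rw [map_add, hφ, ker i m h, map_zero, sub_zero]⟩

/-- A set that generates a vector space contains a basis. -/
theorem exists_basis (R : Type) [CommRing R] [Algebra ℚ R] {L : Type} [AddCommGroup L] [Module R L]
    {s : Set L} (hs : AddSubgroup.closure s = ⊤) : ∃ b ⊆ s, 0 ∉ b ∧ ∀ (M : b → Type)
      [∀ j, AddCommGroup (M j)] [∀ j, Module R (M j)] (_ : DecidableEq b) (w : ∀ j, M j)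
      (_ : ∀ j m, ∃ r : ℚ, m = algebraMap ℚ R r • w j) (ψ : DirectSum b M →ₗ[R] L)
      (_ : ∀ j, ψ (DirectSum.lof R b M j (w j)) = j), Function.Bijective ψ := by
  let : Module ℚ L := Module.compHom L (algebraMap ℚ R)
  obtain ⟨b, hb, hspan, hli⟩ := exists_linearIndependent ℚ s
  refine ⟨b, hb, fun h => hli.ne_zero ⟨0, h⟩ rfl, fun M _ _ _ w hw ψ hψ => ?_⟩
  let (j : b) : Module ℚ (M j) := Module.compHom (M j) (algebraMap ℚ R)
  have htop : ⊤ ≤ Submodule.span ℚ (Set.range ((↑) : b → L)) := by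
    rw [Subtype.range_coe, hspan, ← Submodule.toAddSubgroup_le, Submodule.top_toAddSubgroup, ← hs,
      AddSubgroup.closure_le]
    exact Submodule.subset_span
  let B := Module.Basis.mk hli htop
  have hB j : B j = j := Module.Basis.mk_apply hli htop j
  let g : L →ₗ[ℚ] DirectSum b M := B.constr ℚ fun j => DirectSum.lof R b M j (w j)
  have hg (j : b) : g j = DirectSum.lof R b M j (w j) := by rw [← hB, Module.Basis.constr_basis]
  refine ⟨Function.LeftInverse.injective (g := g) fun x => ?_,
    Function.RightInverse.surjective (g := g) fun y => ?_⟩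
  · induction x using DirectSum.induction_on with
    | zero => simp
    | of j m =>
      obtain ⟨r, rfl⟩ := hw j m
      have : DirectSum.of M j (algebraMap ℚ R r • w j) =
        algebraMap ℚ R r • DirectSum.lof R b M j (w j) := (map_smul (DirectSum.lof R b M j) _ _)
      rw [this, map_smul, hψ]
      refine (g.map_smul r j).trans ?_
      rw [hg]
      exact (map_smul (DirectSum.lof ℚ b M j) r (w j)).symm.trans this
    | add x y hx hy => rw [map_add, map_add, hx, hy]
  · exact LinearMap.congr_fun (B.ext (f₁ := ψ.toAddMonoidHom.toRatLinearMap ∘ₗ g)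
      (f₂ := LinearMap.id) fun j => by
        rw [hB]; exact (congrArg ψ (hg j)).trans (hψ j)) y

end DirectSum

namespace StandardModel

variable {D : FullSubgroups} {X Y Z : StandardModel D}

/-! ### Closure properties of the cellular objects -/

theorem isCellular_dsum {J : Type} {W : J → StandardModel D} (h : ∀ j, IsCellular (W j)) :
    IsCellular (dsum W) := .coproduct W _ (isColimitDsum W) h

theorem isCellular_of_isIso (f : X ⟶ Y) [IsIso f] (h : IsCellular X) : IsCellular Y :=
  .coproduct (fun _ : Unit => X) (Cofan.mk Y fun _ => f)
    (Cofan.IsColimit.mk _ (fun t => inv f ≫ t.inj ()) (fun t _ => IsIso.hom_inv_id_assoc f _)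
      fun t m hm => by rw [← hm ()]; exact (IsIso.inv_hom_id_assoc f m).symm) fun _ => h

/-- A morphism with cellular kernel and cokernel. -/
theorem isCellular_iff_of_hom (f : X ⟶ Y)
    (hK : ∀ (W : StandardModel D) (g : W ⟶ X), Inj g → g ≫ f = 0 → IsCellular W)
    (hC : ∀ (W : StandardModel D) (g : Y ⟶ W), Surj g → f ≫ g = 0 → IsCellular W) :
    IsCellular X ↔ IsCellular Y := by
  obtain ⟨j, hj⟩ := Sub.exists_desc_π (Sub.ker f) f (fun _ h => h) (fun _ h => h) (fun _ h => h)
    fun _ h => h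
  have hj' : Inj j := inj_of_surj_comp (Sub.surj_π _) (fun x hx => (Sub.onV_π _).2 (hj ▸ hx))
    (fun x hx => (Sub.onP_π _).2 (hj ▸ hx)) (fun x hx => (Sub.onQ_π _).2 (hj ▸ hx))
    (fun x hx => (Sub.onN_π _).2 (hj ▸ hx))
  have h₁ := (exactAt_ι_π (Sub.ker f)).shortExact (Sub.inj_ι _) (Sub.surj_π _)
  have h₂ := (exactAt_range j).shortExact hj' (Sub.surj_π _)
  have k₁ := hK _ (Sub.ker f).ι (Sub.inj_ι _) (ι_ker_comp f)
  have k₂ := hC _ (Sub.range j).π (Sub.surj_π _) 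
    ((congrArg (· ≫ (Sub.range j).π) hj).symm.trans (by
      rw [Category.assoc, comp_π_range, Limits.comp_zero]))
  exact ⟨fun h => .middle _ h₂ (.right _ h₁ k₁ h) k₂, fun h => .middle _ h₁ k₁ (.left _ h₂ h k₂)⟩

/-- Sequential colimits of cellular objects are cellular. -/
theorem isCellular_of_telescope {W : ℕ → StandardModel D} (hW : ∀ i, IsCellular (W i))
    (t : ∀ i, W i ⟶ W (i + 1)) (u : ∀ i, W i ⟶ X) (comm : ∀ i, t i ≫ u (i + 1) = u i)
    (ker : ∀ i, (Sub.ker (u i)).ι ≫ t i = 0) (surj : Surj (desc u)) : IsCellular X := by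
  let φ : dsum W ⟶ dsum W := desc fun i => inj W i - t i ≫ inj W (i + 1)
  have hφ i : inj W i ≫ φ = inj W i - t i ≫ inj W (i + 1) := inj_desc _ _
  have hu i : inj W i ≫ desc u = u i := inj_desc _ _
  have hV := telescope_exact (dec := fun a b => Classical.propDecidable _) (φ := (onV φ).toAddMonoidHom) (ψ := (onV (desc u)).toAddMonoidHom)
    (t := fun i => (onV (t i)).toAddMonoidHom) (u := fun i => (onV (u i)).toAddMonoidHom)
    (fun i m => congrArg (fun f : W i ⟶ dsum W => onV f m) (hφ i))
    (fun i m => congrArg (fun f : W i ⟶ X => onV f m) (hu i))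
    (fun i m => congrArg (fun f : W i ⟶ X => onV f m) (comm i))
    (fun i m h => congrArg (fun f : (Sub.ker (u i)).toModel ⟶ _ =>
      onV f (⟨m, h⟩ : (Sub.ker (u i)).toModel.V)) (ker i))
  have hP := telescope_exact (dec := fun a b => Classical.propDecidable _) (φ := (onP φ).toAddMonoidHom) (ψ := (onP (desc u)).toAddMonoidHom)
    (t := fun i => (onP (t i)).toAddMonoidHom) (u := fun i => (onP (u i)).toAddMonoidHom)
    (fun i m => congrArg (fun f : W i ⟶ dsum W => onP f m) (hφ i))
    (fun i m => congrArg (fun f : W i ⟶ X => onP f m) (hu i))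
    (fun i m => congrArg (fun f : W i ⟶ X => onP f m) (comm i))
    (fun i m h => congrArg (fun f : (Sub.ker (u i)).toModel ⟶ _ =>
      onP f (⟨m, h⟩ : (Sub.ker (u i)).toModel.P)) (ker i))
  have hQ := telescope_exact (dec := fun a b => Classical.propDecidable _) (φ := (onQ φ).toAddMonoidHom) (ψ := (onQ (desc u)).toAddMonoidHom)
    (t := fun i => (onQ (t i)).toAddMonoidHom) (u := fun i => (onQ (u i)).toAddMonoidHom)
    (fun i m => congrArg (fun f : W i ⟶ dsum W => onQ f m) (hφ i))
    (fun i m => congrArg (fun f : W i ⟶ X => onQ f m) (hu i))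
    (fun i m => congrArg (fun f : W i ⟶ X => onQ f m) (comm i))
    (fun i m h => congrArg (fun f : (Sub.ker (u i)).toModel ⟶ _ =>
      onQ f (⟨m, h⟩ : (Sub.ker (u i)).toModel.Q)) (ker i))
  have hN := telescope_exact (dec := fun a b => Classical.propDecidable _) (φ := (onN φ).toAddMonoidHom) (ψ := (onN (desc u)).toAddMonoidHom)
    (t := fun i => (onN (t i)).toAddMonoidHom) (u := fun i => (onN (u i)).toAddMonoidHom)
    (fun i m => congrArg (fun f : W i ⟶ dsum W => onN f m) (hφ i))
    (fun i m => congrArg (fun f : W i ⟶ X => onN f m) (hu i))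
    (fun i m => congrArg (fun f : W i ⟶ X => onN f m) (comm i))
    (fun i m h => congrArg (fun f : (Sub.ker (u i)).toModel ⟶ _ =>
      onN f (⟨m, h⟩ : (Sub.ker (u i)).toModel.N)) (ker i))
  have ex : ExactAt φ (desc u) := ⟨hV.2, hP.2, hQ.2, hN.2⟩
  exact .right _ (ex.shortExact ⟨hV.1, hP.1, hQ.1, hN.1⟩ surj) (isCellular_dsum hW)
    (isCellular_dsum hW)

theorem isCellular_of_retract (s : Y ⟶ X) (p : X ⟶ Y) (h : s ≫ p = 𝟙 Y) (hX : IsCellular X) :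
    IsCellular Y := by
  refine isCellular_of_telescope (W := fun _ => X) (fun _ => hX) (fun _ => p ≫ s) (fun _ => p)
    (fun _ => by rw [Category.assoc, h, Category.comp_id])
    (fun _ => by rw [← Category.assoc, ι_ker_comp, Limits.zero_comp]) ?_
  refine .of_comp (f := s ≫ inj (fun _ : ℕ => X) 0) ?_
  rw [Category.assoc, inj_desc, h]
  exact ⟨fun y => ⟨y, rfl⟩, fun y => ⟨y, rfl⟩, fun y => ⟨y, rfl⟩, fun y => ⟨y, rfl⟩⟩

end StandardModel

end

noncomputable section

theorem exists_pair {R M A B : Type} [CommRing R] [Algebra ℚ R] [AddCommGroup M] [Module R M]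
    [AddCommGroup A] [Module R A] [AddCommGroup B] [Module R B] {i : A →ₗ[R] M} {i' : B →ₗ[R] M}
    (h : (∀ a b, i a + i' b = 0 → a = 0 ∧ b = 0) ∧ ∀ y, ∃ a b, y = i a + i' b) {w : A} {w' : B}
    (hw : ∀ a, ∃ r : R, a = r • w) (hw' : ∀ b, ∃ r : R, b = r • w')
    (hz : ∀ r : R, r • w' = 0 → r • w = 0) :
    (∀ y, ∃ a b : R, y = a • (i w + i' w') + b • (i w - i' w')) ∧
      ∀ a b : R, a • (i w + i' w') + b • (i w - i' w') = 0 → a • w = 0 ∧ b • w = 0 := by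
  set t := algebraMap ℚ R (1 / 2)
  have ht : t + t = 1 := by rw [← map_add, add_halves, map_one]
  have key (a b : R) : a • (i w + i' w') + b • (i w - i' w') =
      i ((a + b) • w) + i' ((a - b) • w') := by simp only [map_smul]; module
  refine ⟨fun y => ?_, fun a b hab => ?_⟩
  · obtain ⟨a, b, rfl⟩ := h.2 y
    obtain ⟨r, rfl⟩ := hw a
    obtain ⟨s, rfl⟩ := hw' b
    refine ⟨t * (r + s), t * (r - s), ?_⟩
    rw [key]
    congr 3
    · linear_combination (-r) * ht
    · linear_combination (-s) * ht
  · rw [key] at hab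
    obtain ⟨h₁, h₂⟩ := h.1 _ _ hab
    have h₂ := hz _ h₂
    have e₁ : a = t * (a + b) + t * (a - b) := by linear_combination (-a) * ht
    have e₂ : b = t * (a + b) - t * (a - b) := by linear_combination (-b) * ht
    constructor
    · rw [e₁, add_smul, mul_smul, mul_smul, h₁, h₂, smul_zero, add_zero]
    · rw [e₂, sub_smul, mul_smul, mul_smul, h₁, h₂, smul_zero, sub_zero]

theorem pair_of_total {R M A B : Type} [CommRing R] [AddCommGroup M] [Module R M] [AddCommGroup A]
    [Module R A] [AddCommGroup B] [Module R B] {i : A →ₗ[R] M} {i' : B →ₗ[R] M} {p : M →ₗ[R] A}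
    {p' : M →ₗ[R] B} (h₁ : ∀ a, p (i a) = a) (h₂ : ∀ a, p' (i a) = 0) (h₃ : ∀ b, p (i' b) = 0)
    (h₄ : ∀ b, p' (i' b) = b) (h : ∀ y, i (p y) + i' (p' y) = y) :
    (∀ a b, i a + i' b = 0 → a = 0 ∧ b = 0) ∧ ∀ y, ∃ a b, y = i a + i' b :=
  ⟨fun a b hab => ⟨by simpa [h₁, h₃] using congrArg p hab, by simpa [h₂, h₄] using congrArg p' hab⟩,
    fun y => ⟨_, _, (h y).symm⟩⟩

theorem sum_idem_smul {S M : Type} [AddCommGroup M] [Module (S → ℚ)[X] M] {U : Set S}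
    (hU : U.Finite) {x : M} (h : idem Uᶜ • x = 0) : x = ∑ s ∈ hU.toFinset, idem {s} • x := by
  rw [← Finset.sum_smul]
  simp only [idem]
  rw [← map_sum, StandardModel.sum_charFun, Set.Finite.coe_toFinset]
  change x = idem U • x
  rw [← add_zero (idem U • x), ← h, ← add_smul, idem_add_compl, one_smul]

theorem subsingleton_of_total {M A B : Type} [AddCommGroup M] [AddCommGroup A] [AddCommGroup B]
    [Subsingleton A] [Subsingleton B] (i : A →+ M) (i' : B →+ M) (p : M → A) (p' : M → B)
    (h : ∀ y, i (p y) + i' (p' y) = y) : Subsingleton M := subsingleton_of_forall_eq 0 fun y => by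
  rw [← h y, Subsingleton.elim (p y) 0, Subsingleton.elim (p' y) 0, map_zero, map_zero, add_zero]

namespace StandardModel

variable {D : FullSubgroups} {X Y Z : StandardModel D}

theorem biprod_P (A B : StandardModel D) :
    (∀ a b, onP (biprod.inl : A ⟶ A ⊞ B) a + onP (biprod.inr : B ⟶ A ⊞ B) b = 0 →
      a = 0 ∧ b = 0) ∧
    ∀ y, ∃ a b, y = onP (biprod.inl : A ⟶ A ⊞ B) a + onP (biprod.inr : B ⟶ A ⊞ B) b :=
  pair_of_total (p := onP biprod.fst) (p' := onP biprod.snd)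
    (fun a => congrArg (fun f : A ⟶ A => onP f a) biprod.inl_fst)
    (fun a => congrArg (fun f : A ⟶ B => onP f a) biprod.inl_snd)
    (fun b => congrArg (fun f : B ⟶ A => onP f b) biprod.inr_fst)
    (fun b => congrArg (fun f : B ⟶ B => onP f b) biprod.inr_snd)
    fun y => congrArg (fun f : A ⊞ B ⟶ A ⊞ B => onP f y) biprod.total

theorem biprod_N (A B : StandardModel D) :
    (∀ a b, onN (biprod.inl : A ⟶ A ⊞ B) a + onN (biprod.inr : B ⟶ A ⊞ B) b = 0 →
      a = 0 ∧ b = 0) ∧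
    ∀ y, ∃ a b, y = onN (biprod.inl : A ⟶ A ⊞ B) a + onN (biprod.inr : B ⟶ A ⊞ B) b :=
  pair_of_total (p := onN biprod.fst) (p' := onN biprod.snd)
    (fun a => congrArg (fun f : A ⟶ A => onN f a) biprod.inl_fst)
    (fun a => congrArg (fun f : A ⟶ B => onN f a) biprod.inl_snd)
    (fun b => congrArg (fun f : B ⟶ A => onN f b) biprod.inr_fst)
    (fun b => congrArg (fun f : B ⟶ B => onN f b) biprod.inr_snd)
    fun y => congrArg (fun f : A ⊞ B ⟶ A ⊞ B => onN f y) biprod.total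

/-! ### Objects concentrated at the finite subgroups -/

theorem LineAt.smul_eq_zero {F : FiniteSubgroup D} {y : X.N} (h : LineAt F y) (h0 : y ≠ 0)
    {r : RingF D} : r • y = 0 ↔ r.coeff 0 F = 0 := by
  rw [h.smul]
  refine ⟨fun h1 => ?_, fun h1 => by rw [h1, map_zero, zero_smul]⟩
  by_contra h3
  have h4 := congrArg (algebraMap ℚ (RingF D) (r.coeff 0 F)⁻¹ • ·) h1
  simp only [smul_smul, ← map_mul, inv_mul_cancel₀ h3, map_one, one_smul, smul_zero] at h4
  exact h0 h4

theorem isCellular_of_line [hV : Subsingleton X.V] [hP : Subsingleton X.P] [hQ : Subsingleton X.Q]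
    {F : FiniteSubgroup D} {y : X.N} (h : LineAt F y) (h0 : y ≠ 0) (hy : ∀ z, ∃ r : RingF D, z = r • y)
    {k : ℤ} (hk : y ∈ X.N.gr k) {ε : RingF D} (hε : ε * ε = 1) (act : X.actN y = ε • y) :
    IsCellular X := by
  by_cases hF : F.Disconnected
  · have hd : disc D • y = y := by
      rw [← h.idem, smul_smul, disc, idem_mul, (Set.inter_eq_right.2 (Set.singleton_subset_iff.2 hF) :
        {F : FiniteSubgroup D | F.Disconnected} ∩ {F} = {F})]
    have hc : (conn D - disc D) • y = -y := by
      have := congrArg (· • y) (disc_add_conn (D := D))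
      simp only [add_smul, hd, one_smul, add_eq_left] at this
      rw [sub_smul, this, hd, zero_sub]
    let y' : (twist X).N := y
    have hp := exists_pair (biprod_N X (twist X)) (w := y) (w' := y') hy hy fun r hr => hr
    refine isCellular_of_retract biprod.inl biprod.fst biprod.inl_fst
      (.cell (X ⊞ twist X) ⟨k, .inr (.inr (.inr ⟨F, ?_⟩))⟩)
    have h₁ : (X ⊞ twist X).actN (onN biprod.inl y) = ε • onN biprod.inl y :=
      (onN_actN _ _).symm.trans ((congrArg _ act).trans (map_smul _ _ _))
    have h₂ : (twist X).actN y = (-ε) • y' := by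
      change (conn D - disc D) • X.actN y = (-ε) • y
      rw [act, smul_comm, hc, smul_neg, neg_smul]
    have h₂ : (X ⊞ twist X).actN (onN biprod.inr y') =
        (-ε) • onN biprod.inr y' :=
      (onN_actN _ _).symm.trans ((congrArg _ h₂).trans
        (map_smul (onN (biprod.inr : twist X ⟶ X ⊞ twist X)) (-ε) y'))
    have hact : (X ⊞ twist X).actN (onN biprod.inl y + onN biprod.inr y') =
        ε • (onN biprod.inl y - onN biprod.inr y') := by
      rw [map_add, h₁, h₂, neg_smul, smul_sub, sub_eq_add_neg]
    have : Subsingleton (twist X).P := hP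
    refine ⟨?_, ?_, ?_, onN biprod.inl y + onN biprod.inr y',
      add_mem (onN_mem _ hk) (onN_mem biprod.inr (X := twist X) hk), fun a => ?_, fun z => ?_,
      fun _ a b hab => ?_⟩
    · exact subsingleton_of_total (onV (biprod.inl : X ⟶ X ⊞ twist X)).toAddMonoidHom
        (onV biprod.inr).toAddMonoidHom (onV biprod.fst) (onV biprod.snd) fun y =>
          congrArg (fun f : X ⊞ twist X ⟶ X ⊞ twist X => onV f y) biprod.total
    · exact subsingleton_of_total (onP (biprod.inl : X ⟶ X ⊞ twist X)).toAddMonoidHom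
        (onP biprod.inr).toAddMonoidHom (onP biprod.fst) (onP biprod.snd) fun y =>
          congrArg (fun f : X ⊞ twist X ⟶ X ⊞ twist X => onP f y) biprod.total
    · exact subsingleton_of_total (onQ (biprod.inl : X ⟶ X ⊞ twist X)).toAddMonoidHom
        (onQ biprod.inr).toAddMonoidHom (onQ biprod.fst) (onQ biprod.snd) fun y =>
          congrArg (fun f : X ⊞ twist X ⟶ X ⊞ twist X => onQ f y) biprod.total
    · rw [← h.smul_eq_zero h0]
      refine ⟨fun ha => (hp.2 a 0 (by rw [zero_smul, add_zero, ha])).1, fun ha => ?_⟩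
      rw [smul_add, ← map_smul, ha, map_zero, zero_add, ← map_smul]
      exact (congrArg (onN (biprod.inr : twist X ⟶ X ⊞ twist X)) ha).trans (map_zero _)
    · obtain ⟨a, b, rfl⟩ := hp.1 z
      exact ⟨a, b * ε, by rw [hact, smul_smul, mul_assoc, hε, mul_one]⟩
    · rw [hact, smul_smul] at hab
      obtain ⟨h₁, h₂⟩ := hp.2 _ _ hab
      rw [← h.smul_eq_zero h0, ← h.smul_eq_zero h0]
      refine ⟨h₁, ?_⟩
      rw [← mul_one b, ← hε, ← mul_assoc, mul_comm, mul_smul, h₂, smul_zero]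
  · exact .cell X ⟨k, .inr (.inr (.inr ⟨F, hV, hP, hQ, y, hk, fun a => h.smul_eq_zero h0,
      fun z => (hy z).imp fun a ha => ⟨0, by rw [zero_smul, add_zero, ha]⟩,
      fun h => absurd h hF⟩))⟩

theorem isCellular_of_finite (hV : Subsingleton X.V) (hP : Subsingleton X.P)
    (hQ : Subsingleton X.Q) (hc : ∀ x : X.N, (Polynomial.X : RingF D) • x = 0) : IsCellular X := by
  let s : Set X.N := {y | ∃ F k, LineAt F y ∧ y ∈ X.N.gr k ∧
    ∃ ε : RingF D, ε * ε = 1 ∧ X.actN y = ε • y}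
  have key {F : FiniteSubgroup D} {y : X.N} {k : ℤ} (h : idem {F} • y = y) (hk : y ∈ X.N.gr k) :
      y ∈ AddSubgroup.closure s := by
    rw [sub_half_smul (R := RingF D) y (X.actN y)]
    have hk' := X.N.smul_mem (half_mem_degC _) (sub_mem hk (X.actN_gr k y hk))
    rw [zero_add] at hk'
    refine add_mem (AddSubgroup.subset_closure ⟨F, k, ⟨?_, hc _⟩, avgN_mem hk, 1, one_mul 1, ?_⟩)
      (AddSubgroup.subset_closure ⟨F, k, ⟨?_, hc _⟩, hk', -1, by ring, actN_half y⟩)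
    · rw [smul_comm, smul_add, ← map_smul, h]
    · rw [one_smul]; exact actN_avgN y
    · rw [smul_comm, smul_sub, ← map_smul, h]
  have hs : AddSubgroup.closure s = ⊤ := by
    refine eq_top_iff.2 fun x _ => GrMod.mem_of_forall_proj fun k => ?_
    have hk := X.N.proj_mem k x
    generalize X.N.proj k x = x at hk
    obtain ⟨K, hK⟩ := exists_eq_sum_N hQ x
    rw [hK]
    refine sum_mem fun n _ => ?_
    obtain ⟨e, he, hex⟩ := exists_euler_smul_N hP x
    obtain ⟨T, m, r, hr⟩ := exists_dvd_eulerElt he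
    have h1 : inflT D (eulerElt (T : Set OverT) m) • x = 0 := by
      rw [hr, map_mul, mul_comm, mul_smul, hex, smul_zero]
    rw [inflT_eulerElt] at h1
    have hfin : (FiniteSubgroup.mulZ ⁻¹' {n} ∩ FiniteSubgroup.mulT ⁻¹' (T : Set OverT) :
        Set (FiniteSubgroup D)).Finite :=
      (T.finite_toSet.biUnion fun H _ => finite_setOf_mul (D := D) n H).subset fun F hF =>
        Set.mem_biUnion hF.2 ⟨hF.1, rfl⟩
    rw [sum_idem_smul hfin (x := inflZ D (charFun {n}) • x)]
    · exact sum_mem fun F _ => key (F := F) (by rw [smul_smul, idem_mul_self])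
        (by simpa using X.N.smul_mem (idem_mem_degC {F}) (X.N.smul_mem (inflZ_mem_degC D _) hk))
    · have h2 : idem (FiniteSubgroup.mulT (D := D) ⁻¹' (T : Set OverT))ᶜ • x = 0 := by
        rw [← idem_compl_mul_eulerElt _ m, mul_smul, h1, smul_zero]
      have h3 : ((FiniteSubgroup.mulZ ⁻¹' {n} ∩ FiniteSubgroup.mulT ⁻¹' (T : Set OverT))ᶜ ∩
          FiniteSubgroup.mulZ ⁻¹' {n} : Set (FiniteSubgroup D)) =
          FiniteSubgroup.mulZ ⁻¹' {n} ∩ (FiniteSubgroup.mulT ⁻¹' (T : Set OverT))ᶜ := by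
        ext F; simp; tauto
      rw [inflZ_charFun, smul_smul, idem_mul, h3, ← idem_mul, mul_smul, h2, smul_zero]
  obtain ⟨b, hb, hb0, hbij⟩ := exists_basis (RingF D) hs
  choose F k hF hk ε hε act using fun y : b => hb y.2
  let W (y : b) := Sub.line (hF y) (hk y) ⟨_, act y⟩
  have hW (y : b) (z : (W y).toModel.N) : ∃ r : RingF D,
      z = r • (⟨y, Submodule.mem_span_singleton_self _⟩ : (W y).toModel.N) := by
    obtain ⟨r, hr⟩ := Submodule.mem_span_singleton.1 z.2
    exact ⟨r, Subtype.ext hr.symm⟩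
  have hV' (y : b) : Subsingleton (W y).toModel.V := ⟨fun u v => Subtype.ext (Subsingleton.elim _ _)⟩
  have hP' (y : b) : Subsingleton (W y).toModel.P := ⟨fun u v => Subtype.ext (Subsingleton.elim _ _)⟩
  have hQ' (y : b) : Subsingleton (W y).toModel.Q := ⟨fun u v => Subtype.ext (Subsingleton.elim _ _)⟩
  have hN := hbij (fun y => (W y).toModel.N) (fun _ _ => Classical.propDecidable _)
    (fun y => ⟨y, Submodule.mem_span_singleton_self _⟩)
    (fun y z => by
      obtain ⟨r, hr⟩ := hW y z
      refine ⟨r.coeff 0 (F y), hr.trans (Subtype.ext ((hF y).smul r))⟩)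
    (onN (desc fun y => (W y).ι))
    (fun y => congrArg (fun f : (W y).toModel ⟶ X => onN f (⟨y, Submodule.mem_span_singleton_self _⟩ :
      (W y).toModel.N)) (inj_desc (fun y => (W y).ι) y))
  have hs' : Surj (desc fun y => (W y).ι) := ⟨fun v => ⟨0, Subsingleton.elim _ _⟩,
    fun v => ⟨0, Subsingleton.elim _ _⟩, fun v => ⟨0, Subsingleton.elim _ _⟩, hN.2⟩
  have hi' : Inj (desc fun y => (W y).ι) := by
    refine ⟨fun u v _ => dsum_extV fun j => Subsingleton.elim _ _,
      fun u v _ => dsum_extP fun j => Subsingleton.elim _ _,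
      fun u v _ => dsum_extQ fun j => Subsingleton.elim _ _, hN.1⟩
  have := isIso_of_inj_surj hi' hs'
  refine isCellular_of_isIso (desc fun y => (W y).ι) (isCellular_dsum fun y => ?_)
  exact isCellular_of_line (X := (W y).toModel) (F := F y) (y := ⟨y, Submodule.mem_span_singleton_self _⟩)
    ⟨Subtype.ext (hF y).idem, Subtype.ext (hF y).X⟩ (fun h => hb0 (by
      have h' : y.1 = 0 := congrArg Subtype.val h
      exact h' ▸ y.2))
    (hW y) (hk y) (hε y) (Subtype.ext (act y))

end StandardModel

end

noncomputable section

namespace StandardModel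

variable {D : FullSubgroups} {X Y Z : StandardModel D}

/-! ### Objects without components over `Z` -/

theorem isCell_thick (H : OverT) (k : ℤ) : IsCell (thick D H 1 k) := by
  refine ⟨k, .inr (.inr (.inl ⟨H, inferInstance, inferInstance, (thickUnit D H 1 k).q, ?_,
    (thickUnit D H 1 k).x, ?_, exists_smul_thickUnit_q, fun a => ?_, exists_smul_thickUnit_x,
    fun a => ?_, (thickUnit D H 1 k).extQ, (thickUnit D H 1 k).actN⟩))⟩
  · simpa [idem, charFun] using (thickUnit D H 1 k).q_mem.outer
  · simpa [idem, charFun] using (thickUnit D H 1 k).x_mem.outer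
  · rw [smul_thickUnit_q, eulerElt_dvd_iff]; simp
  · rw [smul_thickUnit_x, inflT_eulerElt, eulerElt_dvd_iff]; rfl

theorem exists_thick_hom {H : OverT} {k : ℤ} {q : X.Q} (hq : q ∈ X.Q.gr k)
    (h : eulerClass H • q = 0) : ∃ f : thick D H 1 k ⟶ X, onQ f (thickUnit D H 1 k).q = q := by
  obtain ⟨g, hv, hp, rfl, hx⟩ := exists_gen_q hq ⟨_, Submonoid.subset_closure ⟨H, rfl⟩⟩ h
  obtain ⟨f, fv, fp, fq, fx⟩ := exists_sphere_hom g
  rw [eulerClass_eq] at h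
  have hx : inflT D (eulerElt {H} 1) • g.x = 0 := by rw [← eulerClass_eq]; exact hx
  obtain ⟨f', hf⟩ := Sub.exists_desc_π (eulerGen H 1 k).sub f
    (fun z hz => by
      obtain ⟨r, rfl⟩ := Submodule.mem_span_singleton.1 hz
      exact (map_smul (onV f) _ _).trans (by
        rw [show onV f (eulerGen H 1 k).v = 0 from fv.trans hv, smul_zero]))
    (fun z hz => by
      obtain ⟨r, rfl⟩ := Submodule.mem_span_singleton.1 hz
      exact (map_smul (onP f) _ _).trans (by
        rw [show onP f (eulerGen H 1 k).p = 0 from fp.trans hp, smul_zero]))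
    (fun z hz => by
      obtain ⟨r, rfl⟩ := Submodule.mem_span_singleton.1 hz
      exact (map_smul (onQ f) _ _).trans (by
        rw [show onQ f (eulerGen H 1 k).q = 0 from
          (map_smul (onQ f) _ _).trans ((congrArg _ fq).trans h), smul_zero]))
    (fun z hz => by
      obtain ⟨r, rfl⟩ := Submodule.mem_span_singleton.1 hz
      exact (map_smul (onN f) _ _).trans (by
        rw [show onN f (eulerGen H 1 k).x = 0 from
          (map_smul (onN f) _ _).trans ((congrArg _ fx).trans hx), smul_zero]))
  exact ⟨f', (congrArg (fun φ => onQ φ (sphereUnit D ∅ 0 k).q) hf).trans fq⟩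

theorem X_smul_thick {H : OverT} {k : ℤ} (y : (thick D H 1 k).N) :
    (Polynomial.X : RingF D) • y = 0 := by
  obtain ⟨a, rfl⟩ := exists_smul_thickUnit_x y
  rw [smul_smul, smul_thickUnit_x, inflT_eulerElt, eulerElt_dvd_iff]
  exact fun F _ => congrFun (Polynomial.coeff_X_mul_zero a) F

theorem isCellular_of_X_smul (hV : Subsingleton X.V) (hP : Subsingleton X.P)
    (hQ : ∀ q : X.Q, (Polynomial.X : RingT) • q = 0)
    (hN : ∀ x : X.N, (Polynomial.X : RingF D) • x = 0) : IsCellular X := by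
  let s : Set X.Q := {q | ∃ H k, q ∈ X.Q.gr k ∧ eulerClass H • q = 0}
  have hs : AddSubgroup.closure s = ⊤ := by
    refine eq_top_iff.2 fun q _ => GrMod.mem_of_forall_proj fun k => ?_
    have hk := X.Q.proj_mem k q
    generalize X.Q.proj k q = q at hk
    obtain ⟨e, he, hq⟩ := exists_euler_smul_Q hV q
    obtain ⟨T, m, r, hr⟩ := exists_dvd_eulerElt he
    rw [sum_idem_smul T.finite_toSet (x := q)]
    · refine sum_mem fun H _ => AddSubgroup.subset_closure ⟨H, k, ?_, ?_⟩
      · simpa using X.Q.smul_mem (idem_mem_degC {H}) hk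
      · rw [eulerClass_eq, smul_smul, mul_comm, idem_mul_eulerElt, pow_one, mul_smul, hQ, smul_zero]
    · rw [← idem_compl_mul_eulerElt _ m, mul_smul, hr, mul_comm e, mul_smul, hq, smul_zero, smul_zero]
  obtain ⟨b, hb, -, hbij⟩ := exists_basis RingT hs
  choose H k hk hH using fun y : b => hb y.2
  choose f hf using fun y => exists_thick_hom (hk y) (hH y)
  have hW := hbij (fun y => (thick D (H y) 1 (k y)).Q) (fun _ _ => Classical.propDecidable _)
    (fun y => (thickUnit D (H y) 1 (k y)).q)
    (fun y z => by
      obtain ⟨a, rfl⟩ := exists_smul_thickUnit_q z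
      exact ⟨_, smul_eq_of_eulerElt (smul_thickUnit_q.2 dvd_rfl) a⟩)
    (onQ (desc f))
    (fun y => (congrArg (fun φ : thick D (H y) 1 (k y) ⟶ X => onQ φ (thickUnit D (H y) 1 (k y)).q)
      (inj_desc f y)).trans (hf y))
  refine (isCellular_iff_of_hom (desc f) (fun W g hg hgf => ?_) fun W g hg hfg => ?_).1
    (isCellular_dsum fun y => .cell _ (isCell_thick _ _))
  · refine isCellular_of_finite
      ⟨fun u v => hg.V (dsum_extV fun j => Subsingleton.elim (α := (thick D (H j) 1 (k j)).V) _ _)⟩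
      ⟨fun u v => hg.P (dsum_extP fun j => Subsingleton.elim (α := (thick D (H j) 1 (k j)).P) _ _)⟩
      (subsingleton_of_forall_eq 0 fun u => hg.Q (hW.1 ?_)) fun x => hg.N (dsum_extN fun j => ?_)
    · rw [map_zero]
      exact (congrArg (fun φ : W ⟶ X => onQ φ u) hgf).trans (map_zero _).symm
    · rw [map_smul, map_smul, map_zero, map_zero]
      exact X_smul_thick _
  · have hW' := hg.Q
    refine isCellular_of_finite hg.V.subsingleton hg.P.subsingleton
      (subsingleton_of_forall_eq 0 fun u => ?_) fun x => ?_
    · obtain ⟨z, rfl⟩ := hg.Q u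
      obtain ⟨w, rfl⟩ := hW.2 z
      exact congrArg (fun φ : dsum _ ⟶ W => onQ φ w) hfg
    · obtain ⟨z, rfl⟩ := hg.N x
      rw [← map_smul, hN, map_zero]

section Torsion

variable (X) [hV : Subsingleton X.V] [hP : Subsingleton X.P]

theorem exists_torsion_hom (i : ℕ) : ∃ t : (Sub.torsion X i).toModel ⟶ (Sub.torsion X (i + 1)).toModel,
    t ≫ (Sub.torsion X (i + 1)).ι = (Sub.torsion X i).ι :=
  Sub.exists_lift_ι _ _ (fun z => z.2) (fun z => z.2)
    (fun z => by
      change (Polynomial.X ^ (i + 1) : RingT) • z.1 = 0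
      rw [pow_succ', mul_smul, show (Polynomial.X ^ i : RingT) • z.1 = 0 from z.2, smul_zero])
    (fun z => by
      change (Polynomial.X ^ (i + 1) : RingF D) • z.1 = 0
      rw [pow_succ', mul_smul, show (Polynomial.X ^ i : RingF D) • z.1 = 0 from z.2, smul_zero])

instance (i : ℕ) : Subsingleton (Sub.torsion X i).toModel.V :=
  ⟨fun _ _ => Subtype.ext (Subsingleton.elim _ _)⟩

instance (i : ℕ) : Subsingleton (Sub.torsion X i).toModel.P :=
  ⟨fun _ _ => Subtype.ext (Subsingleton.elim _ _)⟩

theorem isCellular_torsion (i : ℕ) : IsCellular (Sub.torsion X i).toModel := by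
  induction i with
  | zero =>
    refine isCellular_of_X_smul inferInstance inferInstance (fun q => Subtype.ext ?_)
      fun q => Subtype.ext ?_
    · have h : (Polynomial.X ^ 0 : RingT) • q.1 = 0 := q.2
      rw [pow_zero, one_smul] at h
      exact (congrArg _ h).trans (smul_zero _)
    · have h : (Polynomial.X ^ 0 : RingF D) • q.1 = 0 := q.2
      rw [pow_zero, one_smul] at h
      exact (congrArg _ h).trans (smul_zero _)
  | succ i ih =>
    obtain ⟨t, ht⟩ := exists_torsion_hom X i
    have ti : Inj t := .of_comp (g := (Sub.torsion X (i + 1)).ι) (ht ▸ Sub.inj_ι _)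
    refine (isCellular_iff_of_hom t (fun W g hg hgt => ?_) fun W g hg htg => ?_).1 ih
    · have hQ (u : W.Q) : u = 0 := (hg.comp ti).Q
        ((congrArg (fun φ : W ⟶ _ => onQ φ u) hgt).trans (map_zero _).symm)
      have hN (u : W.N) : u = 0 := (hg.comp ti).N
        ((congrArg (fun φ : W ⟶ _ => onN φ u) hgt).trans (map_zero _).symm)
      exact isCellular_of_X_smul hg.V.subsingleton hg.P.subsingleton (fun u => hQ _) fun u => hN _
    · refine isCellular_of_X_smul hg.V.subsingleton hg.P.subsingleton (fun u => ?_) fun u => ?_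
      · obtain ⟨z, rfl⟩ := hg.Q u
        let z' : (Sub.torsion X i).toModel.Q := ⟨(Polynomial.X : RingT) • z.1, by
          change (Polynomial.X ^ i : RingT) • (Polynomial.X : RingT) • z.1 = 0
          rw [smul_smul, ← pow_succ]; exact z.2⟩
        have h1 : onQ t z' = (Polynomial.X : RingT) • z :=
          Subtype.ext (congrArg (fun φ : _ ⟶ X => onQ φ z') ht)
        rw [← map_smul, ← h1]
        exact congrArg (fun φ : _ ⟶ W => onQ φ z') htg
      · obtain ⟨z, rfl⟩ := hg.N u
        let z' : (Sub.torsion X i).toModel.N := ⟨(Polynomial.X : RingF D) • z.1, by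
          change (Polynomial.X ^ i : RingF D) • (Polynomial.X : RingF D) • z.1 = 0
          rw [smul_smul, ← pow_succ]; exact z.2⟩
        have h1 : onN t z' = (Polynomial.X : RingF D) • z :=
          Subtype.ext (congrArg (fun φ : _ ⟶ X => onN φ z') ht)
        rw [← map_smul, ← h1]
        exact congrArg (fun φ : _ ⟶ W => onN φ z') htg

theorem isCellular_of_subsingleton_P : IsCellular X := by
  choose t ht using exists_torsion_hom X
  have hd i : inj _ i ≫ desc (fun i => (Sub.torsion X i).ι) = (Sub.torsion X i).ι := inj_desc _ i
  refine isCellular_of_telescope (isCellular_torsion X) t (fun i => (Sub.torsion X i).ι) ht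
    (fun i => ?_) ⟨fun v => ⟨0, Subsingleton.elim _ _⟩, fun v => ⟨0, Subsingleton.elim _ _⟩,
      fun q => ?_, fun x => ?_⟩
  · have := (Sub.inj_ι (Sub.torsion X (i + 1))).mono
    rw [← cancel_mono (Sub.torsion X (i + 1)).ι, Category.assoc, ht, ι_ker_comp, Limits.zero_comp]
  · obtain ⟨e, he, hq⟩ := exists_euler_smul_Q hV q
    obtain ⟨T, m, r, hr⟩ := exists_dvd_eulerElt he
    have h : (Polynomial.X ^ m : RingT) • q = 0 := by
      rw [X_pow_eq_mul_eulerElt (T : Set OverT), mul_smul, hr, mul_comm e, mul_smul, hq, smul_zero,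
        smul_zero]
    let z : (Sub.torsion X m).toModel.Q := ⟨q, h⟩
    exact ⟨onQ (inj _ m) z, congrArg (fun φ : (Sub.torsion X m).toModel ⟶ X => onQ φ z) (hd m)⟩
  · obtain ⟨e, he, hx⟩ := exists_euler_smul_N hP x
    obtain ⟨T, m, r, hr⟩ := exists_dvd_eulerElt he
    have h : (Polynomial.X ^ m : RingF D) • x = 0 := by
      rw [X_pow_eq_mul_eulerElt (FiniteSubgroup.mulT ⁻¹' (T : Set OverT)), ← inflT_eulerElt, hr,
        map_mul, mul_comm (inflT D e), mul_smul, mul_smul, hx, smul_zero, smul_zero]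
    let z : (Sub.torsion X m).toModel.N := ⟨x, h⟩
    exact ⟨onN (inj _ m) z, congrArg (fun φ : (Sub.torsion X m).toModel ⟶ X => onN φ z) (hd m)⟩

end Torsion

end StandardModel

end

noncomputable section

namespace StandardModel

variable {D : FullSubgroups} {X Y : StandardModel D}

/-! ### Objects without component at `G` -/

theorem isCellular_iff_of_bijective_P [Subsingleton X.V] [Subsingleton Y.V] (f : X ⟶ Y)
    (hf : Function.Bijective (onP f)) : IsCellular X ↔ IsCellular Y := by
  refine isCellular_iff_of_hom f (fun W g hg hgf => ?_) fun W g hg hfg => ?_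
  · have := hg.V.subsingleton
    have : Subsingleton W.P := subsingleton_of_forall_eq 0 fun u => hg.P (hf.1
      ((congrArg (fun φ : W ⟶ Y => onP φ u) hgf).trans (by rw [map_zero, map_zero]; rfl)))
    exact isCellular_of_subsingleton_P W
  · have := hg.V.subsingleton
    have : Subsingleton W.P := subsingleton_of_forall_eq 0 fun u => by
      obtain ⟨z, rfl⟩ := hg.P u
      obtain ⟨w, rfl⟩ := hf.2 z
      exact congrArg (fun φ : X ⟶ W => onP φ w) hfg
    exact isCellular_of_subsingleton_P W

theorem exists_sphere_hom_sphere (T : Finset OverT) (m : ℕ) (k : ℤ) :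
    ∃ h : sphere D T m k ⟶ sphere D ∅ 0 k, Inj h ∧ Function.Surjective (onV h) ∧
      Function.Surjective (onP h) := by
  obtain ⟨h, hh⟩ := Sub.exists_lift_ι (sphereGen D ∅ 0 k).sub (sphereGen D T m k).sub.ι
    (fun z => z.2) (fun z => z.2)
    (fun z => by
      obtain ⟨a, ha⟩ := Submodule.mem_span_singleton.1 z.2
      refine Submodule.mem_span_singleton.2 ⟨a * eulerElt (T : Set OverT) m, ?_⟩
      refine Eq.trans ?_ ha
      refine (smul_ofPoly _ _ _).trans (Eq.trans ?_ (smul_ofPoly _ _ _).symm)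
      rw [eulerElt_zero, mul_one])
    (fun z => by
      obtain ⟨a, ha⟩ := Submodule.mem_span_singleton.1 z.2
      refine Submodule.mem_span_singleton.2 ⟨a * inflT D (eulerElt (T : Set OverT) m), ?_⟩
      refine Eq.trans ?_ ha
      refine (smul_ofPoly _ _ _).trans (Eq.trans ?_ (smul_ofPoly _ _ _).symm)
      rw [eulerElt_zero, map_one, mul_one])
  exact ⟨h, .of_comp (g := (sphereGen D ∅ 0 k).sub.ι) (hh ▸ Sub.inj_ι _),
    fun z => ⟨⟨z.1, z.2⟩, Subtype.ext (congrArg (fun φ : sphere D T m k ⟶ large D k => onV φ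
      (⟨z.1, z.2⟩ : (sphere D T m k).V)) hh)⟩,
    fun z => ⟨⟨z.1, z.2⟩, Subtype.ext (congrArg (fun φ : sphere D T m k ⟶ large D k => onP φ
      (⟨z.1, z.2⟩ : (sphere D T m k).P)) hh)⟩⟩

variable (D) in
/-- The generators of the part of a sphere. -/
def partUnit (n : OverZ) (k : ℤ) : Gen (part n (sphere D ∅ 0 k)) ∅ 0 k :=
  (sphereUnit D ∅ 0 k).map (partπ n _)

theorem charFun_mul_of_smul_partUnit {n : OverZ} {k : ℤ} {r : RingZ}
    (h : r • (partUnit D n k).p = 0) : charFun {n} * r = 0 := by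
  refine (sphere_free D ∅ 0 k).P.1 ?_
  have h1 := (map_smul (onP (partι n _)) _ _).symm.trans ((congrArg (onP (partι n _)) h).trans (map_zero _))
  have h2 := congrArg (fun φ : sphere D ∅ 0 k ⟶ _ => r • onP φ (sphereUnit D ∅ 0 k).p)
    (partπ_ι n (sphere D ∅ 0 k))
  have h3 : r • charFun {n} • (sphereUnit D ∅ 0 k).p = 0 := h2.symm.trans h1
  exact ((((congrArg (· • (sphereUnit D ∅ 0 k).p) (mul_comm (charFun {n}) r)).trans
    (mul_smul _ _ _)).trans h3).trans
    (zero_smul _ (sphereUnit D ∅ 0 k).p).symm)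

theorem inflZ_mul_of_smul_partUnit {n : OverZ} {k : ℤ} {r : RingF D}
    (h : r • (partUnit D n k).x = 0) : inflZ D (charFun {n}) * r = 0 := by
  refine (sphere_free D ∅ 0 k).N.1 ?_
  have h1 := (map_smul (onN (partι n _)) _ _).symm.trans ((congrArg (onN (partι n _)) h).trans (map_zero _))
  have h2 := congrArg (fun φ : sphere D ∅ 0 k ⟶ _ => r • onN φ (sphereUnit D ∅ 0 k).x)
    (partπ_ι n (sphere D ∅ 0 k))
  have h3 : r • inflZ D (charFun {n}) • (sphereUnit D ∅ 0 k).x = 0 := h2.symm.trans h1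
  exact ((((congrArg (· • (sphereUnit D ∅ 0 k).x) (mul_comm (inflZ D (charFun {n})) r)).trans
    (mul_smul _ _ _)).trans h3).trans
    (zero_smul _ (sphereUnit D ∅ 0 k).x).symm)

theorem isCell_part_biprod (n : OverZ) (k : ℤ) :
    IsCell (part n (sphere D ∅ 0 k) ⊞ twist (part n (sphere D ∅ 0 k))) := by
  set A := part n (sphere D ∅ 0 k) with hA
  let u : Gen A ∅ 0 k := partUnit D n k
  let p' : (twist A).P := u.p
  let x' : (twist A).N := u.x
  have hu : A.extP u.p = LocalizedModule.mk u.x 1 := by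
    rw [u.extP]
    exact (loc_mk_eq_iff _ _).2 ⟨1, one_mem _, by simp [eulerOf]⟩
  have eP := (atZ_part n (sphere D ∅ 0 k)).P u.p
  have eN := (atZ_part n (sphere D ∅ 0 k)).N u.x
  have kx : u.x ∈ A.N.gr k := by simpa [idem, charFun] using u.x_mem.outer
  have sP (a : A.P) : ∃ r : RingZ, a = r • u.p := exists_smul_part n ∅ 0 k a
  have sN (a : A.N) : ∃ r : RingF D, a = r • u.x := by
    obtain ⟨a, rfl⟩ := (surj_partπ n _).N a
    obtain ⟨r, rfl⟩ := (sphere_free D ∅ 0 k).N.2 a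
    exact ⟨r, map_smul (onN (partπ n _)) _ _⟩
  have hP := exists_pair (biprod_P A (twist A)) (w := u.p) (w' := p') sP sP fun r hr => hr
  have hN := exists_pair (biprod_N A (twist A)) (w := u.x) (w' := x') sN sN fun r hr => hr
  have hA' := atZ_part n (sphere D ∅ 0 k)
  have := hA'.V
  have := hA'.Q
  have : Subsingleton (twist A).V := hA'.V
  have : Subsingleton (twist A).Q := hA'.Q
  have act : (A ⊞ twist A).actP (onP biprod.inl u.p + onP biprod.inr p') =
      onP biprod.inl u.p - onP biprod.inr p' := by
    have h₁ : (A ⊞ twist A).actP (onP biprod.inl u.p) = onP biprod.inl u.p :=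
      (onP_actP _ _).symm.trans (congrArg _ u.actP)
    have h₂ : (A ⊞ twist A).actP (onP biprod.inr p') = -onP biprod.inr p' :=
      (onP_actP _ _).symm.trans ((congrArg _ (congrArg Neg.neg u.actP :)).trans
        (map_neg (onP (biprod.inr : twist A ⟶ A ⊞ twist A)) p'))
    rw [map_add, h₁, h₂, sub_eq_add_neg]
  have e₁ : (A ⊞ twist A).extP (onP biprod.inl u.p) = LocalizedModule.mk (onN biprod.inl u.x) 1 :=
    (extP_onP _ _).trans ((congrArg _ hu).trans (LocalizedModule.map_mk _ _ _ _))
  have e₂ : (A ⊞ twist A).extP (onP biprod.inr p') = LocalizedModule.mk (onN biprod.inr x') 1 :=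
    (extP_onP _ _).trans ((congrArg _ hu).trans (LocalizedModule.map_mk _ _ _ _))
  have i₁ : charFun {n} • onP (biprod.inl : A ⟶ A ⊞ twist A) u.p = onP biprod.inl u.p :=
    (map_smul _ _ _).symm.trans (congrArg _ eP)
  have i₂ : charFun {n} • onP (biprod.inr : twist A ⟶ A ⊞ twist A) p' = onP biprod.inr p' :=
    (map_smul (onP (biprod.inr : twist A ⟶ A ⊞ twist A)) _ p').symm.trans (congrArg _ eP)
  have j₁ : inflZ D (charFun {n}) • onN (biprod.inl : A ⟶ A ⊞ twist A) u.x = onN biprod.inl u.x :=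
    (map_smul _ _ _).symm.trans (congrArg _ eN)
  have j₂ : inflZ D (charFun {n}) • onN (biprod.inr : twist A ⟶ A ⊞ twist A) x' =
      onN biprod.inr x' :=
    (map_smul (onN (biprod.inr : twist A ⟶ A ⊞ twist A)) _ x').symm.trans (congrArg _ eN)
  have m₂ : onN (biprod.inr : twist A ⟶ A ⊞ twist A) x' ∈ (A ⊞ twist A).N.gr k :=
    onN_mem biprod.inr (X := twist A) kx
  refine ⟨k, .inr (.inl ⟨n, ?_, ?_, onP biprod.inl u.p + onP biprod.inr p',
    add_mem (onP_mem _ u.p_mem) (onP_mem biprod.inr (X := twist A) u.p_mem),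
    onN biprod.inl u.x + onN biprod.inr x', add_mem (onN_mem _ kx) m₂,
    onN biprod.inl u.x - onN biprod.inr x', sub_mem (onN_mem _ kx) m₂, ?_, ?_, ?_, ?_, ?_, ?_, hN.1,
    fun a b hab => ?_⟩)⟩
  · exact subsingleton_of_total (onV (biprod.inl : A ⟶ A ⊞ twist A)).toAddMonoidHom
      (onV biprod.inr).toAddMonoidHom (onV biprod.fst) (onV biprod.snd) fun y =>
        congrArg (fun f : A ⊞ twist A ⟶ A ⊞ twist A => onV f y) biprod.total
  · exact subsingleton_of_total (onQ (biprod.inl : A ⟶ A ⊞ twist A)).toAddMonoidHom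
      (onQ biprod.inr).toAddMonoidHom (onQ biprod.fst) (onQ biprod.snd) fun y =>
        congrArg (fun f : A ⊞ twist A ⟶ A ⊞ twist A => onQ f y) biprod.total
  · rw [smul_add, i₁, i₂]
  · rw [act]
    refine ⟨fun a b hab => ?_, fun y => ?_⟩
    · have h1 : ((a.1 - b.1) • charFun {n} : RingZ) • (onP biprod.inl u.p + onP biprod.inr p') +
          ((a.2 - b.2) • charFun {n} : RingZ) • (onP biprod.inl u.p - onP biprod.inr p') = 0 := by
        rw [sub_smul, sub_smul, sub_smul, sub_smul, sub_add_sub_comm]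
        exact sub_eq_zero.2 hab
      obtain ⟨h2, h3⟩ := hP.2 _ _ h1
      have ev {r : ℚ} (h : (r • charFun {n} : RingZ) • u.p = 0) : r = 0 := by
        simpa [charFun_apply] using congrFun (charFun_mul_of_smul_partUnit h) n
      exact Prod.ext (sub_eq_zero.1 (ev h2)) (sub_eq_zero.1 (ev h3))
    · obtain ⟨a, b, rfl⟩ := hP.1 y
      refine ⟨(a n, b n), ?_⟩
      have k₁ : charFun {n} • (onP biprod.inl u.p + onP biprod.inr p') =
        onP biprod.inl u.p + onP biprod.inr p' := by rw [smul_add, i₁, i₂]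
      have k₂ : charFun {n} • (onP biprod.inl u.p - onP biprod.inr p') =
        onP biprod.inl u.p - onP biprod.inr p' := by rw [smul_sub, i₁, i₂]
      conv_rhs => rw [← k₁, ← k₂]
      rw [smul_smul, smul_smul, mul_comm a, mul_comm b, charFun_singleton_mul, charFun_singleton_mul,
        ← Algebra.smul_def, ← Algebra.smul_def]
  · rw [map_add, e₁, e₂, mk_one_add]
  · rw [act, map_sub, e₁, e₂, mk_one_sub]
  · rw [smul_add, j₁, j₂]
  · rw [smul_sub, j₁, j₂]
  · exact ⟨inflZ_mul_of_smul_partUnit (hN.2 a b hab).1, inflZ_mul_of_smul_partUnit (hN.2 a b hab).2⟩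

theorem isCellular_twist_iff [Subsingleton X.V] [Subsingleton X.Q] [Subsingleton Y.V]
    [Subsingleton Y.Q] (f : X ⟶ Y) (hf : Function.Bijective (onP f)) :
    IsCellular (twist X) ↔ IsCellular (twist Y) := by
  have : Subsingleton (twist X).V := ‹Subsingleton X.V›
  have : Subsingleton (twist Y).V := ‹Subsingleton Y.V›
  exact isCellular_iff_of_bijective_P (twistHom f) hf

theorem isCellular_part_sphere (n : OverZ) (T : Finset OverT) (m : ℕ) (k : ℤ) :
    IsCellular (part n (sphere D T m k)) ∧ IsCellular (twist (part n (sphere D T m k))) := by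
  have h := IsCellular.cell _ (isCell_part_biprod (D := D) n k)
  have := (atZ_part n (sphere D ∅ 0 k)).V
  have := (atZ_part n (sphere D T m k)).V
  obtain ⟨f, hf, -, fP⟩ := exists_sphere_hom_sphere (D := D) T m k
  let q := partι n _ ≫ f ≫ partπ n _
  have h₁ : q ≫ partι n _ = partι n _ ≫ f := by
    simp only [q, Category.assoc, partπ_ι]
    rw [← eHom_comp, ← Category.assoc, partι_eHom]
  have h₂ : partπ n _ ≫ q = f ≫ partπ n _ := by
    simp only [q, ← Category.assoc, partπ_ι]
    rw [eHom_comp, ← partπ_ι, Category.assoc, Category.assoc, partι_π, Category.comp_id]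
  have hq : Function.Bijective (onP q) := by
    refine ⟨(Inj.of_comp (g := partι n _) (h₁ ▸ (inj_partι n _).comp hf)).P, fun y => ?_⟩
    obtain ⟨z, rfl⟩ := (surj_partπ n _).P y
    obtain ⟨w, rfl⟩ := fP z
    exact ⟨onP (partπ n _) w, congrArg (fun φ : sphere D T m k ⟶ _ => onP φ w) h₂⟩
  exact ⟨(isCellular_iff_of_bijective_P q hq).2 (isCellular_of_retract _ _ biprod.inl_fst h),
    (isCellular_twist_iff q hq).2 (isCellular_of_retract _ _ biprod.inr_snd h)⟩

end StandardModel

end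

noncomputable section

namespace StandardModel

variable {D : FullSubgroups} {X Y : StandardModel D}

theorem exists_smul_partπ {n : OverZ} {T : Finset OverT} {m : ℕ} {k : ℤ}
    (z : (part n (sphere D T m k)).P) : ∃ r : ℚ, z =
      algebraMap ℚ RingZ r • onP (partπ n (sphere D T m k)) (sphereUnit D T m k).p := by
  obtain ⟨r, rfl⟩ := exists_smul_part n T m k z
  refine ⟨r n, ?_⟩
  have h := (atZ_part n (sphere D T m k)).P (onP (partπ n (sphere D T m k)) (sphereUnit D T m k).p)
  conv_lhs => rw [← h]
  rw [smul_smul, mul_comm, charFun_singleton_mul, mul_smul, h]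

theorem exists_cellular_P {p : X.P} {k : ℤ} (hp : p ∈ X.P.gr k) {n : OverZ}
    (hn : charFun {n} • p = p) (act : X.actP p = p ∨ -X.actP p = p) :
    ∃ (W : StandardModel D) (f : W ⟶ X) (w : W.P), IsCellular W ∧ Subsingleton W.V ∧
      (∀ z, ∃ r : ℚ, z = algebraMap ℚ RingZ r • w) ∧ onP f w = p := by
  rcases act with act | act
  · obtain ⟨T, m, g, -, hg, -⟩ := exists_gen_p hp hn act
    obtain ⟨f, -, hf, -⟩ := exists_sphere_hom g
    have h2 := onP_partι_comp n f (sphereUnit D T m k).p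
    rw [hf, hg, hn] at h2
    exact ⟨_, _, _, (isCellular_part_sphere n T m k).1, (atZ_part n _).V, exists_smul_partπ, h2⟩
  · obtain ⟨T, m, g, -, hg, -⟩ := exists_gen_p (X := twist (part n X)) (k := k)
      (p := onP (partπ n X) p) (onP_mem (partπ n X) hp) (n := n)
      ((map_smul (onP (partπ n X)) _ _).symm.trans (congrArg _ hn))
      ((congrArg Neg.neg (onP_actP (partπ n X) p).symm).trans
        ((map_neg (onP (partπ n X)) _).symm.trans (congrArg (onP (partπ n X)) act)))
    obtain ⟨f, -, hf, -⟩ := exists_sphere_hom g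
    exact ⟨_, untwist f, _, (isCellular_part_sphere n T m k).2, (atZ_part n (sphere D T m k)).V,
      exists_smul_partπ, onP_untwist f (hf.trans hg) hn⟩

theorem isCellular_of_subsingleton_V (hV : Subsingleton X.V) : IsCellular X := by
  let s : Set X.P := {p | ∃ (n : OverZ) (k : ℤ), p ∈ X.P.gr k ∧ charFun {n} • p = p ∧
    (X.actP p = p ∨ -X.actP p = p)}
  have hs : AddSubgroup.closure s = ⊤ := by
    refine eq_top_iff.2 fun p _ => GrMod.mem_of_forall_proj fun k => ?_
    have hk := X.P.proj_mem k p
    generalize X.P.proj k p = p at hk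
    obtain ⟨K, hK⟩ := exists_eq_sum_P hV p
    rw [hK]
    refine sum_mem fun n _ => ?_
    have hk := X.P.smul_mem (i := 0) (a := charFun {n}) (fun _ => rfl) hk
    have hn : charFun {n} • charFun {n} • p = charFun {n} • p := by
      rw [smul_smul, charFun_mul_self]
    rw [zero_add] at hk
    generalize charFun {n} • p = p at hk hn
    have hk' := X.P.smul_mem (i := 0) (a := algebraMap ℚ RingZ (1 / 2)) (fun _ => rfl)
      (sub_mem hk (X.actP_gr k p hk))
    rw [zero_add] at hk'
    rw [sub_half_smul (R := RingZ) p (X.actP p)]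
    refine add_mem (AddSubgroup.subset_closure ⟨n, k, avgP_mem hk, ?_, .inl (actP_avgP p)⟩)
      (AddSubgroup.subset_closure ⟨n, k, hk', ?_, .inr (neg_act_half_sub X.actP X.actP_actP p)⟩)
    · rw [smul_comm, smul_add, ← map_smul, hn]
    · rw [smul_comm, smul_sub, ← map_smul, hn]
  obtain ⟨b, hb, -, hbij⟩ := exists_basis RingZ hs
  choose n k hk hn act using fun y : b => hb y.2
  choose W f w hW hWV hw hf using fun y => exists_cellular_P (hk y) (hn y) (act y)
  have hP := hbij (fun y => (W y).P) (fun _ _ => Classical.propDecidable _) w hw (onP (desc f))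
    fun y => (congrArg (fun φ : W y ⟶ X => onP φ (w y)) (inj_desc f y)).trans (hf y)
  have : Subsingleton (dsum W).V := ⟨fun u v => dsum_extV fun j => Subsingleton.elim (α := (W j).V) _ _⟩
  exact (isCellular_iff_of_bijective_P (desc f) hP).1 (isCellular_dsum hW)

/-! ### All objects are cellular -/

theorem isCellular_iff_of_bijective_V (f : X ⟶ Y) (hf : Function.Bijective (onV f)) :
    IsCellular X ↔ IsCellular Y := by
  refine isCellular_iff_of_hom f (fun W g hg hgf => isCellular_of_subsingleton_V ?_)
    fun W g hg hfg => isCellular_of_subsingleton_V ?_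
  · exact subsingleton_of_forall_eq 0 fun u => hg.V (hf.1
      ((congrArg (fun φ : W ⟶ Y => onV φ u) hgf).trans (by rw [map_zero, map_zero]; rfl)))
  · refine subsingleton_of_forall_eq 0 fun u => ?_
    obtain ⟨z, rfl⟩ := hg.V u
    obtain ⟨w, rfl⟩ := hf.2 z
    exact congrArg (fun φ : X ⟶ W => onV φ w) hfg

theorem isCell_sphere (k : ℤ) : IsCell (sphere D ∅ 0 k) := by
  let u := sphereUnit D ∅ 0 k
  have hu := sphere_free D ∅ 0 k
  refine ⟨k, .inl ⟨u.v, u.v_mem, u.p, u.p_mem, u.q, ?_, u.x, ?_, hu.V, hu.P, hu.Q, hu.N, u.extVP,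
    u.extVQ.trans ?_, u.extP.trans ?_, u.extQ, u.actP, u.actN⟩⟩
  · simpa [idem, charFun] using u.q_mem.outer
  · simpa [idem, charFun] using u.x_mem.outer
  · exact (loc_mk_eq_iff _ _).2 ⟨1, one_mem _, by simp⟩
  · exact (loc_mk_eq_iff _ _).2 ⟨1, one_mem _, by simp [eulerOf]⟩

theorem isCellular_sphere (T : Finset OverT) (m : ℕ) (k : ℤ) : IsCellular (sphere D T m k) := by
  obtain ⟨h, hi, hV, -⟩ := exists_sphere_hom_sphere (D := D) T m k
  exact (isCellular_iff_of_bijective_V h ⟨hi.V, hV⟩).2 (.cell _ (isCell_sphere k))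

theorem isCellular (X : StandardModel D) : IsCellular X := by
  let s : Set X.V := {v | ∃ k, v ∈ X.V.gr k}
  have hs : AddSubgroup.closure s = ⊤ := eq_top_iff.2 fun v _ => GrMod.mem_of_forall_proj fun k =>
    AddSubgroup.subset_closure ⟨k, X.V.proj_mem k v⟩
  obtain ⟨b, hb, -, hbij⟩ := exists_basis ℚ hs
  choose k hk using fun y : b => hb y.2
  choose T m g hg using fun y => exists_gen_v (hk y)
  choose f hf _ using fun y => exists_sphere_hom (g y)
  have hV := hbij (fun y => (sphere D (T y) (m y) (k y)).V) (fun _ _ => Classical.propDecidable _)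
    (fun y => (sphereUnit D (T y) (m y) (k y)).v)
    (fun y z => ((sphere_free D (T y) (m y) (k y)).V.2 z).imp fun _ h => h.symm) (onV (desc f))
    fun y => (congrArg (fun φ : sphere D (T y) (m y) (k y) ⟶ X =>
      onV φ (sphereUnit D (T y) (m y) (k y)).v) (inj_desc f y)).trans ((hf y).trans (hg y))
  exact (isCellular_iff_of_bijective_V (desc f) hV).1
    (isCellular_dsum fun y => isCellular_sphere (T y) (m y) (k y))

end StandardModel

end

/-- The standard model is an abelian category in which every object has an injective resolution
`0 ⟶ X ⟶ I₀ ⟶ I₁ ⟶ I₂ ⟶ 0`; the bound is attained; and all objects are cellular. -/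
theorem mainTheorem3 (D : FullSubgroups) :
    ∃ _ : Abelian (StandardModel D),
      (∀ X : StandardModel D, ∃ I : InjectiveResolution X,
        ∀ k : ℕ, 2 < k → IsZero (I.cocomplex.X k)) ∧
      (∃ X : StandardModel D, ¬ ∃ I : InjectiveResolution X,
        ∀ k : ℕ, 1 < k → IsZero (I.cocomplex.X k)) ∧
      (∀ X : StandardModel D, StandardModel.IsCellular X) :=
  ⟨StandardModel.instAbelian, StandardModel.exists_resolution, StandardModel.exists_not_short D,
    StandardModel.isCellular⟩
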